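/- Let $n\ge 2$ and $D\ge 1$ be integers, let $v$ be a formal variable, put $\mathbf K=\mathbb C(v)$, and let $\mathbf Z_0=\mathbb C[v]_{(v)}\subset\mathbf K$ be the ring of rational functions regular at $v=0$. Let $S_D$ be the affine symmetric group of type $GL_D$, i.e. the group of bijections $w:\mathbb Z\to\mathbb Z$ with $w(j+D)=w(j)+D$, with length $\ell(w)=\#\{(k,l): 1\le k\le D,\ k<l,\ w(k)>w(l)\}$, and let $\mathbf H_D$ be the affine Hecke algebra of type $GL_D$ over $\mathbf K$, with standard elements $T_w$ ($w\in S_D$) satisfying $T_1=1$, $T_wT_{w'}=T_{ww'}$ if $\ell(ww')=\ell(w)+\ell(w')$, and $(T_s+1)(T_s-v^{-2})=0$ for the simple reflections $s$. Let $\mathfrak P_D$ be the set of functions $p:\mathbb Z\to\mathbb Z$ with $p(j+D)=p(j)+n$, on which $S_D$ acts on the right by composition, and let $\mathfrak C_D=\{\lambda\in\mathfrak P_D: 1\le\lambda(1)\le\dots\le\lambda(D)\le n\}$, a fundamental domain. For $p$ in the orbit of $\lambda\in\mathfrak C_D$ put $T_p=\sum_{w:\,\lambda\circ w=p}T_w$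 and $[p]=v^{x_p}T_p$, where $x_p=\#\{(k,l): 1\le p(k)\le n,\ k<l,\ p(k)\ge p(l)\}$. Then $T_p\in T_\lambda\mathbf H_D$. Put $\mathbf T_D\otimes\mathbf K=\bigoplus_{\lambda\in\mathfrak C_D}T_\lambda\mathbf H_D$, a right $\mathbf H_D$-module, and let $\mathbf S_D\otimes\mathbf K$ be its endomorphism ring (the affine $q$-Schur algebra over $\mathbf K$). For an $\mathbb N$-valued matrix $s=(s_{ij})_{i,j\in\mathbb Z}$, invariant under $(i,j)\mapsto(i+n,j+n)$, with row sums $\sum_j s_{ij}=\#\lambda^{-1}(i)$ and column sums $\sum_i s_{ij}=\#\mu^{-1}(j)$ ($\lambda,\mu\in\mathfrak C_D$), let $[s]\in\mathbf S_D\otimes\mathbf K$ be the element such that $T_\nu\mapsto\delta_{\mu\nu}\,v^{y_s}\sum_w T_w\in T_\lambda\mathbf H_D$, the sum being over the $w\in S_D$ with $\#\{k:\lambda(w(k))=i,\ \mu(k)=j\}=s_{ij}$ for all $i,j$, and $y_s=\sum s_{ij}s_{kl}$ over $i\ge k$, $j<l$, $1\le i\le n$. Let $\dot{\mathbf U}$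 be the modified quantum algebra of $\widehat{\mathfrak{gl}}_n$ at level $0$, i.e. the $\mathbf K$-algebra without unity generated by the elements $\mathbf a_\mu$, $\mathbf e_i\mathbf a_\mu$, $\mathbf f_i\mathbf a_\mu$ ($i\in\mathbb Z/n$, $\mu\in\mathbb N^n$, components indexed by $\mathbb Z/n$, $\omega_i$ the $i$-th unit vector), subject to $\mathbf a_\mu\mathbf a_\nu=\delta_{\mu\nu}\mathbf a_\mu$, $\mathbf e_i\mathbf a_\mu=\mathbf a_{\mu+\omega_i-\omega_{i+1}}\mathbf e_i$, $\mathbf f_i\mathbf a_\mu=\mathbf a_{\mu-\omega_i+\omega_{i+1}}\mathbf f_i$ (where $\mathbf a_\nu=0$ if $\nu\notin\mathbb N^n$), $[\mathbf e_i,\mathbf f_j]\mathbf a_\mu=\delta_{ij}[\mu_i-\mu_{i+1}]\mathbf a_\mu$ with $[k]=(v^k-v^{-k})/(v-v^{-1})$, and the quantum Serre relations of type $A^{(1)}_{n-1}$ for the $\mathbf e_i$ and for the $\mathbf f_i$. Write ${}^\sharp\lambda=(\#\lambda^{-1}(i))_{i}$ for $\lambda\in\mathfrak C_D$. There is a unique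 algebra homomorphism $\Phi_D:\dot{\mathbf U}\to\mathbf S_D\otimes\mathbf K$ such that $\Phi_D(\mathbf a_\mu)=0$ if $\sum_i\mu_i\ne D$, $\Phi_D(\mathbf a_{{}^\sharp\lambda})=[{}^\delta\lambda]$ with ${}^\delta\lambda$ the diagonal matrix with entries $\#\lambda^{-1}(k)$, and, whenever ${}^\sharp\lambda_i\ge1$, $\Phi_D(\mathbf a_{{}^\sharp\lambda}\mathbf e_i)=[s]$ and $\Phi_D(\mathbf f_i\mathbf a_{{}^\sharp\lambda})=[t]$, where $s$ is obtained from ${}^\delta\lambda$ by subtracting $1$ at the places $(k,k)$ and adding $1$ at the places $(k,k+1)$, for all $k\equiv i$ mod $n$, and $t$ is the transpose of $s$. Through $\Phi_D$ the space $\mathbf T_D\otimes\mathbf K$ is a $\dot{\mathbf U}$-module. **Theorem.** The $\dot{\mathbf U}$-module $\mathbf T_D\otimes\mathbf K$ is integrable (it is the sum of its weight spaces $\mathbf a_\mu(\mathbf T_D\otimes\mathbf K)$, and all $\mathbf e_i,\mathbf f_i$ act locally nilpotently). Let $\mathbf L_D$ be the $\mathbf Z_0$-span of the elements $[p]$, $p\in\mathfrak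 P_D$, and let $B_D\subset\mathbf L_D/v\mathbf L_D$ be the set of their classes. Then $(\mathbf L_D,B_D)$ is a (lower) Kashiwara crystal base of $\mathbf T_D\otimes\mathbf K$, that is: $\mathbf L_D$ is a free $\mathbf Z_0$-module that spans $\mathbf T_D\otimes\mathbf K$ over $\mathbf K$ and is the sum of its weight spaces; $B_D$ is a $\mathbb C$-basis of $\mathbf L_D/v\mathbf L_D$ formed by classes of weight vectors; and the Kashiwara operators $\tilde{\mathbf e}_i,\tilde{\mathbf f}_i$ (defined by $\mathbf f_i^{(k)}u\mapsto\mathbf f_i^{(k-1)}u$, resp. $\mathbf f_i^{(k)}u\mapsto\mathbf f_i^{(k+1)}u$, for $u$ of weight $\mu$ with $\mathbf e_iu=0$ and $0\le k\le\mu_i-\mu_{i+1}$, where $\mathbf f_i^{(k)}=\mathbf f_i^k/[k]!$ and $\mathbf f_i^{(-1)}=0$) satisfy, for all $i$: $\tilde{\mathbf e}_i\mathbf L_D\subseteq\mathbf L_D$ and $\tilde{\mathbf f}_i\mathbf L_D\subseteq\mathbf L_D$; $\tilde{\mathbf e}_iB_D\subseteq B_D\cup\{0\}$ and $\tilde{\mathbf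 f}_iB_D\subseteq B_D\cup\{0\}$; and $\tilde{\mathbf e}_ib=b'$ if and only if $\tilde{\mathbf f}_ib'=b$, for all $b,b'\in B_D$. -/

import Mathlib

open Polynomial

noncomputable section

namespace AffineSchur

/-! ### Ground rings -/

/-- The field `K = ℂ(v)`. -/
abbrev K : Type := RatFunc ℂ

/-- The formal variable `v`, as an element of `K`. -/
def v : K := RatFunc.X

/-- The local ring `ℂ[v]_(v)` of rational functions that are regular at `v = 0`. -/
def Z₀ : Subring K where
  carrier := {f | ∃ a b : ℂ[X], b.eval 0 ≠ 0 ∧ f = algebraMap ℂ[X] K a / algebraMap ℂ[X] K b}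
  one_mem' := ⟨1, 1, by simp, by simp⟩
  zero_mem' := ⟨0, 1, by simp, by simp⟩
  mul_mem' := by
    rintro _ _ ⟨a, b, hb, rfl⟩ ⟨c, d, hd, rfl⟩
    refine ⟨a * c, b * d, by simp [hb, hd], ?_⟩
    rw [map_mul, map_mul, div_mul_div_comm]
  neg_mem' := by
    rintro _ ⟨a, b, hb, rfl⟩
    exact ⟨-a, b, hb, by rw [map_neg]; ring⟩
  add_mem' := by
    rintro _ _ ⟨a, b, hb, rfl⟩ ⟨c, d, hd, rfl⟩
    have ne : ∀ q : ℂ[X], q.eval 0 ≠ 0 → algebraMap ℂ[X] K q ≠ 0 := fun q hq h0 =>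
      hq (by rw [(map_eq_zero_iff _ (RatFunc.algebraMap_injective ℂ)).1 h0, eval_zero])
    refine ⟨a * d + b * c, b * d, by simp [hb, hd], ?_⟩
    rw [map_add, map_mul, map_mul, map_mul, div_add_div _ _ (ne b hb) (ne d hd)]

/-- `v` as an element of `Z₀`. -/
def vZ : Z₀ := ⟨v, X, 1, by simp, by simp [v]⟩

/-- The quantum integer `[k] = (v^k - v^{-k}) / (v - v⁻¹)`. -/
def qInt (k : ℤ) : K := (v ^ k - v ^ (-k)) / (v - v⁻¹)

/-- The quantum factorial `[k]! = [k][k-1]⋯[1]`. -/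
def qFact (k : ℕ) : K := ∏ j ∈ Finset.range k, qInt (j + 1)

/-! ### The affine symmetric group and the affine Hecke algebra of type `GL_D` -/

/-- The (extended) affine symmetric group of type `GL_D`: the permutations `w` of `ℤ` with
`w (j + D) = w j + D` for all `j`. -/
def affineSym (D : ℕ) : Subgroup (Equiv.Perm ℤ) where
  carrier := {w | ∀ j : ℤ, w (j + D) = w j + D}
  one_mem' := fun _ => rfl
  mul_mem' := fun {a b} ha hb j => by
    rw [Equiv.Perm.mul_apply, hb j, ha (b j), Equiv.Perm.mul_apply]
  inv_mem' := fun {a} ha j => by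
    rw [Equiv.Perm.inv_eq_iff_eq, ha, Equiv.Perm.coe_inv, Equiv.apply_symm_apply]

/-- The length of `w`: the number of inversions `k < l`, `w k > w l`, up to simultaneous
translation of `k` and `l` by `D`. -/
def len {D : ℕ} (w : affineSym D) : ℕ :=
  Set.ncard {x : ℤ × ℤ | 1 ≤ x.1 ∧ x.1 ≤ D ∧ x.1 < x.2 ∧ w.1 x.2 < w.1 x.1}

/-- `w` is the simple reflection that exchanges `j + mD` and `j + 1 + mD` for all `m`, for some `j`
(there is none if `D = 1`). -/
def IsSimpleReflection {D : ℕ} (w : affineSym D) : Prop :=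
  ∃ j : ℤ, w.1 j = j + 1 ∧ w.1 (j + 1) = j ∧
    ∀ k : ℤ, ¬ k ≡ j [ZMOD D] → ¬ k ≡ j + 1 [ZMOD D] → w.1 k = k

/-- The Iwahori–Matsumoto relations between the elements `T_w`. -/
inductive HeckeRel (D : ℕ) :
    FreeAlgebra K (affineSym D) → FreeAlgebra K (affineSym D) → Prop
  | one : HeckeRel D (FreeAlgebra.ι K 1) 1
  | mul (w x : affineSym D) (h : len (w * x) = len w + len x) :
      HeckeRel D (FreeAlgebra.ι K w * FreeAlgebra.ι K x) (FreeAlgebra.ι K (w * x))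
  | quad (s : affineSym D) (h : IsSimpleReflection s) :
      HeckeRel D ((FreeAlgebra.ι K s + 1) *
        (FreeAlgebra.ι K s - algebraMap K (FreeAlgebra K (affineSym D)) (v ^ (-2 : ℤ)))) 0

/-- The affine Hecke algebra of type `GL_D`, over the field `K`. -/
def Hecke (D : ℕ) : Type := RingQuot (HeckeRel D)

instance (D : ℕ) : Ring (Hecke D) := inferInstanceAs (Ring (RingQuot (HeckeRel D)))

instance (D : ℕ) : Algebra K (Hecke D) := inferInstanceAs (Algebra K (RingQuot (HeckeRel D)))

/-- The element `T_w` of the Hecke algebra. -/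
def T {D : ℕ} (w : affineSym D) : Hecke D :=
  RingQuot.mkAlgHom K (HeckeRel D) (FreeAlgebra.ι K w)

/-! ### The module `T_D ⊗ K` -/

/-- The set `P_D` of functions `p : ℤ → ℤ` with `p (j + D) = p j + n`. -/
def PD (n D : ℕ) : Type := {p : ℤ → ℤ // ∀ j : ℤ, p (j + D) = p j + n}

/-- The subset `C_D` of `P_D`: `1 ≤ p 1 ≤ p 2 ≤ ⋯ ≤ p D ≤ n`. -/
def CD (n D : ℕ) : Type :=
  {p : PD n D // 1 ≤ p.1 1 ∧ (∀ j : ℤ, 1 ≤ j → j < D → p.1 j ≤ p.1 (j + 1)) ∧ p.1 D ≤ n}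

/-- The coset of `S_λ \ S_D` identified with `p`, for `p` in the orbit of `λ`:
all `w` with `(λ)w = p`. It is empty if `p` is not in the orbit of `λ`. -/
def cosetOf {n D : ℕ} (lam : CD n D) (p : PD n D) : Set (affineSym D) :=
  {w | ∀ k : ℤ, lam.1.1 (w.1 k) = p.1 k}

/-- `T_p`, the sum of the `T_w` over the (finite) coset `p` of `S_λ \ S_D`; zero if `p` is not in
the orbit of `λ`. -/
def Tcoset {n D : ℕ} (lam : CD n D) (p : PD n D) : Hecke D :=
  ∑ᶠ w ∈ cosetOf lam p, T w

/-- The right ideal `T_λ H_D`, where `T_λ` is the sum of the `T_w` over the Young subgroup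
`S_λ = {w | (λ)w = λ}`. -/
def rightIdeal {n D : ℕ} (lam : CD n D) : Submodule (Hecke D)ᵐᵒᵖ (Hecke D) :=
  Submodule.span (Hecke D)ᵐᵒᵖ {Tcoset lam lam.1}

/-- The right `H_D`-module `T_D ⊗ K`, the direct sum of the `T_λ H_D` (the index set `C_D` is
finite). -/
abbrev TD (n D : ℕ) : Type := ∀ lam : CD n D, rightIdeal lam

/-- `S_D ⊗ K`: the endomorphism ring of the right `H_D`-module `T_D ⊗ K`. -/
abbrev SD (n D : ℕ) : Type := Module.End (Hecke D)ᵐᵒᵖ (TD n D)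

open Classical in
/-- The element `T_λ` of the summand `T_λ H_D` of `T_D`. -/
def Tgen {n D : ℕ} (lam : CD n D) : TD n D :=
  Pi.single lam ⟨Tcoset lam lam.1, Submodule.subset_span rfl⟩

/-- The number `x_p`. -/
def xdim {n D : ℕ} (p : PD n D) : ℕ :=
  Set.ncard {x : ℤ × ℤ | 1 ≤ p.1 x.1 ∧ p.1 x.1 ≤ n ∧ x.1 < x.2 ∧ p.1 x.2 ≤ p.1 x.1}

open Classical in
/-- The normalized standard element `[p] = v^{x_p} T_p` of `T_D`. The component `T_p` always
belongs to `T_λ H_D`, so that the alternative in the definition does not occur. -/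
def std {n D : ℕ} (p : PD n D) : TD n D := fun lam =>
  if h : v ^ xdim p • Tcoset lam p ∈ rightIdeal lam then ⟨_, h⟩ else 0

/-! ### Standard elements of the affine `q`-Schur algebra -/

/-- `♯λ_k`, the number of elements of `λ⁻¹(k)`, for `k ∈ ℤ` (it is `n`-periodic in `k`). -/
def sharpInt {n D : ℕ} (p : PD n D) (k : ℤ) : ℕ := Set.ncard {j : ℤ | p.1 j = k}

/-- The matrix of the relative position of the coordinate flags `L_p` and `L_q`:
its entry `(i,j)` is `dim (L_i ∩ L'_j / (L_{i-1} ∩ L'_j + L_i ∩ L'_{j-1}))`, which counts the basis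
vectors `e_k` with `p k = i`, `q k = j`. -/
def relPos (p q : ℤ → ℤ) (i j : ℤ) : ℤ := Set.ncard {k : ℤ | p k = i ∧ q k = j}

/-- The number `y_s`: the sum of `s_{ij} s_{kl}` over `i ≥ k`, `j < l`, `1 ≤ i ≤ n`. -/
def ydim (n : ℕ) (s : ℤ → ℤ → ℤ) : ℤ :=
  ∑ᶠ x ∈ {x : ℤ × ℤ × ℤ × ℤ | 1 ≤ x.1 ∧ x.1 ≤ n ∧ x.2.2.1 ≤ x.1 ∧ x.2.1 < x.2.2.2},
    s x.1 x.2.1 * s x.2.2.1 x.2.2.2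

/-- The element `T_s`, the sum of the `T_w` over the (finite) double coset of `S_λ \ S_D / S_μ` of
those `w` such that `(L_{(λ)w}, L_μ)` is in relative position `s`. -/
def Tdouble {n D : ℕ} (s : ℤ → ℤ → ℤ) (lam mu : CD n D) : Hecke D :=
  ∑ᶠ w ∈ {w : affineSym D | relPos (fun k => lam.1.1 (w.1 k)) mu.1.1 = s}, T w

/-- `φ` is the element `[s] = v^{y_s} T_s` of the affine `q`-Schur algebra, where the matrix `s` has
row sums `♯λ` and column sums `♯μ`: the `H_D`-linear map that sends `T_ν` to `δ_{μν} [s]`, with `T_s`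
viewed in the summand `T_λ H_D`. -/
def IsStdEndo {n D : ℕ} (φ : SD n D) (s : ℤ → ℤ → ℤ) (lam mu : CD n D) : Prop :=
  ∀ nu kap : CD n D,
    (nu = mu ∧ kap = lam → (φ (Tgen nu) kap : Hecke D) = v ^ ydim n s • Tdouble s lam mu) ∧
    (¬ (nu = mu ∧ kap = lam) → (φ (Tgen nu) kap : Hecke D) = 0)

/-- The diagonal matrix `^δλ`. -/
def deltaMat {n D : ℕ} (lam : CD n D) (k l : ℤ) : ℤ := if k = l then sharpInt lam.1 k else 0

/-- The matrix obtained from `^δλ` by subtracting the `n`-periodic elementary matrix at `(i,i)` and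
adding the one at `(i,i+1)`. -/
def eMat {n D : ℕ} (lam : CD n D) (i : ZMod n) (k l : ℤ) : ℤ :=
  deltaMat lam k l - (if (k : ZMod n) = i ∧ l = k then 1 else 0)
    + (if (k : ZMod n) = i ∧ l = k + 1 then 1 else 0)

/-! ### The modified quantum algebra -/

/-- Weights, with the indices `1, …, n` read modulo `n`. -/
abbrev Wt (n : ℕ) : Type := ZMod n → ℤ

/-- `ω_i`. -/
def omega {n : ℕ} (i : ZMod n) : Wt n := Pi.single i 1

/-- `♯λ` as a weight. -/
def sharp {n D : ℕ} (p : PD n D) : Wt n := fun i => sharpInt p (i.val : ℤ)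

/-- The symbols `e_i` and `f_i`. -/
inductive Letter (n : ℕ) : Type
  | e (i : ZMod n)
  | f (i : ZMod n)

/-- The change of weight by a letter: `e_i` adds `ω_i - ω_{i+1}` and `f_i` subtracts it. -/
def Letter.shift {n : ℕ} : Letter n → Wt n → Wt n
  | .e i, mu => mu + omega i - omega (i + 1)
  | .f i, mu => mu - omega i + omega (i + 1)

/-- The generators `a_μ` and `x a_μ`, with `x = e_i` or `x = f_i`. To make the relations uniform,
`μ` runs over all integral weights; the generators whose weights are not in `ℕ^n` are set equal to
zero in `UdotRel`. -/
inductive UGen (n : ℕ) : Type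
  | a (mu : Wt n)
  | x (l : Letter n) (mu : Wt n)

/-- The final weight of a word in the letters `e_i`, `f_i`, applied from the right. -/
def wordWt {n : ℕ} : List (Letter n) → Wt n → Wt n
  | [], mu => mu
  | l :: w, mu => l.shift (wordWt w mu)

/-- The monomial `x_1 x_2 ⋯ x_r a_μ` attached to the word `x_1, …, x_r`. -/
def mono {n : ℕ} : List (Letter n) → Wt n → FreeAlgebra K (UGen n)
  | [], mu => FreeAlgebra.ι K (.a mu)
  | l :: w, mu => FreeAlgebra.ι K (.x l (wordWt w mu)) * mono w mu

/-- The affine Cartan matrix of type `A^{(1)}_{n-1}`, `n ≥ 2`. -/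
def cartan {n : ℕ} (i j : ZMod n) : ℤ :=
  if i = j then 2 else (if j = i + 1 then -1 else 0) + (if i = j + 1 then -1 else 0)

/-- The quantum Serre expression
`∑_{k=0}^{m} (-1)^k x^{(k)} y x^{(m-k)} a_μ`, with divided powers `x^{(k)} = x^k / [k]!`. -/
def serre {n : ℕ} (x y : Letter n) (m : ℕ) (mu : Wt n) : FreeAlgebra K (UGen n) :=
  ∑ k ∈ Finset.range (m + 1), ((-1 : K) ^ k * (qFact k * qFact (m - k))⁻¹) •
    mono (List.replicate k x ++ y :: List.replicate (m - k) x) mu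

/-- The defining relations of the modified algebra. -/
inductive UdotRel (n : ℕ) : FreeAlgebra K (UGen n) → FreeAlgebra K (UGen n) → Prop
  | a_self (mu : Wt n) :
      UdotRel n (FreeAlgebra.ι K (.a mu) * FreeAlgebra.ι K (.a mu)) (FreeAlgebra.ι K (.a mu))
  | a_orth (mu nu : Wt n) (h : mu ≠ nu) :
      UdotRel n (FreeAlgebra.ι K (.a mu) * FreeAlgebra.ι K (.a nu)) 0
  | a_neg (mu : Wt n) (h : ∃ j, mu j < 0) : UdotRel n (FreeAlgebra.ι K (.a mu)) 0
  | x_source (l : Letter n) (mu : Wt n) :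
      UdotRel n (FreeAlgebra.ι K (.x l mu) * FreeAlgebra.ι K (.a mu)) (FreeAlgebra.ι K (.x l mu))
  | x_target (l : Letter n) (mu : Wt n) :
      UdotRel n (FreeAlgebra.ι K (.a (l.shift mu)) * FreeAlgebra.ι K (.x l mu))
        (FreeAlgebra.ι K (.x l mu))
  | comm_self (i : ZMod n) (mu : Wt n) :
      UdotRel n (mono [.e i, .f i] mu - mono [.f i, .e i] mu)
        (qInt (mu i - mu (i + 1)) • FreeAlgebra.ι K (.a mu))
  | comm_ne (i j : ZMod n) (h : i ≠ j) (mu : Wt n) :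
      UdotRel n (mono [.e i, .f j] mu - mono [.f j, .e i] mu) 0
  | serre_e (i j : ZMod n) (h : i ≠ j) (mu : Wt n) :
      UdotRel n (serre (.e i) (.e j) (1 - cartan i j).toNat mu) 0
  | serre_f (i j : ZMod n) (h : i ≠ j) (mu : Wt n) :
      UdotRel n (serre (.f i) (.f j) (1 - cartan i j).toNat mu) 0

/-- The unital algebra with the generators and relations of the modified algebra. -/
def UdotOne (n : ℕ) : Type := RingQuot (UdotRel n)

instance (n : ℕ) : Ring (UdotOne n) := inferInstanceAs (Ring (RingQuot (UdotRel n)))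

instance (n : ℕ) : Algebra K (UdotOne n) := inferInstanceAs (Algebra K (RingQuot (UdotRel n)))

/-- A generator, in `UdotOne n`. -/
def ugen {n : ℕ} (g : UGen n) : UdotOne n := RingQuot.mkAlgHom K (UdotRel n) (FreeAlgebra.ι K g)

/-- The modified algebra, a `K`-algebra without unity: all relations are without constant term, so
it is the subalgebra without unity generated by the generators in `UdotOne n`. -/
def Udot (n : ℕ) : NonUnitalSubalgebra K (UdotOne n) :=
  NonUnitalAlgebra.adjoin K (Set.range ugen)

/-- The element `a_μ` of the modified algebra (zero if `μ` is not in `ℕ^n`). -/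
def ua {n : ℕ} (mu : Wt n) : Udot n :=
  ⟨ugen (.a mu), NonUnitalAlgebra.subset_adjoin K ⟨_, rfl⟩⟩

/-- The element `e_i a_μ` or `f_i a_μ` of the modified algebra. -/
def ux {n : ℕ} (l : Letter n) (mu : Wt n) : Udot n :=
  ⟨ugen (.x l mu), NonUnitalAlgebra.subset_adjoin K ⟨_, rfl⟩⟩

/-- The properties that characterize the homomorphism `Φ_D` from the modified algebra to the affine
`q`-Schur algebra:
`Φ_D(a_μ) = 0` if `∑ μ_i ≠ D`, `Φ_D(a_{♯λ}) = [^δλ]`, `Φ_D(a_{♯λ} e_i) = [s]` and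
`Φ_D(f_i a_{♯λ}) = [t]`, where `s` is obtained from `^δλ` by moving a unit from the place `(i,i)` to
the place `(i,i+1)` and `t` is the transpose of `s`. Here `♯λ_i ≥ 1`, and `♯μ` is the vector of
column sums of `s`. (If `♯λ_i = 0`, then `a_{♯λ} e_i = f_i a_{♯λ} = 0`.) -/
structure IsPhi {n D : ℕ} (Φ : Udot n →ₙₐ[K] SD n D) : Prop where
  a_zero : ∀ mu : Wt n, (∀ j, 0 ≤ mu j) → ∑ j ∈ Finset.range n, mu (j : ZMod n) ≠ D → Φ (ua mu) = 0
  a_sharp : ∀ lam : CD n D, IsStdEndo (Φ (ua (sharp lam.1))) (deltaMat lam) lam lam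
  e_sharp : ∀ (i : ZMod n) (lam mu : CD n D), 1 ≤ sharp lam.1 i →
    sharp mu.1 = sharp lam.1 - omega i + omega (i + 1) →
    IsStdEndo (Φ (ua (sharp lam.1) * ux (.e i) (sharp mu.1))) (eMat lam i) lam mu
  f_sharp : ∀ (i : ZMod n) (lam mu : CD n D), 1 ≤ sharp lam.1 i →
    sharp mu.1 = sharp lam.1 - omega i + omega (i + 1) →
    IsStdEndo (Φ (ux (.f i) (sharp lam.1))) (fun k l => eMat lam i l k) mu lam

/-- The representation of the modified algebra on the `K`-vector space `T_D ⊗ K` defined by a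
homomorphism to the affine `q`-Schur algebra. -/
def toRep {n D : ℕ} (Φ : Udot n →ₙₐ[K] SD n D) : Udot n →ₙₐ[K] Module.End K (TD n D) where
  toFun u := (Φ u).restrictScalars K
  map_smul' c u := by ext1 x; simp
  map_zero' := by ext1 x; simp
  map_add' u w := by ext1 x; simp
  map_mul' u w := by ext1 x; simp

/-! ### Integrable modules, Kashiwara operators and crystal bases -/

section Crystal

variable {n : ℕ} {M : Type*} [AddCommGroup M] [Module K M]

/-- The weight space `M_μ = a_μ M`. -/
def wtSpace (ρ : Udot n →ₙₐ[K] Module.End K M) (mu : Wt n) : Submodule K M :=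
  LinearMap.range (ρ (ua mu))

/-- The operator `e_i` or `f_i` on a module that is the sum of its weight spaces: it acts on `M_μ` by
`e_i a_μ` or `f_i a_μ`. -/
def act (ρ : Udot n →ₙₐ[K] Module.End K M) (l : Letter n) (m : M) : M :=
  ∑ᶠ mu : Wt n, ρ (ux l mu) m

/-- `M` is integrable: it is the sum of its weight spaces, and all `e_i` and `f_i` are locally
nilpotent. -/
structure IsIntegrable (ρ : Udot n →ₙₐ[K] Module.End K M) : Prop where
  weight : ⨆ mu : Wt n, wtSpace ρ mu = ⊤
  nilpotent : ∀ (l : Letter n) (m : M), ∃ N : ℕ, (act ρ l)^[N] m = 0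

/-- The divided power `f_i^{(k)} m`. -/
def fDiv (ρ : Udot n →ₙₐ[K] Module.End K M) (i : ZMod n) (k : ℕ) (m : M) : M :=
  (qFact k)⁻¹ • (act ρ (.f i))^[k] m

/-- The triples `(μ, u, k)` that enter the decompositions `m = ∑ f_i^{(k)} u`: `u ∈ M_μ`, `e_i u = 0`
and `0 ≤ k ≤ ⟨h_i, μ⟩ = μ_i - μ_{i+1}`. -/
def IsString (ρ : Udot n →ₙₐ[K] Module.End K M) (i : ZMod n) (mu : Wt n) (u : M) (k : ℕ) : Prop :=
  u ∈ wtSpace ρ mu ∧ act ρ (.e i) u = 0 ∧ (k : ℤ) ≤ mu i - mu (i + 1)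

/-- `Et` and `Ft` are the (lower) Kashiwara operators attached to `i`: every element of `M` is a sum
of vectors `f_i^{(k)} u` as in `IsString`, and the operators are given on these by
`f_i^{(k)} u ↦ f_i^{(k-1)} u` (zero if `k = 0`) and `f_i^{(k)} u ↦ f_i^{(k+1)} u`. -/
structure IsKashiwara (ρ : Udot n →ₙₐ[K] Module.End K M) (i : ZMod n) (Et Ft : Module.End K M) :
    Prop where
  span : Submodule.span K {m : M | ∃ mu u k, IsString ρ i mu u k ∧ m = fDiv ρ i k u} = ⊤
  e_zero : ∀ mu u, IsString ρ i mu u 0 → Et (fDiv ρ i 0 u) = 0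
  e_succ : ∀ mu u k, IsString ρ i mu u (k + 1) → Et (fDiv ρ i (k + 1) u) = fDiv ρ i k u
  f_succ : ∀ mu u k, IsString ρ i mu u k → Ft (fDiv ρ i k u) = fDiv ρ i (k + 1) u

/-- The submodule `v L` of `L`. -/
abbrev vL (L : Submodule Z₀ M) : Submodule Z₀ L := Ideal.span {vZ} • ⊤

/-- The class in `L / v L` of an element of `L`. -/
def cls (L : Submodule Z₀ M) (x : L) : L ⧸ vL L := Submodule.Quotient.mk x

/-- The restriction to `L` of an operator on `M` that preserves `L`. -/
def restrictTo (L : Submodule Z₀ M) (F : Module.End K M) (h : ∀ x ∈ L, F x ∈ L) : L →ₗ[Z₀] L where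
  toFun x := ⟨F x, h x x.2⟩
  map_add' x y := Subtype.ext (map_add F (x : M) (y : M))
  map_smul' c x := Subtype.ext (map_smul F (c : K) (x : M))

/-- The endomorphism of `L / v L` induced by an operator on `M` that preserves `L`. -/
def induced (L : Submodule Z₀ M) (F : Module.End K M) (h : ∀ x ∈ L, F x ∈ L) :
    (L ⧸ vL L) →ₗ[Z₀] (L ⧸ vL L) :=
  Submodule.mapQ (vL L) (vL L) (restrictTo L F h) (by
    rw [← Submodule.map_le_iff_le_comap, Submodule.map_smul'']
    exact Submodule.smul_mono le_rfl le_top)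

/-- `(L, B)` is a (lower) crystal base of the integrable module `M`. -/
structure IsCrystalBase (ρ : Udot n →ₙₐ[K] Module.End K M) (L : Submodule Z₀ M)
    (B : Set (L ⧸ vL L)) : Prop where
  /-- `L` is a free `Z₀`-module with `L ⊗ K = M`. -/
  free : Module.Free Z₀ L
  generates : Submodule.span K (L : Set M) = ⊤
  /-- `L` is the sum of its weight spaces `L ∩ M_μ`. -/
  weight : ∀ x ∈ L, ∀ mu : Wt n, ρ (ua mu) x ∈ L
  /-- `B` is a basis of the vector space `L / v L` over the residue field `Z₀ / v Z₀ = ℂ`. -/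
  linInd : LinearIndepOn (Z₀ ⧸ Ideal.span {vZ}) id B
  spans : Submodule.span (Z₀ ⧸ Ideal.span {vZ}) B = ⊤
  /-- Every element of `B` is the class of a weight vector. -/
  weightB : ∀ b ∈ B, ∃ (mu : Wt n) (x : L), (x : M) ∈ wtSpace ρ mu ∧ cls L x = b
  /-- The Kashiwara operators exist, preserve `L`, send `B` to `B ∪ {0}`, and `ẽ_i b = b'` if and
  only if `f̃_i b' = b`, for `b` and `b'` in `B`. -/
  operators : ∃ Et Ft : ZMod n → Module.End K M, (∀ i, IsKashiwara ρ i (Et i) (Ft i)) ∧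
    ∃ (hE : ∀ i, ∀ x ∈ L, Et i x ∈ L) (hF : ∀ i, ∀ x ∈ L, Ft i x ∈ L),
      (∀ i, ∀ b ∈ B, induced L (Et i) (hE i) b ∈ B ∪ {0}) ∧
      (∀ i, ∀ b ∈ B, induced L (Ft i) (hF i) b ∈ B ∪ {0}) ∧
      (∀ i, ∀ b ∈ B, ∀ b' ∈ B,
        induced L (Et i) (hE i) b = b' ↔ induced L (Ft i) (hF i) b' = b)

end Crystal

/-! ### The crystal lattice of `T_D` -/

/-- The `Z₀`-span of the elements `[p]`. -/
def LD (n D : ℕ) : Submodule Z₀ (TD n D) := Submodule.span Z₀ (Set.range std)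

/-- The class of `[p]` modulo `v`. -/
def bcls {n D : ℕ} (p : PD n D) : LD n D ⧸ vL (LD n D) :=
  cls (LD n D) ⟨std p, Submodule.subset_span ⟨p, rfl⟩⟩

/-- The set `B_D` of the classes of the elements `[p]`. -/
def BD (n D : ℕ) : Set (LD n D ⧸ vL (LD n D)) := Set.range bcls

end AffineSchur

end

open Polynomial

noncomputable section

namespace AffineSchur

/-! ### Equivariant functions -/

/-! The space `T_D ⊗ K` has the basis `T_p`, `p ∈ P_D`. It is spanned by these elements because
their span inside `T_λ H_D` is stable under the generators of `H_D`: the product `T_p T_s` is given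
by a formula with three cases, according to whether `p` ascends, is stationary or descends at the
places exchanged by `s`. Independence reduces to that of the `T_w`. For this one lets the generators
act from the left and from the right on the free vector space over `S_D`; the two actions commute
(`regLeft_regRight`), so that for every `w` there is exactly one operator that commutes with the
right action and sends `1` to `w`. These operators satisfy the Hecke relations.

On the basis `T_p` the operator `e_i` replaces one value `i + 1` by `i`, summed over all places
where this is possible and weighted by powers of `v`; `f_i` does the reverse. Both commute with the
right action of `H_D` (`opE_opS`, and `opF_opS` by a duality that reverses the order of the places).
Applied to `T_λ` they give the prescribed elements `[s]`: since `λ` is monotone, the powers of `v`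
are the same for all summands.

Now fix `i`. Only the places where `p` has the value `i` or `i + 1` matter; read in increasing order
they spell a word in two letters. After the normalization `[p] = v^{x_p} T_p` the operators `e_i`,
`f_i` become, by `xdim_set`, the coproduct action of quantum `sl_2` on a tensor power of its
two-dimensional module, the words being the pure tensors. So `T_D ⊗ K` is, for each `i` separately,
a sum of such tensor powers, and `L_D`, `B_D` are the standard lattice and basis.

The heart of the proof is an explicit second basis `Word.cW` of these tensor powers, obtained by
iterating the decomposition `V ⊗ V(m) = V(m+1) ⊕ V(m-1)`. It is congruent to the basis of words
modulo `v` and spans the same lattice over the local ring, and `e`, `f` act on it by the signature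
rule with coefficients `[phi + 1]` and `[eps + 1]`, exactly as on the vectors `f^{(k)} u` of simple
modules (`Word.e_cW`, `Word.f_cW`). This one fact yields the commutator of `e_i` and `f_i`, local
nilpotence, and the crystal base: the Kashiwara operators move the vectors of the second basis along
their strings, hence preserve the lattice and act on `B_D` by the signature rule.

It also yields the Serre relations. The expression `S = ∑ (-1)^k e_i^{(k)} e_j e_i^{(m-k)}` commutes
with `f_i` because `e_j` does. If `b` is a string vector of weight `a` with `e_i b = 0`, then
`f_i^{a+1} S b = S f_i^{a+1} b = 0`; but `S b` has weight `a + m + 1`, and `f_i^{a+1}` is injective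
in that weight. So `S b = 0`, and such `b` generate everything under `f_i`
(`IsStringFamily.serreOp_eq_zero`).

Finally `Φ_D` is unique because an `H_D`-linear endomorphism is determined by its values at the
`T_λ`, and generators whose source or target weight is not of the form `♯λ` must go to zero. -/

lemma equivariant_int {N D : ℤ} {f : ℤ → ℤ} (hf : ∀ j, f (j + D) = f j + N) (j m : ℤ) :
    f (j + m * D) = f j + m * N := by
  induction m using Int.induction_on with
  | zero => simp
  | succ i ih => rw [add_mul, one_mul, ← add_assoc, hf, ih]; ring
  | pred i ih =>
    have := hf (j + (-(i : ℤ) - 1) * D)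
    rw [show j + (-(i : ℤ) - 1) * D + D = j + -(i : ℤ) * D by ring, ih] at this
    linarith

lemma PD.shift {n D : ℕ} (p : PD n D) (j m : ℤ) : p.1 (j + m * D) = p.1 j + m * n :=
  equivariant_int p.2 j m

lemma affineSym_shift {D : ℕ} (w : affineSym D) (j m : ℤ) : w.1 (j + m * D) = w.1 j + m * D :=
  equivariant_int w.2 j m

@[ext] lemma PD.ext {n D : ℕ} {p q : PD n D} (h : ∀ k, p.1 k = q.1 k) : p = q :=
  Subtype.ext (funext h)

lemma modEq_iff_exists {D k l : ℤ} : k ≡ l [ZMOD D] ↔ ∃ m : ℤ, k = l + m * D := by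
  rw [Int.modEq_comm, Int.modEq_iff_dvd]
  constructor
  · rintro ⟨m, hm⟩; exact ⟨m, by linarith⟩
  · rintro ⟨m, hm⟩; exact ⟨m, by linarith⟩

/-- On a residue class modulo `D` the function `p` is an arithmetic progression with difference `n >
0`, hence injective there. -/
lemma PD.eq_of_modEq {n D : ℕ} (hn : 0 < n) (p : PD n D) {k l : ℤ} (h : k ≡ l [ZMOD D])
    (hp : p.1 k = p.1 l) : k = l := by
  obtain ⟨m, rfl⟩ := modEq_iff_exists.1 h
  rw [p.shift] at hp
  have : m * (n : ℤ) = 0 := by linarith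
  rcases mul_eq_zero.1 this with h | h
  · simp [h]
  · omega

/-! ### Counting pairs of integers modulo simultaneous translation -/

/-- The invariant of a pair of integers that determines it up to translation by `D`. -/
def pairClass (D : ℕ) (x : ℤ × ℤ) : ZMod D × ℤ := ((x.1 : ZMod D), x.2 - x.1)

lemma pairClass_eq_iff {D : ℕ} {x y : ℤ × ℤ} :
    pairClass D x = pairClass D y ↔ ∃ m : ℤ, x = (y.1 + m * D, y.2 + m * D) := by
  obtain ⟨a, b⟩ := x
  obtain ⟨c, d⟩ := y
  simp only [pairClass, Prod.mk.injEq, ZMod.intCast_eq_intCast_iff, modEq_iff_exists]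
  constructor
  · rintro ⟨⟨m, rfl⟩, h⟩; exact ⟨m, rfl, by linarith⟩
  · rintro ⟨m, rfl, rfl⟩; exact ⟨⟨m, rfl⟩, by ring⟩

/-- A set of pairs is invariant under simultaneous translation by `D`. -/
def TransInv (D : ℕ) (S : Set (ℤ × ℤ)) : Prop :=
  ∀ (x : ℤ × ℤ) (m : ℤ), x ∈ S → (x.1 + m * D, x.2 + m * D) ∈ S

/-- The number of translation classes of the elements of a set of pairs. -/
def orbCount (D : ℕ) (S : Set (ℤ × ℤ)) : ℕ := (pairClass D '' S).ncard

lemma exists_shift_mem {N : ℤ} (hN : 0 < N) (a : ℤ) : ∃ m : ℤ, 1 ≤ a + m * N ∧ a + m * N ≤ N := by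
  refine ⟨-((a - 1) / N), ?_⟩
  have h1 := Int.emod_add_mul_ediv (a - 1) N
  have h2 := Int.emod_nonneg (a - 1) hN.ne'
  have h3 := Int.emod_lt_of_pos (a - 1) hN
  constructor <;> nlinarith

lemma image_pairClass_normalize {D : ℕ} {N : ℤ} (hN : 0 < N) {f : ℤ → ℤ}
    (hf : ∀ j, f (j + D) = f j + N) {S : Set (ℤ × ℤ)} (hS : TransInv D S) :
    pairClass D '' {x ∈ S | 1 ≤ f x.1 ∧ f x.1 ≤ N} = pairClass D '' S := by
  apply Set.Subset.antisymm (Set.image_mono fun x hx => hx.1)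
  rintro _ ⟨x, hx, rfl⟩
  obtain ⟨m, hm1, hm2⟩ := exists_shift_mem hN (f x.1)
  refine ⟨(x.1 + m * D, x.2 + m * D), ⟨hS x m hx, ?_, ?_⟩, ?_⟩
  · simpa [equivariant_int hf] using hm1
  · simpa [equivariant_int hf] using hm2
  · exact pairClass_eq_iff.2 ⟨m, rfl⟩

lemma injOn_pairClass_normalize {D : ℕ} {N : ℤ} (hN : 0 < N) {f : ℤ → ℤ}
    (hf : ∀ j, f (j + D) = f j + N) (S : Set (ℤ × ℤ)) :
    Set.InjOn (pairClass D) {x ∈ S | 1 ≤ f x.1 ∧ f x.1 ≤ N} := by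
  rintro x ⟨-, hx1, hx2⟩ y ⟨-, hy1, hy2⟩ hxy
  obtain ⟨m, rfl⟩ := pairClass_eq_iff.1 hxy
  simp only [equivariant_int hf] at hx1 hx2
  have : m = 0 := by
    have h1 : m < 1 := by by_contra h; nlinarith
    have h2 : -1 < m := by by_contra h; nlinarith
    omega
  simp [this]

/-- Each translation class of an invariant set meets the window `1 ≤ f x.1 ≤ N` in exactly one pair,
so the count does not depend on the equivariant function used as a ruler. The ruler `id` occurs in
lengths, the ruler `p` in the numbers `x_p`; both become `orbCount`. -/
lemma ncard_normalize {D : ℕ} {N : ℤ} (hN : 0 < N) {f : ℤ → ℤ}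
    (hf : ∀ j, f (j + D) = f j + N) {S : Set (ℤ × ℤ)} (hS : TransInv D S) :
    {x ∈ S | 1 ≤ f x.1 ∧ f x.1 ≤ N}.ncard = orbCount D S := by
  rw [orbCount, ← image_pairClass_normalize hN hf hS,
    (injOn_pairClass_normalize hN hf S).ncard_image]

/-- If representatives are normalized by `w` on one side and by the identity on the other, then `w`
itself is a bijection between them. -/
lemma orbCount_preimage {D : ℕ} (hD : 0 < D) (w : affineSym D) {S : Set (ℤ × ℤ)}
    (hS : TransInv D S) : orbCount D {x | (w.1 x.1, w.1 x.2) ∈ S} = orbCount D S := by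
  have hS' : TransInv D {x | (w.1 x.1, w.1 x.2) ∈ S} := by
    intro x m hx
    simpa only [Set.mem_ofPred_eq, affineSym_shift w] using hS _ m hx
  have hD' : (0 : ℤ) < D := by exact_mod_cast hD
  rw [← ncard_normalize hD' w.2 hS', ← ncard_normalize (f := id) hD' (fun _ => rfl) hS]
  refine Set.ncard_congr (fun x _ => (w.1 x.1, w.1 x.2)) (fun x hx => hx) ?_ ?_
  · intro x y _ _ h
    simpa [Prod.ext_iff] using h
  · intro y hy
    refine ⟨(w.1.symm y.1, w.1.symm y.2), ?_, ?_⟩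
    · simp only [Set.mem_ofPred_eq, Equiv.apply_symm_apply]
      exact hy
    · simp

lemma TransInv.disjoint_image {D : ℕ} {S S' : Set (ℤ × ℤ)} (hS : TransInv D S)
    (h : Disjoint S S') : Disjoint (pairClass D '' S) (pairClass D '' S') := by
  rw [Set.disjoint_left]
  rintro _ ⟨x, hx, rfl⟩ ⟨y, hy, hxy⟩
  obtain ⟨m, rfl⟩ := pairClass_eq_iff.1 hxy
  exact Set.disjoint_left.1 h (hS x m hx) hy

/-! ### Finiteness -/

/-- The function `p l * D - l * n` of `l` is periodic modulo `D`, so `p` stays at bounded distance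
from a linear function. The finiteness of fibres and of sets of inversions modulo translation rests
on this. -/
lemma PD.exists_bound {n D : ℕ} (hD : 0 < D) (p : PD n D) :
    ∃ B : ℤ, ∀ l : ℤ, |p.1 l * D - l * n| ≤ B := by
  have hD' : (0 : ℤ) < D := by exact_mod_cast hD
  refine ⟨∑ r ∈ Finset.Icc (1 : ℤ) D, |p.1 r * D - r * n|, fun l => ?_⟩
  obtain ⟨m, h1, h2⟩ := exists_shift_mem hD' l
  have : p.1 l * D - l * n = p.1 (l + m * D) * D - (l + m * D) * n := by
    rw [p.shift]; ring
  rw [this]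
  exact Finset.single_le_sum (f := fun r => |p.1 r * D - r * n|) (fun _ _ => abs_nonneg _)
    (Finset.mem_Icc.2 ⟨h1, h2⟩)

lemma PD.finite_Icc {n D : ℕ} (hn : 0 < n) (hD : 0 < D) (p : PD n D) (a b : ℤ) :
    {k : ℤ | a ≤ p.1 k ∧ p.1 k ≤ b}.Finite := by
  obtain ⟨B, hB⟩ := p.exists_bound hD
  have hD' : (0 : ℤ) < D := by exact_mod_cast hD
  have hn' : (0 : ℤ) < n := by exact_mod_cast hn
  refine (Set.finite_Icc (-(B + |a| * D)) (B + |b| * D)).subset ?_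
  rintro k ⟨h1, h2⟩
  have h3 := abs_le.1 (hB k)
  have h4 := neg_abs_le a
  have h5 := le_abs_self b
  have h6 : p.1 k * D ≤ |b| * D := by nlinarith
  have h7 : -|a| * D ≤ p.1 k * D := by nlinarith
  have h8 : 0 ≤ |b| * D := by positivity
  have h9 : 0 ≤ |a| * D := by positivity
  have h10 : 0 ≤ B := le_trans (abs_nonneg _) (hB k)
  constructor
  · by_contra h
    have : k * n ≤ k := by nlinarith
    nlinarith [h3.2]
  · by_contra h
    have : k ≤ k * n := by nlinarith
    nlinarith [h3.1]

lemma PD.finite_fiber {n D : ℕ} (hn : 0 < n) (hD : 0 < D) (p : PD n D) (a : ℤ) :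
    {k : ℤ | p.1 k = a}.Finite :=
  (p.finite_Icc hn hD a a).subset fun k hk => by simp [show p.1 k = a from hk]

lemma PD.finite_pairs {n D : ℕ} (hn : 0 < n) (hD : 0 < D) (p : PD n D) :
    (pairClass D '' {x : ℤ × ℤ | x.1 < x.2 ∧ p.1 x.2 ≤ p.1 x.1}).Finite := by
  have hD' : (0 : ℤ) < D := by exact_mod_cast hD
  have hn' : (0 : ℤ) < n := by exact_mod_cast hn
  have hS : TransInv D {x : ℤ × ℤ | x.1 < x.2 ∧ p.1 x.2 ≤ p.1 x.1} := by
    intro x m hx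
    simpa [p.shift] using hx
  rw [← image_pairClass_normalize (f := id) hD' (fun _ => rfl) hS]
  apply Set.Finite.image
  obtain ⟨B, hB⟩ := p.exists_bound hD
  refine ((Set.finite_Icc (1 : ℤ) D).prod (Set.finite_Icc (1 : ℤ) (B + B + D * n))).subset ?_
  rintro ⟨k, l⟩ ⟨⟨h1, h2⟩, h3, h4⟩
  simp only [id] at h1 h2 h3 h4
  refine ⟨⟨h3, h4⟩, by simp; omega, ?_⟩
  have h5 := abs_le.1 (hB k)
  have h6 := abs_le.1 (hB l)
  have h7 : p.1 l * D ≤ p.1 k * D := by nlinarith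
  have h8 : k * n ≤ D * n := by nlinarith
  have h9 : l ≤ l * n := by nlinarith
  simp only
  linarith [h5.1, h5.2, h6.1, h6.2]

/-! ### Simple reflections -/

/-- `s` is the simple reflection that exchanges `j` and `j + 1`. -/
def IsRefl {D : ℕ} (s : affineSym D) (j : ℤ) : Prop :=
  s.1 j = j + 1 ∧ s.1 (j + 1) = j ∧
    ∀ k : ℤ, ¬ k ≡ j [ZMOD D] → ¬ k ≡ j + 1 [ZMOD D] → s.1 k = k

section Refl

variable {D : ℕ} {s : affineSym D} {j : ℤ}

/-- The conditions on a simple reflection exclude `D = 1`: if `j` and `j + 1` were congruent,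
equivariance would contradict the exchange of the two. -/
lemma IsRefl.not_modEq (h : IsRefl s j) : ¬ j ≡ j + 1 [ZMOD D] := by
  intro hj
  obtain ⟨m, hm⟩ := modEq_iff_exists.1 hj
  have h1 := affineSym_shift s (j + 1) m
  rw [← hm, h.1, h.2.1] at h1
  omega

lemma IsRefl.apply_of_modEq (h : IsRefl s j) {k : ℤ} (hk : k ≡ j [ZMOD D]) : s.1 k = k + 1 := by
  obtain ⟨m, rfl⟩ := modEq_iff_exists.1 hk
  rw [affineSym_shift, h.1]; ring

lemma IsRefl.apply_of_modEq_succ (h : IsRefl s j) {k : ℤ} (hk : k ≡ j + 1 [ZMOD D]) :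
    s.1 k = k - 1 := by
  obtain ⟨m, rfl⟩ := modEq_iff_exists.1 hk
  rw [affineSym_shift, h.2.1]; ring

lemma modEq_succ_iff {k : ℤ} : k + 1 ≡ j + 1 [ZMOD D] ↔ k ≡ j [ZMOD D] :=
  ⟨fun h => Int.ModEq.add_right_cancel' 1 h, fun h => h.add_right 1⟩

lemma IsRefl.shift (h : IsRefl s j) (m : ℤ) : IsRefl s (j + m * D) := by
  have h0 : j + m * D ≡ j [ZMOD D] := modEq_iff_exists.2 ⟨m, rfl⟩
  refine ⟨h.apply_of_modEq h0, ?_, fun k h1 h2 => h.2.2 k (fun h3 => h1 (h3.trans h0.symm))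
    (fun h3 => h2 (h3.trans (h0.symm.add_right 1)))⟩
  rw [h.apply_of_modEq_succ (h0.add_right 1)]; ring

lemma IsRefl.cases (h : IsRefl s j) (k : ℤ) :
    (k ≡ j [ZMOD D] ∧ s.1 k = k + 1) ∨ (k ≡ j + 1 [ZMOD D] ∧ s.1 k = k - 1) ∨
      (¬ k ≡ j [ZMOD D] ∧ ¬ k ≡ j + 1 [ZMOD D] ∧ s.1 k = k) := by
  by_cases h1 : k ≡ j [ZMOD D]
  · exact Or.inl ⟨h1, h.apply_of_modEq h1⟩
  by_cases h2 : k ≡ j + 1 [ZMOD D]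
  · exact Or.inr (Or.inl ⟨h2, h.apply_of_modEq_succ h2⟩)
  · exact Or.inr (Or.inr ⟨h1, h2, h.2.2 k h1 h2⟩)

lemma IsRefl.apply_apply (h : IsRefl s j) (k : ℤ) : s.1 (s.1 k) = k := by
  rcases h.cases k with ⟨h1, h2⟩ | ⟨h1, h2⟩ | ⟨h1, h3, h2⟩
  · rw [h2, h.apply_of_modEq_succ (modEq_succ_iff.2 h1)]; ring
  · rw [h2, h.apply_of_modEq (k := k - 1)]
    · ring
    · rw [← modEq_succ_iff]; simpa using h1
  · rw [h2, h2]

lemma IsRefl.mul_self (h : IsRefl s j) : s * s = 1 :=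
  Subtype.ext (Equiv.ext fun k => h.apply_apply k)

lemma IsRefl.inv_eq (h : IsRefl s j) : s⁻¹ = s := inv_eq_of_mul_eq_one_left h.mul_self

lemma exists_isRefl (hD : D ≠ 1) (j : ℤ) : ∃ s : affineSym D, IsRefl s j := by
  have hj : ¬ j ≡ j + 1 [ZMOD D] := by
    intro h
    rw [Int.modEq_iff_dvd] at h
    have h1 : (D : ℤ) ∣ 1 := by simpa using h
    have := Int.eq_one_of_dvd_one (by positivity) h1
    omega
  have hk : ∀ {k : ℤ}, k ≡ j [ZMOD D] → ¬ k ≡ j + 1 [ZMOD D] :=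
    fun h h' => hj (h.symm.trans h')
  let f : ℤ → ℤ := fun k => if k ≡ j [ZMOD D] then k + 1 else if k ≡ j + 1 [ZMOD D] then k - 1 else k
  have hf : Function.Involutive f := by
    intro k
    simp only [f]
    by_cases h1 : k ≡ j [ZMOD D]
    · have h2 : k + 1 ≡ j + 1 [ZMOD D] := h1.add_right 1
      rw [if_pos h1, if_neg (fun h => hk h h2), if_pos h2]; ring
    · rw [if_neg h1]
      by_cases h2 : k ≡ j + 1 [ZMOD D]
      · have h3 : k - 1 ≡ j [ZMOD D] := by rw [← modEq_succ_iff]; simpa using h2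
        rw [if_pos h2, if_pos h3]; ring
      · rw [if_neg h2, if_neg h1, if_neg h2]
  refine ⟨⟨hf.toPerm, fun k => ?_⟩, ?_, ?_, ?_⟩
  · have h1 : k + (D : ℤ) ≡ k [ZMOD D] := modEq_iff_exists.2 ⟨1, by ring⟩
    have h2 : ∀ i, k + (D : ℤ) ≡ i [ZMOD D] ↔ k ≡ i [ZMOD D] :=
      fun i => ⟨fun h => h1.symm.trans h, fun h => h1.trans h⟩
    simp only [Function.Involutive.coe_toPerm, f, h2]
    split_ifs <;> ring
  · simp [f]
  · have h1 := fun h : j + 1 ≡ j [ZMOD D] => hj h.symm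
    show f (j + 1) = j
    simp only [f]
    rw [if_neg h1, if_pos (Int.ModEq.refl _)]; ring
  · intro k h1 h2
    simp [f, h1, h2]

end Refl

/-! ### The right action of the affine symmetric group on `P_D` -/

/-- The action of the affine symmetric group on `P_D` by composition. -/
def PD.comp {n D : ℕ} (p : PD n D) (w : affineSym D) : PD n D :=
  ⟨fun k => p.1 (w.1 k), fun j => by
    show p.1 (w.1 (j + D)) = p.1 (w.1 j) + n
    rw [w.2 j, p.2]⟩

@[simp] lemma PD.comp_apply {n D : ℕ} (p : PD n D) (w : affineSym D) (k : ℤ) :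
    (p.comp w).1 k = p.1 (w.1 k) := rfl

lemma PD.comp_mul {n D : ℕ} (p : PD n D) (w x : affineSym D) :
    p.comp (w * x) = (p.comp w).comp x := rfl

@[simp] lemma PD.comp_one {n D : ℕ} (p : PD n D) : p.comp 1 = p := rfl

lemma PD.comp_comp_refl {n D : ℕ} {s : affineSym D} {j : ℤ} (h : IsRefl s j) (p : PD n D) :
    (p.comp s).comp s = p := by
  rw [← PD.comp_mul, h.mul_self, PD.comp_one]

/-- The number of strict inversions of `p`. -/
def PD.inv {n D : ℕ} (p : PD n D) : ℕ :=
  orbCount D {x : ℤ × ℤ | x.1 < x.2 ∧ p.1 x.2 < p.1 x.1}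

lemma xdim_eq_orbCount {n D : ℕ} (hn : 0 < n) (p : PD n D) :
    xdim p = orbCount D {x : ℤ × ℤ | x.1 < x.2 ∧ p.1 x.2 ≤ p.1 x.1} := by
  have hS : TransInv D {x : ℤ × ℤ | x.1 < x.2 ∧ p.1 x.2 ≤ p.1 x.1} := by
    intro x m hx
    simpa [p.shift] using hx
  rw [← ncard_normalize (by exact_mod_cast hn) p.2 hS, xdim]
  congr 1
  ext x
  simp only [Set.mem_ofPred_eq]
  tauto

/-- An affine permutation as an element of `P_D` for `n = D`. -/
def toPD {D : ℕ} (w : affineSym D) : PD D D := ⟨w.1, w.2⟩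

lemma len_eq_inv {D : ℕ} (hD : 0 < D) (w : affineSym D) : len w = (toPD w).inv := by
  have hS : TransInv D {x : ℤ × ℤ | x.1 < x.2 ∧ w.1 x.2 < w.1 x.1} := by
    intro x m hx
    simpa [affineSym_shift w] using hx
  rw [PD.inv]
  refine Eq.trans ?_ (ncard_normalize (f := id) (N := D) (by exact_mod_cast hD) (fun _ => rfl) hS)
  rw [len]
  congr 1
  ext x
  simp only [Set.mem_ofPred_eq, id]
  tauto

lemma PD.finite_inv {n D : ℕ} (hn : 0 < n) (hD : 0 < D) (p : PD n D) :
    (pairClass D '' {x : ℤ × ℤ | x.1 < x.2 ∧ p.1 x.2 < p.1 x.1}).Finite :=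
  (p.finite_pairs hn hD).subset (Set.image_mono fun _ hx => ⟨hx.1, hx.2.le⟩)

/-- A simple reflection moves every integer by at most one, so the only pairs whose order it can
reverse are the adjacent pairs that it exchanges. -/
lemma IsRefl.lt_iff {D : ℕ} {s : affineSym D} {j : ℤ} (h : IsRefl s j) {k l : ℤ}
    (hkl : ¬ (k ≡ j [ZMOD D] ∧ l = k + 1)) (hlk : ¬ (l ≡ j [ZMOD D] ∧ k = l + 1)) :
    s.1 k < s.1 l ↔ k < l := by
  have hinj : s.1 k = s.1 l ↔ k = l := s.1.injective.eq_iff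
  rcases h.cases k with ⟨h1, h2⟩ | ⟨h1, h2⟩ | ⟨h1, h3, h2⟩ <;>
  rcases h.cases l with ⟨g1, g2⟩ | ⟨g1, g2⟩ | ⟨g1, g3, g2⟩ <;>
  rw [h2, g2] at hinj ⊢
  · omega
  · constructor
    · intro _; omega
    · intro hlt
      have : l ≠ k + 1 := fun e => hkl ⟨h1, e⟩
      omega
  · constructor
    · intro _; omega
    · intro hlt; omega
  · have : k ≠ l + 1 := fun e => hlk ⟨g1, e⟩
    omega
  · omega
  · omega
  · omega
  · omega

/-- Transported by `s`, the inversions of `p ∘ s` are the pairs inverted by `p` with respect to the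
order changed by `s`. That order differs from the usual one only on the translates of `(j + 1, j)`,
which form a single class, and the ascent of `p` makes this class a new inversion. -/
lemma inv_comp_refl {n D : ℕ} (hn : 0 < n) (hD : 0 < D) {s : affineSym D} {j : ℤ}
    (h : IsRefl s j) (p : PD n D) (hp : p.1 j < p.1 (j + 1)) :
    (p.comp s).inv = p.inv + 1 := by
  have hS : TransInv D {x : ℤ × ℤ | s.1 x.1 < s.1 x.2 ∧ p.1 x.2 < p.1 x.1} := by
    intro x m hx
    simpa [p.shift, affineSym_shift s] using hx
  have hpj : ∀ k : ℤ, k ≡ j [ZMOD D] → p.1 k < p.1 (k + 1) := by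
    intro k hk
    obtain ⟨m, rfl⟩ := modEq_iff_exists.1 hk
    rw [show j + m * D + 1 = j + 1 + m * D by ring, p.shift, p.shift]
    linarith
  have h1 : (p.comp s).inv = orbCount D {x : ℤ × ℤ | s.1 x.1 < s.1 x.2 ∧ p.1 x.2 < p.1 x.1} := by
    rw [← orbCount_preimage hD s hS, PD.inv]
    congr 1
    ext x
    simp [h.apply_apply]
  have h2 : {x : ℤ × ℤ | s.1 x.1 < s.1 x.2 ∧ p.1 x.2 < p.1 x.1} =
      {x : ℤ × ℤ | x.1 < x.2 ∧ p.1 x.2 < p.1 x.1} ∪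
        {x : ℤ × ℤ | x.2 ≡ j [ZMOD D] ∧ x.1 = x.2 + 1} := by
    ext ⟨k, l⟩
    simp only [Set.mem_ofPred_eq, Set.mem_union]
    by_cases hlk : l ≡ j [ZMOD D] ∧ k = l + 1
    · obtain ⟨hl, rfl⟩ := hlk
      have := hpj l hl
      rw [h.apply_of_modEq hl, h.apply_of_modEq_succ (hl.add_right 1)]
      simp [hl, this]
    · by_cases hkl : k ≡ j [ZMOD D] ∧ l = k + 1
      · obtain ⟨hk, rfl⟩ := hkl
        have := hpj k hk
        rw [h.apply_of_modEq hk, h.apply_of_modEq_succ (hk.add_right 1)]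
        constructor
        · rintro ⟨_, _⟩; omega
        · rintro (⟨_, _⟩ | ⟨_, _⟩) <;> omega
      · rw [h.lt_iff hkl hlk]
        tauto
  have h3 : TransInv D {x : ℤ × ℤ | x.1 < x.2 ∧ p.1 x.2 < p.1 x.1} := by
    intro x m hx
    simpa [p.shift] using hx
  have h4 : pairClass D '' {x : ℤ × ℤ | x.2 ≡ j [ZMOD D] ∧ x.1 = x.2 + 1} =
      {pairClass D (j + 1, j)} := by
    ext y
    simp only [Set.mem_image, Set.mem_singleton_iff, Set.mem_ofPred_eq, Prod.exists]
    constructor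
    · rintro ⟨k, l, ⟨hl, rfl⟩, rfl⟩
      obtain ⟨m, rfl⟩ := modEq_iff_exists.1 hl
      exact pairClass_eq_iff.2 ⟨m, by ext <;> simp; ring⟩
    · rintro rfl
      exact ⟨j + 1, j, ⟨Int.ModEq.refl _, rfl⟩, rfl⟩
  rw [h1, h2, orbCount, Set.image_union, h4, Set.ncard_union_eq _ (p.finite_inv hn hD)
    (Set.finite_singleton _), Set.ncard_singleton, PD.inv, orbCount]
  rw [← h4]
  refine h3.disjoint_image (Set.disjoint_left.2 ?_)
  rintro ⟨k, l⟩ ⟨h5, _⟩ ⟨_, h6⟩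
  simp only at h5 h6
  omega

/-- The translation by `m`, an element of length zero. -/
def translation (D : ℕ) (m : ℤ) : affineSym D :=
  ⟨Equiv.addRight m, fun j => by simp; ring⟩

@[simp] lemma translation_apply {D : ℕ} (m k : ℤ) : (translation D m).1 k = k + m := rfl

lemma exists_descent_or_mono {n D : ℕ} (p : PD n D) :
    (∃ j, p.1 (j + 1) < p.1 j) ∨ Monotone p.1 := by
  by_cases h : ∃ j, p.1 (j + 1) < p.1 j
  · exact Or.inl h
  · push Not at h
    exact Or.inr (monotone_int_of_le_succ h)

lemma ne_one_of_descent {n D : ℕ} {p : PD n D} {j : ℤ} (h : p.1 (j + 1) < p.1 j) :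
    D ≠ 1 := by
  rintro rfl
  have := p.2 j
  push_cast at this
  omega

/-- Every statement about elements of `P_D` can be proved by sorting. -/
lemma PD.sort_induction {n D : ℕ} (hn : 0 < n) (hD : 0 < D) {P : PD n D → Prop}
    (mono : ∀ p : PD n D, Monotone p.1 → P p)
    (step : ∀ (p : PD n D) (s : affineSym D) (j : ℤ), IsRefl s j → p.1 j < p.1 (j + 1) → P p →
      P (p.comp s)) (p : PD n D) : P p := by
  induction h : p.inv using Nat.strong_induction_on generalizing p with
  | _ N ih =>
    rcases exists_descent_or_mono p with ⟨j, hj⟩ | hm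
    · obtain ⟨s, hs⟩ := exists_isRefl (ne_one_of_descent hj) j
      have h1 : (p.comp s).1 j < (p.comp s).1 (j + 1) := by
        simpa [hs.1, hs.2.1] using hj
      have h2 := inv_comp_refl hn hD hs (p.comp s) h1
      rw [PD.comp_comp_refl hs] at h2
      have h3 := step _ s j hs h1 (ih _ (by omega) _ rfl)
      rwa [PD.comp_comp_refl hs] at h3
    · exact mono p hm

lemma CD.monotone {n D : ℕ} (hD : 0 < D) (lam : CD n D) : Monotone lam.1.1 := by
  have hD' : (0 : ℤ) < D := by exact_mod_cast hD
  refine monotone_int_of_le_succ fun j => ?_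
  obtain ⟨m, h1, h2⟩ := exists_shift_mem hD' j
  have key : lam.1.1 (j + m * D) ≤ lam.1.1 (j + m * D + 1) := by
    rcases h2.lt_or_eq with h3 | h3
    · exact lam.2.2.1 _ h1 h3
    · rw [h3, add_comm (D : ℤ) 1, lam.1.2 1]
      have := lam.2.1
      have := lam.2.2.2
      omega
  rw [show j + m * D + 1 = j + 1 + m * D by ring, lam.1.shift, lam.1.shift] at key
  linarith

/-- A monotone element of `P_D` is a translate of an element of `C_D`. -/
lemma exists_CD_of_monotone {n D : ℕ} (hn : 0 < n) (p : PD n D)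
    (hp : Monotone p.1) : ∃ (lam : CD n D) (m : ℤ), lam.1.comp (translation D m) = p := by
  have hn' : (0 : ℤ) < n := by exact_mod_cast hn
  have hlow : ∃ b : ℤ, ∀ z : ℤ, 1 ≤ p.1 z → b ≤ z := by
    refine ⟨-(|p.1 0|) * D, fun z hz => ?_⟩
    by_contra hlt
    push Not at hlt
    have h1 := hp hlt.le
    have h2 := p.shift 0 (-|p.1 0|)
    rw [zero_add] at h2
    rw [h2] at h1
    have h3 := le_abs_self (p.1 0)
    have h4 : |p.1 0| ≤ |p.1 0| * n := by nlinarith [abs_nonneg (p.1 0)]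
    linarith
  have hex : ∃ z : ℤ, 1 ≤ p.1 z := by
    obtain ⟨m, h1, -⟩ := exists_shift_mem hn' (p.1 0)
    exact ⟨0 + m * D, by rwa [p.shift]⟩
  -- The least place `z` where `p` is positive has to become the place `1`. Then the value at `D` is
  -- `p (z - 1) + n ≤ n`.
  obtain ⟨z, hz1, hz2⟩ := Int.exists_least_of_bdd hlow hex
  have h0 : p.1 (z - 1) ≤ 0 := by
    by_contra h
    have := hz2 (z - 1) (by omega)
    omega
  have hmono : Monotone (p.comp (translation D (z - 1))).1 := fun a b hab => hp (by simpa using hab)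
  refine ⟨⟨p.comp (translation D (z - 1)), ?_, fun j _ _ => hmono (by omega), ?_⟩,
    -(z - 1), PD.ext fun k => ?_⟩
  · simpa using hz1
  · have := p.2 (z - 1)
    rw [PD.comp_apply, translation_apply, add_comm (D : ℤ), this]
    linarith
  · simp only [PD.comp_apply, translation_apply]
    rw [show k + -(z - 1) + (z - 1) = k by ring]

/-- Every element of `P_D` lies in the orbit of an element of `C_D`. -/
lemma exists_CD_comp {n D : ℕ} (hn : 0 < n) (hD : 0 < D) (p : PD n D) :
    ∃ (lam : CD n D) (w : affineSym D), lam.1.comp w = p := by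
  induction p using PD.sort_induction hn hD with
  | mono p hp =>
    obtain ⟨lam, m, h⟩ := exists_CD_of_monotone hn p hp
    exact ⟨lam, _, h⟩
  | step p s j _ _ ih =>
    obtain ⟨lam, w, rfl⟩ := ih
    exact ⟨lam, w * s, rfl⟩

lemma sharpInt_comp {n D : ℕ} (p : PD n D) (w : affineSym D) (k : ℤ) :
    sharpInt (p.comp w) k = sharpInt p k := by
  refine Set.ncard_congr (fun x _ => w.1 x) (fun x hx => hx) (fun x y _ _ h => w.1.injective h) ?_
  intro y hy
  exact ⟨w.1.symm y, by simpa using hy, by simp⟩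

lemma sharpInt_add {n D : ℕ} (p : PD n D) (k m : ℤ) : sharpInt p (k + m * n) = sharpInt p k := by
  refine (Set.ncard_congr (fun x _ => x + m * D) (fun x hx => ?_)
    (fun x y _ _ h => by simpa using h) ?_).symm
  · simp only [Set.mem_ofPred_eq] at hx ⊢
    rw [p.shift, hx]
  · intro y hy
    refine ⟨y + (-m) * D, ?_, by ring⟩
    simp only [Set.mem_ofPred_eq] at hy ⊢
    rw [p.shift, hy]
    ring

/-- The change of sign sits between `0` and `1`, because `λ(0) = λ(D) - n ≤ 0 < λ(1)` and `λ` is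
monotone. -/
lemma CD.pos_iff {n D : ℕ} (hD : 0 < D) (lam : CD n D) (k : ℤ) :
    1 ≤ lam.1.1 k ↔ 1 ≤ k := by
  constructor
  · intro h
    by_contra hk
    have h1 := lam.monotone hD (show k ≤ 0 by omega)
    have h2 := lam.1.2 0
    rw [zero_add] at h2
    have := lam.2.2.2
    omega
  · intro h
    exact lam.2.1.trans (lam.monotone hD h)

/-- The largest `k` with `λ(k) ≤ a` is determined by the fibres of `λ`. -/
lemma CD.le_iff {n D : ℕ} (hn : 0 < n) (hD : 0 < D) (lam : CD n D) (a : ℕ) (k : ℤ) :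
    lam.1.1 k ≤ a ↔ k ≤ ∑ b ∈ Finset.range a, (sharpInt lam.1 (b + 1) : ℤ) := by
  induction a generalizing k with
  | zero =>
    have := lam.pos_iff hD k
    simp only [Nat.cast_zero, Finset.range_zero, Finset.sum_empty]
    omega
  | succ a ih =>
    rw [Finset.sum_range_succ]
    set S := ∑ b ∈ Finset.range a, (sharpInt lam.1 (b + 1) : ℤ)
    have hfin := lam.1.finite_fiber hn hD (a + 1)
    obtain ⟨m, hm⟩ : ∃ m : ℕ, ∀ k, lam.1.1 k ≤ (a + 1 : ℕ) ↔ k ≤ S + m := by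
      have hbdd : ∃ b : ℤ, ∀ z : ℤ, lam.1.1 z ≤ (a + 1 : ℕ) → z ≤ b := by
        refine ⟨(a + 1) * D, fun z hz => ?_⟩
        by_contra hlt
        push Not at hlt
        have h2 := lam.1.shift 1 (a + 1)
        have h1 := lam.monotone hD (show 1 + (a + 1) * (D : ℤ) ≤ z by omega)
        rw [h2] at h1
        have := lam.2.1
        have : (a + 1 : ℤ) ≤ (a + 1) * n := by
          have : (1 : ℤ) ≤ n := by exact_mod_cast hn
          nlinarith
        push_cast at hz
        omega
      have hS : lam.1.1 S ≤ (a + 1 : ℕ) := by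
        have := (ih S).2 le_rfl
        push_cast
        omega
      obtain ⟨z, hz1, hz2⟩ := Int.exists_greatest_of_bdd hbdd ⟨S, hS⟩
      obtain ⟨m, hm⟩ := Int.le.dest (hz2 S hS)
      refine ⟨m, fun k => ⟨fun h => by rw [hm]; exact hz2 k h, fun h => ?_⟩⟩
      exact (lam.monotone hD (h.trans hm.le)).trans hz1
    have hset : {k : ℤ | lam.1.1 k = a + 1} = Set.Ioc S (S + m) := by
      ext k
      have h1 := ih k
      have h2 := hm k
      simp only [Set.mem_ofPred_eq, Set.mem_Ioc]
      push_cast at h2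
      omega
    have : sharpInt lam.1 (a + 1) = m := by
      rw [sharpInt, hset, ← Finset.coe_Ioc, Set.ncard_coe_finset, Int.card_Ioc]
      simp
    rw [this]
    exact hm k

/-- By `CD.le_iff` the sizes of the fibres determine all the sets `λ ≤ a` with `a ≥ 0`, hence the
values of `λ` on a period, where they are positive. -/
lemma CD.eq_of_sharpInt {n D : ℕ} (hn : 0 < n) (hD : 0 < D) {lam mu : CD n D}
    (h : ∀ k, sharpInt lam.1 k = sharpInt mu.1 k) : lam = mu := by
  have hD' : (0 : ℤ) < D := by exact_mod_cast hD
  refine Subtype.ext (PD.ext fun k => ?_)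
  obtain ⟨m, h1, -⟩ := exists_shift_mem hD' k
  have key : lam.1.1 (k + m * D) = mu.1.1 (k + m * D) := by
    have hle : ∀ a : ℕ, lam.1.1 (k + m * D) ≤ a ↔ mu.1.1 (k + m * D) ≤ a := by
      intro a
      rw [lam.le_iff hn hD, mu.le_iff hn hD]
      simp only [h]
    have g1 := (lam.pos_iff hD _).2 h1
    have g2 := (mu.pos_iff hD _).2 h1
    have g3 := (hle (lam.1.1 (k + m * D)).toNat).1 (by omega)
    have g4 := (hle (mu.1.1 (k + m * D)).toNat).2 (by omega)
    omega
  rw [lam.1.shift, mu.1.shift] at key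
  linarith

lemma CD.eq_of_comp {n D : ℕ} (hn : 0 < n) (hD : 0 < D) {lam mu : CD n D} {w : affineSym D}
    (h : lam.1.comp w = mu.1) : lam = mu :=
  CD.eq_of_sharpInt hn hD fun k => by rw [← h, sharpInt_comp]

/-! ### Changing one value of an element of `P_D` -/

/-- The function that agrees with `p` except on the residue class of `k`, and takes the value `a`
at `k`. -/
def PD.set {n D : ℕ} (p : PD n D) (k a : ℤ) : PD n D :=
  ⟨fun j => if j ≡ k [ZMOD D] then p.1 j + (a - p.1 k) else p.1 j, fun j => by
    have h1 : j + (D : ℤ) ≡ j [ZMOD D] := modEq_iff_exists.2 ⟨1, by ring⟩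
    have h2 : j + (D : ℤ) ≡ k [ZMOD D] ↔ j ≡ k [ZMOD D] :=
      ⟨fun h => h1.symm.trans h, fun h => h1.trans h⟩
    simp only [h2, p.2]
    split_ifs <;> ring⟩

section Set

variable {n D : ℕ} (p : PD n D) {k l a b : ℤ}

lemma PD.set_apply (k a j : ℤ) :
    (p.set k a).1 j = if j ≡ k [ZMOD D] then p.1 j + (a - p.1 k) else p.1 j := rfl

lemma PD.set_apply_of_modEq (h : l ≡ k [ZMOD D]) : (p.set k a).1 l = p.1 l + (a - p.1 k) := by
  rw [PD.set_apply, if_pos h]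

lemma PD.set_apply_of_not (h : ¬ l ≡ k [ZMOD D]) : (p.set k a).1 l = p.1 l := by
  rw [PD.set_apply, if_neg h]

@[simp] lemma PD.set_apply_self : (p.set k a).1 k = a := by
  rw [PD.set_apply_of_modEq p (Int.ModEq.refl k)]; ring

lemma PD.set_set : (p.set k a).set k b = p.set k b := by
  ext j
  by_cases h : j ≡ k [ZMOD D]
  · rw [PD.set_apply_of_modEq _ h, PD.set_apply_of_modEq _ h, PD.set_apply_of_modEq _ h,
      PD.set_apply_self]
    ring
  · simp only [PD.set_apply_of_not _ h]

lemma PD.set_eq_self (h : p.1 k = a) : p.set k a = p := by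
  ext j
  rw [PD.set_apply, h]
  split_ifs <;> ring

lemma PD.set_comm (h : ¬ k ≡ l [ZMOD D]) : (p.set k a).set l b = (p.set l b).set k a := by
  ext j
  have h' : ¬ l ≡ k [ZMOD D] := fun h1 => h h1.symm
  by_cases h1 : j ≡ k [ZMOD D]
  · have h2 : ¬ j ≡ l [ZMOD D] := fun h3 => h (h1.symm.trans h3)
    rw [PD.set_apply_of_not _ h2, PD.set_apply_of_modEq _ h1, PD.set_apply_of_modEq _ h1,
      PD.set_apply_of_not _ h2, PD.set_apply_of_not _ h]
  · by_cases h2 : j ≡ l [ZMOD D]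
    · rw [PD.set_apply_of_modEq _ h2, PD.set_apply_of_not _ h1, PD.set_apply_of_not _ h1,
        PD.set_apply_of_modEq _ h2, PD.set_apply_of_not _ h']
    · simp only [PD.set_apply_of_not _ h1, PD.set_apply_of_not _ h2]

lemma PD.set_shift (m : ℤ) : p.set (k + m * D) (a + m * n) = p.set k a := by
  ext j
  have h1 : k + m * (D : ℤ) ≡ k [ZMOD D] := modEq_iff_exists.2 ⟨m, rfl⟩
  have h2 : j ≡ k + m * (D : ℤ) [ZMOD D] ↔ j ≡ k [ZMOD D] :=
    ⟨fun h => h.trans h1, fun h => h.trans h1.symm⟩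
  simp only [PD.set_apply, h2, p.shift]
  split_ifs <;> ring

lemma affineSym_modEq_iff (w : affineSym D) : w.1 k ≡ w.1 l [ZMOD D] ↔ k ≡ l [ZMOD D] := by
  simp only [modEq_iff_exists, ← affineSym_shift, w.1.injective.eq_iff]

lemma PD.comp_set (w : affineSym D) : (p.comp w).set k a = (p.set (w.1 k) a).comp w := by
  ext j
  simp only [PD.set_apply, PD.comp_apply, affineSym_modEq_iff]

open Classical in
/-- The fibre of `p` over `a`, as a finite set. -/
def PD.fib (p : PD n D) (a : ℤ) : Finset ℤ :=
  if h : {k | p.1 k = a}.Finite then h.toFinset else ∅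

variable {p} in
lemma PD.mem_fib (hn : 0 < n) (hD : 0 < D) : k ∈ p.fib a ↔ p.1 k = a := by
  rw [PD.fib, dif_pos (p.finite_fiber hn hD a)]
  simp

lemma PD.card_fib (hn : 0 < n) (hD : 0 < D) (a : ℤ) : (p.fib a).card = sharpInt p a := by
  rw [sharpInt, ← Set.ncard_coe_finset]
  congr 1
  ext k
  simp [PD.mem_fib hn hD]

lemma PD.apply_modEq (h : l ≡ k [ZMOD D]) : p.1 l ≡ p.1 k [ZMOD n] := by
  obtain ⟨m, rfl⟩ := modEq_iff_exists.1 h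
  rw [p.shift]
  exact modEq_iff_exists.2 ⟨m, rfl⟩

lemma PD.fib_set_self (hn : 0 < n) (hD : 0 < D) (h : ¬ p.1 k ≡ a [ZMOD n]) :
    (p.set k a).fib a = insert k (p.fib a) := by
  ext l
  rw [Finset.mem_insert, PD.mem_fib hn hD, PD.mem_fib hn hD]
  by_cases h1 : l ≡ k [ZMOD D]
  · have h2 : p.1 l ≠ a := fun h2 => h (by rw [← h2]; exact (p.apply_modEq h1).symm)
    simp only [h2, or_false]
    refine ⟨fun h3 => (p.set k a).eq_of_modEq hn h1 (by rw [h3, PD.set_apply_self]), ?_⟩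
    rintro rfl
    exact PD.set_apply_self p
  · rw [PD.set_apply_of_not p h1]
    have : l ≠ k := by rintro rfl; exact h1 (Int.ModEq.refl _)
    simp [this]

lemma PD.fib_set_source (hn : 0 < n) (hD : 0 < D) (hb : p.1 k = b) (h : ¬ b ≡ a [ZMOD n]) :
    (p.set k a).fib b = (p.fib b).erase k := by
  ext l
  rw [Finset.mem_erase, PD.mem_fib hn hD, PD.mem_fib hn hD]
  by_cases h1 : l ≡ k [ZMOD D]
  · have h2 : (p.set k a).1 l ≠ b := fun h2 => h (by
      have := (p.set k a).apply_modEq h1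
      rwa [h2, PD.set_apply_self] at this)
    simp only [h2, false_iff, not_and]
    exact fun h3 h4 => h3 (p.eq_of_modEq hn h1 (h4.trans hb.symm))
  · rw [PD.set_apply_of_not p h1]
    have : l ≠ k := by rintro rfl; exact h1 (Int.ModEq.refl _)
    simp [this]

lemma PD.fib_set_of_ne (hn : 0 < n) (hD : 0 < D) (h : ¬ p.1 k ≡ b [ZMOD n])
    (h' : ¬ a ≡ b [ZMOD n]) : (p.set k a).fib b = p.fib b := by
  ext l
  rw [PD.mem_fib hn hD, PD.mem_fib hn hD]
  by_cases h1 : l ≡ k [ZMOD D]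
  · have h2 : (p.set k a).1 l ≠ b := fun h2 => h' (by
      have := (p.set k a).apply_modEq h1
      rw [h2, PD.set_apply_self] at this
      exact this.symm)
    have h3 : p.1 l ≠ b := fun h3 => h (by rw [← h3]; exact (p.apply_modEq h1).symm)
    simp [h2, h3]
  · rw [PD.set_apply_of_not p h1]

lemma not_modEq_add_one (hn : 2 ≤ n) (a : ℤ) : ¬ a + 1 ≡ a [ZMOD n] := by
  intro h
  rw [Int.modEq_iff_dvd] at h
  have h1 : (n : ℤ) ∣ 1 := by
    have := (dvd_neg (a := (n : ℤ))).2 h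
    simpa using this
  have := Int.eq_one_of_dvd_one (by positivity) h1
  omega

lemma orbCount_union {S S' : Set (ℤ × ℤ)} (hS : TransInv D S) (h : Disjoint S S')
    (hf : (pairClass D '' S).Finite) (hf' : (pairClass D '' S').Finite) :
    orbCount D (S ∪ S') = orbCount D S + orbCount D S' := by
  rw [orbCount, Set.image_union, Set.ncard_union_eq (hS.disjoint_image h) hf hf', orbCount, orbCount]

lemma orbCount_eq_card {F : Finset ℤ} {S : Set (ℤ × ℤ)} {g : ℤ → ℤ × ℤ} (hmem : ∀ l ∈ F, g l ∈ S)
    (hS : ∀ x ∈ S, ∃ l ∈ F, ∃ m : ℤ, x = ((g l).1 + m * D, (g l).2 + m * D))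
    (hinj : Function.Injective fun l => (g l).2 - (g l).1) :
    orbCount D S = F.card := by
  have : pairClass D '' S = (fun l => pairClass D (g l)) '' F := by
    ext y
    constructor
    · rintro ⟨x, hx, rfl⟩
      obtain ⟨l, hl, m, rfl⟩ := hS x hx
      exact ⟨l, hl, (pairClass_eq_iff.2 ⟨m, rfl⟩).symm⟩
    · rintro ⟨l, hl, rfl⟩
      exact ⟨g l, hmem l hl, rfl⟩
  rw [orbCount, this, Set.InjOn.ncard_image, Set.ncard_coe_finset]
  intro l _ l' _ h
  exact hinj (congrArg Prod.snd h)

end Set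

/-- The change of `x_p` when one value `a + 1` is replaced by `a`. -/
lemma xdim_set {n D : ℕ} (hn : 2 ≤ n) (hD : 0 < D) (p : PD n D) {k a : ℤ} (hk : p.1 k = a + 1) :
    xdim (p.set k a) + ((p.fib (a + 1)).filter (k < ·)).card =
      xdim p + ((p.fib a).filter (· < k)).card := by
  have hn0 : 0 < n := by omega
  set p' := p.set k a with hp'
  have hlow : ∀ l, l ≡ k [ZMOD D] → p'.1 l = p.1 l - 1 := fun l hl => by
    rw [hp', PD.set_apply_of_modEq p hl, hk]; ring
  have hfix : ∀ l, ¬ l ≡ k [ZMOD D] → p'.1 l = p.1 l := fun l hl => PD.set_apply_of_not p hl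
  have hsucc : ∀ l m, p.1 l = p.1 m + 1 → ¬ l ≡ m [ZMOD D] := fun l m h h' => by
    have := p.apply_modEq h'
    rw [h] at this
    exact not_modEq_add_one hn _ this
  -- `C` consists of the pairs counted both before and after the change. The pairs in `A` are lost:
  -- the lowered value drops below an equal value to its right. Those in `A'` are gained: the
  -- lowered value now ties with a value to its left.
  set C : Set (ℤ × ℤ) := {x | x.1 < x.2 ∧ p.1 x.2 ≤ p.1 x.1 ∧ p'.1 x.2 ≤ p'.1 x.1} with hC
  set A : Set (ℤ × ℤ) := {x | x.1 < x.2 ∧ p.1 x.2 = p.1 x.1 ∧ x.1 ≡ k [ZMOD D]} with hA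
  set A' : Set (ℤ × ℤ) := {x | x.1 < x.2 ∧ p.1 x.2 = p.1 x.1 + 1 ∧ x.2 ≡ k [ZMOD D]} with hA'
  have hCinv : TransInv D C := by
    intro x m hx
    simpa [hC, p.shift, p'.shift] using hx
  have e1 : {x : ℤ × ℤ | x.1 < x.2 ∧ p.1 x.2 ≤ p.1 x.1} = C ∪ A := by
    ext ⟨i, l⟩
    simp only [hC, hA, Set.mem_ofPred_eq, Set.mem_union]
    constructor
    · rintro ⟨h1, h2⟩
      by_cases h3 : p'.1 l ≤ p'.1 i
      · exact Or.inl ⟨h1, h2, h3⟩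
      · right
        by_cases hi : i ≡ k [ZMOD D]
        · by_cases hl : l ≡ k [ZMOD D]
          · rw [hlow i hi, hlow l hl] at h3; omega
          · rw [hlow i hi, hfix l hl] at h3
            exact ⟨h1, by omega, hi⟩
        · by_cases hl : l ≡ k [ZMOD D]
          · rw [hfix i hi, hlow l hl] at h3; omega
          · rw [hfix i hi, hfix l hl] at h3; omega
    · rintro (⟨h1, h2, -⟩ | ⟨h1, h2, -⟩)
      · exact ⟨h1, h2⟩
      · exact ⟨h1, h2.le⟩
  have e2 : {x : ℤ × ℤ | x.1 < x.2 ∧ p'.1 x.2 ≤ p'.1 x.1} = C ∪ A' := by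
    ext ⟨i, l⟩
    simp only [hC, hA', Set.mem_ofPred_eq, Set.mem_union]
    constructor
    · rintro ⟨h1, h2⟩
      by_cases h3 : p.1 l ≤ p.1 i
      · exact Or.inl ⟨h1, h3, h2⟩
      · right
        by_cases hi : i ≡ k [ZMOD D]
        · by_cases hl : l ≡ k [ZMOD D]
          · rw [hlow i hi, hlow l hl] at h2; omega
          · rw [hlow i hi, hfix l hl] at h2; omega
        · by_cases hl : l ≡ k [ZMOD D]
          · rw [hfix i hi, hlow l hl] at h2
            exact ⟨h1, by omega, hl⟩
          · rw [hfix i hi, hfix l hl] at h2; omega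
    · rintro (⟨h1, -, h2⟩ | ⟨h1, h2, h3⟩)
      · exact ⟨h1, h2⟩
      · have hi : ¬ i ≡ k [ZMOD D] := fun h => hsucc l i h2 (h3.trans h.symm)
        refine ⟨h1, ?_⟩
        rw [hlow l h3, hfix i hi]; omega
  have d1 : Disjoint C A := by
    rw [Set.disjoint_left]
    rintro ⟨i, l⟩ ⟨h1, h2, h3⟩ ⟨-, h4, h5⟩
    simp only at h1 h2 h3 h4 h5
    have hl : ¬ l ≡ k [ZMOD D] := fun hl =>
      h1.ne (p.eq_of_modEq hn0 (h5.trans hl.symm) h4.symm)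
    rw [hlow i h5, hfix l hl] at h3
    omega
  have d2 : Disjoint C A' := by
    rw [Set.disjoint_left]
    rintro ⟨i, l⟩ ⟨h1, h2, h3⟩ ⟨-, h4, h5⟩
    simp only at h2 h4
    omega
  have f1 := p.finite_pairs hn0 hD
  have f2 := p'.finite_pairs hn0 hD
  rw [e1, Set.image_union, Set.finite_union] at f1
  rw [e2, Set.image_union, Set.finite_union] at f2
  have c1 : orbCount D A = ((p.fib (a + 1)).filter (k < ·)).card := by
    refine orbCount_eq_card (g := fun l => (k, l)) ?_ ?_ ?_
    · intro l hl
      rw [Finset.mem_filter, PD.mem_fib hn0 hD] at hl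
      exact ⟨hl.2, by simp [hl.1, hk], Int.ModEq.refl _⟩
    · rintro ⟨i, l⟩ ⟨h1, h2, h3⟩
      obtain ⟨m, rfl⟩ := modEq_iff_exists.1 h3
      simp only [p.shift, hk] at h1 h2
      refine ⟨l + (-m) * D, ?_, m, by simp⟩
      rw [Finset.mem_filter, PD.mem_fib hn0 hD, p.shift, h2]
      exact ⟨by ring, by linarith⟩
    · intro l l' h
      simpa using h
  have c2 : orbCount D A' = ((p.fib a).filter (· < k)).card := by
    refine orbCount_eq_card (g := fun l => (l, k)) ?_ ?_ ?_
    · intro l hl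
      rw [Finset.mem_filter, PD.mem_fib hn0 hD] at hl
      exact ⟨hl.2, by simp [hl.1, hk], Int.ModEq.refl _⟩
    · rintro ⟨l, i⟩ ⟨h1, h2, h3⟩
      obtain ⟨m, rfl⟩ := modEq_iff_exists.1 h3
      simp only [p.shift, hk] at h1 h2
      refine ⟨l + (-m) * D, ?_, m, by simp⟩
      rw [Finset.mem_filter, PD.mem_fib hn0 hD, p.shift]
      exact ⟨by linarith, by linarith⟩
    · intro l l' h
      simpa using h
  rw [xdim_eq_orbCount hn0, xdim_eq_orbCount hn0, e1, e2, orbCount_union hCinv d1 f1.1 f1.2,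
    orbCount_union hCinv d2 f2.1 f2.2, c1, c2]
  ring

/-! ### Weights -/

lemma sharp_apply {n D : ℕ} (hn : 0 < n) (p : PD n D) (a : ℤ) :
    sharp p (a : ZMod n) = sharpInt p a := by
  have : NeZero n := ⟨hn.ne'⟩
  rw [sharp]
  have : (((a : ZMod n).val : ℤ) : ZMod n) = (a : ZMod n) := by simp
  rw [ZMod.intCast_eq_intCast_iff, modEq_iff_exists] at this
  obtain ⟨m, hm⟩ := this
  rw [hm, sharpInt_add]

lemma sharp_comp {n D : ℕ} (p : PD n D) (w : affineSym D) : sharp (p.comp w) = sharp p := by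
  ext i
  simp [sharp, sharpInt_comp]

lemma sharp_nonneg {n D : ℕ} (p : PD n D) (i : ZMod n) : 0 ≤ sharp p i := by
  simp [sharp]

lemma CD.eq_of_sharp {n D : ℕ} (hn : 0 < n) (hD : 0 < D) {lam mu : CD n D}
    (h : sharp lam.1 = sharp mu.1) : lam = mu :=
  CD.eq_of_sharpInt hn hD fun k => by
    have := congrFun h (k : ZMod n)
    rw [sharp_apply hn, sharp_apply hn] at this
    exact_mod_cast this

lemma sharp_set {n D : ℕ} (hn : 2 ≤ n) (hD : 0 < D) (p : PD n D) {k a b : ℤ} (hk : p.1 k = b)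
    (hab : ¬ b ≡ a [ZMOD n]) : 
    sharp (p.set k a) = sharp p + omega (a : ZMod n) - omega (b : ZMod n) := by
  have hn0 : 0 < n := by omega
  have : NeZero n := ⟨hn0.ne'⟩
  ext i
  obtain ⟨c, rfl⟩ : ∃ c : ℤ, (c : ZMod n) = i := ⟨i.val, by simp⟩
  simp only [Pi.add_apply, Pi.sub_apply, omega, Pi.single_apply]
  rw [sharp_apply hn0, sharp_apply hn0]
  have hab' : (a : ZMod n) ≠ b := fun h => hab ((ZMod.intCast_eq_intCast_iff _ _ _).1 h.symm)
  by_cases h1 : (c : ZMod n) = a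
  · have h2 : (c : ZMod n) ≠ b := fun h => hab' (h1.symm.trans h)
    rw [if_pos h1, if_neg h2, ← sharp_apply hn0, ← sharp_apply hn0 p, h1, sharp_apply hn0,
      sharp_apply hn0, ← PD.card_fib _ hn0 hD, ← PD.card_fib _ hn0 hD,
      PD.fib_set_self p hn0 hD (by rwa [hk]), Finset.card_insert_of_notMem]
    · push_cast; ring
    · rw [PD.mem_fib hn0 hD, hk]
      rintro rfl
      exact hab (Int.ModEq.refl _)
  · rw [if_neg h1]
    by_cases h2 : (c : ZMod n) = b
    · have hk' : k ∈ p.fib b := (PD.mem_fib hn0 hD).2 hk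
      rw [if_pos h2, ← sharp_apply hn0, ← sharp_apply hn0 p, h2, sharp_apply hn0,
        sharp_apply hn0, ← PD.card_fib _ hn0 hD, ← PD.card_fib _ hn0 hD,
        PD.fib_set_source p hn0 hD hk hab, Finset.card_erase_of_mem hk']
      have : 0 < (p.fib b).card := Finset.card_pos.2 ⟨k, hk'⟩
      push_cast [Nat.cast_sub this]
      ring
    · rw [if_neg h2, ← PD.card_fib _ hn0 hD, ← PD.card_fib _ hn0 hD, PD.fib_set_of_ne p hn0 hD]
      · ring
      · rw [hk]
        exact fun h => h2 ((ZMod.intCast_eq_intCast_iff _ _ _).2 h.symm)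
      · exact fun h => h1 ((ZMod.intCast_eq_intCast_iff _ _ _).2 h.symm)

/-- The element of `P_D` with prescribed values at `0, …, D - 1`. -/
def PD.ofFun {n D : ℕ} (hD : 0 < D) (g : ℕ → ℤ) : PD n D :=
  ⟨fun j => g (j % D).toNat + j / D * n, fun j => by
    have : (D : ℤ) ≠ 0 := by exact_mod_cast hD.ne'
    show g ((j + D) % D).toNat + (j + D) / D * n = g (j % D).toNat + j / D * n + n
    rw [Int.add_emod_right, Int.add_ediv_of_dvd_right (dvd_refl _), Int.ediv_self this]; ring⟩

/-- Every weight with non-negative entries and sum `D` is the weight of an element of `C_D`. -/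
lemma exists_sharp_eq {n D : ℕ} (hn : 0 < n) (hD : 0 < D) (mu : Wt n) (h0 : ∀ j, 0 ≤ mu j)
    (hsum : ∑ j ∈ Finset.range n, mu (j : ZMod n) = D) : ∃ lam : CD n D, sharp lam.1 = mu := by
  have : NeZero n := ⟨hn.ne'⟩
  have hD' : (0 : ℤ) < D := by exact_mod_cast hD
  have hn' : (0 : ℤ) < n := by exact_mod_cast hn
  have hsum' : ∑ i : ZMod n, mu i = D := by
    rw [← hsum]
    refine (Finset.sum_nbij (fun j : ℕ => (j : ZMod n)) (fun _ _ => Finset.mem_univ _) ?_ ?_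
      (fun _ _ => rfl)).symm
    · intro a ha b hb hab
      rw [Finset.coe_range, Set.mem_Iio] at ha hb
      have := congrArg ZMod.val hab
      simpa only [ZMod.val_natCast_of_lt ha, ZMod.val_natCast_of_lt hb] using this
    · intro i _
      exact ⟨i.val, by simpa using ZMod.val_lt i, by simp⟩
  have hcard : Fintype.card (Σ i : ZMod n, Fin (mu i).toNat) = D := by
    rw [Fintype.card_sigma]
    simp only [Fintype.card_fin]
    rw [← Nat.cast_inj (R := ℤ), ← hsum']
    push_cast
    exact Finset.sum_congr rfl fun i _ => by simp [h0]
  -- The disjoint union of `mu i` copies of each residue `i` has `D` elements. Numbering them gives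
  -- a sequence of values with the right multiplicities, which remains to be sorted into an element
  -- of `C_D`.
  let e := Fintype.equivFinOfCardEq hcard
  let g : ℕ → ℤ := fun k => if h : k < D then ((e.symm ⟨k, h⟩).1.val : ℤ) else 0
  let p : PD n D := PD.ofFun hD g
  obtain ⟨lam, w, hw⟩ := exists_CD_comp hn hD p
  refine ⟨lam, ?_⟩
  rw [← sharp_comp lam.1 w, hw]
  ext i
  have hg : ∀ k : ℕ, (h : k < D) → g k = ((e.symm ⟨k, h⟩).1.val : ℤ) := fun k h => dif_pos h
  have hg0 : ∀ k, 0 ≤ g k ∧ g k < n := by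
    intro k
    simp only [g]
    split_ifs with h
    · constructor
      · positivity
      · exact_mod_cast ZMod.val_lt _
    · exact ⟨le_rfl, hn'⟩
  have hset : {j : ℤ | p.1 j = (i.val : ℤ)} =
      (fun y : Fin (mu i).toNat => ((e ⟨i, y⟩ : Fin D) : ℤ)) '' Set.univ := by
    ext j
    simp only [Set.mem_ofPred_eq, Set.image_univ, Set.mem_range]
    have hi : (i.val : ℤ) < n := by exact_mod_cast ZMod.val_lt i
    have hpj : p.1 j = g (j % D).toNat + j / D * n := rfl
    constructor
    · intro hj
      rw [hpj] at hj
      have h1 := hg0 (j % D).toNat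
      have h2 : j / D = 0 := by
        have h3 : j / D < 1 := by by_contra h; nlinarith
        have h4 : -1 < j / D := by by_contra h; nlinarith
        omega
      have h3 := Int.emod_add_mul_ediv j D
      have h4 := Int.emod_nonneg j hD'.ne'
      have h5 := Int.emod_lt_of_pos j hD'
      rw [h2, mul_zero, add_zero] at h3
      rw [h2, zero_mul, add_zero, h3] at hj
      obtain ⟨k, rfl⟩ := Int.eq_ofNat_of_zero_le (h3 ▸ h4)
      have hk : k < D := by omega
      simp only [Int.toNat_natCast] at hj
      rw [hg k hk] at hj
      have hx : (e.symm ⟨k, hk⟩).1 = i := ZMod.val_injective n (by exact_mod_cast hj)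
      rcases hxy : e.symm ⟨k, hk⟩ with ⟨x, y⟩
      rw [hxy] at hx
      obtain rfl : x = i := hx
      exact ⟨y, by rw [← hxy]; simp⟩
    · rintro ⟨y, rfl⟩
      have hlt := (e ⟨i, y⟩).2
      have h1 : (((e ⟨i, y⟩ : Fin D) : ℕ) : ℤ) % D = ((e ⟨i, y⟩ : Fin D) : ℕ) :=
        Int.emod_eq_of_lt (by positivity) (by exact_mod_cast hlt)
      have h2 : (((e ⟨i, y⟩ : Fin D) : ℕ) : ℤ) / D = 0 :=
        Int.ediv_eq_zero_of_lt (by positivity) (by exact_mod_cast hlt)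
      rw [hpj, h1, h2, Int.toNat_natCast, hg _ hlt]
      simp
  rw [sharp, sharpInt, hset, Set.ncard_image_of_injective, Set.ncard_univ, Nat.card_eq_fintype_card,
    Fintype.card_fin]
  · simp [h0]
  · intro y y' h
    have h0 : ((e ⟨i, y⟩ : Fin D) : ℤ) = (e ⟨i, y'⟩ : Fin D) := h
    have h1 : e ⟨i, y⟩ = e ⟨i, y'⟩ := Fin.ext (by exact_mod_cast h0)
    simpa using h1

/-! ### Lengths in the affine symmetric group -/

lemma toPD_mul {D : ℕ} (w x : affineSym D) : toPD (w * x) = (toPD w).comp x := rfl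

/-- The value `w j + 1` is taken somewhere to the right of `j`, so strict monotonicity leaves no
room for `w (j + 1)` to exceed it. -/
lemma eq_translation_of_monotone {D : ℕ} {w : affineSym D} (hw : Monotone w.1) :
    w = translation D (w.1 0) := by
  have hs : StrictMono w.1 := hw.strictMono_of_injective w.1.injective
  have h1 : ∀ j, w.1 (j + 1) = w.1 j + 1 := by
    intro j
    have h2 := hs (show j < j + 1 by omega)
    obtain ⟨m, hm⟩ := w.1.surjective (w.1 j + 1)
    have h3 : j < m := hs.lt_iff_lt.1 (by omega)
    have h4 := hs.monotone (show j + 1 ≤ m by omega)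
    omega
  refine Subtype.ext (Equiv.ext fun k => ?_)
  have h := equivariant_int (D := 1) (N := 1) (f := w.1) h1 0 k
  rw [translation_apply, ← mul_one k, ← zero_add (k * 1), h]
  ring

/-- Induction over the affine symmetric group along right multiplication by simple reflections. -/
lemma affineSym_induction {D : ℕ} (hD : 0 < D) {P : affineSym D → Prop}
    (base : ∀ m, P (translation D m))
    (step : ∀ (w s : affineSym D) (j : ℤ), IsRefl s j → w.1 j < w.1 (j + 1) → P w → P (w * s))
    (w : affineSym D) : P w := by
  suffices h : ∀ (p : PD D D) (w : affineSym D), toPD w = p → P w from h _ w rfl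
  intro p
  induction p using PD.sort_induction hD hD with
  | mono p hp =>
    rintro w rfl
    rw [eq_translation_of_monotone (w := w) hp]
    exact base _
  | step p s j hs hj ih =>
    intro w hw
    have h1 : toPD (w * s) = p := by rw [toPD_mul, hw, PD.comp_comp_refl hs]
    have h2 := step (w * s) s j hs (by subst h1; exact hj) (ih _ h1)
    rwa [mul_assoc, hs.mul_self, mul_one] at h2

/-- Induction over the affine symmetric group along left multiplication by simple reflections. -/
lemma affineSym_induction_left {D : ℕ} (hD : 0 < D) {P : affineSym D → Prop}
    (base : ∀ m, P (translation D m))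
    (step : ∀ (w s : affineSym D) (j : ℤ), IsRefl s j → w⁻¹.1 j < w⁻¹.1 (j + 1) → P w →
      P (s * w))
    (w : affineSym D) : P w := by
  suffices h : ∀ u : affineSym D, P u⁻¹ by simpa using h w⁻¹
  intro u
  induction u using affineSym_induction hD with
  | base m =>
    have : (translation D m)⁻¹ = translation D (-m) := by
      refine Subtype.ext (Equiv.ext fun k => ?_)
      change k - m = k + -m
      ring
    rw [this]
    exact base _
  | step u s j hs hj ih =>
    have := step u⁻¹ s j hs (by simpa using hj) ih
    rwa [mul_inv_rev, hs.inv_eq]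

lemma len_mul_refl {D : ℕ} (hD : 0 < D) {s : affineSym D} {j : ℤ} (hs : IsRefl s j)
    {w : affineSym D} (hw : w.1 j < w.1 (j + 1)) : len (w * s) = len w + 1 := by
  rw [len_eq_inv hD, len_eq_inv hD, toPD_mul, inv_comp_refl hD hD hs _ hw]

lemma len_mul_translation {D : ℕ} (hD : 0 < D) (w : affineSym D) (m : ℤ) :
    len (w * translation D m) = len w := by
  have hS : TransInv D {x : ℤ × ℤ | x.1 < x.2 ∧ w.1 x.2 < w.1 x.1} := by
    intro x m hx
    simpa [affineSym_shift w] using hx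
  rw [len_eq_inv hD, len_eq_inv hD, PD.inv, PD.inv]
  refine Eq.trans ?_ (orbCount_preimage hD (translation D m) hS)
  congr 1
  ext x
  simp [toPD]

lemma len_translation_mul {D : ℕ} (hD : 0 < D) (w : affineSym D) (m : ℤ) :
    len (translation D m * w) = len w := by
  rw [len_eq_inv hD, len_eq_inv hD, PD.inv, PD.inv]
  congr 1
  ext x
  simp [toPD]

lemma len_translation {D : ℕ} (m : ℤ) : len (translation D m) = 0 := by
  rw [len]
  convert Set.ncard_empty (ℤ × ℤ)
  ext x
  simp
  intros
  omega

lemma translation_zero (D : ℕ) : translation D 0 = 1 :=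
  Subtype.ext (Equiv.ext fun k => by simp)

lemma len_one {D : ℕ} : len (1 : affineSym D) = 0 := by
  rw [← translation_zero, len_translation]

lemma len_inv {D : ℕ} (hD : 0 < D) (w : affineSym D) : len w⁻¹ = len w := by
  have hS : TransInv D {x : ℤ × ℤ | x.1 < x.2 ∧ w.1 x.2 < w.1 x.1} := by
    intro x m hx
    simpa [affineSym_shift w] using hx
  rw [len_eq_inv hD, len_eq_inv hD, PD.inv, PD.inv]
  have h1 : orbCount D {x : ℤ × ℤ | x.1 < x.2 ∧ w.1 x.2 < w.1 x.1} =
      orbCount D {x : ℤ × ℤ | w⁻¹.1 x.1 < w⁻¹.1 x.2 ∧ x.2 < x.1} := by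
    rw [← orbCount_preimage hD w⁻¹ hS]
    congr 1
    ext x
    simp
  refine Eq.trans ?_ h1.symm
  -- In terms of the invariants `(a, b - a)` of a pair, exchanging its members is `(y, d) ↦ (y + d,
  -- -d)`.
  rw [orbCount, orbCount, ← Set.ncard_image_of_injective
    (f := fun y : ZMod D × ℤ => (y.1 + (y.2 : ZMod D), -y.2))]
  · congr 1
    ext y
    constructor
    · rintro ⟨_, ⟨⟨a, b⟩, ⟨h1, h2⟩, rfl⟩, rfl⟩
      exact ⟨(b, a), ⟨h2, h1⟩, by simp [pairClass]⟩
    · rintro ⟨⟨a, b⟩, ⟨h1, h2⟩, rfl⟩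
      exact ⟨_, ⟨(b, a), ⟨h2, h1⟩, rfl⟩, by simp [pairClass]⟩
  · rintro ⟨a, b⟩ ⟨c, d⟩ h
    simp only [Prod.mk.injEq, neg_inj] at h
    obtain ⟨h1, rfl⟩ := h
    simpa using h1

lemma len_refl_mul {D : ℕ} (hD : 0 < D) {s : affineSym D} {j : ℤ} (hs : IsRefl s j)
    {w : affineSym D} (hw : w⁻¹.1 j < w⁻¹.1 (j + 1)) : len (s * w) = len w + 1 := by
  rw [← len_inv hD (s * w), ← len_inv hD w, mul_inv_rev, hs.inv_eq, len_mul_refl hD hs hw]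

lemma affineSym_lt_or_gt {D : ℕ} (w : affineSym D) (j : ℤ) :
    w.1 j < w.1 (j + 1) ∨ w.1 (j + 1) < w.1 j :=
  lt_or_gt_of_ne fun h => by simpa using w.1.injective h

lemma refl_ascent_of_descent {D : ℕ} {s : affineSym D} {j : ℤ} (hs : IsRefl s j)
    {w : affineSym D} (hw : w.1 (j + 1) < w.1 j) : (w * s).1 j < (w * s).1 (j + 1) := by
  simpa [hs.1, hs.2.1] using hw

lemma len_refl_mul_of_descent {D : ℕ} (hD : 0 < D) {s : affineSym D} {j : ℤ} (hs : IsRefl s j)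
    {w : affineSym D} (hw : w⁻¹.1 (j + 1) < w⁻¹.1 j) : len w = len (s * w) + 1 := by
  have h1 : (s * w)⁻¹.1 j < (s * w)⁻¹.1 (j + 1) := by
    rw [mul_inv_rev, hs.inv_eq]
    exact refl_ascent_of_descent hs hw
  rw [← len_refl_mul hD hs h1, ← mul_assoc, hs.mul_self, one_mul]

/-- A simple reflection on the left changes the length by one in either direction, while `w` is
reached from a translation, of length zero, by increasing steps only. -/
lemma len_mul_le {D : ℕ} (hD : 0 < D) (w x : affineSym D) : len (w * x) ≤ len w + len x := by
  induction w using affineSym_induction_left hD with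
  | base m => rw [len_translation_mul hD, len_translation, zero_add]
  | step w s j hs hw ih =>
    rw [len_refl_mul hD hs hw, mul_assoc]
    rcases affineSym_lt_or_gt (w * x)⁻¹ j with h | h
    · rw [len_refl_mul hD hs h]; omega
    · have := len_refl_mul_of_descent hD hs h; omega

/-! ### The regular representation of the Hecke algebra -/

/-- The parameter `v⁻²` of the Hecke algebra. -/
def q : K := v ^ (-2 : ℤ)

/-- The vector space with a basis indexed by the affine symmetric group. -/
abbrev Reg (D : ℕ) : Type := affineSym D →₀ K

/-- Right multiplication by the standard generator of a simple reflection, in the regular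
representation. -/
def regRight {D : ℕ} (s : affineSym D) (j : ℤ) : Module.End K (Reg D) :=
  Finsupp.linearCombination K fun w : affineSym D =>
    if w.1 j < w.1 (j + 1) then Finsupp.single (w * s) (1 : K)
    else q • Finsupp.single (w * s) 1 + (q - 1) • Finsupp.single w 1

/-- Left multiplication by the standard generator of a simple reflection, in the regular
representation. -/
def regLeft {D : ℕ} (s : affineSym D) (j : ℤ) : Module.End K (Reg D) :=
  Finsupp.linearCombination K fun w : affineSym D =>
    if w⁻¹.1 j < w⁻¹.1 (j + 1) then Finsupp.single (s * w) (1 : K)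
    else q • Finsupp.single (s * w) 1 + (q - 1) • Finsupp.single w 1

/-- Right multiplication by an element of the group. -/
def regRightMul {D : ℕ} (x : affineSym D) : Module.End K (Reg D) :=
  Finsupp.lmapDomain K K (· * x)

/-- Left multiplication by an element of the group. -/
def regLeftMul {D : ℕ} (x : affineSym D) : Module.End K (Reg D) :=
  Finsupp.lmapDomain K K (x * ·)

section Reg

variable {D : ℕ} {s t : affineSym D} {i j : ℤ} (w x : affineSym D)

lemma regRight_single : regRight s j (Finsupp.single w 1) =
    if w.1 j < w.1 (j + 1) then Finsupp.single (w * s) (1 : K)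
    else q • Finsupp.single (w * s) 1 + (q - 1) • Finsupp.single w 1 := by
  rw [regRight, Finsupp.linearCombination_single, one_smul]

lemma regLeft_single : regLeft s j (Finsupp.single w 1) =
    if w⁻¹.1 j < w⁻¹.1 (j + 1) then Finsupp.single (s * w) (1 : K)
    else q • Finsupp.single (s * w) 1 + (q - 1) • Finsupp.single w 1 := by
  rw [regLeft, Finsupp.linearCombination_single, one_smul]

@[simp] lemma regRightMul_single : regRightMul x (Finsupp.single w (1 : K)) =
    Finsupp.single (w * x) 1 := by
  simp [regRightMul]

@[simp] lemma regLeftMul_single : regLeftMul x (Finsupp.single w (1 : K)) =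
    Finsupp.single (x * w) 1 := by
  simp [regLeftMul]

lemma end_ext {X : Type*} {M : Type*} [AddCommGroup M] [Module K M] {f g : (X →₀ K) →ₗ[K] M}
    (h : ∀ x, f (Finsupp.single x 1) = g (Finsupp.single x 1)) : f = g :=
  Finsupp.lhom_ext' fun x => LinearMap.ext_ring (h x)

/-- Since `w` carries the pair exchanged by `t` onto a translate of the pair exchanged by `s`, in
either order, it conjugates `t` into `s`. -/
lemma refl_mul_eq_mul_refl (hs : IsRefl s j) (ht : IsRefl t i) {w : affineSym D}
    (h : (w.1 i ≡ j [ZMOD D] ∧ w.1 (i + 1) = w.1 i + 1) ∨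
      (w.1 (i + 1) ≡ j [ZMOD D] ∧ w.1 i = w.1 (i + 1) + 1)) : s * w = w * t := by
  refine Subtype.ext (Equiv.ext fun k => ?_)
  change s.1 (w.1 k) = w.1 (t.1 k)
  rcases ht.cases k with ⟨h1, h2⟩ | ⟨h1, h2⟩ | ⟨h1, h3, h2⟩
  · rw [h2]
    obtain ⟨m, rfl⟩ := modEq_iff_exists.1 h1
    rw [show i + m * (D : ℤ) + 1 = i + 1 + m * D by ring]
    simp only [affineSym_shift]
    rcases h with ⟨h4, h5⟩ | ⟨h4, h5⟩
    · rw [hs.apply_of_modEq h4, h5]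
    · rw [h5, hs.apply_of_modEq_succ (h4.add_right 1)]; ring
  · rw [h2]
    obtain ⟨m, rfl⟩ := modEq_iff_exists.1 h1
    rw [show i + 1 + m * (D : ℤ) - 1 = i + m * D by ring]
    simp only [affineSym_shift]
    rcases h with ⟨h4, h5⟩ | ⟨h4, h5⟩
    · rw [h5, hs.apply_of_modEq_succ (h4.add_right 1)]; ring
    · rw [hs.apply_of_modEq h4, h5]
  · rw [h2]
    have h4 : ¬ w.1 k ≡ w.1 i [ZMOD D] := by rwa [affineSym_modEq_iff]
    have h5 : ¬ w.1 k ≡ w.1 (i + 1) [ZMOD D] := by rwa [affineSym_modEq_iff]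
    rcases h with ⟨h6, h7⟩ | ⟨h6, h7⟩
    · refine hs.2.2 _ (fun h8 => h4 (h8.trans h6.symm)) (fun h8 => h5 (h8.trans ?_))
      rw [h7]
      exact (h6.add_right 1).symm
    · refine hs.2.2 _ (fun h8 => h5 (h8.trans h6.symm)) (fun h8 => h4 (h8.trans ?_))
      rw [h7]
      exact (h6.add_right 1).symm

lemma ascent_iff_of_adjacent (h : (w.1 i ≡ j [ZMOD D] ∧ w.1 (i + 1) = w.1 i + 1) ∨
      (w.1 (i + 1) ≡ j [ZMOD D] ∧ w.1 i = w.1 (i + 1) + 1)) :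
    w⁻¹.1 j < w⁻¹.1 (j + 1) ↔ w.1 i < w.1 (i + 1) := by
  have key : ∀ a b : ℤ, w.1 a ≡ j [ZMOD D] → w.1 b = w.1 a + 1 →
      (w⁻¹.1 j < w⁻¹.1 (j + 1) ↔ a < b) := by
    intro a b h1 h2
    obtain ⟨m, hm⟩ := modEq_iff_exists.1 h1
    have e1 : w⁻¹.1 j = a + (-m) * D := by
      rw [Subgroup.coe_inv, Equiv.Perm.inv_eq_iff_eq, affineSym_shift, hm]; ring
    have e2 : w⁻¹.1 (j + 1) = b + (-m) * D := by
      rw [Subgroup.coe_inv, Equiv.Perm.inv_eq_iff_eq, affineSym_shift, h2, hm]; ring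
    rw [e1, e2]
    simp
  rcases h with ⟨h1, h2⟩ | ⟨h1, h2⟩
  · rw [key _ _ h1 h2]; omega
  · rw [key _ _ h1 h2]; omega

/-- If `w` carries `{i, i + 1}` onto a translate of `{j, j + 1}`, then `s w = w t`, and the left and
the right operator coincide on the vectors of `w` and `w t`. Otherwise multiplication on one side
does not affect whether the other side ascends, and the formulas can be applied independently of
each other. This commutation is what makes the standard elements linearly independent. -/
lemma regLeft_regRight (hs : IsRefl s j) (ht : IsRefl t i) :
    regLeft s j * regRight t i = regRight t i * regLeft s j := by
  refine end_ext fun w => ?_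
  simp only [Module.End.mul_apply]
  by_cases h : (w.1 i ≡ j [ZMOD D] ∧ w.1 (i + 1) = w.1 i + 1) ∨
      (w.1 (i + 1) ≡ j [ZMOD D] ∧ w.1 i = w.1 (i + 1) + 1)
  · have e1 := refl_mul_eq_mul_refl hs ht h
    have e2 := ascent_iff_of_adjacent w h
    have e3 : s * (w * t) = w := by rw [← e1, ← mul_assoc, hs.mul_self, one_mul]
    have e4 : w * t * t = w := by rw [mul_assoc, ht.mul_self, mul_one]
    have e5 : (w * t)⁻¹.1 j < (w * t)⁻¹.1 (j + 1) ↔ (w * t).1 i < (w * t).1 (i + 1) := by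
      apply ascent_iff_of_adjacent
      have f1 : (w * t).1 i = w.1 (i + 1) := by simp [ht.1]
      have f2 : (w * t).1 (i + 1) = w.1 i := by simp [ht.2.1]
      rw [f1, f2]
      exact h.symm
    have f1 : regLeft s j (Finsupp.single w 1) = regRight t i (Finsupp.single w 1) := by
      rw [regLeft_single, regRight_single, e1]
      simp only [e2]
    have f2 : regLeft s j (Finsupp.single (w * t) 1) = regRight t i (Finsupp.single (w * t) 1) := by
      rw [regLeft_single, regRight_single, e3, e4]
      simp only [e5]
    rw [f1, regRight_single]
    split_ifs
    · exact f2
    · simp only [map_add, map_smul, f1, f2]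
  · have e1 : (s * w).1 i < (s * w).1 (i + 1) ↔ w.1 i < w.1 (i + 1) :=
      hs.lt_iff (fun h' => h (Or.inl h')) (fun h' => h (Or.inr h'))
    have e2 : (w * t)⁻¹.1 j < (w * t)⁻¹.1 (j + 1) ↔ w⁻¹.1 j < w⁻¹.1 (j + 1) := by
      rw [mul_inv_rev, ht.inv_eq]
      refine ht.lt_iff (fun h' => h (Or.inl ?_)) (fun h' => h (Or.inr ?_))
      · obtain ⟨h1, h2⟩ := h'
        obtain ⟨m, hm⟩ := modEq_iff_exists.1 h1
        rw [hm, Subgroup.coe_inv, Equiv.Perm.inv_eq_iff_eq] at h2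
        rw [Subgroup.coe_inv, Equiv.Perm.inv_eq_iff_eq] at hm
        rw [show i + m * (D : ℤ) + 1 = i + 1 + m * D by ring] at h2
        rw [affineSym_shift] at h2 hm
        exact ⟨modEq_iff_exists.2 ⟨-m, by linarith⟩, by linarith⟩
      · obtain ⟨h1, h2⟩ := h'
        obtain ⟨m, hm⟩ := modEq_iff_exists.1 h1
        rw [hm, Subgroup.coe_inv, Equiv.Perm.inv_eq_iff_eq] at h2
        rw [Subgroup.coe_inv, Equiv.Perm.inv_eq_iff_eq] at hm
        rw [show i + m * (D : ℤ) + 1 = i + 1 + m * D by ring] at h2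
        rw [affineSym_shift] at h2 hm
        exact ⟨modEq_iff_exists.2 ⟨-m, by linarith⟩, by linarith⟩
    rw [regLeft_single, regRight_single]
    split_ifs with h1 h2 h2
    · rw [regLeft_single, regRight_single, if_pos (e2.2 h2), if_pos (e1.2 h1), mul_assoc]
    · simp only [map_add, map_smul]
      rw [regLeft_single, regRight_single, regRight_single, if_pos h1, if_pos (e1.2 h1),
        if_neg (fun h' => h2 (e2.1 h')), mul_assoc]
    · simp only [map_add, map_smul]
      rw [regLeft_single, regLeft_single, regRight_single, if_pos h2, if_pos (e2.2 h2),
        if_neg (fun h' => h1 (e1.1 h')), mul_assoc]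
    · simp only [map_add, map_smul]
      rw [regLeft_single, regLeft_single, regRight_single, regRight_single, if_neg h2,
        if_neg h1, if_neg (fun h' => h1 (e1.1 h')), if_neg (fun h' => h2 (e2.1 h')), mul_assoc]
      simp only [smul_add, sub_smul, one_smul, smul_sub]
      abel

lemma regLeft_regRightMul (m : ℤ) :
    regLeft s j * regRightMul (translation D m) = regRightMul (translation D m) * regLeft s j := by
  refine end_ext fun w => ?_
  simp only [Module.End.mul_apply, regRightMul_single]
  have h : (w * translation D m)⁻¹.1 j < (w * translation D m)⁻¹.1 (j + 1) ↔
      w⁻¹.1 j < w⁻¹.1 (j + 1) := by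
    have : ∀ k, (w * translation D m)⁻¹.1 k = w⁻¹.1 k - m := by
      intro k
      rw [Subgroup.coe_inv, Equiv.Perm.inv_eq_iff_eq]
      simp
    rw [this, this]
    omega
  rw [regLeft_single, regLeft_single]
  simp only [h]
  split_ifs
  · rw [regRightMul_single, mul_assoc]
  · simp only [map_add, map_smul, regRightMul_single, mul_assoc]

lemma regLeftMul_regRight (m : ℤ) :
    regLeftMul (translation D m) * regRight s j = regRight s j * regLeftMul (translation D m) := by
  refine end_ext fun w => ?_
  simp only [Module.End.mul_apply, regLeftMul_single]
  rw [regRight_single, regRight_single]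
  simp only [Subgroup.coe_mul, Equiv.Perm.mul_apply, translation_apply, add_lt_add_iff_right]
  split_ifs
  · rw [regLeftMul_single, mul_assoc]
  · simp only [map_add, map_smul, regLeftMul_single, mul_assoc]

lemma regLeftMul_regRightMul :
    regLeftMul w * regRightMul x = regRightMul x * regLeftMul w := by
  refine end_ext fun u => ?_
  simp [mul_assoc]

lemma regLeft_sq (hs : IsRefl s j) :
    regLeft s j * regLeft s j = q • 1 + (q - 1) • regLeft s j := by
  refine end_ext fun w => ?_
  have h0 : s * (s * w) = w := by rw [← mul_assoc, hs.mul_self, one_mul]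
  have h1 : (s * w)⁻¹.1 j < (s * w)⁻¹.1 (j + 1) ↔ w⁻¹.1 (j + 1) < w⁻¹.1 j := by
    rw [mul_inv_rev, hs.inv_eq]
    simp [hs.1, hs.2.1]
  simp only [Module.End.mul_apply, LinearMap.add_apply, LinearMap.smul_apply, Module.End.one_apply]
  rcases affineSym_lt_or_gt w⁻¹ j with h | h
  · rw [regLeft_single, if_pos h, regLeft_single, if_neg (fun h' => h.not_gt (h1.1 h')), h0]
  · rw [regLeft_single, if_neg h.not_gt, map_add, map_smul, map_smul, regLeft_single,
      if_pos (h1.2 h), regLeft_single, if_neg h.not_gt, h0]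

/-- The operators that commute with all right multiplications. -/
def regCommutant (D : ℕ) : Subalgebra K (Module.End K (Reg D)) :=
  Subalgebra.centralizer K ({f | ∃ s j, IsRefl s j ∧ f = regRight s j} ∪
    {f | ∃ m, f = regRightMul (translation D m)})

lemma regLeft_mem (hs : IsRefl s j) : regLeft s j ∈ regCommutant D := by
  rw [regCommutant, Subalgebra.mem_centralizer_iff]
  rintro _ (⟨t, i, ht, rfl⟩ | ⟨m, rfl⟩)
  · exact (regLeft_regRight hs ht).symm
  · exact (regLeft_regRightMul m).symm

lemma regLeftMul_mem (m : ℤ) : regLeftMul (translation D m) ∈ regCommutant D := by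
  rw [regCommutant, Subalgebra.mem_centralizer_iff]
  rintro _ (⟨t, i, ht, rfl⟩ | ⟨m, rfl⟩)
  · exact (regLeftMul_regRight m).symm
  · exact (regLeftMul_regRightMul _ _).symm

/-- The vector of `1` generates the regular representation under the right operators, so an operator
that commutes with them is determined by its value there. Every identity between left operators is
thereby reduced to an evaluation at `1`. -/
lemma regCommutant_ext (hD : 0 < D) {a b : Module.End K (Reg D)} (ha : a ∈ regCommutant D)
    (hb : b ∈ regCommutant D) (h : a (Finsupp.single 1 1) = b (Finsupp.single 1 1)) : a = b := by
  rw [regCommutant, Subalgebra.mem_centralizer_iff] at ha hb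
  refine end_ext fun w => ?_
  induction w using affineSym_induction hD with
  | base m =>
    have h1 := congrArg (fun f => f (Finsupp.single 1 1)) (ha _ (Or.inr ⟨m, rfl⟩))
    have h2 := congrArg (fun f => f (Finsupp.single 1 1)) (hb _ (Or.inr ⟨m, rfl⟩))
    simp only [Module.End.mul_apply, regRightMul_single, one_mul] at h1 h2
    rw [← h1, ← h2, h]
  | step w s j hs hw ih =>
    have h1 := congrArg (fun f => f (Finsupp.single w 1)) (ha _ (Or.inl ⟨s, j, hs, rfl⟩))
    have h2 := congrArg (fun f => f (Finsupp.single w 1)) (hb _ (Or.inl ⟨s, j, hs, rfl⟩))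
    simp only [Module.End.mul_apply, regRight_single, if_pos hw] at h1 h2
    rw [← h1, ← h2, ih]

lemma exists_regCommutant (hD : 0 < D) (w : affineSym D) :
    ∃ a ∈ regCommutant D, a (Finsupp.single 1 1) = Finsupp.single w 1 := by
  induction w using affineSym_induction_left hD with
  | base m => exact ⟨_, regLeftMul_mem m, by simp⟩
  | step w s j hs hw ih =>
    obtain ⟨a, ha, h⟩ := ih
    refine ⟨regLeft s j * a, mul_mem (regLeft_mem hs) ha, ?_⟩
    rw [Module.End.mul_apply, h, regLeft_single, if_pos hw]

/-- Left multiplication by the standard element of `w`, in the regular representation. -/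
def regT (hD : 0 < D) (w : affineSym D) : Module.End K (Reg D) :=
  (exists_regCommutant hD w).choose

lemma regT_mem (hD : 0 < D) : regT hD w ∈ regCommutant D := (exists_regCommutant hD w).choose_spec.1

lemma regT_single_one (hD : 0 < D) : regT hD w (Finsupp.single 1 1) = Finsupp.single w 1 :=
  (exists_regCommutant hD w).choose_spec.2

lemma regT_translation (hD : 0 < D) (m : ℤ) :
    regT hD (translation D m) = regLeftMul (translation D m) :=
  regCommutant_ext hD (regT_mem _ hD) (regLeftMul_mem m) (by rw [regT_single_one]; simp)

lemma regT_refl_mul (hD : 0 < D) (hs : IsRefl s j) (hw : w⁻¹.1 j < w⁻¹.1 (j + 1)) :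
    regT hD (s * w) = regLeft s j * regT hD w := by
  refine regCommutant_ext hD (regT_mem _ hD) (mul_mem (regLeft_mem hs) (regT_mem _ hD)) ?_
  rw [regT_single_one, Module.End.mul_apply, regT_single_one, regLeft_single, if_pos hw]

lemma regT_one (hD : 0 < D) : regT hD (1 : affineSym D) = 1 :=
  regCommutant_ext hD (regT_mem _ hD) (one_mem _) (regT_single_one _ hD)

lemma regT_refl (hD : 0 < D) (hs : IsRefl s j) : regT hD s = regLeft s j := by
  have := regT_refl_mul 1 hD hs (by simp)
  rwa [mul_one, regT_one, mul_one] at this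

/-- Additivity of lengths forces every left factor of `w` to act by an ascent: a descent on the way
would make the total length smaller than subadditivity permits. -/
lemma regT_apply (hD : 0 < D) (h : len (w * x) = len w + len x) :
    regT hD w (Finsupp.single x 1) = Finsupp.single (w * x) 1 := by
  induction w using affineSym_induction_left hD with
  | base m => rw [regT_translation, regLeftMul_single]
  | step w s j hs hw ih =>
    rw [len_refl_mul hD hs hw, mul_assoc] at h
    have h1 := len_mul_le hD w x
    rw [regT_refl_mul w hD hs hw, Module.End.mul_apply]
    rcases affineSym_lt_or_gt (w * x)⁻¹ j with h2 | h2
    · rw [len_refl_mul hD hs h2] at h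
      rw [ih (by omega), regLeft_single, if_pos h2, mul_assoc]
    · have := len_refl_mul_of_descent hD hs h2
      omega

lemma regT_mul (hD : 0 < D) (h : len (w * x) = len w + len x) :
    regT hD w * regT hD x = regT hD (w * x) := by
  refine regCommutant_ext hD (mul_mem (regT_mem _ hD) (regT_mem _ hD)) (regT_mem _ hD) ?_
  rw [regT_single_one, Module.End.mul_apply, regT_single_one, regT_apply _ _ hD h]

end Reg

lemma quadratic_iff {k A : Type*} [Field k] [Ring A] [Algebra k A] (c : k) {a : A} :
    (a + 1) * (a - algebraMap k A c) = 0 ↔ a * a = c • (1 : A) + (c - 1) • a := by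
  rw [add_mul, mul_sub, one_mul, Algebra.algebraMap_eq_smul_one, mul_smul_comm, mul_one,
    ← sub_eq_zero (a := a * a)]
  have : a * a - c • a + (a - c • (1 : A)) = a * a - (c • (1 : A) + (c - 1) • a) := by module
  rw [this]

/-- The left regular representation of the Hecke algebra. -/
def regRep {D : ℕ} (hD : 0 < D) : Hecke D →ₐ[K] Module.End K (Reg D) :=
  RingQuot.liftAlgHom K ⟨FreeAlgebra.lift K (regT hD), by
    intro a b h
    induction h with
    | one => simp [regT_one]
    | mul w x h => simp [regT_mul w x hD h]
    | quad s h =>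
      obtain ⟨j, hs⟩ := h
      have hs : IsRefl s j := hs
      have h1 := regLeft_sq hs
      simp only [map_mul, map_add, map_sub, map_one, map_zero, FreeAlgebra.lift_ι_apply,
        regT_refl hD hs, AlgHom.commutes]
      exact (quadratic_iff (A := Module.End K (Reg D)) q).2 h1⟩

lemma regRep_T {D : ℕ} (hD : 0 < D) (w : affineSym D) : regRep hD (T w) = regT hD w := by
  rw [regRep, T]
  exact (RingQuot.liftAlgHom_mkAlgHom_apply K _ _ _).trans (FreeAlgebra.lift_ι_apply _ _)

/-- The coordinates of an element of the Hecke algebra with respect to the standard basis. -/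
def coords {D : ℕ} (hD : 0 < D) : Hecke D →ₗ[K] Reg D :=
  (LinearMap.applyₗ (Finsupp.single (1 : affineSym D) (1 : K))).comp (regRep hD).toLinearMap

/-- The regular representation separates the standard elements; in particular they are linearly
independent. -/
lemma coords_T {D : ℕ} (hD : 0 < D) (w : affineSym D) : coords hD (T w) = Finsupp.single w 1 := by
  change regRep hD (T w) (Finsupp.single 1 1) = _
  rw [regRep_T, regT_single_one]

/-! ### Multiplication in the Hecke algebra -/

section HeckeMul

variable {D : ℕ} {s : affineSym D} {j : ℤ}

lemma T_mul {w x : affineSym D} (h : len (w * x) = len w + len x) : T w * T x = T (w * x) := by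
  have := RingQuot.mkAlgHom_rel K (HeckeRel.mul w x h)
  rw [map_mul] at this
  exact this

lemma T_sq (hs : IsRefl s j) : T s * T s = q • (1 : Hecke D) + (q - 1) • T s := by
  have h := RingQuot.mkAlgHom_rel K (HeckeRel.quad s ⟨j, hs⟩)
  rw [map_mul, map_add, map_sub, map_one, map_zero, AlgHom.commutes] at h
  exact (quadratic_iff q).1 h

lemma len_refl (hD : 0 < D) (hs : IsRefl s j) : len s = 1 := by
  have := len_mul_refl hD hs (w := 1) (by simp)
  rwa [one_mul, len_one] at this

lemma T_mul_refl (hD : 0 < D) (hs : IsRefl s j) {w : affineSym D} (hw : w.1 j < w.1 (j + 1)) :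
    T w * T s = T (w * s) :=
  T_mul (by rw [len_mul_refl hD hs hw, len_refl hD hs])

lemma T_mul_refl_of_descent (hD : 0 < D) (hs : IsRefl s j) {w : affineSym D}
    (hw : w.1 (j + 1) < w.1 j) : T w * T s = q • T (w * s) + (q - 1) • T w := by
  have h1 := T_mul_refl hD hs (refl_ascent_of_descent hs hw)
  have h2 : w * s * s = w := by rw [mul_assoc, hs.mul_self, mul_one]
  rw [h2] at h1
  rw [← h1, mul_assoc, T_sq hs, mul_add, mul_smul_comm, mul_smul_comm, mul_one, h1]

lemma T_mul_translation (hD : 0 < D) (w : affineSym D) (m : ℤ) :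
    T w * T (translation D m) = T (w * translation D m) :=
  T_mul (by rw [len_mul_translation hD, len_translation, add_zero])

lemma hecke_adjoin_T : Algebra.adjoin K (Set.range (T (D := D))) = ⊤ := by
  have h1 := FreeAlgebra.adjoin_range_ι K (affineSym D)
  have h2 := congrArg (Subalgebra.map (RingQuot.mkAlgHom K (HeckeRel D))) h1
  rw [AlgHom.map_adjoin, ← Set.range_comp, Algebra.map_top,
    (AlgHom.range_eq_top _).2 (RingQuot.mkAlgHom_surjective K (HeckeRel D))] at h2
  exact h2

/-- The Hecke algebra is generated by the simple reflections and the translations. -/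
lemma hecke_eq_top (hD : 0 < D) {A : Subalgebra K (Hecke D)}
    (hA : ∀ (s : affineSym D) (j : ℤ), IsRefl s j → T s ∈ A)
    (hA' : ∀ m, T (translation D m) ∈ A) : A = ⊤ := by
  rw [eq_top_iff, ← hecke_adjoin_T, Algebra.adjoin_le_iff]
  rintro _ ⟨w, rfl⟩
  induction w using affineSym_induction hD with
  | base m => exact hA' m
  | step w s j hs hw ih =>
    rw [← T_mul_refl hD hs hw]
    exact mul_mem ih (hA s j hs)

end HeckeMul

/-! ### The elements `T_p` -/

section Tcoset

variable {n D : ℕ} {lam : CD n D} {p : PD n D} {s w : affineSym D} {j : ℤ}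

lemma mem_cosetOf : w ∈ cosetOf lam p ↔ lam.1.comp w = p :=
  ⟨fun h => PD.ext h, fun h k => by rw [← h]; rfl⟩

lemma cosetOf_finite (hn : 0 < n) (hD : 0 < D) (lam : CD n D) (p : PD n D) :
    (cosetOf lam p).Finite := by
  have h1 : {f : Fin D → ℤ | ∀ i : Fin D, f i ∈ {k | lam.1.1 k = p.1 (i : ℕ)}}.Finite :=
    Set.Finite.pi' fun i => lam.1.finite_fiber hn hD _
  refine Set.Finite.of_finite_image (f := fun w i => w.1 ((i : Fin D) : ℕ))
    (h1.subset ?_) ?_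
  · rintro _ ⟨w, hw, rfl⟩ i
    exact hw _
  · intro w _ x _ h
    refine Subtype.ext (Equiv.ext fun k => ?_)
    have hD' : (0 : ℤ) < D := by exact_mod_cast hD
    obtain ⟨m, h1, h2⟩ := exists_shift_mem hD' (k + 1)
    obtain ⟨i, hi⟩ := Int.eq_ofNat_of_zero_le (show 0 ≤ k + m * D by linarith)
    have h3 : w.1 (i : ℤ) = x.1 (i : ℤ) := congrFun h ⟨i, by omega⟩
    rw [← hi, affineSym_shift, affineSym_shift] at h3
    linarith

/-- The coset indexing `T_p`, as a finite set. -/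
def cosetFin (hn : 0 < n) (hD : 0 < D) (lam : CD n D) (p : PD n D) : Finset (affineSym D) :=
  (cosetOf_finite hn hD lam p).toFinset

lemma mem_cosetFin {hn : 0 < n} {hD : 0 < D} : w ∈ cosetFin hn hD lam p ↔ lam.1.comp w = p := by
  rw [cosetFin, Set.Finite.mem_toFinset, mem_cosetOf]

lemma Tcoset_eq_sum (hn : 0 < n) (hD : 0 < D) (lam : CD n D) (p : PD n D) :
    Tcoset lam p = ∑ w ∈ cosetFin hn hD lam p, T w := by
  rw [Tcoset, finsum_mem_eq_finite_toFinset_sum _ (cosetOf_finite hn hD lam p)]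
  rfl

lemma Tcoset_mul_translation (hn : 0 < n) (hD : 0 < D) (lam : CD n D) (p : PD n D) (m : ℤ) :
    Tcoset lam p * T (translation D m) = Tcoset lam (p.comp (translation D m)) := by
  rw [Tcoset_eq_sum hn hD, Tcoset_eq_sum hn hD, Finset.sum_mul]
  refine Finset.sum_nbij' (· * translation D m) (· * (translation D m)⁻¹) ?_ ?_ ?_ ?_ ?_
  · intro w hw
    rw [mem_cosetFin] at hw ⊢
    rw [PD.comp_mul, hw]
  · intro w hw
    rw [mem_cosetFin] at hw ⊢
    rw [PD.comp_mul, hw, ← PD.comp_mul, mul_inv_cancel, PD.comp_one]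
  · intro w _
    simp
  · intro w _
    simp
  · intro w _
    exact T_mul_translation hD w m

/-- Because `λ` is monotone, an ascent of `p = λ ∘ w` forces an ascent of every `w` in the coset, so
that all products in `T_p T_s` are additive in length. -/
lemma ascent_of_mem_cosetFin {hn : 0 < n} {hD : 0 < D} (hp : p.1 j < p.1 (j + 1))
    (hw : w ∈ cosetFin hn hD lam p) : w.1 j < w.1 (j + 1) := by
  rw [mem_cosetFin] at hw
  subst hw
  exact (lam.monotone hD).reflect_lt hp

lemma Tcoset_mul_refl (hn : 0 < n) (hD : 0 < D) (hs : IsRefl s j) (lam : CD n D)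
    (hp : p.1 j < p.1 (j + 1)) : Tcoset lam p * T s = Tcoset lam (p.comp s) := by
  rw [Tcoset_eq_sum hn hD, Tcoset_eq_sum hn hD, Finset.sum_mul]
  refine Finset.sum_nbij' (· * s) (· * s) ?_ ?_ ?_ ?_ ?_
  · intro w hw
    rw [mem_cosetFin] at hw ⊢
    rw [PD.comp_mul, hw]
  · intro w hw
    rw [mem_cosetFin] at hw ⊢
    rw [PD.comp_mul, hw, PD.comp_comp_refl hs]
  · intro w _
    simp [mul_assoc, hs.mul_self]
  · intro w _
    simp [mul_assoc, hs.mul_self]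
  · intro w hw
    exact T_mul_refl hD hs (ascent_of_mem_cosetFin hp hw)

lemma Tcoset_mul_refl_of_descent (hn : 0 < n) (hD : 0 < D) (hs : IsRefl s j) (lam : CD n D)
    (hp : p.1 (j + 1) < p.1 j) :
    Tcoset lam p * T s = q • Tcoset lam (p.comp s) + (q - 1) • Tcoset lam p := by
  have h1 := Tcoset_mul_refl hn hD hs lam (p := p.comp s) (by simpa [hs.1, hs.2.1] using hp)
  rw [PD.comp_comp_refl hs] at h1
  rw [← h1, mul_assoc, T_sq hs, mul_add, mul_smul_comm, mul_smul_comm, mul_one, h1]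

lemma PD.comp_refl_of_eq (hs : IsRefl s j) (hp : p.1 j = p.1 (j + 1)) : p.comp s = p := by
  ext k
  rw [PD.comp_apply]
  rcases hs.cases k with ⟨h1, h2⟩ | ⟨h1, h2⟩ | ⟨h1, h3, h2⟩
  · obtain ⟨m, rfl⟩ := modEq_iff_exists.1 h1
    rw [h2, show j + m * (D : ℤ) + 1 = j + 1 + m * D by ring, p.shift, p.shift, hp]
  · obtain ⟨m, rfl⟩ := modEq_iff_exists.1 h1
    rw [h2, show j + 1 + m * (D : ℤ) - 1 = j + m * D by ring, p.shift, p.shift, hp]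
  · rw [h2]

/-- Here the coset is stable under right multiplication by `s` and splits into pairs `w`, `w s`, one
an ascent and the other a descent. The sum `T_w + T_{ws}` is an eigenvector of `T_s` with eigenvalue
`q`. -/
lemma Tcoset_mul_refl_of_eq (hn : 0 < n) (hD : 0 < D) (hs : IsRefl s j) (lam : CD n D)
    (hp : p.1 j = p.1 (j + 1)) : Tcoset lam p * T s = q • Tcoset lam p := by
  classical
  have hc := PD.comp_refl_of_eq hs hp
  rw [Tcoset_eq_sum hn hD, Finset.sum_mul]
  set C := cosetFin hn hD lam p with hC
  set asc : affineSym D → Prop := fun w => w.1 j < w.1 (j + 1) with hasc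
  have hmem : ∀ w ∈ C, w * s ∈ C := by
    intro w hw
    rw [hC, mem_cosetFin] at hw ⊢
    rw [PD.comp_mul, hw, hc]
  have hflip : ∀ w, asc (w * s) ↔ ¬ asc w := by
    intro w
    have := affineSym_lt_or_gt w j
    simp only [hasc, Subgroup.coe_mul, Equiv.Perm.mul_apply, hs.1, hs.2.1]
    omega
  have hss : ∀ w : affineSym D, w * s * s = w := fun w => by rw [mul_assoc, hs.mul_self, mul_one]
  have h1 : ∑ w ∈ C with asc w, T (w * s) = ∑ w ∈ C with ¬ asc w, T w := by
    refine Finset.sum_nbij' (· * s) (· * s) ?_ ?_ (fun w _ => hss w) (fun w _ => hss w)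
      (fun _ _ => rfl)
    · intro w hw
      rw [Finset.mem_filter] at hw ⊢
      exact ⟨hmem w hw.1, fun h => (hflip w).1 h hw.2⟩
    · intro w hw
      rw [Finset.mem_filter] at hw ⊢
      exact ⟨hmem w hw.1, (hflip w).2 hw.2⟩
  have h2 : ∑ w ∈ C with ¬ asc w, T (w * s) = ∑ w ∈ C with asc w, T w := by
    refine Finset.sum_nbij' (· * s) (· * s) ?_ ?_ (fun w _ => hss w) (fun w _ => hss w)
      (fun _ _ => rfl)
    · intro w hw
      rw [Finset.mem_filter] at hw ⊢
      exact ⟨hmem w hw.1, (hflip w).2 hw.2⟩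
    · intro w hw
      rw [Finset.mem_filter] at hw ⊢
      exact ⟨hmem w hw.1, fun h => (hflip w).1 h hw.2⟩
  rw [← Finset.sum_filter_add_sum_filter_not C asc, ← Finset.sum_filter_add_sum_filter_not C asc T]
  have h3 : ∑ w ∈ C with asc w, T w * T s = ∑ w ∈ C with asc w, T (w * s) :=
    Finset.sum_congr rfl fun w hw => T_mul_refl hD hs (Finset.mem_filter.1 hw).2
  have h4 : ∑ w ∈ C with ¬ asc w, T w * T s =
      q • ∑ w ∈ C with ¬ asc w, T (w * s) + (q - 1) • ∑ w ∈ C with ¬ asc w, T w := by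
    rw [Finset.smul_sum, Finset.smul_sum, ← Finset.sum_add_distrib]
    refine Finset.sum_congr rfl fun w hw => T_mul_refl_of_descent hD hs ?_
    exact (affineSym_lt_or_gt w j).resolve_left (Finset.mem_filter.1 hw).2
  rw [h3, h4, h1, h2, sub_smul, one_smul, smul_add]
  abel

lemma Tcoset_eq_zero (h : ∀ w : affineSym D, lam.1.comp w ≠ p) : Tcoset lam p = 0 := by
  have : cosetOf lam p = ∅ := by
    ext w
    simpa [mem_cosetOf] using h w
  rw [Tcoset, this, finsum_mem_empty]

lemma Tcoset_CD_of_ne (hn : 0 < n) (hD : 0 < D) {mu : CD n D} (h : lam ≠ mu) (w : affineSym D) :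
    Tcoset lam (mu.1.comp w) = 0 := by
  refine Tcoset_eq_zero fun x hx => h (CD.eq_of_comp hn hD (w := x * w⁻¹) ?_)
  rw [PD.comp_mul, hx, ← PD.comp_mul, mul_inv_cancel, PD.comp_one]

lemma mul_mem_rightIdeal {x : Hecke D} (hx : x ∈ rightIdeal lam) (h : Hecke D) :
    x * h ∈ rightIdeal lam :=
  (rightIdeal lam).smul_mem (MulOpposite.op h) hx

lemma smul_mem_rightIdeal {x : Hecke D} (hx : x ∈ rightIdeal lam) (c : K) :
    c • x ∈ rightIdeal lam := by
  rw [← mul_one (c • x), smul_mul_assoc, ← mul_smul_comm]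
  exact mul_mem_rightIdeal hx _

/-- The element `T_p` belongs to `T_λ H_D`. -/
theorem Tcoset_mem_rightIdeal (hn : 0 < n) (hD : 0 < D) (lam : CD n D) (p : PD n D) :
    Tcoset lam p ∈ rightIdeal lam := by
  induction p using PD.sort_induction hn hD with
  | mono p hp =>
    obtain ⟨mu, m, rfl⟩ := exists_CD_of_monotone hn p hp
    by_cases h : lam = mu
    · subst h
      rw [← Tcoset_mul_translation hn hD]
      exact mul_mem_rightIdeal (Submodule.subset_span rfl) _
    · rw [Tcoset_CD_of_ne hn hD h]
      exact zero_mem _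
  | step p s j hs hp ih =>
    rw [← Tcoset_mul_refl hn hD hs lam hp]
    exact mul_mem_rightIdeal ih _

lemma Tcoset_mul_refl_mem_span (hn : 0 < n) (hD : 0 < D) (hs : IsRefl s j) (lam : CD n D)
    (p : PD n D) : Tcoset lam p * T s ∈ Submodule.span K (Set.range (Tcoset lam)) := by
  have hmem : ∀ p, Tcoset lam p ∈ Submodule.span K (Set.range (Tcoset lam)) :=
    fun p => Submodule.subset_span ⟨p, rfl⟩
  rcases lt_trichotomy (p.1 j) (p.1 (j + 1)) with h | h | h
  · rw [Tcoset_mul_refl hn hD hs lam h]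
    exact hmem _
  · rw [Tcoset_mul_refl_of_eq hn hD hs lam h]
    exact Submodule.smul_mem _ _ (hmem _)
  · rw [Tcoset_mul_refl_of_descent hn hD hs lam h]
    exact add_mem (Submodule.smul_mem _ _ (hmem _)) (Submodule.smul_mem _ _ (hmem _))

/-- The elements `T_p` span the right ideal `T_λ H_D`. -/
lemma mem_span_Tcoset (hn : 0 < n) (hD : 0 < D) (lam : CD n D) {x : Hecke D}
    (hx : x ∈ rightIdeal lam) : x ∈ Submodule.span K (Set.range (Tcoset lam)) := by
  set N := Submodule.span K (Set.range (Tcoset lam)) with hN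
  -- The elements whose right multiplication preserves `N` form a subalgebra, so only the generators
  -- have to be tested.
  let A : Subalgebra K (Hecke D) :=
    { carrier := {h | ∀ y ∈ N, y * h ∈ N}
      mul_mem' := fun {a b} ha hb y hy => by
        rw [← mul_assoc]
        exact hb _ (ha y hy)
      add_mem' := fun {a b} ha hb y hy => by
        rw [mul_add]
        exact add_mem (ha y hy) (hb y hy)
      algebraMap_mem' := fun c y hy => by
        rw [Algebra.algebraMap_eq_smul_one, mul_smul_comm, mul_one]
        exact N.smul_mem c hy }
  have hgen : ∀ h : Hecke D, (∀ p, Tcoset lam p * h ∈ N) → h ∈ A := by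
    intro h hh y hy
    refine Submodule.span_induction (p := fun y _ => y * h ∈ N) ?_ ?_ ?_ ?_ hy
    · rintro _ ⟨p, rfl⟩
      exact hh p
    · rw [zero_mul]; exact zero_mem _
    · intro a b _ _ ha hb
      rw [add_mul]; exact add_mem ha hb
    · intro c a _ ha
      rw [smul_mul_assoc]; exact N.smul_mem c ha
  have hA : A = ⊤ := by
    refine hecke_eq_top hD (fun s j hs => ?_) (fun m => ?_)
    · exact hgen _ (Tcoset_mul_refl_mem_span hn hD hs lam)
    · refine hgen _ fun p => ?_
      rw [Tcoset_mul_translation hn hD]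
      exact Submodule.subset_span ⟨_, rfl⟩
  obtain ⟨h, rfl⟩ := Submodule.mem_span_singleton.1 hx
  have h1 : h.unop ∈ A := by rw [hA]; trivial
  exact h1 _ (Submodule.subset_span ⟨_, rfl⟩)

end Tcoset

/-! ### `T_D` as a vector space with a basis indexed by `P_D` -/

/-- The vector space with a basis indexed by `P_D`. -/
abbrev VD (n D : ℕ) : Type := PD n D →₀ K

/-- The element `T_p` of `T_D`. -/
def tp {n D : ℕ} (hn : 0 < n) (hD : 0 < D) (p : PD n D) : TD n D :=
  fun lam => ⟨Tcoset lam p, Tcoset_mem_rightIdeal hn hD lam p⟩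

lemma CD.finite {n D : ℕ} (hD : 0 < D) : Finite (CD n D) := by
  have hmem : ∀ (lam : CD n D) (i : Fin D), lam.1.1 ((i : ℕ) + 1) ∈ Set.Icc (1 : ℤ) n :=
    fun lam i => ⟨(lam.pos_iff hD _).2 (by omega),
      (lam.monotone hD (show ((i : ℕ) : ℤ) + 1 ≤ D by omega)).trans lam.2.2.2⟩
  refine Finite.of_injective (β := Fin D → Set.Icc (1 : ℤ) n)
    (fun lam i => ⟨lam.1.1 ((i : ℕ) + 1), hmem lam i⟩) fun lam mu h => ?_
  refine Subtype.ext (PD.ext fun k => ?_)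
  have hD' : (0 : ℤ) < D := by exact_mod_cast hD
  obtain ⟨m, h1, h2⟩ := exists_shift_mem hD' k
  obtain ⟨i, hi⟩ := Int.eq_ofNat_of_zero_le (show 0 ≤ k + m * D - 1 by linarith)
  have h3 : lam.1.1 ((i : ℤ) + 1) = mu.1.1 (i + 1) :=
    congrArg Subtype.val (congrFun h ⟨i, by omega⟩)
  rw [← hi, sub_add_cancel, lam.1.shift, mu.1.shift] at h3
  linarith

section Theta

variable {n D : ℕ} (hn : 0 < n) (hD : 0 < D)

/-- The linear map that sends the basis vector of `p` to `T_p`. -/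
def thetaMap : VD n D →ₗ[K] TD n D := Finsupp.linearCombination K (tp hn hD)

lemma thetaMap_single (p : PD n D) : thetaMap hn hD (Finsupp.single p 1) = tp hn hD p := by
  rw [thetaMap, Finsupp.linearCombination_single, one_smul]

/-- The functional on `T_D` that gives the coefficient of `T_w` of the component at `λ`. -/
def coordAt (lam : CD n D) (w : affineSym D) : TD n D →ₗ[K] K where
  toFun x := coords hD (x lam : Hecke D) w
  map_add' x y := by simp
  map_smul' c x := by
    have : ((c • x) lam : Hecke D) = c • (x lam : Hecke D) := rfl
    rw [this, map_smul]
    rfl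

lemma coordAt_tp (lam : CD n D) (w : affineSym D) (p : PD n D) [Decidable (lam.1.comp w = p)] :
    coordAt hD lam w (tp hn hD p) = if lam.1.comp w = p then 1 else 0 := by
  classical
  change coords hD (Tcoset lam p) w = _
  rw [Tcoset_eq_sum hn hD, map_sum]
  simp only [coords_T, Finsupp.finsetSum_apply, Finsupp.single_apply]
  rw [Finset.sum_ite_eq']
  simp only [mem_cosetFin]

/-- Different `p` index disjoint cosets, so the coefficient of `T_w` in the component at `λ` is the
coefficient of `p = λ ∘ w`. As every `p` is of this form, independence of the `T_p` follows. -/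
lemma coordAt_thetaMap (lam : CD n D) (w : affineSym D) (x : VD n D) :
    coordAt hD lam w (thetaMap hn hD x) = x (lam.1.comp w) := by
  classical
  have : (coordAt hD lam w).comp (thetaMap hn hD) = Finsupp.lapply (lam.1.comp w) := by
    refine end_ext fun p => ?_
    rw [LinearMap.comp_apply, thetaMap_single, coordAt_tp, Finsupp.lapply_apply,
      Finsupp.single_apply]
    simp only [eq_comm]
  exact congrArg (fun f => f x) this

lemma thetaMap_injective : Function.Injective (thetaMap hn hD) := by
  intro x y h
  ext p
  obtain ⟨lam, w, rfl⟩ := exists_CD_comp hn hD p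
  rw [← coordAt_thetaMap hn hD, ← coordAt_thetaMap hn hD, h]

open Classical in
lemma tp_comp (lam : CD n D) (w : affineSym D) : tp hn hD (lam.1.comp w) =
    Pi.single lam ⟨Tcoset lam (lam.1.comp w), Tcoset_mem_rightIdeal hn hD lam _⟩ := by
  ext mu
  by_cases h : mu = lam
  · subst h
    rw [Pi.single_eq_same]
    rfl
  · rw [Pi.single_eq_of_ne h]
    exact Tcoset_CD_of_ne hn hD h w

lemma thetaMap_surjective : Function.Surjective (thetaMap hn hD) := by
  classical
  have key : ∀ (lam : CD n D) (x : Hecke D) (hx : x ∈ rightIdeal lam),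
      (Pi.single lam ⟨x, hx⟩ : TD n D) ∈ LinearMap.range (thetaMap hn hD) := by
    intro lam x hx
    have h1 := mem_span_Tcoset hn hD lam hx
    have h2 : ∀ y ∈ Submodule.span K (Set.range (Tcoset lam)), ∃ hy : y ∈ rightIdeal lam,
        (Pi.single lam ⟨y, hy⟩ : TD n D) ∈ LinearMap.range (thetaMap hn hD) := by
      intro y hy
      induction hy using Submodule.span_induction with
      | mem y hy =>
        obtain ⟨p, rfl⟩ := hy
        refine ⟨Tcoset_mem_rightIdeal hn hD lam p, ?_⟩
        obtain ⟨mu, w, rfl⟩ := exists_CD_comp hn hD p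
        by_cases h : lam = mu
        · subst h
          exact ⟨Finsupp.single _ 1, by rw [thetaMap_single, tp_comp]⟩
        · have h0 : (⟨Tcoset lam (mu.1.comp w), Tcoset_mem_rightIdeal hn hD lam _⟩ :
              rightIdeal lam) = 0 := Subtype.ext (Tcoset_CD_of_ne hn hD h w)
          rw [h0, Pi.single_zero]
          exact zero_mem _
      | zero =>
        refine ⟨zero_mem _, ?_⟩
        have h0 : (⟨0, zero_mem _⟩ : rightIdeal lam) = 0 := rfl
        rw [h0, Pi.single_zero]
        exact zero_mem _
      | add a b _ _ ha hb =>
        obtain ⟨ha, ha'⟩ := ha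
        obtain ⟨hb, hb'⟩ := hb
        refine ⟨add_mem ha hb, ?_⟩
        have h0 : (⟨a + b, add_mem ha hb⟩ : rightIdeal lam) = ⟨a, ha⟩ + ⟨b, hb⟩ := rfl
        rw [h0, Pi.single_add]
        exact add_mem ha' hb'
      | smul c a _ ha =>
        obtain ⟨ha, ha'⟩ := ha
        refine ⟨smul_mem_rightIdeal ha c, ?_⟩
        have h0 : (⟨c • a, smul_mem_rightIdeal ha c⟩ : rightIdeal lam) = c • ⟨a, ha⟩ := rfl
        rw [h0, Pi.single_smul]
        exact Submodule.smul_mem _ c ha'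
    exact (h2 x h1).2
  intro x
  have := CD.finite (n := n) hD
  have := Fintype.ofFinite (CD n D)
  rw [← LinearMap.mem_range, ← Finset.univ_sum_single x]
  exact sum_mem fun lam _ => key lam _ (x lam).2

/-- The isomorphism of vector spaces that sends the basis vector of `p` to `T_p`. -/
def theta : VD n D ≃ₗ[K] TD n D :=
  LinearEquiv.ofBijective (thetaMap hn hD) ⟨thetaMap_injective hn hD, thetaMap_surjective hn hD⟩

@[simp] lemma theta_single (p : PD n D) : theta hn hD (Finsupp.single p 1) = tp hn hD p :=
  thetaMap_single hn hD p

lemma std_eq (p : PD n D) : std p = v ^ xdim p • tp hn hD p := by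
  ext lam
  have h := smul_mem_rightIdeal (Tcoset_mem_rightIdeal hn hD lam p) (v ^ xdim p)
  rw [std, dif_pos h]
  rfl

/-! ### The right action of the generators of the Hecke algebra -/

/-- The action of the simple reflection `s` that exchanges `j` and `j + 1`. -/
def opS (s : affineSym D) (j : ℤ) : Module.End K (VD n D) :=
  Finsupp.linearCombination K fun p : PD n D =>
    if p.1 j < p.1 (j + 1) then Finsupp.single (p.comp s) (1 : K)
    else if p.1 j = p.1 (j + 1) then q • Finsupp.single p 1
    else q • Finsupp.single (p.comp s) 1 + (q - 1) • Finsupp.single p 1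

/-- The action of a translation. -/
def opT (m : ℤ) : Module.End K (VD n D) :=
  Finsupp.lmapDomain K K fun p : PD n D => p.comp (translation D m)

lemma opS_single (s : affineSym D) (j : ℤ) (p : PD n D) : opS s j (Finsupp.single p 1) =
    if p.1 j < p.1 (j + 1) then Finsupp.single (p.comp s) (1 : K)
    else if p.1 j = p.1 (j + 1) then q • Finsupp.single p 1
    else q • Finsupp.single (p.comp s) 1 + (q - 1) • Finsupp.single p 1 := by
  rw [opS, Finsupp.linearCombination_single, one_smul]

@[simp] lemma opT_single (m : ℤ) (p : PD n D) (c : K) : opT m (Finsupp.single p c) =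
    Finsupp.single (p.comp (translation D m)) c := by
  simp [opT]

/-- Right multiplication by an element of the Hecke algebra. -/
def rmul (h : Hecke D) : Module.End K (TD n D) where
  toFun x := MulOpposite.op h • x
  map_add' := smul_add _
  map_smul' c x := by
    ext lam
    exact smul_mul_assoc c (x lam : Hecke D) h

lemma rmul_apply (h : Hecke D) (x : TD n D) (lam : CD n D) :
    (rmul h x lam : Hecke D) = x lam * h := rfl

lemma theta_opS {s : affineSym D} {j : ℤ} (hs : IsRefl s j) (x : VD n D) :
    theta hn hD (opS s j x) = rmul (T s) (theta hn hD x) := by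
  suffices h : (theta hn hD).toLinearMap.comp (opS s j) =
      (rmul (T s)).comp (theta hn hD).toLinearMap from congrArg (fun f => f x) h
  refine end_ext fun p => ?_
  simp only [LinearMap.comp_apply, LinearEquiv.coe_coe, theta_single, opS_single]
  ext lam
  rw [rmul_apply]
  change _ = Tcoset lam p * T s
  split_ifs with h1 h2
  · rw [theta_single, Tcoset_mul_refl hn hD hs lam h1]
    rfl
  · rw [map_smul, theta_single, Tcoset_mul_refl_of_eq hn hD hs lam h2]
    rfl
  · rw [map_add, map_smul, map_smul, theta_single, theta_single,
      Tcoset_mul_refl_of_descent hn hD hs lam (by omega)]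
    rfl

lemma theta_opT (m : ℤ) (x : VD n D) :
    theta hn hD (opT m x) = rmul (T (translation D m)) (theta hn hD x) := by
  suffices h : (theta hn hD).toLinearMap.comp (opT m) =
      (rmul (T (translation D m))).comp (theta hn hD).toLinearMap from congrArg (fun f => f x) h
  refine end_ext fun p => ?_
  simp only [LinearMap.comp_apply, LinearEquiv.coe_coe, theta_single, opT_single]
  ext lam
  exact (Tcoset_mul_translation hn hD lam p m).symm

/-- The operators that commute with the right action of the generators of the Hecke algebra. -/
def commutant (n D : ℕ) : Subalgebra K (Module.End K (VD n D)) :=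
  Subalgebra.centralizer K ({f | ∃ s j, IsRefl s j ∧ f = opS s j} ∪ {f | ∃ m, f = opT m})

lemma commutant_conj_rmul (f : commutant n D) (h : Hecke D) (x : TD n D) :
    theta hn hD (f.1 ((theta hn hD).symm (rmul h x))) =
      rmul h (theta hn hD (f.1 ((theta hn hD).symm x))) := by
  let g : Module.End K (TD n D) := (theta hn hD).conj f.1
  have hg : ∀ x, g x = theta hn hD (f.1 ((theta hn hD).symm x)) := fun x => rfl
  -- Again the elements whose action commutes with `g` form a subalgebra, and commutation is known
  -- for the generators.
  let A : Subalgebra K (Hecke D) :=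
    { carrier := {h | ∀ x, g (rmul h x) = rmul h (g x)}
      mul_mem' := fun {a b} ha hb x => by
        have hmul : ∀ x : TD n D, rmul (a * b) x = rmul b (rmul a x) := fun x => by
          ext lam
          simp only [rmul_apply, mul_assoc]
        rw [hmul, hmul, hb, ha]
      add_mem' := fun {a b} ha hb x => by
        have hadd : ∀ x : TD n D, rmul (a + b) x = rmul a x + rmul b x := fun x => by
          ext lam
          exact mul_add _ _ _
        rw [hadd, hadd, map_add, ha, hb]
      algebraMap_mem' := fun c x => by
        have hc : ∀ x : TD n D, rmul (algebraMap K (Hecke D) c) x = c • x := fun x => by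
          ext lam
          rw [rmul_apply, Algebra.algebraMap_eq_smul_one, mul_smul_comm, mul_one]
          rfl
        rw [hc, hc, map_smul] }
  have hf := Subalgebra.mem_centralizer_iff (R := K) |>.1 f.2
  have hA : A = ⊤ := by
    refine hecke_eq_top hD (fun s j hs x => ?_) (fun m x => ?_)
    · obtain ⟨y, rfl⟩ := (theta hn hD).surjective x
      rw [← theta_opS hn hD hs, hg, hg, LinearEquiv.symm_apply_apply, LinearEquiv.symm_apply_apply,
        ← theta_opS hn hD hs]
      exact congrArg (fun f => theta hn hD (f y)) (hf _ (Or.inl ⟨s, j, hs, rfl⟩)).symm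
    · obtain ⟨y, rfl⟩ := (theta hn hD).surjective x
      rw [← theta_opT hn hD, hg, hg, LinearEquiv.symm_apply_apply, LinearEquiv.symm_apply_apply,
        ← theta_opT hn hD]
      exact congrArg (fun f => theta hn hD (f y)) (hf _ (Or.inr ⟨m, rfl⟩)).symm
  have : h ∈ A := by rw [hA]; trivial
  exact this x

/-- Operators that commute with the right action act on `T_D` by `H_D`-linear maps. -/
def toSD : commutant n D →ₐ[K] SD n D where
  toFun f :=
    { toFun := fun x => theta hn hD (f.1 ((theta hn hD).symm x))
      map_add' := fun x y => by simp
      map_smul' := fun h x => commutant_conj_rmul hn hD f h.unop x }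
  map_one' := by ext1 x; simp
  map_mul' f g := by
    ext1 x
    exact congrArg (fun y => theta hn hD (f.1 y)) (LinearEquiv.symm_apply_apply _ _).symm
  map_zero' := by ext1 x; simp
  map_add' f g := by
    ext1 x
    exact map_add (theta hn hD) _ _
  commutes' c := by
    ext1 x
    simp [Algebra.algebraMap_eq_smul_one]

lemma toSD_apply (f : commutant n D) (x : TD n D) :
    toSD hn hD f x = theta hn hD (f.1 ((theta hn hD).symm x)) := rfl

lemma toSD_theta (f : commutant n D) (x : VD n D) :
    toSD hn hD f (theta hn hD x) = theta hn hD (f.1 x) := by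
  rw [toSD_apply, LinearEquiv.symm_apply_apply]

end Theta

/-! ### The operators `e_i` and `f_i` on the vector space with basis `P_D` -/

lemma v_ne_zero : v ≠ 0 := RatFunc.X_ne_zero

section Fib

variable {n D : ℕ} (hn : 0 < n) (hD : 0 < D)

include hn hD in
lemma PD.fib_comp (p : PD n D) (w : affineSym D) (a : ℤ) :
    (p.comp w).fib a = (p.fib a).map w⁻¹.1.toEmbedding := by
  ext k
  rw [Finset.mem_map_equiv, PD.mem_fib hn hD, PD.mem_fib hn hD]
  exact Iff.rfl

include hn hD in
lemma PD.fib_shift (p : PD n D) (a m : ℤ) :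
    p.fib (a + m * n) = (p.fib a).map (Equiv.addRight (m * D : ℤ)).toEmbedding := by
  ext k
  rw [Finset.mem_map_equiv, PD.mem_fib hn hD, PD.mem_fib hn hD]
  have : (Equiv.addRight (m * D : ℤ)).symm k = k + (-m) * D := by
    simp
  rw [this, p.shift]
  constructor <;> intro h <;> linarith

/-- The exponent of `v` in the coefficient of a summand of `e_i T_p`. -/
def expE (i : ℤ) (p : PD n D) (k : ℤ) : ℤ :=
  (p.fib i).card - 2 * ((p.fib i).filter (k < ·)).card

/-- The exponent of `v` in the coefficient of a summand of `f_i T_p`. -/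
def expF (i : ℤ) (p : PD n D) (k : ℤ) : ℤ :=
  (p.fib (i + 1)).card - 2 * ((p.fib (i + 1)).filter (· < k)).card

/-- The operator `e_i`: it replaces values `i + 1` by `i`. -/
def opE (i : ℤ) : Module.End K (VD n D) :=
  Finsupp.linearCombination K fun p : PD n D =>
    ∑ k ∈ p.fib (i + 1), v ^ expE i p k • Finsupp.single (p.set k i) (1 : K)

/-- The operator `f_i`: it replaces values `i` by `i + 1`. -/
def opF (i : ℤ) : Module.End K (VD n D) :=
  Finsupp.linearCombination K fun p : PD n D =>
    ∑ k ∈ p.fib i, v ^ expF i p k • Finsupp.single (p.set k (i + 1)) (1 : K)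

lemma opE_single (i : ℤ) (p : PD n D) : opE i (Finsupp.single p 1) =
    ∑ k ∈ p.fib (i + 1), v ^ expE i p k • Finsupp.single (p.set k i) (1 : K) := by
  rw [opE, Finsupp.linearCombination_single, one_smul]

lemma opF_single (i : ℤ) (p : PD n D) : opF i (Finsupp.single p 1) =
    ∑ k ∈ p.fib i, v ^ expF i p k • Finsupp.single (p.set k (i + 1)) (1 : K) := by
  rw [opF, Finsupp.linearCombination_single, one_smul]

/-! #### Periodicity -/

include hn hD in
lemma opE_shift (i m : ℤ) : (opE (i + m * n) : Module.End K (VD n D)) = opE i := by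
  refine end_ext fun p => ?_
  rw [opE_single, opE_single, show i + m * n + 1 = i + 1 + m * (n : ℤ) by ring,
    p.fib_shift hn hD, Finset.sum_map]
  refine Finset.sum_congr rfl fun k _ => ?_
  simp only [Equiv.coe_toEmbedding, Equiv.coe_addRight]
  rw [PD.set_shift, expE, p.fib_shift hn hD, Finset.card_map, Finset.filter_map, Finset.card_map]
  congr 2
  rw [expE]
  congr 5
  ext l
  simp

/-! #### Compatibility with the right action of the Hecke algebra -/

include hn hD in
lemma expE_comp (i : ℤ) (p : PD n D) (w : affineSym D) (k : ℤ) :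
    expE i (p.comp w) (w⁻¹.1 k) =
      (p.fib i).card - 2 * ((p.fib i).filter (fun l => w⁻¹.1 k < w⁻¹.1 l)).card := by
  rw [expE, p.fib_comp hn hD, Finset.card_map, Finset.filter_map, Finset.card_map]
  rfl

include hn hD in
lemma opE_single_comp (i : ℤ) (p : PD n D) (w : affineSym D) :
    opE i (Finsupp.single (p.comp w) 1) = ∑ k ∈ p.fib (i + 1),
      v ^ expE i (p.comp w) (w⁻¹.1 k) • Finsupp.single ((p.set k i).comp w) (1 : K) := by
  rw [opE_single, p.fib_comp hn hD, Finset.sum_map]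
  refine Finset.sum_congr rfl fun k _ => ?_
  rw [Equiv.coe_toEmbedding, PD.comp_set]
  simp

include hn hD in
lemma opE_opT (i m : ℤ) : (opE i * opT m : Module.End K (VD n D)) = opT m * opE i := by
  refine end_ext fun p => ?_
  simp only [Module.End.mul_apply, opT_single]
  rw [opE_single_comp hn hD, opE_single, map_sum]
  refine Finset.sum_congr rfl fun k _ => ?_
  have h : ∀ l, (translation D m)⁻¹.1 l = l - m := by
    intro l
    rw [Subgroup.coe_inv, Equiv.Perm.inv_eq_iff_eq]
    simp
  rw [map_smul, opT_single, expE_comp hn hD]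
  simp only [h, sub_lt_sub_iff_right]
  rfl

variable {s : affineSym D} {j : ℤ}

lemma opS_sq (hs : IsRefl s j) :
    (opS s j * opS s j : Module.End K (VD n D)) = q • 1 + (q - 1) • opS s j := by
  refine end_ext fun p => ?_
  simp only [Module.End.mul_apply, LinearMap.add_apply, LinearMap.smul_apply, Module.End.one_apply]
  have h1 : (p.comp s).1 j = p.1 (j + 1) := by simp [hs.1]
  have h2 : (p.comp s).1 (j + 1) = p.1 j := by simp [hs.2.1]
  rcases lt_trichotomy (p.1 j) (p.1 (j + 1)) with h | h | h
  · rw [opS_single, if_pos h, opS_single, h1, h2, if_neg h.not_gt, if_neg h.ne',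
      PD.comp_comp_refl hs]
  · have h3 : opS s j (Finsupp.single p (1 : K)) = q • Finsupp.single p (1 : K) := by
      rw [opS_single, if_neg (by omega), if_pos h]
    rw [h3, map_smul, h3, sub_smul, one_smul, add_sub_cancel]
  · have h3 : opS s j (Finsupp.single p (1 : K)) =
        q • Finsupp.single (p.comp s) 1 + (q - 1) • Finsupp.single p (1 : K) := by
      rw [opS_single, if_neg (by omega), if_neg (by omega)]
    have h4 : opS s j (Finsupp.single (p.comp s) (1 : K)) = Finsupp.single p (1 : K) := by
      rw [opS_single, h1, h2, if_pos h, PD.comp_comp_refl hs]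
    rw [h3, map_add, map_smul, map_smul, h4, h3]

lemma PD.lt_of_modEq {p : PD n D} {k : ℤ} (hk : k ≡ j [ZMOD D]) (hp : p.1 j < p.1 (j + 1)) :
    p.1 k < p.1 (k + 1) := by
  obtain ⟨m, rfl⟩ := modEq_iff_exists.1 hk
  rw [show j + m * (D : ℤ) + 1 = j + 1 + m * D by ring, p.shift, p.shift]
  linarith

lemma opS_single_shift (m : ℤ) (p : PD n D) :
    opS s (j + m * D) (Finsupp.single p 1) = opS s j (Finsupp.single p (1 : K)) := by
  rw [opS_single, opS_single, show j + m * (D : ℤ) + 1 = j + 1 + m * D by ring, p.shift, p.shift]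
  simp only [add_lt_add_iff_right, add_left_inj]

include hn hD in
-- The two sides agree summand by summand. Usually lowering the value at `k` keeps the ascent and
-- the exponent is unaffected. The exception is a lowered value at `k` that meets an equal value `i`
-- at `k - 1`: then `T_s` contributes `q = v⁻²` on one side, and on the other `s` brings one more
-- place of the fibre to the right of `k`, which lowers the exponent by two.
lemma opE_opS_of_lt (hs : IsRefl s j) (i : ℤ) (p : PD n D) (hp : p.1 j < p.1 (j + 1)) :
    opE i (opS s j (Finsupp.single p 1)) = opS s j (opE i (Finsupp.single p (1 : K))) := by
  rw [opS_single, if_pos hp, opE_single_comp hn hD, opE_single, map_sum]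
  refine Finset.sum_congr rfl fun k hk => ?_
  rw [PD.mem_fib hn hD] at hk
  rw [map_smul, expE_comp hn hD, hs.inv_eq]
  by_cases hX : k ≡ j + 1 [ZMOD D] ∧ p.1 (k - 1) = i
  · obtain ⟨hX1, hX2⟩ := hX
    have hX3 : k - 1 ≡ j [ZMOD D] := by rw [← modEq_succ_iff]; simpa using hX1
    obtain ⟨m, hm⟩ := modEq_iff_exists.1 hX3
    have hk1 : ¬ k - 1 ≡ k [ZMOD D] := fun h =>
      hs.not_modEq (hX3.symm.trans (h.trans hX1))
    have hS : opS s j (Finsupp.single (p.set k i) (1 : K)) = q • Finsupp.single (p.set k i) 1 := by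
      rw [← opS_single_shift m, ← hm, opS_single, sub_add_cancel, PD.set_apply_self,
        PD.set_apply_of_not p hk1, hX2, if_neg (lt_irrefl _), if_pos rfl]
    have hc : (p.set k i).comp s = p.set k i := by
      refine PD.comp_refl_of_eq (hs.shift m) ?_
      rw [← hm, sub_add_cancel, PD.set_apply_self, PD.set_apply_of_not p hk1, hX2]
    have hfilt : (p.fib i).filter (fun l => s.1 k < s.1 l) =
        insert (k - 1) ((p.fib i).filter (k < ·)) := by
      ext l
      simp only [Finset.mem_filter, Finset.mem_insert, PD.mem_fib hn hD]
      by_cases hl : l = k - 1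
      · subst hl
        rw [hs.apply_of_modEq_succ hX1, hs.apply_of_modEq hX3]
        simp only [hX2, true_and, true_or, iff_true]
        omega
      · have h1 : ¬ (k ≡ j [ZMOD D] ∧ l = k + 1) := fun h => hs.not_modEq (h.1.symm.trans hX1)
        have h2 : ¬ (l ≡ j [ZMOD D] ∧ k = l + 1) := fun h => hl (by omega)
        rw [hs.lt_iff h1 h2]
        simp [hl]
    have hnot : k - 1 ∉ (p.fib i).filter (k < ·) := by
      simp only [Finset.mem_filter, not_and]
      intro _
      omega
    rw [hS, hc, hfilt, Finset.card_insert_of_notMem hnot, smul_smul, q, expE,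
      ← zpow_add₀ v_ne_zero]
    congr 2
    push_cast
    ring
  · have hlt : (p.set k i).1 j < (p.set k i).1 (j + 1) := by
      by_cases h1 : j ≡ k [ZMOD D]
      · have h2 : ¬ j + 1 ≡ k [ZMOD D] := fun h => hs.not_modEq (h1.trans h.symm)
        rw [PD.set_apply_of_modEq p h1, PD.set_apply_of_not p h2]
        omega
      · rw [PD.set_apply_of_not p h1]
        by_cases h2 : j + 1 ≡ k [ZMOD D]
        · rw [PD.set_apply_of_modEq p h2]
          obtain ⟨m, hm⟩ := modEq_iff_exists.1 h2.symm
          have h3 : p.1 (k - 1) ≠ i := fun h => hX ⟨h2.symm, h⟩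
          rw [show k - 1 = j + m * D by linarith, p.shift] at h3
          have h4 : p.1 k = p.1 (j + 1) + m * n := by rw [hm, p.shift]
          rw [hk] at h4
          rcases (show p.1 j < p.1 (j + 1) + (i - p.1 k) ∨ p.1 j = p.1 (j + 1) + (i - p.1 k) by
            omega) with h5 | h5
          · exact h5
          · exact absurd (by linarith) h3
        · rwa [PD.set_apply_of_not p h2]
    rw [opS_single, if_pos hlt, expE]
    congr 6
    refine Finset.filter_congr fun l hl => ?_
    rw [PD.mem_fib hn hD] at hl
    refine hs.lt_iff ?_ ?_
    · rintro ⟨h1, rfl⟩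
      have := PD.lt_of_modEq h1 hp
      omega
    · rintro ⟨h1, rfl⟩
      exact hX ⟨h1.add_right 1, by simpa using hl⟩

include hn hD in
-- In the difference of the two sides the summands of `k` and `s k` cancel each other: both
-- exponents are equal, and `T_s` acts on the two lowered elements by its two-dimensional matrix. At
-- places fixed by `s` each summand vanishes on its own.
lemma opE_opS_of_eq (hs : IsRefl s j) (i : ℤ) (p : PD n D) (hp : p.1 j = p.1 (j + 1)) :
    opE i (opS s j (Finsupp.single p 1)) = opS s j (opE i (Finsupp.single p (1 : K))) := by
  have hc := PD.comp_refl_of_eq hs hp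
  have hS : opS s j (Finsupp.single p (1 : K)) = q • Finsupp.single p 1 := by
    rw [opS_single, if_neg (by omega), if_pos hp]
  rw [hS, map_smul, opE_single, map_sum, Finset.smul_sum, ← sub_eq_zero, ← Finset.sum_sub_distrib]
  refine Finset.sum_involution (fun k _ => s.1 k) ?_ ?_ ?_ (fun k _ => hs.apply_apply k)
  · intro k hk
    rw [PD.mem_fib hn hD] at hk
    have key : ∀ k, p.1 k = i + 1 → k ≡ j [ZMOD D] →
        q • v ^ expE i p k • Finsupp.single (p.set k i) (1 : K) -
          opS s j (v ^ expE i p k • Finsupp.single (p.set k i) (1 : K)) +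
        (q • v ^ expE i p (k + 1) • Finsupp.single (p.set (k + 1) i) (1 : K) -
          opS s j (v ^ expE i p (k + 1) • Finsupp.single (p.set (k + 1) i) (1 : K))) = 0 := by
      intro k hk h1
      obtain ⟨m, hm⟩ := modEq_iff_exists.1 h1
      have hk1 : p.1 (k + 1) = i + 1 := by
        rw [← hk, hm, show j + m * (D : ℤ) + 1 = j + 1 + m * D by ring, p.shift, p.shift, hp]
      have h2 : ¬ k ≡ k + 1 [ZMOD D] := fun h =>
        hs.not_modEq (h1.symm.trans (h.trans (h1.add_right 1)))
      have h3 : ¬ k + 1 ≡ k [ZMOD D] := fun h => h2 h.symm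
      have hexp : expE i p (k + 1) = expE i p k := by
        rw [expE, expE]
        congr 3
        refine congrArg Finset.card (Finset.filter_congr fun l hl => ?_)
        rw [PD.mem_fib hn hD] at hl
        have : l ≠ k + 1 := by rintro rfl; omega
        omega
      have hcs : ∀ l, (p.set (s.1 l) i).comp s = p.set l i := fun l => by
        rw [← PD.comp_set, hc]
      have e1 : opS s j (Finsupp.single (p.set k i) (1 : K)) =
          Finsupp.single (p.set (k + 1) i) 1 := by
        rw [← opS_single_shift m, ← hm, opS_single, PD.set_apply_self, PD.set_apply_of_not p h3,
          if_pos (by omega)]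
        congr 1
        rw [← hcs (k + 1), hs.apply_of_modEq_succ (h1.add_right 1), add_sub_cancel_right]
      have e2 : opS s j (Finsupp.single (p.set (k + 1) i) (1 : K)) =
          q • Finsupp.single (p.set k i) 1 + (q - 1) • Finsupp.single (p.set (k + 1) i) 1 := by
        rw [← opS_single_shift m, ← hm, opS_single, PD.set_apply_self, PD.set_apply_of_not p h2,
          if_neg (by omega), if_neg (by omega)]
        congr 3
        rw [← hcs k, hs.apply_of_modEq h1]
      rw [hexp, map_smul, map_smul, e1, e2, smul_comm q, smul_comm q, ← smul_sub, ← smul_sub,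
        ← smul_add, sub_smul, one_smul]
      convert smul_zero _
      abel
    rcases hs.cases k with ⟨h1, h2⟩ | ⟨h1, h2⟩ | ⟨h1, h3, h2⟩
    · rw [h2]
      exact key k hk h1
    · rw [h2]
      have h3 : k - 1 ≡ j [ZMOD D] := by rw [← modEq_succ_iff]; simpa using h1
      have h4 : p.1 (k - 1) = i + 1 := by
        obtain ⟨m, rfl⟩ := modEq_iff_exists.1 h1
        rw [← hk, show j + 1 + m * (D : ℤ) - 1 = j + m * D by ring, p.shift, p.shift, hp]
      have := key (k - 1) h4 h3
      rw [sub_add_cancel] at this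
      rw [add_comm]
      exact this
    · have e1 : opS s j (Finsupp.single (p.set k i) (1 : K)) =
          q • Finsupp.single (p.set k i) 1 := by
        rw [opS_single, PD.set_apply_of_not p (fun h => h1 h.symm),
          PD.set_apply_of_not p (fun h => h3 h.symm), if_neg (by omega), if_pos hp]
      rw [h2, map_smul, e1, smul_comm, sub_self, add_zero]
  · intro k hk hne heq
    refine hne ?_
    rcases hs.cases k with ⟨h1, h2⟩ | ⟨h1, h2⟩ | ⟨h1, h3, h2⟩
    · omega
    · omega
    · have e1 : opS s j (Finsupp.single (p.set k i) (1 : K)) =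
          q • Finsupp.single (p.set k i) 1 := by
        rw [opS_single, PD.set_apply_of_not p (fun h => h1 h.symm),
          PD.set_apply_of_not p (fun h => h3 h.symm), if_neg (by omega), if_pos hp]
      rw [map_smul, e1, smul_comm, sub_self]
  · intro k hk
    rw [PD.mem_fib hn hD] at hk ⊢
    rw [← hk]
    exact congrArg (fun p : PD n D => p.1 k) hc

include hn hD in
lemma opE_opS (hs : IsRefl s j) (i : ℤ) :
    (opE i * opS s j : Module.End K (VD n D)) = opS s j * opE i := by
  refine end_ext fun p => ?_
  simp only [Module.End.mul_apply]
  rcases lt_trichotomy (p.1 j) (p.1 (j + 1)) with h | h | h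
  · exact opE_opS_of_lt hn hD hs i p h
  · exact opE_opS_of_eq hn hD hs i p h
  -- For a descent, `p` is the image of the ascending element `p ∘ s` under `T_s`, so the ascending
  -- case and the quadratic relation suffice.
  · have h1 : (p.comp s).1 j < (p.comp s).1 (j + 1) := by simpa [hs.1, hs.2.1] using h
    have h2 : opS s j (Finsupp.single (p.comp s) (1 : K)) = Finsupp.single p 1 := by
      rw [opS_single, if_pos h1, PD.comp_comp_refl hs]
    have h3 := opE_opS_of_lt hn hD hs i _ h1
    have h4 : ∀ x : VD n D, opS s j (opS s j x) = q • x + (q - 1) • opS s j x := fun x =>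
      congrArg (fun f => f x) (opS_sq hs)
    rw [h2] at h3
    rw [h3, h4, ← h2, h4, map_add, map_smul, map_smul, h2, h3]

/-! #### Duality -/

/-- The duality `p ↦ (k ↦ -p(-k))`. -/
def PD.dual (p : PD n D) : PD n D :=
  ⟨fun k => -p.1 (-k), fun k => by
    have := p.shift (-k) (-1)
    show -p.1 (-(k + D)) = -p.1 (-k) + n
    rw [show -(k + (D : ℤ)) = -k + -1 * D by ring, this]
    ring⟩

@[simp] lemma PD.dual_apply (p : PD n D) (k : ℤ) : p.dual.1 k = -p.1 (-k) := rfl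

@[simp] lemma PD.dual_dual (p : PD n D) : p.dual.dual = p := by
  ext k
  simp

/-- The linear involution induced by the duality of `P_D`. -/
def dualMap : Module.End K (VD n D) := Finsupp.lmapDomain K K PD.dual

@[simp] lemma dualMap_single (p : PD n D) (c : K) :
    dualMap (Finsupp.single p c) = Finsupp.single p.dual c := by
  simp [dualMap]

include hn hD in
lemma PD.fib_dual (p : PD n D) (a : ℤ) :
    p.dual.fib a = (p.fib (-a)).map (Equiv.neg ℤ).toEmbedding := by
  ext k
  rw [Finset.mem_map_equiv, PD.mem_fib hn hD, PD.mem_fib hn hD]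
  simp only [PD.dual_apply, Equiv.neg_symm, Equiv.neg_apply]
  omega

lemma PD.dual_set (p : PD n D) (k a : ℤ) : p.dual.set k a = (p.set (-k) (-a)).dual := by
  ext l
  have h : -l ≡ -k [ZMOD D] ↔ l ≡ k [ZMOD D] :=
    ⟨fun h => by simpa using h.neg, fun h => h.neg⟩
  simp only [PD.set_apply, PD.dual_apply, h]
  split_ifs
  · ring
  · rfl

include hn hD in
-- Negating places and values turns raising `i` to `i + 1` into lowering `-i` to `-i - 1`, and the
-- places to the left of `k` into places to the right. The commutation of `f_i` with the Hecke
-- algebra is thus inherited from that of `e_{-i-1}`.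
lemma opF_eq_dual (i : ℤ) :
    (opF i : Module.End K (VD n D)) = dualMap * opE (-i - 1) * dualMap := by
  refine end_ext fun p => ?_
  simp only [Module.End.mul_apply, dualMap_single]
  rw [opF_single, opE_single, map_sum, p.fib_dual hn hD, Finset.sum_map,
    show -(-i - 1 + 1) = i by ring]
  refine Finset.sum_congr rfl fun k _ => ?_
  rw [map_smul, dualMap_single, PD.dual_set, PD.dual_dual]
  simp only [Equiv.coe_toEmbedding, Equiv.neg_apply, neg_neg]
  rw [show -(-i - 1) = i + 1 by ring, expE, p.fib_dual hn hD, Finset.card_map, Finset.filter_map,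
    Finset.card_map, show -(-i - 1) = i + 1 by ring, expF]
  congr 6
  ext l
  simp

include hn hD in
lemma opF_opT (i m : ℤ) : (opF i * opT m : Module.End K (VD n D)) = opT m * opF i := by
  have h : (dualMap * opT m : Module.End K (VD n D)) = opT (-m) * dualMap := by
    refine end_ext fun p => ?_
    simp only [Module.End.mul_apply, dualMap_single, opT_single]
    congr 1
    ext k
    simp only [PD.dual_apply, PD.comp_apply, translation_apply, neg_add, neg_neg]
  have h' : (opT m * dualMap : Module.End K (VD n D)) = dualMap * opT (-m) := by
    refine end_ext fun p => ?_
    simp only [Module.End.mul_apply, dualMap_single, opT_single]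
    congr 1
    ext k
    simp only [PD.dual_apply, PD.comp_apply, translation_apply, neg_add, neg_neg]
  rw [opF_eq_dual hn hD, mul_assoc, h, ← mul_assoc, mul_assoc dualMap, opE_opT hn hD,
    ← mul_assoc, ← h', mul_assoc, mul_assoc, mul_assoc]

/-- The image of an affine permutation under the duality. -/
def dualPerm (s : affineSym D) : affineSym D :=
  ⟨(Equiv.neg ℤ).trans (s.1.trans (Equiv.neg ℤ)), fun k => by
    have := affineSym_shift s (-k) (-1)
    show -s.1 (-(k + D)) = -s.1 (-k) + D
    rw [show -(k + (D : ℤ)) = -k + -1 * D by ring, this]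
    ring⟩

lemma dualPerm_apply (s : affineSym D) (k : ℤ) : (dualPerm s).1 k = -s.1 (-k) := rfl

lemma IsRefl.dual (hs : IsRefl s j) : IsRefl (dualPerm s) (-j - 1) := by
  refine ⟨?_, ?_, fun k h1 h2 => ?_⟩
  · rw [dualPerm_apply, show -(-j - 1) = j + 1 by ring, hs.2.1]; ring
  · rw [dualPerm_apply, show -(-j - 1 + 1) = j by ring, hs.1]; ring
  · rw [dualPerm_apply, hs.2.2 (-k), neg_neg]
    · intro h
      refine h2 ?_
      have := h.neg
      rwa [neg_neg, show -j = -j - 1 + 1 by ring] at this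
    · intro h
      refine h1 ?_
      have := h.neg
      rwa [neg_neg, show -(j + 1) = -j - 1 by ring] at this

lemma dualMap_opS (s : affineSym D) (j : ℤ) :
    (dualMap * opS s j : Module.End K (VD n D)) = opS (dualPerm s) (-j - 1) * dualMap := by
  refine end_ext fun p => ?_
  simp only [Module.End.mul_apply, dualMap_single]
  have hc : p.dual.comp (dualPerm s) = (p.comp s).dual := by
    ext k
    simp [dualPerm_apply]
  rw [opS_single, opS_single, hc]
  have e1 : p.dual.1 (-j - 1) = -p.1 (j + 1) := by
    rw [PD.dual_apply, show -(-j - 1) = j + 1 by ring]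
  have e2 : p.dual.1 (-j - 1 + 1) = -p.1 j := by
    rw [PD.dual_apply, show -(-j - 1 + 1) = j by ring]
  rw [e1, e2]
  simp only [neg_lt_neg_iff, neg_inj, eq_comm (a := p.1 (j + 1))]
  split_ifs
  · rw [dualMap_single]
  · rw [map_smul, dualMap_single]
  · rw [map_add, map_smul, map_smul, dualMap_single, dualMap_single]

lemma dualPerm_dualPerm (s : affineSym D) : dualPerm (dualPerm s) = s :=
  Subtype.ext (Equiv.ext fun k => by simp [dualPerm_apply])

include hn hD in
lemma opF_opS (hs : IsRefl s j) (i : ℤ) :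
    (opF i * opS s j : Module.End K (VD n D)) = opS s j * opF i := by
  have h := dualMap_opS (n := n) s j
  have h' := dualMap_opS (n := n) (dualPerm s) (-j - 1)
  rw [dualPerm_dualPerm, show -(-j - 1) - 1 = j by ring] at h'
  rw [opF_eq_dual hn hD, mul_assoc, h, ← mul_assoc, mul_assoc dualMap,
    opE_opS hn hD hs.dual, ← mul_assoc, h', mul_assoc, mul_assoc, mul_assoc]

include hn hD in
lemma opE_mem_commutant (i : ℤ) : opE i ∈ commutant n D := by
  rw [commutant, Subalgebra.mem_centralizer_iff]
  rintro _ (⟨s, j, hs, rfl⟩ | ⟨m, rfl⟩)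
  · exact (opE_opS hn hD hs i).symm
  · exact (opE_opT hn hD i m).symm

include hn hD in
lemma opF_mem_commutant (i : ℤ) : opF i ∈ commutant n D := by
  rw [commutant, Subalgebra.mem_centralizer_iff]
  rintro _ (⟨s, j, hs, rfl⟩ | ⟨m, rfl⟩)
  · exact (opF_opS hn hD hs i).symm
  · exact (opF_opT hn hD i m).symm

end Fib

/-! ### Quantum integers over a field -/

section QInt

variable {𝕜 : Type*} [Field 𝕜] {x : 𝕜}

/-- The quantum integer `[k]` with parameter `x`. -/
def qi (x : 𝕜) (k : ℤ) : 𝕜 := (x ^ k - x ^ (-k)) / (x - x⁻¹)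

@[simp] lemma qi_zero : qi x 0 = 0 := by simp [qi]

lemma qi_one (hx' : x - x⁻¹ ≠ 0) : qi x 1 = 1 := by
  rw [qi, zpow_one, zpow_neg_one, div_self hx']

lemma qi_neg (k : ℤ) : qi x (-k) = -qi x k := by
  rw [qi, qi, neg_neg, ← neg_div, neg_sub]

lemma qi_add_one (hx : x ≠ 0) (hx' : x - x⁻¹ ≠ 0) (k : ℤ) :
    qi x (k + 1) = x ^ k + x⁻¹ * qi x k := by
  have h : qi x (k + 1) * (x - x⁻¹) = (x ^ k + x⁻¹ * qi x k) * (x - x⁻¹) := by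
    rw [add_mul, mul_assoc, qi, qi, div_mul_cancel₀ _ hx', div_mul_cancel₀ _ hx',
      zpow_neg, zpow_neg, zpow_add_one₀ hx, mul_inv]
    ring
  exact mul_right_cancel₀ hx' h

lemma qi_add_one' (hx : x ≠ 0) (hx' : x - x⁻¹ ≠ 0) (k : ℤ) :
    qi x (k + 1) = x * qi x k + x ^ (-k) := by
  have h : qi x (k + 1) * (x - x⁻¹) = (x * qi x k + x ^ (-k)) * (x - x⁻¹) := by
    rw [add_mul, mul_assoc, qi, qi, div_mul_cancel₀ _ hx', div_mul_cancel₀ _ hx',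
      zpow_neg, zpow_neg, zpow_add_one₀ hx, mul_inv]
    ring
  exact mul_right_cancel₀ hx' h

lemma qi_sub (hx : x ≠ 0) (hx' : x - x⁻¹ ≠ 0) (a b : ℤ) :
    qi x (a + 1) * qi x b - qi x (b + 1) * qi x a = qi x (b - a) := by
  have ha := zpow_ne_zero a hx
  have hb := zpow_ne_zero b hx
  rw [qi_add_one hx hx', qi_add_one hx hx']
  have h : x ^ a * qi x b - x ^ b * qi x a = qi x (b - a) := by
    refine mul_right_cancel₀ hx' ?_
    rw [sub_mul, mul_assoc, mul_assoc, qi, qi, qi, div_mul_cancel₀ _ hx', div_mul_cancel₀ _ hx',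
      div_mul_cancel₀ _ hx', zpow_neg, zpow_neg, zpow_neg, zpow_sub₀ hx]
    field_simp
    ring
  rw [← h]
  ring

/-- This is the recursion for the coefficients in the commutator of a power of `E` with `F`. -/
lemma qi_mul_add (hx : x ≠ 0) (hx' : x - x⁻¹ ≠ 0) (k h : ℤ) :
    qi x k * qi x (h + k - 1) + qi x (h + 2 * k) = qi x (k + 1) * qi x (h + k) := by
  have h1 := qi_sub hx hx' k (h + k)
  have h2 := qi_sub hx hx' (-(h + k)) k
  have h3 := qi_sub hx hx' k (h + k - 1)
  have h4 := qi_add_one hx hx' (h + k)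
  rw [show h + k - k = h by ring] at h1
  rw [show k - -(h + k) = h + 2 * k by ring, show -(h + k) + 1 = -(h + k - 1) by ring,
    qi_neg, qi_neg] at h2
  rw [← h2]
  ring

/-- The normalized quantum integer `x^m [m+1] = 1 + x² + ⋯ + x^{2m}`. -/
def gi (x : 𝕜) (m : ℕ) : 𝕜 := ∑ j ∈ Finset.range (m + 1), x ^ (2 * j)

lemma gi_eq (hx : x ≠ 0) (hx' : x - x⁻¹ ≠ 0) (m : ℕ) : gi x m = x ^ m * qi x (m + 1) := by
  induction m with
  | zero =>
    have h : gi x 0 = 1 := by unfold gi; simp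
    simp [h, qi_one hx']
  | succ m ih =>
    have h1 : gi x (m + 1) = gi x m + x ^ (2 * (m + 1)) := Finset.sum_range_succ (fun j => x ^ (2 * j)) (m + 1)
    rw [h1, ih]
    push_cast
    rw [qi_add_one hx hx' (m + 1)]
    have : x ^ ((m : ℤ) + 1) = x ^ (m + 1) := by exact_mod_cast zpow_natCast x (m + 1)
    rw [this]
    field_simp
    ring

lemma gi_add (m k : ℕ) : gi x m + x ^ (2 * (m + 1)) * gi x k = gi x (m + 1 + k) := by
  have h1 := Finset.sum_range_add (fun j => x ^ (2 * j)) (m + 1) (k + 1)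
  have h2 := Finset.mul_sum (Finset.range (k + 1)) (fun j => x ^ (2 * j)) (x ^ (2 * (m + 1)))
  unfold gi
  rw [show m + 1 + k + 1 = (m + 1) + (k + 1) by ring, h1, h2]
  simp only [← pow_add, ← mul_add]

lemma gi_mem {R : Subring 𝕜} (h : x ∈ R) (m : ℕ) : gi x m ∈ R :=
  sum_mem fun _ _ => pow_mem h _

/-- Only the value `1` at `x = 0` matters: it makes these numbers invertible in the local ring, so
that the change to the string basis is possible over the lattice. -/
lemma exists_gi {R : Subring 𝕜} (h : x ∈ R) (m : ℕ) : ∃ r ∈ R, gi x m = 1 + x * r := by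
  refine ⟨∑ j ∈ Finset.range m, x ^ (2 * j + 1), sum_mem fun _ _ => pow_mem h _, ?_⟩
  rw [gi, Finset.sum_range_succ' (fun j => x ^ (2 * j)) m,
    Finset.mul_sum _ (fun j => x ^ (2 * j + 1)), add_comm, mul_zero, pow_zero]
  congr 1
  refine Finset.sum_congr rfl fun j _ => ?_
  ring

end QInt

/-! ### Crystals of type `A₁` and string bases -/

/-- The combinatorial structure of a crystal of type `A₁`, in which all strings are finite. The
values of `et` where `eps = 0`, and of `ft` where `phi = 0`, are irrelevant. -/
structure Crystal (X : Type*) where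
  eps : X → ℕ
  phi : X → ℕ
  et : X → X
  ft : X → X
  eps_ft : ∀ w, 0 < phi w → eps (ft w) = eps w + 1
  phi_ft : ∀ w, 0 < phi w → phi (ft w) + 1 = phi w
  et_ft : ∀ w, 0 < phi w → et (ft w) = w
  eps_et : ∀ w, 0 < eps w → eps (et w) + 1 = eps w
  phi_et : ∀ w, 0 < eps w → phi (et w) = phi w + 1
  ft_et : ∀ w, 0 < eps w → ft (et w) = w

/-- The crystal with the roles of the two operators exchanged. -/
def Crystal.swap {X : Type*} (C : Crystal X) : Crystal X where
  eps := C.phi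
  phi := C.eps
  et := C.ft
  ft := C.et
  eps_ft := C.phi_et
  phi_ft := C.eps_et
  et_ft := C.ft_et
  eps_et := C.phi_ft
  phi_et := C.eps_ft
  ft_et := C.et_ft

/-- The operators `E`, `F` act on the family `b` by the crystal operators, up to the quantum
integers that occur for the bases `f^{(k)} u` of simple modules. -/
structure IsStringFamily {𝕜 V X : Type*} [Field 𝕜] [AddCommGroup V] [Module 𝕜 V] (x : 𝕜)
    (C : Crystal X) (E F : Module.End 𝕜 V) (b : X → V) : Prop where
  E_apply : ∀ w, E (b w) = if C.eps w = 0 then 0 else qi x (C.phi w + 1) • b (C.et w)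
  F_apply : ∀ w, F (b w) = if C.phi w = 0 then 0 else qi x (C.eps w + 1) • b (C.ft w)

section StringBasis

variable {𝕜 V X : Type*} [Field 𝕜] [AddCommGroup V] [Module 𝕜 V] {x : 𝕜}
  {C : Crystal X} {E F : Module.End 𝕜 V}

lemma IsStringFamily.swap {b : X → V} (H : IsStringFamily x C E F b) :
    IsStringFamily x C.swap F E b :=
  ⟨H.F_apply, H.E_apply⟩

/-- The span of the elements of weight `h` of a string basis. -/
def wtSpan (C : Crystal X) (b : Module.Basis X 𝕜 V) (h : ℤ) : Submodule 𝕜 V :=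
  Submodule.span 𝕜 (b '' {w | (C.phi w : ℤ) - C.eps w = h})

variable {b : Module.Basis X 𝕜 V}

lemma basis_mem_wtSpan (w : X) : b w ∈ wtSpan C b (C.phi w - C.eps w) :=
  Submodule.subset_span ⟨w, rfl, rfl⟩

lemma wtSpan_induction {h : ℤ} {P : V → Prop} (h0 : P 0) (hadd : ∀ a c, P a → P c → P (a + c))
    (hsmul : ∀ (r : 𝕜) a, P a → P (r • a)) (hb : ∀ w, (C.phi w : ℤ) - C.eps w = h → P (b w))
    {z : V} (hz : z ∈ wtSpan C b h) : P z := by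
  induction hz using Submodule.span_induction with
  | mem z hz => obtain ⟨w, hw, rfl⟩ := hz; exact hb w hw
  | zero => exact h0
  | add a c _ _ ha hc => exact hadd a c ha hc
  | smul r a _ ha => exact hsmul r a ha

lemma IsStringFamily.E_mem (H : IsStringFamily x C E F b) {h : ℤ} {z : V}
    (hz : z ∈ wtSpan C b h) : E z ∈ wtSpan C b (h + 2) := by
  refine wtSpan_induction (P := fun z => E z ∈ wtSpan C b (h + 2)) (by simp)
    (fun a c ha hc => by rw [map_add]; exact add_mem ha hc)
    (fun r a ha => by rw [map_smul]; exact Submodule.smul_mem _ _ ha) (fun w hw => ?_) hz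
  rw [H.E_apply]
  split_ifs with h0
  · exact zero_mem _
  · refine Submodule.smul_mem _ _ ?_
    have h1 := C.eps_et w (Nat.pos_of_ne_zero h0)
    have h2 := C.phi_et w (Nat.pos_of_ne_zero h0)
    have h3 := basis_mem_wtSpan (C := C) (b := b) (C.et w)
    rwa [show (C.phi (C.et w) : ℤ) - C.eps (C.et w) = h + 2 by omega] at h3

/-- On a string vector both products are scalar, `E F` being `[eps + 1][phi]` and `F E` being `[phi
+ 1][eps]`; their difference is `[phi - eps]` by `qi_sub`. -/
lemma IsStringFamily.commutator (hx : x ≠ 0) (hx' : x - x⁻¹ ≠ 0) (H : IsStringFamily x C E F b)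
    {h : ℤ} {z : V} (hz : z ∈ wtSpan C b h) : E (F z) = F (E z) + qi x h • z := by
  refine wtSpan_induction (P := fun z => E (F z) = F (E z) + qi x h • z) (by simp)
    (fun a c ha hc => ?_) (fun r a ha => ?_) (fun w hw => ?_) hz
  · simp only [map_add, ha, hc, smul_add]; abel
  · simp only [map_smul, ha, smul_add, smul_comm r]
  · have key := qi_sub hx hx' (C.eps w) (C.phi w)
    rw [hw] at key
    have h1 : E (F (b w)) = (qi x (C.eps w + 1) * qi x (C.phi w)) • b w := by
      rw [H.F_apply]
      split_ifs with h0
      · simp [h0]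
      · have h2 := Nat.pos_of_ne_zero h0
        rw [map_smul, H.E_apply, if_neg (by rw [C.eps_ft w h2]; omega), C.et_ft w h2, smul_smul]
        congr 3
        exact_mod_cast C.phi_ft w h2
    have h2 : F (E (b w)) = (qi x (C.phi w + 1) * qi x (C.eps w)) • b w := by
      rw [H.E_apply]
      split_ifs with h0
      · simp [h0]
      · have h2 := Nat.pos_of_ne_zero h0
        rw [map_smul, H.F_apply, if_neg (by rw [C.phi_et w h2]; omega), C.ft_et w h2, smul_smul]
        congr 3
        exact_mod_cast C.eps_et w h2
    rw [h1, h2, ← key, ← add_smul]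
    congr 1
    ring

/-- The quantum factorial with parameter `x`. -/
def qfac (x : 𝕜) (k : ℕ) : 𝕜 := ∏ j ∈ Finset.range k, qi x (j + 1)

lemma qfac_succ (k : ℕ) : qfac x (k + 1) = qfac x k * qi x (k + 1) := by
  rw [qfac, Finset.prod_range_succ, ← qfac]

lemma qfac_ne_zero (hq : ∀ k : ℕ, qi x (k + 1) ≠ 0) (k : ℕ) : qfac x k ≠ 0 :=
  Finset.prod_ne_zero_iff.2 fun j _ => hq j

/-- The divided power `E^{(k)}`. -/
def divPow (x : 𝕜) (E : Module.End 𝕜 V) (k : ℕ) : Module.End 𝕜 V := (qfac x k)⁻¹ • E ^ k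

/-- The divided power `E^{(k-1)}`, which is zero for `k = 0`. -/
def divPowPred (x : 𝕜) (E : Module.End 𝕜 V) : ℕ → Module.End 𝕜 V
  | 0 => 0
  | k + 1 => divPow x E k

lemma IsStringFamily.pow_mem (H : IsStringFamily x C E F b) (k : ℕ) {h : ℤ} {z : V}
    (hz : z ∈ wtSpan C b h) : (E ^ k) z ∈ wtSpan C b (h + 2 * k) := by
  induction k with
  | zero => simpa using hz
  | succ k ih =>
    rw [pow_succ', Module.End.mul_apply]
    have := H.E_mem ih
    rwa [show h + 2 * (k : ℤ) + 2 = h + 2 * (k + 1 : ℕ) by push_cast; ring] at this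

lemma IsStringFamily.divPow_mem (H : IsStringFamily x C E F b) (k : ℕ) {h : ℤ} {z : V}
    (hz : z ∈ wtSpan C b h) : divPow x E k z ∈ wtSpan C b (h + 2 * k) :=
  Submodule.smul_mem _ _ (H.pow_mem k hz)

lemma IsStringFamily.pow_commutator (hx : x ≠ 0) (hx' : x - x⁻¹ ≠ 0)
    (H : IsStringFamily x C E F b) (k : ℕ) {h : ℤ} {z : V} (hz : z ∈ wtSpan C b h) :
    (E ^ (k + 1)) (F z) = F ((E ^ (k + 1)) z) + (qi x (k + 1) * qi x (h + k)) • (E ^ k) z := by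
  induction k with
  | zero => simpa [qi_one hx'] using H.commutator hx hx' hz
  | succ k ih =>
    rw [pow_succ' E (k + 1), Module.End.mul_apply, ih, map_add, map_smul, Module.End.mul_apply,
      H.commutator hx hx' (H.pow_mem (k + 1) hz), add_assoc, ← Module.End.mul_apply E (E ^ k),
      ← pow_succ', ← add_smul]
    congr 2
    have := qi_mul_add hx hx' (k + 1) h
    push_cast
    rw [← this, add_comm]
    congr 3
    ring

lemma IsStringFamily.divPow_commutator (hx : x ≠ 0) (hx' : x - x⁻¹ ≠ 0)
    (hq : ∀ k : ℕ, qi x (k + 1) ≠ 0) (H : IsStringFamily x C E F b) (k : ℕ) {h : ℤ} {z : V}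
    (hz : z ∈ wtSpan C b h) :
    divPow x E k (F z) = F (divPow x E k z) + qi x (h + k - 1) • divPowPred x E k z := by
  cases k with
  | zero => simp [divPow, divPowPred, qfac]
  | succ k =>
    simp only [divPow, divPowPred, LinearMap.smul_apply, map_smul]
    rw [H.pow_commutator hx hx' k hz, smul_add, smul_smul, smul_smul, qfac_succ]
    congr 2
    have h1 := qfac_ne_zero hq k
    have h2 := hq k
    rw [show h + ((k + 1 : ℕ) : ℤ) - 1 = h + k by push_cast; ring]
    field_simp

/-- The quantum Serre expression `∑ (-1)^k E^{(k)} Y E^{(m-k)}`. -/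
def serreOp (x : 𝕜) (E Y : Module.End 𝕜 V) (m : ℕ) : Module.End 𝕜 V :=
  ∑ k ∈ Finset.range (m + 1), (-1 : 𝕜) ^ k • (divPow x E k * Y * divPow x E (m - k))

/-- Moving `F` to the left through the divided powers leaves two families of corrections, one from
each side of `Y`. The assumption on the weight of `Y` makes the `k`-th correction of the first
family and the `(k+1)`-st of the second carry the same quantum integer, and their signs are
opposite. -/
lemma IsStringFamily.serreOp_comm (hx : x ≠ 0) (hx' : x - x⁻¹ ≠ 0)
    (hq : ∀ k : ℕ, qi x (k + 1) ≠ 0) (H : IsStringFamily x C E F b) {Y : Module.End 𝕜 V} {m : ℕ}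
    (hYF : Y * F = F * Y)
    (hY : ∀ h, ∀ z ∈ wtSpan C b h, Y z ∈ wtSpan C b (h + 1 - m)) :
    serreOp x E Y m * F = F * serreOp x E Y m := by
  have hYF' : ∀ z, Y (F z) = F (Y z) := fun z => congrArg (fun f => f z) hYF
  refine b.ext fun w => ?_
  set h : ℤ := C.phi w - C.eps w with hh
  have hw : b w ∈ wtSpan C b h := basis_mem_wtSpan w
  set u := b w
  have term : ∀ k ∈ Finset.range (m + 1),
      (-1 : 𝕜) ^ k • divPow x E k (Y (divPow x E (m - k) (F u))) =
        F ((-1 : 𝕜) ^ k • divPow x E k (Y (divPow x E (m - k) u))) +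
        ((-1 : 𝕜) ^ k • qi x (h + m - k - 1) • divPow x E k (Y (divPowPred x E (m - k) u)) +
          (-1 : 𝕜) ^ k • qi x (h + m - k) • divPowPred x E k (Y (divPow x E (m - k) u))) := by
    intro k hk
    have hk' : k ≤ m := Nat.lt_succ_iff.1 (Finset.mem_range.1 hk)
    have h1 := H.divPow_mem (m - k) hw
    have h2 := hY _ _ h1
    rw [H.divPow_commutator hx hx' hq _ hw, map_add, map_add, hYF', 
      H.divPow_commutator hx hx' hq _ h2, map_smul, map_smul, map_smul]
    rw [show h + ((m - k : ℕ) : ℤ) - 1 = h + m - k - 1 by push_cast [Nat.cast_sub hk']; ring,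
      show h + 2 * ((m - k : ℕ) : ℤ) + 1 - m + k - 1 = h + m - k by
        push_cast [Nat.cast_sub hk']; ring]
    simp only [smul_add]
    abel
  simp only [serreOp, Module.End.mul_apply, LinearMap.sum_apply, LinearMap.smul_apply]
  rw [Finset.sum_congr rfl term, Finset.sum_add_distrib, map_sum, Finset.sum_add_distrib,
    Finset.sum_range_succ (fun k => (-1 : 𝕜) ^ k • qi x (h + m - k - 1) •
      divPow x E k (Y (divPowPred x E (m - k) u))),
    Finset.sum_range_succ' (fun k => (-1 : 𝕜) ^ k • qi x (h + m - k) •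
      divPowPred x E k (Y (divPow x E (m - k) u)))]
  -- The two boundary terms split off above vanish because `E^{(-1)} = 0`; the others cancel in
  -- pairs.
  have e1 : divPowPred x E (m - m) = 0 := by rw [Nat.sub_self]; rfl
  have e2 : divPowPred x E 0 = 0 := rfl
  rw [e1, e2]
  simp only [LinearMap.zero_apply, map_zero, smul_zero, add_zero]
  refine add_eq_left.2 ?_
  rw [← Finset.sum_add_distrib]
  refine Finset.sum_eq_zero fun k hk => ?_
  have hk' : k < m := Finset.mem_range.1 hk
  have e3 : divPowPred x E (m - k) = divPow x E (m - (k + 1)) := by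
    rw [show m - k = m - (k + 1) + 1 by omega]; rfl
  have e4 : divPowPred x E (k + 1) = divPow x E k := rfl
  rw [e3, e4, pow_succ, show h + m - ((k + 1 : ℕ) : ℤ) = h + m - k - 1 by push_cast; ring]
  simp

lemma IsStringFamily.serreOp_mem (H : IsStringFamily x C E F b) {Y : Module.End 𝕜 V} {m : ℕ}
    (hY : ∀ h, ∀ z ∈ wtSpan C b h, Y z ∈ wtSpan C b (h + 1 - m)) {h : ℤ} {z : V}
    (hz : z ∈ wtSpan C b h) : serreOp x E Y m z ∈ wtSpan C b (h + m + 1) := by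
  simp only [serreOp, Module.End.mul_apply, LinearMap.sum_apply, LinearMap.smul_apply]
  refine sum_mem fun k hk => Submodule.smul_mem _ _ ?_
  have hk' : k ≤ m := Nat.lt_succ_iff.1 (Finset.mem_range.1 hk)
  have := H.divPow_mem k (hY _ _ (H.divPow_mem (m - k) hz))
  rwa [show h + 2 * ((m - k : ℕ) : ℤ) + 1 - m + 2 * k = h + m + 1 by
    push_cast [Nat.cast_sub hk']; ring] at this

lemma IsStringFamily.F_pow_eq_zero (H : IsStringFamily x C E F b) {k : ℕ} {w : X}
    (hk : C.phi w < k) : (F ^ k) (b w) = 0 := by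
  induction k generalizing w with
  | zero => omega
  | succ k ih =>
    rw [pow_succ, Module.End.mul_apply, H.F_apply]
    split_ifs with h0
    · rw [map_zero]
    · have := C.phi_ft w (Nat.pos_of_ne_zero h0)
      rw [map_smul, ih (by omega), smul_zero]

/-- Along a string the operators act by nonzero quantum integers as long as `phi` is not exhausted.
The use of this is that `F^k` is injective on the span of the vectors with `phi ≥ k`. -/
lemma IsStringFamily.E_pow_F_pow (hq : ∀ k : ℕ, qi x (k + 1) ≠ 0)
    (H : IsStringFamily x C E F b) {k : ℕ} {w : X} (hk : k ≤ C.phi w) :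
    ∃ c : 𝕜, c ≠ 0 ∧ (E ^ k) ((F ^ k) (b w)) = c • b w := by
  induction k generalizing w with
  | zero => exact ⟨1, one_ne_zero, by simp⟩
  | succ k ih =>
    have h0 : 0 < C.phi w := by omega
    have h1 := C.phi_ft w h0
    obtain ⟨c, hc, h2⟩ := ih (w := C.ft w) (by omega)
    refine ⟨qi x (C.eps w + 1) * (c * qi x (C.phi (C.ft w) + 1)),
      mul_ne_zero (hq _) (mul_ne_zero hc (hq _)), ?_⟩
    rw [pow_succ F, Module.End.mul_apply, H.F_apply, if_neg h0.ne', map_smul, map_smul, pow_succ',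
      Module.End.mul_apply, h2, map_smul, H.E_apply, if_neg (by rw [C.eps_ft w h0]; omega),
      C.et_ft w h0, smul_smul, smul_smul, mul_assoc]

lemma basis_eq_zero_of_diag (T : Module.End 𝕜 V) {S : Set X} {z : V}
    (hT : ∀ w ∈ S, ∃ c : 𝕜, c ≠ 0 ∧ T (b w) = c • b w)
    (hz : z ∈ Submodule.span 𝕜 (b '' S)) (h0 : T z = 0) : z = 0 := by
  classical
  choose! c hc hcT using hT
  have key : ∀ w, b.repr (T z) w = c w * b.repr z w := by
    refine Submodule.span_induction (p := fun z _ => ∀ w, b.repr (T z) w = c w * b.repr z w)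
      ?_ (by simp) (fun a d _ _ ha hd w => by simp [ha w, hd w, mul_add])
      (fun r a _ ha w => by simp [ha w, mul_left_comm]) hz
    rintro _ ⟨u, hu, rfl⟩ w
    rw [hcT u hu]
    by_cases hw : u = w
    · simp [hw]
    · simp [hw]
  have hsupp := (Module.Basis.mem_span_image b).1 hz
  refine b.repr.injective (Finsupp.ext fun w => ?_)
  rw [map_zero, Finsupp.zero_apply]
  by_contra hw
  have hwS : w ∈ S := hsupp (by simpa using hw)
  have := key w
  rw [h0, map_zero, Finsupp.zero_apply] at this
  exact mul_ne_zero (hc w hwS) hw this.symm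

/-- The quantum Serre relation holds for every operator `Y` that commutes with `F` and lowers the
weight by `m - 1`. -/
lemma IsStringFamily.serreOp_eq_zero (hx : x ≠ 0) (hx' : x - x⁻¹ ≠ 0)
    (hq : ∀ k : ℕ, qi x (k + 1) ≠ 0) (H : IsStringFamily x C E F b) {Y : Module.End 𝕜 V} {m : ℕ}
    (hYF : Y * F = F * Y)
    (hY : ∀ h, ∀ z ∈ wtSpan C b h, Y z ∈ wtSpan C b (h + 1 - m)) : serreOp x E Y m = 0 := by
  have hcomm := H.serreOp_comm hx hx' hq hYF hY
  set S := serreOp x E Y m with hS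
  suffices h : ∀ k w, C.eps w = k → S (b w) = 0 from b.ext fun w => h _ w rfl
  intro k
  induction k with
  | zero =>
    intro w hw
    -- A vector with `eps w = 0` has weight `phi w`, so its image has weight `phi w + m + 1`. All
    -- string vectors of that weight have `phi > phi w`, and there `F^{phi w + 1}` cannot kill
    -- anything, although it kills `S (b w)` by commutation.
    have hz : S (b w) ∈ wtSpan C b (C.phi w + m + 1) := by
      have := H.serreOp_mem hY (basis_mem_wtSpan (C := C) (b := b) w)
      rwa [hw, Nat.cast_zero, sub_zero] at this
    have hF : (F ^ (C.phi w + 1)) (S (b w)) = 0 := by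
      have h1 : Commute S (F ^ (C.phi w + 1)) := Commute.pow_right hcomm _
      rw [← Module.End.mul_apply, ← h1.eq, Module.End.mul_apply,
        H.F_pow_eq_zero (Nat.lt_succ_self _), map_zero]
    refine basis_eq_zero_of_diag (E ^ (C.phi w + 1) * F ^ (C.phi w + 1)) (fun u hu => ?_) hz
      (by rw [Module.End.mul_apply, hF, map_zero])
    have hu' : (C.phi u : ℤ) - C.eps u = C.phi w + m + 1 := hu
    obtain ⟨c, hc, h⟩ := H.E_pow_F_pow hq (k := C.phi w + 1) (w := u) (by omega)
    exact ⟨c, hc, h⟩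
  | succ k ih =>
    intro w hw
    have h0 : 0 < C.eps w := by omega
    have h1 := C.eps_et w h0
    -- Further down the string, `b w` is a nonzero multiple of `F` applied to the preceding vector,
    -- and `S` commutes with `F`.
    have h2 : F (b (C.et w)) = qi x (C.eps (C.et w) + 1) • b w := by
      rw [H.F_apply, if_neg (by rw [C.phi_et w h0]; omega), C.ft_et w h0]
    have h3 : S (F (b (C.et w))) = 0 := by
      rw [← Module.End.mul_apply, hcomm, Module.End.mul_apply, ih _ (by omega), map_zero]
    rw [h2, map_smul] at h3
    exact (smul_eq_zero.1 h3).resolve_left (hq _)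

end StringBasis

/-! ### Kashiwara operators on a string basis -/

section Kashiwara

variable {𝕜 V X : Type*} [Field 𝕜] [AddCommGroup V] [Module 𝕜 V] {x : 𝕜}
  {C : Crystal X} {E F : Module.End 𝕜 V} {b : Module.Basis X 𝕜 V}

lemma Crystal.phi_iterate (C : Crystal X) {k : ℕ} {w : X} (hk : k ≤ C.phi w) :
    C.phi (C.ft^[k] w) + k = C.phi w ∧ C.eps (C.ft^[k] w) = C.eps w + k := by
  induction k with
  | zero => simp
  | succ k ih =>
    obtain ⟨h1, h2⟩ := ih (by omega)
    rw [Function.iterate_succ_apply']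
    have h3 : 0 < C.phi (C.ft^[k] w) := by omega
    have := C.phi_ft _ h3
    have := C.eps_ft _ h3
    omega

/-- Every element of the crystal lies on the string of an element with `eps = 0`. -/
lemma Crystal.exists_eq_iterate (C : Crystal X) (w : X) :
    ∃ u, C.eps u = 0 ∧ C.phi u = C.phi w + C.eps w ∧ w = C.ft^[C.eps w] u := by
  induction h : C.eps w generalizing w with
  | zero => exact ⟨w, h, rfl, rfl⟩
  | succ k ih =>
    have h0 : 0 < C.eps w := by omega
    have h1 := C.eps_et w h0
    have h2 := C.phi_et w h0
    obtain ⟨u, hu, hphi, hw⟩ := ih (C.et w) (by omega)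
    refine ⟨u, hu, by omega, ?_⟩
    rw [Function.iterate_succ_apply', ← hw, C.ft_et w h0]

lemma IsStringFamily.divPow_apply (hq : ∀ k : ℕ, qi x (k + 1) ≠ 0) (H : IsStringFamily x C E F b)
    {k : ℕ} {w : X} (hw : C.eps w = 0) (hk : k ≤ C.phi w) :
    divPow x F k (b w) = b (C.ft^[k] w) := by
  have key : (F ^ k) (b w) = qfac x k • b (C.ft^[k] w) := by
    induction k with
    | zero => simp [qfac]
    | succ k ih =>
      obtain ⟨h1, h2⟩ := C.phi_iterate (k := k) (w := w) (by omega)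
      rw [pow_succ', Module.End.mul_apply, ih (by omega), map_smul, H.F_apply,
        if_neg (by omega), qfac_succ, smul_smul, Function.iterate_succ_apply', h2, hw, zero_add]
  rw [divPow, LinearMap.smul_apply, key, smul_smul, inv_mul_cancel₀ (qfac_ne_zero hq k), one_smul]

lemma IsStringFamily.divPow_eq_zero (H : IsStringFamily x C E F b) {k : ℕ} {w : X}
    (hk : C.phi w < k) : divPow x F k (b w) = 0 := by
  rw [divPow, LinearMap.smul_apply, H.F_pow_eq_zero hk, smul_zero]

lemma IsStringFamily.exists_divPow (hq : ∀ k : ℕ, qi x (k + 1) ≠ 0)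
    (H : IsStringFamily x C E F b) (w : X) :
    ∃ u, C.eps u = 0 ∧ C.phi u = C.phi w + C.eps w ∧ b w = divPow x F (C.eps w) (b u) := by
  obtain ⟨u, h1, h2, h3⟩ := C.exists_eq_iterate w
  exact ⟨u, h1, h2, by rw [H.divPow_apply hq h1 (by omega), ← h3]⟩

lemma basis_induction (b : Module.Basis X 𝕜 V) {P : V → Prop} (zero : P 0)
    (coe : ∀ w, P (b w)) (add : ∀ a c, P a → P c → P (a + c))
    (smul : ∀ (r : 𝕜) a, P a → P (r • a)) (z : V) : P z := by
  have hz : z ∈ Submodule.span 𝕜 (Set.range b) := by rw [b.span_eq]; trivial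
  induction hz using Submodule.span_induction with
  | mem z hz => obtain ⟨w, rfl⟩ := hz; exact coe w
  | zero => exact zero
  | add a c _ _ ha hc => exact add a c ha hc
  | smul r a _ ha => exact smul r a ha

lemma IsStringFamily.exists_F_pow_eq_zero (H : IsStringFamily x C E F b) (z : V) :
    ∃ N, (F ^ N) z = 0 := by
  induction z using basis_induction b with
  | zero => exact ⟨0, by simp⟩
  | coe w => exact ⟨_, H.F_pow_eq_zero (Nat.lt_succ_self _)⟩
  | add a c ha hc =>
    obtain ⟨N, hN⟩ := ha
    obtain ⟨M, hM⟩ := hc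
    refine ⟨N + M, ?_⟩
    rw [map_add, pow_add, Module.End.mul_apply _ _ c, hM, (Commute.pow_pow_self F N M).eq,
      Module.End.mul_apply, hN, map_zero, map_zero, add_zero]
  | smul r a ha =>
    obtain ⟨N, hN⟩ := ha
    exact ⟨N, by rw [map_smul, hN, smul_zero]⟩

/-- A vector of weight `h` killed by `E` is a combination of basis vectors killed by `E`. -/
lemma IsStringFamily.mem_span_of_E_eq_zero (hq : ∀ k : ℕ, qi x (k + 1) ≠ 0)
    (H : IsStringFamily x C E F b) {h : ℤ} {z : V} (hz : z ∈ wtSpan C b h) (hE : E z = 0) :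
    z ∈ Submodule.span 𝕜 (b '' {w | C.eps w = 0 ∧ (C.phi w : ℤ) = h}) := by
  classical
  -- The map `et` is injective on the elements with `eps > 0`, so the coefficient of `E z` at `et w`
  -- comes from that of `z` at `w` alone.
  have key : ∀ z w, 0 < C.eps w → b.repr (E z) (C.et w) = qi x (C.phi w + 1) * b.repr z w := by
    intro z w hw
    induction z using basis_induction b with
    | zero => simp
    | add a c ha hc => simp [ha, hc, mul_add]
    | smul r a ha => simp [ha, mul_left_comm]
    | coe u =>
      rw [H.E_apply]
      by_cases hu : u = w
      · subst hu
        rw [if_neg hw.ne']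
        simp
      · split_ifs with h0
        · simp [hu]
        · have : C.et u ≠ C.et w := fun h => hu <| by
            rw [← C.ft_et u (Nat.pos_of_ne_zero h0), h, C.ft_et w hw]
          simp [this, hu]
  rw [Module.Basis.mem_span_image]
  have hsupp := (Module.Basis.mem_span_image b).1 hz
  intro w hw
  have h1 : (C.phi w : ℤ) - C.eps w = h := hsupp hw
  have h2 : C.eps w = 0 := by
    by_contra h0
    have h3 := key z w (Nat.pos_of_ne_zero h0)
    rw [hE, map_zero, Finsupp.zero_apply] at h3
    exact mul_ne_zero (hq _) (Finsupp.mem_support_iff.1 hw) h3.symm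
  exact ⟨h2, by omega⟩

/-- The lowering of indices along strings. -/
def kashE (C : Crystal X) (b : Module.Basis X 𝕜 V) : Module.End 𝕜 V :=
  b.constr 𝕜 fun w => if C.eps w = 0 then 0 else b (C.et w)

/-- The raising of indices along strings. -/
def kashF (C : Crystal X) (b : Module.Basis X 𝕜 V) : Module.End 𝕜 V :=
  b.constr 𝕜 fun w => if C.phi w = 0 then 0 else b (C.ft w)

lemma kashE_basis (w : X) : kashE C b (b w) = if C.eps w = 0 then 0 else b (C.et w) :=
  b.constr_basis _ _ _

lemma kashF_basis (w : X) : kashF C b (b w) = if C.phi w = 0 then 0 else b (C.ft w) :=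
  b.constr_basis _ _ _

/-- The definition of the Kashiwara operators involves arbitrary `u` with `e_i u = 0`. This reduces
its conditions to the top vectors of the strings. -/
lemma IsStringFamily.eqOn_of_E_eq_zero (hq : ∀ k : ℕ, qi x (k + 1) ≠ 0)
    (H : IsStringFamily x C E F b) {h : ℤ} {z : V} (hz : z ∈ wtSpan C b h) (hE : E z = 0)
    {S T : Module.End 𝕜 V} (hST : ∀ w, C.eps w = 0 → (C.phi w : ℤ) = h → S (b w) = T (b w)) :
    S z = T z := by
  refine LinearMap.eqOn_span (s := b '' {w | C.eps w = 0 ∧ (C.phi w : ℤ) = h}) ?_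
    (H.mem_span_of_E_eq_zero hq hz hE)
  rintro _ ⟨w, hw, rfl⟩
  exact hST w hw.1 hw.2

lemma IsStringFamily.kashE_eq_zero (hq : ∀ k : ℕ, qi x (k + 1) ≠ 0)
    (H : IsStringFamily x C E F b) {h : ℤ} {z : V} (hz : z ∈ wtSpan C b h) (hE : E z = 0) :
    kashE C b z = 0 :=
  H.eqOn_of_E_eq_zero hq hz hE (T := 0) fun w hw _ => by
    rw [kashE_basis, if_pos hw, LinearMap.zero_apply]

lemma IsStringFamily.kashE_divPow (hq : ∀ k : ℕ, qi x (k + 1) ≠ 0)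
    (H : IsStringFamily x C E F b) {h : ℤ} {z : V} (hz : z ∈ wtSpan C b h) (hE : E z = 0)
    {k : ℕ} (hk : ((k + 1 : ℕ) : ℤ) ≤ h) :
    kashE C b (divPow x F (k + 1) z) = divPow x F k z :=
  H.eqOn_of_E_eq_zero hq hz hE (S := kashE C b * divPow x F (k + 1)) fun w hw hphi => by
    have hk' : k + 1 ≤ C.phi w := by omega
    obtain ⟨h1, h2⟩ := C.phi_iterate hk'
    obtain ⟨h3, h4⟩ := C.phi_iterate (k := k) (w := w) (by omega)
    rw [Module.End.mul_apply, H.divPow_apply hq hw hk', H.divPow_apply hq hw (by omega),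
      kashE_basis, if_neg (by omega), Function.iterate_succ_apply', C.et_ft _ (by omega)]

lemma IsStringFamily.kashF_divPow (hq : ∀ k : ℕ, qi x (k + 1) ≠ 0)
    (H : IsStringFamily x C E F b) {h : ℤ} {z : V} (hz : z ∈ wtSpan C b h) (hE : E z = 0)
    {k : ℕ} (hk : (k : ℤ) ≤ h) :
    kashF C b (divPow x F k z) = divPow x F (k + 1) z :=
  H.eqOn_of_E_eq_zero hq hz hE (S := kashF C b * divPow x F k) fun w hw hphi => by
    have hk' : k ≤ C.phi w := by omega
    obtain ⟨h1, h2⟩ := C.phi_iterate hk'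
    rw [Module.End.mul_apply, H.divPow_apply hq hw hk', kashF_basis]
    split_ifs with h0
    · rw [H.divPow_eq_zero (by omega)]
    · rw [H.divPow_apply hq hw (by omega), Function.iterate_succ_apply']

end Kashiwara

/-! ### Tensor powers of the two-dimensional module -/

namespace Word

/-- The number of unmatched letters `false` of a word. -/
def eps : List Bool → ℕ
  | [] => 0
  | false :: w => eps w + 1
  | true :: w => eps w - 1

/-- The number of unmatched letters `true` of a word. -/
def phi : List Bool → ℕ
  | [] => 0
  | false :: w => phi w
  | true :: w => if eps w = 0 then phi w + 1 else phi w

/-- The crystal operator that changes a letter `false` into `true`. -/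
def et : List Bool → List Bool
  | [] => []
  | false :: w => if eps w = 0 then true :: w else false :: et w
  | true :: w => true :: et w

/-- The crystal operator that changes a letter `true` into `false`. -/
def ft : List Bool → List Bool
  | [] => []
  | false :: w => false :: ft w
  | true :: w => if eps w = 0 then false :: w else true :: ft w

/-- The weight of a word. -/
def wt : List Bool → ℤ
  | [] => 0
  | false :: w => wt w - 1
  | true :: w => wt w + 1

@[simp] lemma length_et (w : List Bool) : (et w).length = w.length := by
  induction w with
  | nil => rfl
  | cons b w ih => cases b <;> simp only [et] <;> try split_ifs
                   all_goals simp [ih]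

@[simp] lemma length_ft (w : List Bool) : (ft w).length = w.length := by
  induction w with
  | nil => rfl
  | cons b w ih => cases b <;> simp only [ft] <;> try split_ifs
                   all_goals simp [ih]

lemma wt_eq (w : List Bool) : wt w = phi w - eps w := by
  induction w with
  | nil => rfl
  | cons b w ih =>
    cases b
    · simp only [wt, phi, eps, ih]; push_cast; ring
    · simp only [wt, phi, eps, ih]; split_ifs <;> omega

/-- This is the signature rule: every `true` cancels an unmatched `false` to its right, so that the
unmatched letters are `eps` times `false` followed by `phi` times `true`. Then `ft` changes the
leftmost unmatched `true` and `et` the rightmost unmatched `false`. -/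
lemma ft_spec (w : List Bool) (h : 0 < phi w) :
    eps (ft w) = eps w + 1 ∧ phi (ft w) + 1 = phi w ∧ et (ft w) = w := by
  induction w with
  | nil => simp [phi] at h
  | cons b w ih =>
    cases b
    · simp only [phi] at h
      obtain ⟨h1, h2, h3⟩ := ih h
      simp [eps, ft, phi, et, h1, h2, h3]
    · by_cases h0 : eps w = 0
      · simp [eps, ft, phi, et, h0]
      · simp only [phi, if_neg h0] at h
        obtain ⟨h1, h2, h3⟩ := ih h
        simp [eps, ft, phi, et, h0, h1, h2, h3]
        omega

lemma et_spec (w : List Bool) (h : 0 < eps w) :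
    eps (et w) + 1 = eps w ∧ phi (et w) = phi w + 1 ∧ ft (et w) = w := by
  induction w with
  | nil => simp [eps] at h
  | cons b w ih =>
    cases b
    · by_cases h0 : eps w = 0
      · simp [eps, ft, phi, et, h0]
      · obtain ⟨h1, h2, h3⟩ := ih (Nat.pos_of_ne_zero h0)
        simp [eps, ft, phi, et, h0, h1, h2, h3]
    · simp only [eps] at h
      obtain ⟨h1, h2, h3⟩ := ih (by omega)
      have h4 : eps w ≠ 0 := by omega
      have h5 : eps (et w) ≠ 0 := by omega
      simp [eps, ft, phi, et, h4, h5, h2, h3]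
      omega

variable {𝕜 : Type*} [Field 𝕜] (x : 𝕜)

/-- The vector space with the words as basis. -/
abbrev Mod (𝕜 : Type*) [Field 𝕜] : Type _ := List Bool →₀ 𝕜

/-- The linear map that adds a letter on the left. -/
def cons (b : Bool) : Mod 𝕜 →ₗ[𝕜] Mod 𝕜 := Finsupp.lmapDomain 𝕜 𝕜 (List.cons b)

@[simp] lemma cons_single (b : Bool) (w : List Bool) (r : 𝕜) :
    cons b (Finsupp.single w r) = Finsupp.single (b :: w) r := Finsupp.mapDomain_single

/-- The action of `e` on a word. -/
def eW : List Bool → Mod 𝕜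
  | [] => 0
  | false :: w => x ^ (-wt w) • Finsupp.single (true :: w) 1 + cons false (eW w)
  | true :: w => cons true (eW w)

/-- The action of `f` on a word. -/
def fW : List Bool → Mod 𝕜
  | [] => 0
  | false :: w => x⁻¹ • cons false (fW w)
  | true :: w => Finsupp.single (false :: w) 1 + x • cons true (fW w)

/-- The linear map given on words. -/
def ext (g : List Bool → Mod 𝕜) : Module.End 𝕜 (Mod 𝕜) := Finsupp.linearCombination 𝕜 g

@[simp] lemma ext_single (g : List Bool → Mod 𝕜) (w : List Bool) :
    ext g (Finsupp.single w 1) = g w := by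
  simp [ext]

lemma hom_ext {S T : Mod 𝕜 →ₗ[𝕜] Mod 𝕜}
    (h : ∀ w, S (Finsupp.single w 1) = T (Finsupp.single w 1)) : S = T :=
  Finsupp.lhom_ext' fun w => LinearMap.ext_ring (h w)

/-- With the first letter as first tensor factor, this lemma and the next ones are the coproduct `e
↦ e ⊗ K⁻¹ + 1 ⊗ e`, `f ↦ f ⊗ 1 + K ⊗ f`, made linear in the second factor so that it can be applied
to string vectors. -/
lemma e_cons_true (m : Mod 𝕜) : ext (eW x) (cons true m) = cons true (ext (eW x) m) := by
  have : ext (eW x) ∘ₗ cons true = cons true ∘ₗ ext (eW x) := hom_ext fun w => by simp [eW]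
  exact congrArg (fun f => f m) this

/-- The inverse of the weight operator. -/
def kW (w : List Bool) : Mod 𝕜 := x ^ (-wt w) • Finsupp.single w 1

lemma e_cons_false (m : Mod 𝕜) :
    ext (eW x) (cons false m) = cons true (ext (kW x) m) + cons false (ext (eW x) m) := by
  have : ext (eW x) ∘ₗ cons false = cons true ∘ₗ ext (kW x) + cons false ∘ₗ ext (eW x) :=
    hom_ext fun w => by simp [eW, kW]
  exact congrArg (fun f => f m) this

lemma f_cons_true (m : Mod 𝕜) :
    ext (fW x) (cons true m) = cons false m + x • cons true (ext (fW x) m) := by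
  have : ext (fW x) ∘ₗ cons true = cons false + x • (cons true ∘ₗ ext (fW x)) :=
    hom_ext fun w => by simp [fW]
  exact congrArg (fun f => f m) this

lemma f_cons_false (m : Mod 𝕜) :
    ext (fW x) (cons false m) = x⁻¹ • cons false (ext (fW x) m) := by
  have : ext (fW x) ∘ₗ cons false = x⁻¹ • (cons false ∘ₗ ext (fW x)) :=
    hom_ext fun w => by simp [fW]
  exact congrArg (fun f => f m) this

/-- The string basis. -/
def cW : List Bool → Mod 𝕜
  | [] => Finsupp.single [] 1
  | false :: w =>
    (if phi w = 0 then 0 else x ^ (eps w + 1) • cons true (cW (ft w))) + cons false (cW w)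
  | true :: w =>
    if eps w = 0 then cons true (cW w)
    else gi x (eps w - 1) • cons true (cW w) -
      (x ^ eps w * gi x (phi w)) • cons false (cW (et w))
termination_by w => w.length
decreasing_by all_goals simp

variable {x}

lemma cW_false_of_eq {w : List Bool} (h : phi w = 0) : cW x (false :: w) = cons false (cW x w) := by
  rw [cW, if_pos h, zero_add]

lemma cW_false_of_pos {w : List Bool} (h : 0 < phi w) :
    cW x (false :: w) = x ^ (eps w + 1) • cons true (cW x (ft w)) + cons false (cW x w) := by
  rw [cW, if_neg h.ne']

lemma cW_true_of_eq {w : List Bool} (h : eps w = 0) : cW x (true :: w) = cons true (cW x w) := by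
  rw [cW, if_pos h]

lemma cW_true_of_succ {w : List Bool} {k : ℕ} (h : eps w = k + 1) :
    cW x (true :: w) = gi x k • cons true (cW x w) -
      (x ^ (k + 1) * gi x (phi w)) • cons false (cW x (et w)) := by
  rw [cW, if_neg (by omega), h, Nat.add_sub_cancel]

/-- The words of the same weight and length as `w` span a space that contains `cW x w`. -/
lemma cW_mem (w : List Bool) : cW x w ∈ Submodule.span 𝕜
    ((fun u => Finsupp.single u (1 : 𝕜)) '' {u | wt u = wt w ∧ u.length = w.length}) := by
  have hcons : ∀ (b : Bool) (w u : List Bool), wt (b :: w) = wt u → (b :: w).length = u.length →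
      ∀ m ∈ Submodule.span 𝕜
        ((fun u => Finsupp.single u (1 : 𝕜)) '' {u | wt u = wt w ∧ u.length = w.length}),
      cons b m ∈ Submodule.span 𝕜
        ((fun u => Finsupp.single u (1 : 𝕜)) '' {v | wt v = wt u ∧ v.length = u.length}) := by
    intro b w u h1 h2 m hm
    have := Submodule.mem_map_of_mem (f := cons b) hm
    rw [Submodule.map_span] at this
    refine Submodule.span_mono ?_ this
    rintro _ ⟨_, ⟨t, ⟨ht1, ht2⟩, rfl⟩, rfl⟩
    refine ⟨b :: t, ⟨?_, ?_⟩, by simp⟩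
    · rw [← h1]; cases b <;> simp [wt, ht1]
    · rw [← h2]; simp [ht2]
  induction hl : w.length using Nat.strong_induction_on generalizing w with
  | _ l ih =>
    subst hl
    have ih' : ∀ u : List Bool, u.length < w.length → cW x u ∈ Submodule.span 𝕜
      ((fun u => Finsupp.single u (1 : 𝕜)) '' {v | wt v = wt u ∧ v.length = u.length}) :=
      fun u hu => ih _ hu u rfl
    match w, ih' with
    | [], _ => rw [cW]; exact Submodule.subset_span ⟨[], ⟨rfl, rfl⟩, rfl⟩
    | false :: w, ih' =>
      have h1 := hcons false w (false :: w) rfl rfl _ (ih' w (by simp))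
      rcases Nat.eq_zero_or_pos (phi w) with h | h
      · rw [cW_false_of_eq h]; exact h1
      · rw [cW_false_of_pos h]
        refine add_mem (Submodule.smul_mem _ _ (hcons true (ft w) (false :: w) ?_ (by simp) _
          (ih' (ft w) (by simp)))) h1
        have := ft_spec w h
        simp only [wt, wt_eq]
        omega
    | true :: w, ih' =>
      have h1 := hcons true w (true :: w) rfl rfl _ (ih' w (by simp))
      rcases h : eps w with _ | k
      · rw [cW_true_of_eq h]; exact h1
      · rw [cW_true_of_succ h]
        refine sub_mem (Submodule.smul_mem _ _ h1) (Submodule.smul_mem _ _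
          (hcons false (et w) (true :: w) ?_ (by simp) _ (ih' (et w) (by simp))))
        have := et_spec w (by omega)
        simp only [wt, wt_eq]
        omega

lemma kW_cW (w : List Bool) : ext (kW x) (cW x w) = x ^ ((eps w : ℤ) - phi w) • cW x w := by
  have := LinearMap.eqOn_span (f := ext (kW x)) (g := x ^ ((eps w : ℤ) - phi w) • LinearMap.id)
    (s := (fun u => Finsupp.single u (1 : 𝕜)) '' {u | wt u = wt w ∧ u.length = w.length}) (by
      rintro _ ⟨u, ⟨hu, -⟩, rfl⟩
      simp only [ext_single, kW, LinearMap.smul_apply, LinearMap.id_apply]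
      rw [hu, wt_eq, neg_sub]) (cW_mem (x := x) w)
  exact this

/-- Suppose that the vectors of the tails form the string `f^{(a)} u` of a simple module `V(m)`, `m
= eps + phi`. In `V ⊗ V(m) = V(m+1) ⊕ V(m-1)` the vectors of `true :: w` with `eps w = 0` and of
`false :: w` are the divided powers of `f` applied to `true ⊗ u`. Those of `true :: w` with `eps w >
0` form the string of the second summand, whose top vector is `true ⊗ f u - x (1 + x² + ⋯ +
x^{2(m-1)}) false ⊗ u`. The coefficients in `cW` are chosen so that this reproduces the signature
rule. -/
lemma f_cW (hx : x ≠ 0) (hx' : x - x⁻¹ ≠ 0) (w : List Bool) :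
    ext (fW x) (cW x w) = if phi w = 0 then 0 else qi x (eps w + 1) • cW x (ft w) := by
  induction hl : w.length using Nat.strong_induction_on generalizing w with
  | _ l ih =>
    subst hl
    have ih' : ∀ u : List Bool, u.length < w.length →
        ext (fW x) (cW x u) = if phi u = 0 then 0 else qi x (eps u + 1) • cW x (ft u) :=
      fun u hu => ih _ hu u rfl
    clear ih
    match w, ih' with
    | [], _ => simp [cW, fW, phi]
    | false :: w, ih' =>
      have hw := ih' w (by simp)
      have hfw := ih' (ft w) (by simp)
      show _ = if phi w = 0 then 0 else qi x ((eps w + 1 : ℕ) + 1) • cW x (false :: ft w)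
      rcases Nat.eq_zero_or_pos (phi w) with h | h
      · rw [if_pos h] at hw ⊢
        rw [cW_false_of_eq h, f_cons_false, hw, map_zero, smul_zero]
      · obtain ⟨h1, h2, -⟩ := ft_spec w h
        rw [if_neg h.ne'] at hw ⊢
        rw [cW_false_of_pos h, map_add, map_smul, f_cons_true, f_cons_false, hw, hfw, map_smul]
        have key := qi_add_one hx hx' (eps w + 1)
        have e : x ^ ((eps w : ℤ) + 1) = x ^ (eps w + 1) := by exact_mod_cast zpow_natCast x _
        rw [e] at key
        push_cast
        rw [key, h1]
        rcases Nat.eq_zero_or_pos (phi (ft w)) with h' | h'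
        · rw [if_pos h', cW_false_of_eq h']
          simp only [map_zero, smul_zero, add_zero, smul_smul, add_smul]
        · rw [if_neg h'.ne', cW_false_of_pos h', h1]
          push_cast
          rw [key]
          simp only [map_smul, smul_add, smul_smul]
          match_scalars <;> ring
    | true :: w, ih' =>
      have hw := ih' w (by simp)
      show _ = if (if eps w = 0 then phi w + 1 else phi w) = 0 then 0 else
        qi x ((eps w - 1 : ℕ) + 1) • cW x (if eps w = 0 then false :: w else true :: ft w)
      rcases h : eps w with _ | k
      · rw [cW_true_of_eq h, f_cons_true, hw, h]
        simp only [if_true, Nat.succ_ne_zero, if_false, Nat.cast_zero, zero_add, qi_one hx', one_smul,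
          Nat.zero_sub]
        rcases Nat.eq_zero_or_pos (phi w) with h' | h'
        · simp [h', cW_false_of_eq h']
        · rw [if_neg h'.ne', cW_false_of_pos h', h, zero_add, pow_one, add_comm]
      · obtain ⟨h1, h2, h3⟩ := et_spec w (by omega)
        have hew := ih' (et w) (by simp)
        rw [if_neg (by omega), h3, show (eps (et w) : ℤ) + 1 = k + 1 by omega] at hew
        rw [cW_true_of_succ h, map_sub, map_smul, map_smul, f_cons_true, f_cons_false, hw, hew,
          if_neg (Nat.succ_ne_zero k), if_neg (Nat.succ_ne_zero k), Nat.add_sub_cancel]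
        have gk := gi_eq hx hx' k
        rcases h' : phi w with _ | f
        · have g0 : gi x 0 = 1 := by unfold gi; simp
          rw [if_pos rfl, if_pos rfl, map_zero, smul_zero, add_zero, g0, gk]
          simp only [map_smul, smul_smul]
          match_scalars
          field_simp
          ring
        · obtain ⟨h4, h5, h6⟩ := ft_spec w (by omega)
          rw [if_neg (Nat.succ_ne_zero f), if_neg (Nat.succ_ne_zero f),
            cW_true_of_succ (h4.trans (congrArg (· + 1) h)), h6, show phi (ft w) = f by omega, h]
          have g1 := gi_add (x := x) 0 f
          have g0 : gi x 0 = 1 := by unfold gi; simp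
          have gk1 := gi_eq hx hx' (k + 1)
          rw [g0, show 0 + 1 + f = f + 1 by ring] at g1
          rw [← g1, gk1, gk]
          simp only [map_smul, smul_smul, smul_add, smul_sub]
          push_cast
          match_scalars
          · field_simp
            ring
          · ring

/-- The decomposition is the same as for `f`. The coproduct of `e` also involves `K⁻¹` on the tail,
which acts by a scalar since the vectors of the string basis are homogeneous (`kW_cW`). -/
lemma e_cW (hx : x ≠ 0) (hx' : x - x⁻¹ ≠ 0) (w : List Bool) :
    ext (eW x) (cW x w) = if eps w = 0 then 0 else qi x (phi w + 1) • cW x (et w) := by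
  induction hl : w.length using Nat.strong_induction_on generalizing w with
  | _ l ih =>
    subst hl
    have ih' : ∀ u : List Bool, u.length < w.length →
        ext (eW x) (cW x u) = if eps u = 0 then 0 else qi x (phi u + 1) • cW x (et u) :=
      fun u hu => ih _ hu u rfl
    clear ih
    match w, ih' with
    | [], _ => simp [cW, eW, eps]
    | false :: w, ih' =>
      have hw := ih' w (by simp)
      show _ = if eps w + 1 = 0 then 0 else
        qi x (phi w + 1) • cW x (if eps w = 0 then true :: w else false :: et w)
      have hfalse : ext (eW x) (cW x (false :: w)) =
          (x ^ eps w * qi x (phi w + 1)) • cons true (cW x w) + cons false (ext (eW x) (cW x w)) := by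
        have e : x ^ ((eps w : ℤ) - phi w) = x ^ eps w * x ^ (-(phi w : ℤ)) := by
          rw [sub_eq_add_neg, zpow_add₀ hx, zpow_natCast]
        rcases Nat.eq_zero_or_pos (phi w) with h | h
        · rw [cW_false_of_eq h, e_cons_false, kW_cW, e, h]
          simp [qi_one hx']
        · obtain ⟨h1, h2, h3⟩ := ft_spec w h
          have hfw := ih' (ft w) (by simp)
          rw [if_neg (by omega), h3, show (phi (ft w) : ℤ) + 1 = phi w by omega] at hfw
          rw [cW_false_of_pos h, map_add, map_smul, e_cons_true, e_cons_false, hfw, kW_cW, e,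
            qi_add_one' hx hx']
          simp only [map_smul, smul_smul]
          match_scalars <;> ring
      rw [hfalse, hw]
      rcases h : eps w with _ | k
      · rw [if_pos rfl, if_pos rfl, cW_true_of_eq h]
        simp
      · obtain ⟨h1, h2, h3⟩ := et_spec w (by omega)
        rw [if_neg (Nat.succ_ne_zero k), if_neg (Nat.succ_ne_zero (k + 1)),
          if_neg (Nat.succ_ne_zero k), cW_false_of_pos (by omega), h3,
          h1, h]
        simp only [map_smul, smul_smul, smul_add]
        match_scalars <;> ring
    | true :: w, ih' =>
      have hw := ih' w (by simp)
      show _ = if eps w - 1 = 0 then 0 else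
        qi x ((if eps w = 0 then phi w + 1 else phi w : ℕ) + 1) • cW x (true :: et w)
      rcases h : eps w with _ | k
      · rw [cW_true_of_eq h, e_cons_true, hw, if_pos h, map_zero]
        simp
      · obtain ⟨h1, h2, h3⟩ := et_spec w (by omega)
        have hew := ih' (et w) (by simp)
        rw [if_neg (by omega)] at hw
        rw [cW_true_of_succ h, map_sub, map_smul, map_smul, e_cons_true, e_cons_false, hw, hew, kW_cW,
          if_neg (Nat.succ_ne_zero k), Nat.add_sub_cancel]
        have gk := gi_eq hx hx' k
        have gf := gi_eq hx hx' (phi w)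
        rcases k with _ | k
        · rw [if_pos (by omega), if_pos rfl, map_zero, add_zero, h2, gf, gk,
            show (eps (et w) : ℤ) - ((phi w + 1 : ℕ) : ℤ) = -(phi w : ℤ) - 1 by push_cast; omega,
            zpow_sub_one₀ hx, zpow_neg, zpow_natCast]
          simp only [map_smul, smul_smul, Nat.cast_zero, zero_add, qi_one hx']
          match_scalars
          field_simp
          ring
        · rw [if_neg (by omega), if_neg (by omega), cW_true_of_succ (k := k) (by omega), h2]
          have gk1 := gi_eq hx hx' k
          have gf1 := gi_eq hx hx' (phi w + 1)
          have key := qi_add_one hx hx' (k + 1)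
          have e1 : x ^ ((k : ℤ) + 1) = x ^ (k + 1) := by exact_mod_cast zpow_natCast x _
          rw [show (eps (et w) : ℤ) - ((phi w + 1 : ℕ) : ℤ) = -(phi w : ℤ) + k by push_cast; omega,
            zpow_add₀ hx, zpow_neg, zpow_natCast, zpow_natCast]
          push_cast at gk gf1 ⊢
          rw [key, e1] at gk
          rw [gk, gf, gk1, gf1]
          simp only [map_smul, smul_smul, smul_add, smul_sub]
          match_scalars
          · field_simp
            ring
          · ring

end Word

/-! ### The inverse transition matrix and the lattice of words -/

namespace Word

variable {𝕜 : Type*} [Field 𝕜] (x : 𝕜)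

/-- The inverse transition matrix on the words that begin with `true`. -/
def bT (w : List Bool) : Mod 𝕜 :=
  if eps w = 0 then Finsupp.single (true :: w) 1
  else (gi x (eps w + phi w))⁻¹ • (Finsupp.single (true :: w) 1 +
    (x ^ eps w * gi x (phi w)) • Finsupp.single (false :: et w) 1)

/-- The inverse transition matrix for one letter. -/
def bW : List Bool → Mod 𝕜
  | [] => Finsupp.single [] 1
  | true :: w => bT x w
  | false :: w => Finsupp.single (false :: w) 1 -
      if phi w = 0 then 0 else x ^ (eps w + 1) • bT x (ft w)

/-- The inverse transition matrix of the string basis. -/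
def dW : List Bool → Mod 𝕜
  | [] => Finsupp.single [] 1
  | b :: w => ext (bW x) (cons b (dW w))

variable {x}

lemma ext_dW_cons (b : Bool) (m : Mod 𝕜) :
    ext (dW x) (cons b m) = ext (bW x) (cons b (ext (dW x) m)) := by
  have : ext (dW x) ∘ₗ cons b = ext (bW x) ∘ₗ cons b ∘ₗ ext (dW x) :=
    hom_ext fun w => by simp [dW]
  exact congrArg (fun f => f m) this

lemma gi_ne_zero (hx : x ≠ 0) (hx' : x - x⁻¹ ≠ 0) (hq : ∀ k : ℕ, qi x (k + 1) ≠ 0) (m : ℕ) :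
    gi x m ≠ 0 := by
  rw [gi_eq hx hx']
  exact mul_ne_zero (pow_ne_zero _ hx) (hq m)

/-- When `eps w > 0`, the string vectors of `true :: w` and `false :: et w` are combinations of
`true ⊗ c_w` and `false ⊗ c_{et w}`. By `gi_add` this system of size two has the determinant `gi
(eps w + phi w)`, which is a unit at `x = 0`; `bT` is a row of its inverse. -/
lemma ext_cW_bT (hg : ∀ m, gi x m ≠ 0) (w : List Bool) :
    ext (cW x) (bT x w) = cons true (cW x w) := by
  rw [bT]
  split_ifs with h
  · rw [ext_single, cW_true_of_eq h]
  · obtain ⟨k, hk⟩ := Nat.exists_eq_succ_of_ne_zero h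
    obtain ⟨h1, h2, h3⟩ := et_spec w (by omega)
    simp only [map_smul, map_add, ext_single]
    rw [cW_true_of_succ hk, cW_false_of_pos (by omega), h3, h1, hk]
    have h4 := gi_add (x := x) k (phi w)
    have h5 := hg (k + 1 + phi w)
    rw [Nat.succ_eq_add_one]
    simp only [smul_add, smul_sub, smul_smul]
    rw [← h4] at h5 ⊢
    match_scalars
    · field_simp
      ring
    · ring

lemma ext_cW_bW (hg : ∀ m, gi x m ≠ 0) (b : Bool) (w : List Bool) :
    ext (cW x) (bW x (b :: w)) = cons b (cW x w) := by
  cases b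
  · rcases Nat.eq_zero_or_pos (phi w) with h | h
    · rw [bW, if_pos h, sub_zero, ext_single, cW_false_of_eq h]
    · rw [bW, if_neg h.ne', map_sub, map_smul, ext_cW_bT hg, ext_single, cW_false_of_pos h,
        add_sub_cancel_left]
  · exact ext_cW_bT hg w

lemma ext_cW_bW_cons (hg : ∀ m, gi x m ≠ 0) (b : Bool) (m : Mod 𝕜) :
    ext (cW x) (ext (bW x) (cons b m)) = cons b (ext (cW x) m) := by
  have : ext (cW x) ∘ₗ ext (bW x) ∘ₗ cons b = cons b ∘ₗ ext (cW x) :=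
    hom_ext fun w => by simp [ext_cW_bW hg]
  exact congrArg (fun f => f m) this

lemma ext_cW_dW (hg : ∀ m, gi x m ≠ 0) (w : List Bool) :
    ext (cW x) (dW x w) = Finsupp.single w 1 := by
  induction w with
  | nil => rw [dW, ext_single, cW]
  | cons b w ih => rw [dW, ext_cW_bW_cons hg, ih, cons_single]

lemma ext_dW_cW (hg : ∀ m, gi x m ≠ 0) (w : List Bool) :
    ext (dW x) (cW x w) = Finsupp.single w 1 := by
  induction hl : w.length using Nat.strong_induction_on generalizing w with
  | _ l ih =>
    subst hl
    have ih' : ∀ (b : Bool) (u : List Bool), u.length < w.length →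
        ext (dW x) (cons b (cW x u)) = bW x (b :: u) :=
      fun b u hu => by rw [ext_dW_cons, ih _ hu u rfl, cons_single, ext_single]
    clear ih
    match w, ih' with
    | [], _ => rw [cW, ext_single, dW]
    | false :: w, ih' =>
      have h1 := ih' false w (by simp)
      rcases Nat.eq_zero_or_pos (phi w) with h | h
      · rw [cW_false_of_eq h, h1, bW, if_pos h, sub_zero]
      · have h2 := ih' true (ft w) (by simp)
        rw [cW_false_of_pos h, map_add, map_smul, h1, h2, bW, bW, if_neg h.ne', add_sub_cancel]
    | true :: w, ih' =>
      have h1 := ih' true w (by simp)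
      rcases h : eps w with _ | k
      · rw [cW_true_of_eq h, h1, bW, bT, if_pos h]
      · obtain ⟨h2, h3, h4⟩ := et_spec w (by omega)
        have h5 := ih' false (et w) (by simp)
        rw [cW_true_of_succ h, map_sub, map_smul, map_smul, h1, h5, bW, bW, if_neg (by omega), h4, bT,
          if_neg (by omega), h2, h]
        have h6 := gi_add (x := x) k (phi w)
        have h7 := hg (k + 1 + phi w)
        simp only [smul_add, smul_sub, smul_smul]
        rw [← h6] at h7 ⊢
        match_scalars
        · field_simp
          ring
        · field_simp
          ring

/-- The lattice spanned by the words. -/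
def lat (R : Subring 𝕜) : Submodule R (Mod 𝕜) :=
  Submodule.span R (Set.range fun w => Finsupp.single w (1 : 𝕜))

lemma single_mem_lat (R : Subring 𝕜) (w : List Bool) : Finsupp.single w (1 : 𝕜) ∈ lat R :=
  Submodule.subset_span ⟨w, rfl⟩

lemma map_mem_of_mem_lat {V : Type*} [AddCommGroup V] [Module 𝕜 V] {R : Subring 𝕜}
    {N : Submodule R V} (g : Mod 𝕜 →ₗ[𝕜] V) (h : ∀ w, g (Finsupp.single w 1) ∈ N) {m : Mod 𝕜}
    (hm : m ∈ lat R) : g m ∈ N := by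
  induction hm using Submodule.span_induction with
  | mem m hm => obtain ⟨w, rfl⟩ := hm; exact h w
  | zero => rw [map_zero]; exact zero_mem _
  | add a b _ _ ha hb => rw [map_add]; exact add_mem ha hb
  | smul r a _ ha =>
    have : g (r • a) = r • g a := map_smul g (r : 𝕜) a
    rw [this]
    exact N.smul_mem r ha

lemma smul_mem_lat {R : Subring 𝕜} {r : 𝕜} (hr : r ∈ R) {m : Mod 𝕜} (hm : m ∈ lat R) :
    r • m ∈ lat R :=
  (lat R).smul_mem ⟨r, hr⟩ hm

lemma cons_mem_lat {R : Subring 𝕜} (b : Bool) {m : Mod 𝕜} (hm : m ∈ lat R) : cons b m ∈ lat R :=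
  map_mem_of_mem_lat (cons b) (fun w => by rw [cons_single]; exact single_mem_lat R _) hm

lemma bT_mem_lat {R : Subring 𝕜} (hxR : x ∈ R) (hgR : ∀ m, (gi x m)⁻¹ ∈ R) (w : List Bool) :
    bT x w ∈ lat R := by
  rw [bT]
  split_ifs
  · exact single_mem_lat R _
  · exact smul_mem_lat (hgR _) (add_mem (single_mem_lat R _) (smul_mem_lat
      (mul_mem (pow_mem hxR _) (gi_mem hxR _)) (single_mem_lat R _)))

lemma bW_mem_lat {R : Subring 𝕜} (hxR : x ∈ R) (hgR : ∀ m, (gi x m)⁻¹ ∈ R) (w : List Bool) :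
    bW x w ∈ lat R := by
  match w with
  | [] => exact single_mem_lat R _
  | true :: w => exact bT_mem_lat hxR hgR w
  | false :: w =>
    rw [bW]
    refine sub_mem (single_mem_lat R _) ?_
    split_ifs
    · exact zero_mem _
    · exact smul_mem_lat (pow_mem hxR _) (bT_mem_lat hxR hgR _)

lemma dW_mem_lat {R : Subring 𝕜} (hxR : x ∈ R) (hgR : ∀ m, (gi x m)⁻¹ ∈ R) (w : List Bool) :
    dW x w ∈ lat R := by
  induction w with
  | nil => exact single_mem_lat R _
  | cons b w ih =>
    exact map_mem_of_mem_lat (ext (bW x)) (fun w => by rw [ext_single]; exact bW_mem_lat hxR hgR w)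
      (cons_mem_lat b ih)

/-- In the recursion for `cW` every coefficient off the diagonal contains a positive power of `x`,
and the diagonal ones are `1` or some `gi k`, which is `1` modulo `x`. -/
lemma exists_cW_eq {R : Subring 𝕜} (hxR : x ∈ R) (w : List Bool) :
    ∃ m ∈ lat R, cW x w = Finsupp.single w 1 + x • m := by
  induction hl : w.length using Nat.strong_induction_on generalizing w with
  | _ l ih =>
    subst hl
    have ih' : ∀ (b : Bool) (u : List Bool), u.length < w.length →
        ∃ m ∈ lat R, cons b (cW x u) = Finsupp.single (b :: u) 1 + x • m := fun b u hu => by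
      obtain ⟨m, hm, h⟩ := ih _ hu u rfl
      exact ⟨cons b m, cons_mem_lat b hm, by rw [h, map_add, cons_single, map_smul]⟩
    clear ih
    match w, ih' with
    | [], _ => exact ⟨0, zero_mem _, by rw [cW, smul_zero, add_zero]⟩
    | false :: w, ih' =>
      obtain ⟨m, hm, h1⟩ := ih' false w (by simp)
      rcases Nat.eq_zero_or_pos (phi w) with h | h
      · exact ⟨m, hm, by rw [cW_false_of_eq h, h1]⟩
      · obtain ⟨m', hm', h2⟩ := ih' true (ft w) (by simp)
        refine ⟨x ^ eps w • (Finsupp.single (true :: ft w) 1 + x • m') + m,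
          add_mem (smul_mem_lat (pow_mem hxR _) (add_mem (single_mem_lat R _)
            (smul_mem_lat hxR hm'))) hm, ?_⟩
        rw [cW_false_of_pos h, h1, h2, pow_succ']
        module
    | true :: w, ih' =>
      obtain ⟨m, hm, h1⟩ := ih' true w (by simp)
      rcases h : eps w with _ | k
      · exact ⟨m, hm, by rw [cW_true_of_eq h, h1]⟩
      · obtain ⟨m', hm', h2⟩ := ih' false (et w) (by simp)
        obtain ⟨r, hr, hg⟩ := exists_gi hxR k
        refine ⟨m + r • (Finsupp.single (true :: w) 1 + x • m) -
          (x ^ k * gi x (phi w)) • (Finsupp.single (false :: et w) 1 + x • m'),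
          sub_mem (add_mem hm (smul_mem_lat hr (add_mem (single_mem_lat R _)
            (smul_mem_lat hxR hm)))) (smul_mem_lat (mul_mem (pow_mem hxR _) (gi_mem hxR _))
            (add_mem (single_mem_lat R _) (smul_mem_lat hxR hm'))), ?_⟩
        rw [cW_true_of_succ h, h1, h2, hg, pow_succ']
        module

end Word

/-! ### Words attached to the elements of `P_D` -/

section Over

variable {n D : ℕ} {𝕜 : Type*} [Field 𝕜] {x : 𝕜} {i : ℤ}

/-- The value encoded by a letter. -/
def letterVal (i : ℤ) (b : Bool) : ℤ := if b then i else i + 1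

/-- The modification of `p` that has values encoded by `w` at the places `A`. -/
def PD.over (i : ℤ) (p : PD n D) : List ℤ → List Bool → PD n D
  | [], _ => p
  | k :: A, w => (PD.over i p A w.tail).set k (letterVal i (w.headD false))

/-- The places in `A` where the word `w` has the letter `b`. -/
def places (b : Bool) : List ℤ → List Bool → Finset ℤ
  | [], _ => ∅
  | k :: A, w => if w.headD false = b then insert k (places b A w.tail) else places b A w.tail

/-- The list is increasing and its members are incongruent modulo `D`. -/
def IsPlaceList (D : ℕ) (A : List ℤ) : Prop := A.Pairwise fun a b => a < b ∧ ¬ a ≡ b [ZMOD D]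

lemma PD.over_set (p : PD n D) {k : ℤ} (a : ℤ) {A : List ℤ} (h : ∀ l ∈ A, ¬ k ≡ l [ZMOD D])
    (w : List Bool) : (p.set k a).over i A w = (p.over i A w).set k a := by
  induction A generalizing w with
  | nil => rfl
  | cons l A ih =>
    simp only [PD.over]
    rw [ih (fun m hm => h m (List.mem_cons_of_mem _ hm)), PD.set_comm _ (h l List.mem_cons_self)]

lemma PD.over_over (p : PD n D) {A : List ℤ} (hA : IsPlaceList D A) (w w' : List Bool) :
    (p.over i A w).over i A w' = p.over i A w' := by
  induction A generalizing w w' with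
  | nil => rfl
  | cons k A ih =>
    obtain ⟨h1, h2⟩ := List.pairwise_cons.1 hA
    simp only [PD.over]
    rw [PD.over_set _ _ (fun l hl => (h1 l hl).2), ih h2, PD.set_set]

lemma places_subset {b : Bool} {A : List ℤ} {w : List Bool} {k : ℤ} (h : k ∈ places b A w) :
    k ∈ A := by
  induction A generalizing w with
  | nil => simp [places] at h
  | cons l A ih =>
    simp only [places] at h
    split_ifs at h
    · rcases Finset.mem_insert.1 h with rfl | h
      · exact List.mem_cons_self
      · exact List.mem_cons_of_mem _ (ih h)
    · exact List.mem_cons_of_mem _ (ih h)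

lemma exists_mem_places {A : List ℤ} {k : ℤ} (h : k ∈ A) (w : List Bool) :
    ∃ b, k ∈ places b A w := by
  induction A generalizing w with
  | nil => simp at h
  | cons l A ih =>
    simp only [places]
    rcases List.mem_cons.1 h with rfl | h
    · exact ⟨w.headD false, by rw [if_pos rfl]; exact Finset.mem_insert_self _ _⟩
    · obtain ⟨b, hb⟩ := ih h w.tail
      refine ⟨b, ?_⟩
      split_ifs
      · exact Finset.mem_insert_of_mem hb
      · exact hb

lemma PD.over_apply_of_mem (p : PD n D) {A : List ℤ} (hA : IsPlaceList D A) {w : List Bool} {k : ℤ}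
    {b : Bool} (h : k ∈ places b A w) : (p.over i A w).1 k = letterVal i b := by
  induction A generalizing w with
  | nil => simp [places] at h
  | cons l A ih =>
    obtain ⟨h1, h2⟩ := List.pairwise_cons.1 hA
    simp only [places] at h
    simp only [PD.over]
    have key : k ∈ places b A w.tail →
        ((p.over i A w.tail).set l (letterVal i (w.headD false))).1 k = letterVal i b := fun h => by
      rw [PD.set_apply_of_not _ fun h3 => (h1 k (places_subset h)).2 h3.symm, ih h2 h]
    split_ifs at h with h0
    · rcases Finset.mem_insert.1 h with rfl | h
      · rw [PD.set_apply_self, h0]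
      · exact key h
    · exact key h

lemma PD.over_apply_of_not (p : PD n D) {A : List ℤ} (w : List Bool) {k : ℤ}
    (h : ∀ a ∈ A, ¬ k ≡ a [ZMOD D]) : (p.over i A w).1 k = p.1 k := by
  induction A generalizing w with
  | nil => rfl
  | cons l A ih =>
    simp only [PD.over]
    rw [PD.set_apply_of_not _ (h l List.mem_cons_self),
      ih _ fun a ha => h a (List.mem_cons_of_mem _ ha)]

/-- Two of the values `i`, `i + 1` differ by at most `1 < n`. This is where `n ≥ 2` keeps the two
letters apart and makes the places of a word incongruent modulo `D`. -/
lemma letterVal_sub {n : ℕ} (hn : 2 ≤ n) {b c : Bool} {m : ℤ}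
    (h : letterVal i c + m * n = letterVal i b) : m = 0 ∧ c = b := by
  have hn' : (2 : ℤ) ≤ n := by exact_mod_cast hn
  have hm : m = 0 := by
    have h1 : m * n ≤ 1 ∧ -1 ≤ m * n := by
      cases b <;> cases c <;> simp only [letterVal, if_true, Bool.false_eq_true, if_false] at h <;>
        omega
    rcases lt_trichotomy m 0 with h2 | h2 | h2
    · nlinarith
    · exact h2
    · nlinarith
  subst hm
  refine ⟨rfl, ?_⟩
  cases b <;> cases c <;> simp [letterVal] at h <;> rfl

lemma PD.fib_over (hn : 2 ≤ n) (hD : 0 < D) (p : PD n D) {A : List ℤ} (hA : IsPlaceList D A)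
    (hp : ∀ k, (p.1 k = i ∨ p.1 k = i + 1) → k ∈ A) (w : List Bool) (b : Bool) :
    (p.over i A w).fib (letterVal i b) = places b A w := by
  ext k
  rw [PD.mem_fib (by omega) hD]
  refine ⟨fun h => ?_, fun h => p.over_apply_of_mem hA h⟩
  by_cases hk : ∃ a ∈ A, k ≡ a [ZMOD D]
  · obtain ⟨a, ha, hka⟩ := hk
    obtain ⟨m, rfl⟩ := modEq_iff_exists.1 hka
    obtain ⟨c, hc⟩ := exists_mem_places ha w
    rw [PD.shift, p.over_apply_of_mem hA hc] at h
    obtain ⟨rfl, rfl⟩ := letterVal_sub hn h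
    simpa using hc
  · push Not at hk
    rw [p.over_apply_of_not w hk] at h
    refine absurd (Int.ModEq.refl k) (hk k (hp k ?_))
    cases b
    · exact Or.inr h
    · exact Or.inl h

lemma wt_eq_card {A : List ℤ} (hA : IsPlaceList D A) {w : List Bool} (hw : w.length = A.length) :
    Word.wt w = ((places true A w).card : ℤ) - (places false A w).card := by
  induction A generalizing w with
  | nil =>
    obtain rfl := List.length_eq_zero_iff.1 hw
    simp [Word.wt, places]
  | cons k A ih =>
    obtain ⟨h1, h2⟩ := List.pairwise_cons.1 hA
    match w, hw with
    | b :: w, hw =>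
      have := ih h2 (w := w) (by simpa using hw)
      have hk : ∀ b, k ∉ places b A w := fun b hb => (h1 k (places_subset hb)).1.false
      cases b
      · simp only [Word.wt, places, List.headD_cons, List.tail_cons, this, if_true,
          Bool.false_eq_true, if_false, Finset.card_insert_of_notMem (hk false)]
        push_cast
        ring
      · simp only [Word.wt, places, List.headD_cons, List.tail_cons, this, if_true,
          Bool.true_eq_false, if_false, Finset.card_insert_of_notMem (hk true)]
        push_cast
        ring

/-- The linear map that sends a word to the corresponding modification of `p`. -/
def overMap (i : ℤ) (p : PD n D) (A : List ℤ) : Word.Mod 𝕜 →ₗ[𝕜] (PD n D →₀ 𝕜) :=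
  Finsupp.lmapDomain 𝕜 𝕜 (p.over i A)

@[simp] lemma overMap_single (p : PD n D) (A : List ℤ) (w : List Bool) :
    (overMap i p A : Word.Mod 𝕜 →ₗ[𝕜] _) (Finsupp.single w 1) =
      Finsupp.single (p.over i A w) 1 :=
  Finsupp.mapDomain_single

/-- The linear map that sends `p` to `p.set k a`. -/
def setMap (k a : ℤ) : (PD n D →₀ 𝕜) →ₗ[𝕜] (PD n D →₀ 𝕜) :=
  Finsupp.lmapDomain 𝕜 𝕜 fun p => p.set k a

@[simp] lemma setMap_single (k a : ℤ) (p : PD n D) :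
    setMap k a (Finsupp.single p (1 : 𝕜)) = Finsupp.single (p.set k a) 1 :=
  Finsupp.mapDomain_single

lemma overMap_cons (p : PD n D) (k : ℤ) (A : List ℤ) (b : Bool) (m : Word.Mod 𝕜) :
    overMap i p (k :: A) (Word.cons b m) = setMap k (letterVal i b) (overMap i p A m) := by
  have : overMap i p (k :: A) ∘ₗ (Word.cons b : Word.Mod 𝕜 →ₗ[𝕜] _) = setMap k (letterVal i b) ∘ₗ overMap i p A :=
    Finsupp.lhom_ext' fun w => LinearMap.ext_ring (by simp [PD.over])
  exact congrArg (fun f => f m) this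

/-- The exponent of the parameter in the normalized action of `f_i`. -/
def expFn (S S' : Finset ℤ) (k : ℤ) : ℤ := (S.filter (· < k)).card - (S'.filter (· < k)).card

/-- The exponent of the parameter in the normalized action of `e_i`. -/
def expEn (S S' : Finset ℤ) (k : ℤ) : ℤ := (S'.filter (k < ·)).card - (S.filter (k < ·)).card

/-- The first place `l` lies to the left of all others. It contributes its own summand with exponent
zero if its letter is `true`, and shifts all other exponents by `1` or `-1` according to its letter.
This is the coproduct of `f`, with `K` acting on the first factor. -/
lemma sum_places_f (hx : x ≠ 0) (p : PD n D) {A : List ℤ} (hA : IsPlaceList D A) {w : List Bool}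
    (hw : w.length = A.length) :
    ∑ k ∈ places true A w, x ^ expFn (places true A w) (places false A w) k •
      Finsupp.single ((p.over i A w).set k (i + 1)) (1 : 𝕜) = overMap i p A (Word.fW x w) := by
  induction A generalizing w with
  | nil =>
    obtain rfl := List.length_eq_zero_iff.1 hw
    simp [places, Word.fW]
  | cons l A ih =>
    obtain ⟨h1, h2⟩ := List.pairwise_cons.1 hA
    match w, hw with
    | b :: w, hw =>
      have ih' := ih h2 (w := w) (by simpa using hw)
      have hl : ∀ b, l ∉ places b A w := fun b hb => (h1 l (places_subset hb)).1.false
      have hlt : ∀ b k, k ∈ places b A w → l < k := fun b k hk => (h1 k (places_subset hk)).1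
      have hset : ∀ b k a c, k ∈ places b A w → ((p.over i A w).set l c).set k a =
          ((p.over i A w).set k a).set l c := fun b k a c hk =>
        PD.set_comm _ (h1 k (places_subset hk)).2
      cases b
      · simp only [places, PD.over, List.headD_cons, List.tail_cons, if_true,
          Bool.false_eq_true, if_false, Word.fW, map_smul, overMap_cons]
        rw [← ih', map_sum, Finset.smul_sum]
        refine Finset.sum_congr rfl fun k hk => ?_
        rw [map_smul, setMap_single, hset _ _ _ _ hk, smul_smul]
        congr 1
        rw [expFn, expFn, Finset.filter_insert, if_pos (hlt _ _ hk),
          Finset.card_insert_of_notMem (by simp [hl]), ← zpow_neg_one, ← zpow_add₀ hx]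
        congr 1
        push_cast
        ring
      · simp only [places, PD.over, List.headD_cons, List.tail_cons, if_true,
          Bool.true_eq_false, if_false, Word.fW, map_smul, map_add, overMap_cons, overMap_single]
        rw [← ih', map_sum, Finset.smul_sum, Finset.sum_insert (hl true)]
        congr 1
        · have e : expFn (insert l (places true A w)) (places false A w) l = 0 := by
            rw [expFn, Finset.filter_eq_empty_iff.2, Finset.filter_eq_empty_iff.2]
            · simp
            · exact fun k hk => not_lt.2 (hlt _ _ hk).le
            · intro k hk
              rcases Finset.mem_insert.1 hk with rfl | hk
              · exact lt_irrefl _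
              · exact not_lt.2 (hlt _ _ hk).le
          rw [e, zpow_zero, one_smul, PD.set_set]
          rfl
        · refine Finset.sum_congr rfl fun k hk => ?_
          rw [map_smul, setMap_single, hset _ _ _ _ hk, smul_smul]
          congr 1
          rw [expFn, expFn, Finset.filter_insert, if_pos (hlt _ _ hk),
            Finset.card_insert_of_notMem (by simp [hl]), ← zpow_one_add₀ hx]
          congr 1
          push_cast
          ring

/-- The exponents of `e_i` count places to the right. So the first place does not affect the other
summands, while its own exponent is minus the weight of the tail, as in the coproduct of `e`. -/
lemma sum_places_e (p : PD n D) {A : List ℤ} (hA : IsPlaceList D A) {w : List Bool}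
    (hw : w.length = A.length) :
    ∑ k ∈ places false A w, x ^ expEn (places true A w) (places false A w) k •
      Finsupp.single ((p.over i A w).set k i) (1 : 𝕜) = overMap i p A (Word.eW x w) := by
  induction A generalizing w with
  | nil =>
    obtain rfl := List.length_eq_zero_iff.1 hw
    simp [places, Word.eW]
  | cons l A ih =>
    obtain ⟨h1, h2⟩ := List.pairwise_cons.1 hA
    match w, hw with
    | b :: w, hw =>
      have hw' : w.length = A.length := by simpa using hw
      have ih' := ih h2 hw'
      have hl : ∀ b, l ∉ places b A w := fun b hb => (h1 l (places_subset hb)).1.false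
      have hlt : ∀ b k, k ∈ places b A w → l < k := fun b k hk => (h1 k (places_subset hk)).1
      have hset : ∀ b k a c, k ∈ places b A w → ((p.over i A w).set l c).set k a =
          ((p.over i A w).set k a).set l c := fun b k a c hk =>
        PD.set_comm _ (h1 k (places_subset hk)).2
      cases b
      · simp only [places, PD.over, List.headD_cons, List.tail_cons, if_true,
          Bool.false_eq_true, if_false, Word.eW, map_smul, map_add, overMap_cons, overMap_single]
        rw [← ih', map_sum, Finset.sum_insert (hl false)]
        congr 1
        · have e : expEn (places true A w) (insert l (places false A w)) l = -Word.wt w := by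
            rw [expEn, Finset.filter_insert, if_neg (lt_irrefl _), Finset.filter_true_of_mem,
              Finset.filter_true_of_mem, wt_eq_card h2 hw', neg_sub]
            · exact fun k hk => hlt _ _ hk
            · exact fun k hk => hlt _ _ hk
          rw [e, PD.set_set]
          rfl
        · refine Finset.sum_congr rfl fun k hk => ?_
          rw [map_smul, setMap_single, hset _ _ _ _ hk]
          congr 2
          rw [expEn, expEn, Finset.filter_insert, if_neg (hlt _ _ hk).not_gt]
      · simp only [places, PD.over, List.headD_cons, List.tail_cons, if_true,
          Bool.true_eq_false, if_false, Word.eW, overMap_cons]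
        rw [← ih', map_sum]
        refine Finset.sum_congr rfl fun k hk => ?_
        rw [map_smul, setMap_single, hset _ _ _ _ hk]
        congr 2
        rw [expEn, expEn, Finset.filter_insert, if_neg (hlt _ _ hk).not_gt]

end Over

/-! ### The crystal and the string basis of `P_D` for a fixed index -/

section PDCrystal

variable {n D : ℕ} {𝕜 : Type*} [Field 𝕜] {x : 𝕜} {i : ℤ}

/-- The places where `p` has the values `i` or `i + 1`, in increasing order. -/
def PD.placeList (i : ℤ) (p : PD n D) : List ℤ := (p.fib i ∪ p.fib (i + 1)).sort

/-- The word formed by the values `i`, `i + 1` of `p`. -/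
def PD.word (i : ℤ) (p : PD n D) : List Bool := (p.placeList i).map fun k => decide (p.1 k = i)

@[simp] lemma PD.length_word (p : PD n D) : (p.word i).length = (p.placeList i).length :=
  List.length_map _

lemma PD.mem_placeList (hn : 2 ≤ n) (hD : 0 < D) {p : PD n D} {k : ℤ} :
    k ∈ p.placeList i ↔ p.1 k = i ∨ p.1 k = i + 1 := by
  rw [PD.placeList, Finset.mem_sort, Finset.mem_union, PD.mem_fib (by omega) hD,
    PD.mem_fib (by omega) hD]

lemma PD.isPlaceList (hn : 2 ≤ n) (hD : 0 < D) (p : PD n D) : IsPlaceList D (p.placeList i) := by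
  have h := (Finset.sortedLT_sort (p.fib i ∪ p.fib (i + 1))).pairwise
  refine List.Pairwise.imp_of_mem (fun {a b} ha hb hab => ⟨hab, fun hmod => ?_⟩) h
  have ha' := (PD.mem_placeList hn hD).1 ha
  have hb' := (PD.mem_placeList hn hD).1 hb
  obtain ⟨m, rfl⟩ := modEq_iff_exists.1 hmod
  rw [PD.shift] at ha'
  have hm : m = 0 := by
    obtain ⟨c, hc⟩ : ∃ c, p.1 b = letterVal i c := by
      rcases hb' with h | h
      · exact ⟨true, h⟩
      · exact ⟨false, h⟩
    obtain ⟨d, hd⟩ : ∃ d, p.1 b + m * n = letterVal i d := by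
      rcases ha' with h | h
      · exact ⟨true, h⟩
      · exact ⟨false, h⟩
    rw [hc] at hd
    exact (letterVal_sub hn hd).1
  simp [hm] at hab

/-- The element obtained from `p` by changing the word to `w`. -/
def PD.mod (i : ℤ) (p : PD n D) (w : List Bool) : PD n D := p.over i (p.placeList i) w

lemma PD.mod_word (hn : 2 ≤ n) (hD : 0 < D) (p : PD n D) : p.mod i (p.word i) = p := by
  have : ∀ A : List ℤ, (∀ k ∈ A, p.1 k = i ∨ p.1 k = i + 1) →
      p.over i A (A.map fun k => decide (p.1 k = i)) = p := by
    intro A hA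
    induction A with
    | nil => rfl
    | cons k A ih =>
      simp only [PD.over, List.map_cons, List.tail_cons, List.headD_cons]
      rw [ih fun l hl => hA l (List.mem_cons_of_mem _ hl), PD.set_eq_self]
      by_cases h : p.1 k = i
      · simp [letterVal, h]
      · have := (hA k List.mem_cons_self).resolve_left h
        simp [letterVal, this]
  exact this _ fun k hk => (PD.mem_placeList hn hD).1 hk

lemma PD.fib_mod (hn : 2 ≤ n) (hD : 0 < D) (p : PD n D) (w : List Bool) (b : Bool) :
    (p.mod i w).fib (letterVal i b) = places b (p.placeList i) w :=
  p.fib_over hn hD (p.isPlaceList hn hD) (fun _ hk => (PD.mem_placeList hn hD).2 hk) w b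

lemma PD.fib_eq_places (hn : 2 ≤ n) (hD : 0 < D) (p : PD n D) (b : Bool) :
    p.fib (letterVal i b) = places b (p.placeList i) (p.word i) := by
  conv_lhs => rw [← p.mod_word (i := i) hn hD]
  exact p.fib_mod hn hD _ b

lemma PD.placeList_mod (hn : 2 ≤ n) (hD : 0 < D) (p : PD n D) (w : List Bool) :
    (p.mod i w).placeList i = p.placeList i := by
  have h1 := p.fib_mod (i := i) hn hD w true
  have h2 := p.fib_mod (i := i) hn hD w false
  have : (p.mod i w).fib i ∪ (p.mod i w).fib (i + 1) = p.fib i ∪ p.fib (i + 1) := by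
    change (p.mod i w).fib i = _ at h1
    change (p.mod i w).fib (i + 1) = _ at h2
    rw [h1, h2]
    ext k
    have h3 : k ∈ p.placeList i ↔ k ∈ p.fib i ∪ p.fib (i + 1) := Finset.mem_sort _
    rw [← h3, Finset.mem_union]
    refine ⟨fun h => h.elim places_subset places_subset, fun h => ?_⟩
    obtain ⟨b, hb⟩ := exists_mem_places h w
    cases b
    · exact Or.inr hb
    · exact Or.inl hb
  rw [PD.placeList, this, PD.placeList]

lemma PD.word_mod (hn : 2 ≤ n) (hD : 0 < D) (p : PD n D) {w : List Bool}
    (hw : w.length = (p.placeList i).length) : (p.mod i w).word i = w := by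
  rw [PD.word, p.placeList_mod hn hD, PD.mod]
  have hA := p.isPlaceList (i := i) hn hD
  generalize p.placeList i = A at hA hw
  induction A generalizing w with
  | nil => exact (List.length_eq_zero_iff.1 hw).symm
  | cons l A ih =>
    obtain ⟨h1, h2⟩ := List.pairwise_cons.1 hA
    match w, hw with
    | b :: w, hw =>
      have hw' : w.length = A.length := by simpa using hw
      simp only [PD.over, List.map_cons, List.tail_cons, List.headD_cons, PD.set_apply_self]
      congr 1
      · cases b <;> simp [letterVal]
      · refine Eq.trans (List.map_congr_left fun k hk => ?_) (ih h2 hw')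
        have h4 := PD.set_apply_of_not (p.over i A w) (a := letterVal i b)
          fun h3 => (h1 k hk).2 h3.symm
        exact decide_eq_decide.2 (by rw [← h4])

lemma PD.mod_mod (hn : 2 ≤ n) (hD : 0 < D) (p : PD n D) (w w' : List Bool) :
    (p.mod i w).mod i w' = p.mod i w' := by
  rw [PD.mod, p.placeList_mod hn hD]
  exact p.over_over (p.isPlaceList hn hD) w w'

/-- The crystal structure on `P_D` for the index `i`. -/
def PD.crystal (hn : 2 ≤ n) (hD : 0 < D) (i : ℤ) : Crystal (PD n D) where
  eps p := Word.eps (p.word i)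
  phi p := Word.phi (p.word i)
  et p := p.mod i (Word.et (p.word i))
  ft p := p.mod i (Word.ft (p.word i))
  eps_ft p h := by rw [p.word_mod hn hD (by simp)]; exact (Word.ft_spec _ h).1
  phi_ft p h := by rw [p.word_mod hn hD (by simp)]; exact (Word.ft_spec _ h).2.1
  et_ft p h := by
    rw [p.word_mod hn hD (by simp), p.mod_mod hn hD, (Word.ft_spec _ h).2.2, p.mod_word hn hD]
  eps_et p h := by rw [p.word_mod hn hD (by simp)]; exact (Word.et_spec _ h).1
  phi_et p h := by rw [p.word_mod hn hD (by simp)]; exact (Word.et_spec _ h).2.1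
  ft_et p h := by
    rw [p.word_mod hn hD (by simp), p.mod_mod hn hD, (Word.et_spec _ h).2.2, p.mod_word hn hD]

lemma PD.phi_sub_eps (hn : 2 ≤ n) (hD : 0 < D) (p : PD n D) :
    ((PD.crystal hn hD i).phi p : ℤ) - (PD.crystal hn hD i).eps p =
      (p.fib i).card - (p.fib (i + 1)).card := by
  have h1 := p.fib_eq_places (i := i) hn hD true
  have h2 := p.fib_eq_places (i := i) hn hD false
  change p.fib i = _ at h1
  change p.fib (i + 1) = _ at h2
  rw [h1, h2, ← wt_eq_card (p.isPlaceList hn hD) (by simp), Word.wt_eq]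
  rfl

/-- The operator given by an operator on words. -/
def liftW (i : ℤ) (h : List Bool → Word.Mod 𝕜) : Module.End 𝕜 (PD n D →₀ 𝕜) :=
  Finsupp.linearCombination 𝕜 fun p => overMap i p (p.placeList i) (h (p.word i))

lemma liftW_single (h : List Bool → Word.Mod 𝕜) (p : PD n D) :
    liftW i h (Finsupp.single p 1) = overMap i p (p.placeList i) (h (p.word i)) := by
  rw [liftW, Finsupp.linearCombination_single, one_smul]

/-- The span of the words of length `N`. -/
def homog (𝕜 : Type*) [Field 𝕜] (N : ℕ) : Submodule 𝕜 (Word.Mod 𝕜) :=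
  Submodule.span 𝕜 ((fun u => Finsupp.single u (1 : 𝕜)) '' {u | u.length = N})

lemma overMap_mod (hn : 2 ≤ n) (hD : 0 < D) (p : PD n D) (w : List Bool) (m : Word.Mod 𝕜) :
    overMap i (p.mod i w) (p.placeList i) m = overMap i p (p.placeList i) m := by
  have : (overMap i (p.mod i w) (p.placeList i) : Word.Mod 𝕜 →ₗ[𝕜] _) =
      overMap i p (p.placeList i) :=
    Finsupp.lhom_ext' fun w' => LinearMap.ext_ring (by
      have := p.over_over (i := i) (p.isPlaceList (i := i) hn hD) w w'
      simp [PD.mod, this])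
  rw [this]

/-- The elements `p.mod i w`, for all words `w` of the length of the word of `p`, span a copy of a
tensor power on which a lifted operator acts as it does on words. The restriction on the length is
needed because only then is `w` the word of `p.mod i w`. -/
lemma liftW_overMap (hn : 2 ≤ n) (hD : 0 < D) (h : List Bool → Word.Mod 𝕜) (p : PD n D)
    {m : Word.Mod 𝕜} (hm : m ∈ homog 𝕜 (p.placeList i).length) :
    liftW i h (overMap i p (p.placeList i) m) = overMap i p (p.placeList i) (Word.ext h m) := by
  induction hm using Submodule.span_induction with
  | mem m hm =>
    obtain ⟨w, hw, rfl⟩ := hm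
    have h1 := liftW_single (i := i) h (p.mod i w)
    rw [p.placeList_mod hn hD, p.word_mod hn hD hw, overMap_mod hn hD] at h1
    beta_reduce
    rw [overMap_single, Word.ext_single]
    exact h1
  | zero => simp only [map_zero]
  | add a b _ _ ha hb => simp only [map_add, ha, hb]
  | smul r a _ ha => simp only [map_smul, ha]

lemma cW_mem_homog (w : List Bool) : Word.cW x w ∈ homog 𝕜 w.length :=
  Submodule.span_mono (Set.image_mono fun _ hu => hu.2) (Word.cW_mem w)

lemma ext_mem_homog {N M : ℕ} {g : Word.Mod 𝕜 →ₗ[𝕜] Word.Mod 𝕜}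
    (hg : ∀ w : List Bool, w.length = N → g (Finsupp.single w 1) ∈ homog 𝕜 M) {m : Word.Mod 𝕜}
    (hm : m ∈ homog 𝕜 N) : g m ∈ homog 𝕜 M := by
  refine (Submodule.span_le (p := (homog 𝕜 M).comap g)).2 ?_ hm
  rintro _ ⟨w, hw, rfl⟩
  exact hg w hw

lemma single_mem_homog (w : List Bool) : Finsupp.single w (1 : 𝕜) ∈ homog 𝕜 w.length :=
  Submodule.subset_span ⟨w, rfl, rfl⟩

lemma bT_mem_homog (w : List Bool) : Word.bT x w ∈ homog 𝕜 (w.length + 1) := by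
  rw [Word.bT]
  split_ifs
  · exact single_mem_homog (true :: w)
  · have := single_mem_homog (𝕜 := 𝕜) (false :: Word.et w)
    rw [List.length_cons, Word.length_et] at this
    exact Submodule.smul_mem _ _ (add_mem (single_mem_homog (true :: w))
      (Submodule.smul_mem _ _ this))

lemma bW_mem_homog (w : List Bool) : Word.bW x w ∈ homog 𝕜 w.length := by
  match w with
  | [] => exact single_mem_homog []
  | true :: w => exact bT_mem_homog w
  | false :: w =>
    rw [Word.bW]
    refine sub_mem (single_mem_homog (false :: w)) ?_
    split_ifs
    · exact zero_mem _
    · have := bT_mem_homog (x := x) (Word.ft w)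
      rw [Word.length_ft] at this
      exact Submodule.smul_mem _ _ this

lemma dW_mem_homog (w : List Bool) : Word.dW x w ∈ homog 𝕜 w.length := by
  induction w with
  | nil => exact single_mem_homog []
  | cons b w ih =>
    rw [Word.dW]
    refine ext_mem_homog (N := w.length + 1) (fun u hu => ?_) (ext_mem_homog (fun u hu => ?_) ih)
    · rw [Word.ext_single, List.length_cons, ← hu]
      exact bW_mem_homog u
    · rw [Word.cons_single, ← hu]
      exact single_mem_homog (b :: u)

/-- The normalized operator `e_i` on the vector space with basis `P_D`. -/
def eB (x : 𝕜) (i : ℤ) : Module.End 𝕜 (PD n D →₀ 𝕜) :=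
  Finsupp.linearCombination 𝕜 fun p => ∑ k ∈ p.fib (i + 1),
    x ^ expEn (p.fib i) (p.fib (i + 1)) k • Finsupp.single (p.set k i) (1 : 𝕜)

/-- The normalized operator `f_i` on the vector space with basis `P_D`. -/
def fB (x : 𝕜) (i : ℤ) : Module.End 𝕜 (PD n D →₀ 𝕜) :=
  Finsupp.linearCombination 𝕜 fun p => ∑ k ∈ p.fib i,
    x ^ expFn (p.fib i) (p.fib (i + 1)) k • Finsupp.single (p.set k (i + 1)) (1 : 𝕜)

lemma eB_eq (hn : 2 ≤ n) (hD : 0 < D) :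
    (eB x i : Module.End 𝕜 (PD n D →₀ 𝕜)) = liftW i (Word.eW x) := by
  refine congrArg (Finsupp.linearCombination 𝕜) (funext fun p => ?_)
  have h1 := p.fib_eq_places (i := i) hn hD true
  have h2 := p.fib_eq_places (i := i) hn hD false
  change p.fib i = _ at h1
  change p.fib (i + 1) = _ at h2
  have h3 := sum_places_e (x := x) (i := i) p (p.isPlaceList (i := i) hn hD) (w := p.word i) (by simp)
  have h4 : p.over i (p.placeList i) (p.word i) = p := p.mod_word hn hD
  rw [← h3, h4, ← h1, ← h2]

lemma fB_eq (hn : 2 ≤ n) (hD : 0 < D) (hx : x ≠ 0) :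
    (fB x i : Module.End 𝕜 (PD n D →₀ 𝕜)) = liftW i (Word.fW x) := by
  refine congrArg (Finsupp.linearCombination 𝕜) (funext fun p => ?_)
  have h1 := p.fib_eq_places (i := i) hn hD true
  have h2 := p.fib_eq_places (i := i) hn hD false
  change p.fib i = _ at h1
  change p.fib (i + 1) = _ at h2
  have h3 := sum_places_f (i := i) hx p (p.isPlaceList (i := i) hn hD) (w := p.word i) (by simp)
  have h4 : p.over i (p.placeList i) (p.word i) = p := p.mod_word hn hD
  rw [← h3, h4, ← h1, ← h2]

lemma liftW_liftW_single (hn : 2 ≤ n) (hD : 0 < D) {g h : List Bool → Word.Mod 𝕜}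
    (hg : ∀ w, g w ∈ homog 𝕜 w.length) (p : PD n D) :
    liftW i h (liftW i g (Finsupp.single p 1)) =
      overMap i p (p.placeList i) (Word.ext h (g (p.word i))) := by
  have := hg (p.word i)
  rw [PD.length_word] at this
  rw [liftW_single, liftW_overMap hn hD h p this]

lemma liftW_mul_eq_one (hn : 2 ≤ n) (hD : 0 < D) {g h : List Bool → Word.Mod 𝕜}
    (hg : ∀ w, g w ∈ homog 𝕜 w.length) (hgh : ∀ w, Word.ext h (g w) = Finsupp.single w 1) :
    (liftW i h : Module.End 𝕜 (PD n D →₀ 𝕜)) ∘ₗ liftW i g = LinearMap.id :=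
  Finsupp.lhom_ext' fun p => LinearMap.ext_ring (by
    have h1 := liftW_liftW_single (i := i) (h := h) hn hD hg p
    have h2 : p.over i (p.placeList i) (p.word i) = p := p.mod_word hn hD
    rw [hgh, overMap_single, h2] at h1
    simpa using h1)

/-- The string basis for the index `i`. -/
def cBasis (hn : 2 ≤ n) (hD : 0 < D) (hg : ∀ m, gi x m ≠ 0) (i : ℤ) :
    Module.Basis (PD n D) 𝕜 (PD n D →₀ 𝕜) :=
  Finsupp.basisSingleOne.map (LinearEquiv.ofLinearMap (liftW i (Word.cW x)) (liftW i (Word.dW x))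
    (liftW_mul_eq_one hn hD dW_mem_homog (Word.ext_cW_dW hg))
    (liftW_mul_eq_one hn hD cW_mem_homog (Word.ext_dW_cW hg)))

lemma cBasis_apply (hn : 2 ≤ n) (hD : 0 < D) (hg : ∀ m, gi x m ≠ 0) (p : PD n D) :
    cBasis hn hD hg i p = liftW i (Word.cW x) (Finsupp.single p 1) := by
  simp [cBasis]

lemma liftW_cW_mod (hn : 2 ≤ n) (hD : 0 < D) (p : PD n D) {w : List Bool}
    (hw : w.length = (p.placeList i).length) :
    liftW i (Word.cW x) (Finsupp.single (p.mod i w) 1) =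
      overMap i p (p.placeList i) (Word.cW x w) := by
  rw [liftW_single, p.placeList_mod hn hD, p.word_mod hn hD hw, overMap_mod hn hD]

lemma cBasis_isStringFamily (hn : 2 ≤ n) (hD : 0 < D) (hx : x ≠ 0) (hx' : x - x⁻¹ ≠ 0)
    (hg : ∀ m, gi x m ≠ 0) :
    IsStringFamily x (PD.crystal hn hD i) (eB x i) (fB x i) (cBasis hn hD hg i) := by
  constructor
  · intro p
    rw [cBasis_apply, cBasis_apply, eB_eq hn hD, liftW_liftW_single hn hD cW_mem_homog,
      Word.e_cW hx hx']
    show _ = if Word.eps (p.word i) = 0 then 0 else qi x (Word.phi (p.word i) + 1) •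
      liftW i (Word.cW x) (Finsupp.single (p.mod i (Word.et (p.word i))) 1)
    rw [liftW_cW_mod hn hD p (by simp)]
    split_ifs
    · rw [map_zero]
    · rw [map_smul]
  · intro p
    rw [cBasis_apply, cBasis_apply, fB_eq hn hD hx, liftW_liftW_single hn hD cW_mem_homog,
      Word.f_cW hx hx']
    show _ = if Word.phi (p.word i) = 0 then 0 else qi x (Word.eps (p.word i) + 1) •
      liftW i (Word.cW x) (Finsupp.single (p.mod i (Word.ft (p.word i))) 1)
    rw [liftW_cW_mod hn hD p (by simp)]
    split_ifs
    · rw [map_zero]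
    · rw [map_smul]

/-- The lattice with basis `P_D`. -/
def latV (n D : ℕ) (R : Subring 𝕜) : Submodule R (PD n D →₀ 𝕜) :=
  Submodule.span R (Set.range fun p => Finsupp.single p (1 : 𝕜))

lemma overMap_mem_latV {R : Subring 𝕜} (p : PD n D) (A : List ℤ) {m : Word.Mod 𝕜}
    (hm : m ∈ Word.lat R) : overMap i p A m ∈ latV n D R :=
  Word.map_mem_of_mem_lat (overMap i p A)
    (fun w => by rw [overMap_single]; exact Submodule.subset_span ⟨_, rfl⟩) hm

lemma exists_cBasis_eq (hn : 2 ≤ n) (hD : 0 < D) (hg : ∀ m, gi x m ≠ 0) {R : Subring 𝕜}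
    (hxR : x ∈ R) (p : PD n D) :
    ∃ m ∈ latV n D R, cBasis hn hD hg i p = Finsupp.single p 1 + x • m := by
  obtain ⟨m, hm, h⟩ := Word.exists_cW_eq hxR (p.word i)
  have h2 : p.over i (p.placeList i) (p.word i) = p := p.mod_word hn hD
  refine ⟨_, overMap_mem_latV (i := i) p (p.placeList i) hm, ?_⟩
  rw [cBasis_apply, liftW_single, h, map_add, map_smul, overMap_single, h2]

/-- With `exists_cBasis_eq` this shows that the string basis and the standard basis span the same
lattice: the denominators of the inverse transition are products of the units `gi`. -/
lemma single_mem_span_cBasis (hn : 2 ≤ n) (hD : 0 < D) (hg : ∀ m, gi x m ≠ 0) {R : Subring 𝕜}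
    (hxR : x ∈ R) (hgR : ∀ m, (gi x m)⁻¹ ∈ R) (p : PD n D) :
    Finsupp.single p (1 : 𝕜) ∈ Submodule.span R (Set.range (cBasis hn hD hg i)) := by
  have h1 := LinearMap.congr_fun (liftW_mul_eq_one (i := i) hn hD dW_mem_homog
    (Word.ext_cW_dW hg)) (Finsupp.single p 1)
  rw [LinearMap.comp_apply, LinearMap.id_apply, liftW_single (Word.dW x)] at h1
  rw [← h1]
  refine Word.map_mem_of_mem_lat (liftW i (Word.cW x) ∘ₗ overMap i p (p.placeList i)) (fun w => ?_)
    (Word.dW_mem_lat hxR hgR (p.word i))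
  rw [LinearMap.comp_apply, overMap_single, ← cBasis_apply hn hD hg]
  exact Submodule.subset_span ⟨_, rfl⟩

end PDCrystal

/-! ### The parameter `v` -/

lemma v_pow_ne_one {m : ℕ} (hm : m ≠ 0) : v ^ m ≠ 1 := by
  intro h
  have h1 : algebraMap ℂ[X] K (X ^ m) = algebraMap ℂ[X] K 1 := by
    rw [map_pow, map_one, RatFunc.algebraMap_X]; exact h
  have h2 := congrArg (eval 0) (RatFunc.algebraMap_injective ℂ h1)
  simp [hm] at h2

lemma v_sub_ne_zero : v - v⁻¹ ≠ 0 := by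
  intro h
  refine v_pow_ne_one two_ne_zero ?_
  rw [pow_two]
  nth_rewrite 2 [sub_eq_zero.1 h]
  exact mul_inv_cancel₀ v_ne_zero

lemma qi_v_ne_zero (k : ℕ) : qi v (k + 1) ≠ 0 := by
  intro h
  rw [qi, div_eq_zero_iff, or_iff_left v_sub_ne_zero, sub_eq_zero] at h
  refine v_pow_ne_one (m := 2 * (k + 1)) (by omega) ?_
  have h1 : v ^ ((k : ℤ) + 1) = v ^ (k + 1) := by exact_mod_cast zpow_natCast v (k + 1)
  rw [zpow_neg, h1] at h
  rw [two_mul, pow_add]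
  nth_rewrite 2 [h]
  exact mul_inv_cancel₀ (pow_ne_zero _ v_ne_zero)

lemma gi_v_ne_zero (m : ℕ) : gi v m ≠ 0 :=
  Word.gi_ne_zero v_ne_zero v_sub_ne_zero qi_v_ne_zero m

lemma v_mem : v ∈ Z₀ := vZ.2

/-- If `r = a / b`, the new denominator `b + X a` has the same value at `0` as `b`. -/
lemma inv_mem_of_eq {f r : K} (hr : r ∈ Z₀) (h : f = 1 + v * r) : f⁻¹ ∈ Z₀ := by
  obtain ⟨a, b, hb, rfl⟩ := hr
  refine ⟨b, b + X * a, by simpa using hb, ?_⟩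
  have hb' : algebraMap ℂ[X] K b ≠ 0 := fun h0 =>
    hb (by rw [(map_eq_zero_iff _ (RatFunc.algebraMap_injective ℂ)).1 h0, eval_zero])
  rw [h, map_add, map_mul, RatFunc.algebraMap_X]
  change (1 + v * _)⁻¹ = _ / (_ + v * _)
  rw [← inv_div (_ + _), add_div, div_self hb', mul_div_assoc]

lemma gi_v_inv_mem (m : ℕ) : (gi v m)⁻¹ ∈ Z₀ := by
  obtain ⟨r, hr, h⟩ := exists_gi v_mem m
  exact inv_mem_of_eq hr h

/-! ### Weights -/

section Wt

variable {n D : ℕ} {𝕜 : Type*} [Field 𝕜] {x : 𝕜}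

/-- The weight spaces of a string basis and those of a second basis coincide if the members of the
string basis are homogeneous. -/
lemma wtSpan_eq {X V : Type*} [AddCommGroup V] [Module 𝕜 V] {C : Crystal X}
    {b b' : Module.Basis X 𝕜 V} {h : X → ℤ} (hC : ∀ p, (C.phi p : ℤ) - C.eps p = h p)
    (hb : ∀ p, b p ∈ Submodule.span 𝕜 (b' '' {q | h q = h p})) (a : ℤ) :
    wtSpan C b a = Submodule.span 𝕜 (b' '' {q | h q = a}) := by
  apply le_antisymm
  · refine Submodule.span_le.2 ?_
    rintro _ ⟨p, hp, rfl⟩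
    have h1 : h p = a := (hC p).symm.trans hp
    rw [← h1]
    exact hb p
  -- `P` is the projection to weight `a` for the basis `b'`. As each `b p` is homogeneous, `P` fixes
  -- it or kills it, so the image of `P` lies in the weight space of `b`; and `P` fixes the vectors
  -- `b' q` in question.
  · set P : Module.End 𝕜 V := b'.constr 𝕜 fun q => if h q = a then b' q else 0 with hP
    have h1 : ∀ q, P (b' q) = if h q = a then b' q else 0 := fun q => b'.constr_basis _ _ _
    have h2 : ∀ p, P (b p) = if h p = a then b p else 0 := by
      intro p
      have := LinearMap.eqOn_span (f := P) (g := if h p = a then LinearMap.id else 0)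
        (s := b' '' {q | h q = h p}) (by
          rintro _ ⟨q, hq, rfl⟩
          have hq' : h q = h p := hq
          rw [h1, hq']
          split_ifs <;> rfl) (hb p)
      rw [this]
      split_ifs <;> rfl
    have h3 : ∀ z, P z ∈ wtSpan C b a := by
      intro z
      induction z using basis_induction b with
      | zero => rw [map_zero]; exact zero_mem _
      | coe p =>
        rw [h2]
        split_ifs with h0
        · exact Submodule.subset_span ⟨p, (hC p).trans h0, rfl⟩
        · exact zero_mem _
      | add c d hc hd => rw [map_add]; exact add_mem hc hd
      | smul r c hc => rw [map_smul]; exact Submodule.smul_mem _ _ hc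
    refine Submodule.span_le.2 ?_
    rintro _ ⟨q, hq, rfl⟩
    have := h3 (b' q)
    have hq' : h q = a := hq
    rwa [h1, if_pos hq'] at this

/-- The weight of `p` with respect to the index `i`. -/
def PD.hwt (p : PD n D) (i : ZMod n) : ℤ := sharp p i - sharp p (i + 1)

lemma PD.hwt_intCast (hn : 2 ≤ n) (hD : 0 < D) (p : PD n D) (i : ℤ) :
    p.hwt (i : ZMod n) = (p.fib i).card - (p.fib (i + 1)).card := by
  have h : ((i : ZMod n) + 1) = ((i + 1 : ℤ) : ZMod n) := by push_cast; rfl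
  rw [PD.hwt, h, sharp_apply (by omega), sharp_apply (by omega), p.card_fib (by omega) hD,
    p.card_fib (by omega) hD]

lemma PD.hwt_mod (hn : 2 ≤ n) (hD : 0 < D) (p : PD n D) (i : ℤ) {w : List Bool}
    (hw : w.length = (p.placeList i).length) : (p.mod i w).hwt (i : ZMod n) = Word.wt w := by
  have h1 := p.fib_mod (i := i) hn hD w true
  have h2 := p.fib_mod (i := i) hn hD w false
  change (p.mod i w).fib i = _ at h1
  change (p.mod i w).fib (i + 1) = _ at h2
  rw [PD.hwt_intCast hn hD, h1, h2, wt_eq_card (p.isPlaceList hn hD) hw]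

lemma liftW_cW_mem (hn : 2 ≤ n) (hD : 0 < D) (i : ℤ) (p : PD n D) :
    liftW i (Word.cW x) (Finsupp.single p 1) ∈ Submodule.span 𝕜
      ((fun q => Finsupp.single q (1 : 𝕜)) '' {q | q.hwt (i : ZMod n) = p.hwt (i : ZMod n)}) := by
  rw [liftW_single]
  have h := Submodule.mem_map_of_mem (f := overMap i p (p.placeList i))
    (Word.cW_mem (x := x) (p.word i))
  rw [Submodule.map_span] at h
  refine Submodule.span_mono ?_ h
  rintro _ ⟨_, ⟨w, ⟨hw1, hw2⟩, rfl⟩, rfl⟩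
  refine ⟨p.mod i w, ?_, (overMap_single p _ w).symm⟩
  have h1 := p.hwt_mod hn hD i (w := p.word i) (by simp)
  rw [p.mod_word hn hD] at h1
  have h2 := p.hwt_mod hn hD i (w := w) (by simpa using hw2)
  exact h2.trans (hw1.trans h1.symm)

end Wt

/-! ### The string bases of `T_D` -/

section Scale

variable {n D : ℕ} {i : ℤ}

/-- The basis of the vectors `v^{x_p} p`. -/
def bBasis (n D : ℕ) : Module.Basis (PD n D) K (VD n D) :=
  Finsupp.basisSingleOne.unitsSMul fun p => Units.mk0 (v ^ xdim p) (pow_ne_zero _ v_ne_zero)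

lemma bBasis_apply (p : PD n D) : bBasis n D p = v ^ xdim p • Finsupp.single p 1 := by
  rw [bBasis, Module.Basis.unitsSMul_apply, Finsupp.coe_basisSingleOne, Units.smul_def,
    Units.val_mk0]

/-- The normalization of the basis vectors. -/
def scale (n D : ℕ) : VD n D ≃ₗ[K] VD n D :=
  Finsupp.basisSingleOne.equiv (bBasis n D) (Equiv.refl _)

lemma scale_single (p : PD n D) : scale n D (Finsupp.single p 1) = bBasis n D p := by
  have := Finsupp.basisSingleOne.equiv_apply p (bBasis n D) (Equiv.refl (PD n D))
  rw [Finsupp.coe_basisSingleOne] at this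
  exact this

lemma single_eq (p : PD n D) : Finsupp.single p (1 : K) = v ^ (-(xdim p : ℤ)) • bBasis n D p := by
  rw [bBasis_apply, smul_smul, zpow_neg, zpow_natCast,
    inv_mul_cancel₀ (pow_ne_zero _ v_ne_zero), one_smul]

lemma card_filter_lt_add {S : Finset ℤ} {k : ℤ} (hk : k ∉ S) :
    (S.filter (k < ·)).card + (S.filter (· < k)).card = S.card := by
  rw [← Finset.card_filter_add_card_filter_not (s := S) (k < ·)]
  congr 2
  refine Finset.filter_congr fun l hl => ?_
  have : l ≠ k := fun h => hk (h ▸ hl)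
  omega

/-- The normalization changes the exponent of a summand by the difference of the numbers `x_p`. By
`xdim_set` the exponent then only counts, to the right of `k`, the places of value `i + 1` minus
those of value `i`, which is the exponent of the coproduct. -/
lemma opE_scale (hn : 2 ≤ n) (hD : 0 < D) (i : ℤ) (z : VD n D) :
    opE i (scale n D z) = scale n D (eB v i z) := by
  suffices h : opE i ∘ₗ (scale n D).toLinearMap = (scale n D).toLinearMap ∘ₗ eB v i from
    LinearMap.congr_fun h z
  refine Finsupp.lhom_ext' fun p => LinearMap.ext_ring ?_
  show opE i (scale n D (Finsupp.single p 1)) = scale n D (eB v i (Finsupp.single p 1))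
  rw [scale_single, bBasis_apply, map_smul, opE_single, eB, Finsupp.linearCombination_single,
    one_smul, map_sum, Finset.smul_sum]
  refine Finset.sum_congr rfl fun k hk => ?_
  rw [PD.mem_fib (by omega) hD] at hk
  rw [map_smul, scale_single, bBasis_apply, smul_smul, smul_smul, ← zpow_natCast, ← zpow_natCast,
    ← zpow_add₀ v_ne_zero, ← zpow_add₀ v_ne_zero]
  congr 2
  have h1 := xdim_set hn hD p hk
  have h2 : k ∉ p.fib i := by rw [PD.mem_fib (by omega) hD]; omega
  have h3 := card_filter_lt_add h2
  rw [expE, expEn]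
  omega

lemma opF_scale (hn : 2 ≤ n) (hD : 0 < D) (i : ℤ) (z : VD n D) :
    opF i (scale n D z) = scale n D (fB v i z) := by
  suffices h : opF i ∘ₗ (scale n D).toLinearMap = (scale n D).toLinearMap ∘ₗ fB v i from
    LinearMap.congr_fun h z
  refine Finsupp.lhom_ext' fun p => LinearMap.ext_ring ?_
  show opF i (scale n D (Finsupp.single p 1)) = scale n D (fB v i (Finsupp.single p 1))
  rw [scale_single, bBasis_apply, map_smul, opF_single, fB, Finsupp.linearCombination_single,
    one_smul, map_sum, Finset.smul_sum]
  refine Finset.sum_congr rfl fun k hk => ?_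
  rw [PD.mem_fib (by omega) hD] at hk
  rw [map_smul, scale_single, bBasis_apply, smul_smul, smul_smul, ← zpow_natCast, ← zpow_natCast,
    ← zpow_add₀ v_ne_zero, ← zpow_add₀ v_ne_zero]
  congr 2
  have hmod := not_modEq_add_one hn i
  -- The comparison of the numbers `x_p` is for lowering a value, so it is applied to the raised
  -- element, from which lowering at `k` recovers `p`.
  have h1 := xdim_set hn hD (p.set k (i + 1)) (k := k) (a := i) (p.set_apply_self)
  rw [PD.set_set, PD.set_eq_self p hk,
    p.fib_set_self (by omega) hD (by rw [hk]; exact fun h => hmod h.symm),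
    p.fib_set_source (by omega) hD hk (fun h => hmod h.symm)] at h1
  have h2 : k ∉ p.fib (i + 1) := by rw [PD.mem_fib (by omega) hD]; omega
  have h3 := card_filter_lt_add h2
  have h4 : (insert k (p.fib (i + 1))).filter (k < ·) = (p.fib (i + 1)).filter (k < ·) := by
    rw [Finset.filter_insert, if_neg (lt_irrefl _)]
  have h5 : ((p.fib i).erase k).filter (· < k) = (p.fib i).filter (· < k) := by
    ext l
    simp only [Finset.mem_filter, Finset.mem_erase]
    exact ⟨fun h => ⟨h.1.2, h.2⟩, fun h => ⟨⟨h.2.ne, h.1⟩, h.2⟩⟩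
  rw [h4, h5] at h1
  rw [expF, expFn]
  omega

/-- The string basis of `T_D` for the index `i`. -/
def sBasis (hn : 2 ≤ n) (hD : 0 < D) (i : ℤ) : Module.Basis (PD n D) K (VD n D) :=
  (cBasis hn hD gi_v_ne_zero i).map (scale n D)

lemma sBasis_apply (hn : 2 ≤ n) (hD : 0 < D) (i : ℤ) (p : PD n D) :
    sBasis hn hD i p = scale n D (cBasis hn hD gi_v_ne_zero i p) := rfl

lemma sBasis_isStringFamily (hn : 2 ≤ n) (hD : 0 < D) (i : ℤ) :
    IsStringFamily v (PD.crystal hn hD i) (opE i) (opF i) (sBasis hn hD i) := by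
  have H := cBasis_isStringFamily (i := i) hn hD v_ne_zero v_sub_ne_zero gi_v_ne_zero
  constructor
  · intro p
    rw [sBasis_apply, opE_scale hn hD, H.E_apply]
    split_ifs
    · rw [map_zero]
    · rw [map_smul, sBasis_apply]
  · intro p
    rw [sBasis_apply, opF_scale hn hD, H.F_apply]
    split_ifs
    · rw [map_zero]
    · rw [map_smul, sBasis_apply]

/-- The weight spaces for the index `i`. -/
lemma wtSpan_sBasis (hn : 2 ≤ n) (hD : 0 < D) (i : ℤ) (a : ℤ) :
    wtSpan (PD.crystal hn hD i) (sBasis hn hD i) a =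
      Submodule.span K (bBasis n D '' {q | q.hwt (i : ZMod n) = a}) := by
  refine wtSpan_eq (C := PD.crystal hn hD i) (b := sBasis hn hD i) (b' := bBasis n D)
    (h := fun p : PD n D => p.hwt (i : ZMod n)) (fun p => ?_) (fun p => ?_) a
  · rw [PD.phi_sub_eps, PD.hwt_intCast hn hD]
  · rw [sBasis_apply, cBasis_apply]
    have := Submodule.mem_map_of_mem (f := (scale n D).toLinearMap)
      (liftW_cW_mem (x := v) hn hD i p)
    rw [Submodule.map_span, Set.image_image] at this
    simp only [LinearEquiv.coe_coe, scale_single] at this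
    exact this

lemma single_mem_wtSpan (hn : 2 ≤ n) (hD : 0 < D) (i : ℤ) (p : PD n D) :
    Finsupp.single p 1 ∈ wtSpan (PD.crystal hn hD i) (sBasis hn hD i) (p.hwt (i : ZMod n)) := by
  rw [wtSpan_sBasis, single_eq]
  exact Submodule.smul_mem _ _ (Submodule.subset_span ⟨p, rfl, rfl⟩)

end Scale

/-! ### Commutation of `e_i` with `f_j` for different indices -/

section Commute

variable {n D : ℕ}

lemma PD.fib_set_eq_filter (hn : 0 < n) (hD : 0 < D) (p : PD n D) {k a b : ℤ}
    (h : ¬ a ≡ b [ZMOD n]) :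
    (p.set k a).fib b = (p.fib b).filter fun l => ¬ l ≡ k [ZMOD D] := by
  ext l
  rw [Finset.mem_filter, PD.mem_fib hn hD, PD.mem_fib hn hD]
  by_cases hl : l ≡ k [ZMOD D]
  · simp only [hl, not_true, and_false, iff_false]
    intro h1
    refine h ?_
    obtain ⟨m, rfl⟩ := modEq_iff_exists.1 hl
    rw [PD.shift, PD.set_apply_self] at h1
    exact (modEq_iff_exists.2 ⟨m, h1.symm⟩).symm
  · rw [PD.set_apply_of_not _ hl]
    simp [hl]

/-- The two orders of moving values from `j` to `j + 1` and from `i + 1` to `i` give the same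
exponents. -/
lemma expE_add_expF (hn : 2 ≤ n) (hD : 0 < D) {i j : ℤ} (hij : ¬ i ≡ j [ZMOD n])
    (hij' : i = j + 1 ∨ ¬ i ≡ j + 1 [ZMOD n]) (p : PD n D) {k l : ℤ} (hk : p.1 k = i + 1)
    (hl : p.1 l = j) :
    expF j p l + expE i (p.set l (j + 1)) k = expE i p k + expF j (p.set k i) l := by
  have hn0 : 0 < n := by omega
  rcases hij' with rfl | h
  · have h1 := p.fib_set_self hn0 hD (k := l) (a := j + 1) (by rw [hl]; exact fun h => hij h.symm)
    have h2 := p.fib_set_self hn0 hD (k := k) (a := j + 1)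
      (by rw [hk]; exact not_modEq_add_one hn (j + 1))
    have h3 : k ∉ p.fib (j + 1) := by rw [PD.mem_fib hn0 hD]; omega
    have h4 : l ∉ p.fib (j + 1) := by rw [PD.mem_fib hn0 hD]; omega
    rw [expF, expE, expE, expF, h1, h2, Finset.card_insert_of_notMem h3,
      Finset.card_insert_of_notMem h4, Finset.filter_insert, Finset.filter_insert]
    have h5 : l ∉ (p.fib (j + 1)).filter (k < ·) := by simp [h4]
    have h6 : k ∉ (p.fib (j + 1)).filter (· < l) := by simp [h3]
    split_ifs
    · rw [Finset.card_insert_of_notMem h5, Finset.card_insert_of_notMem h6]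
      push_cast
      ring
    · push_cast
      ring
  · have h1 := p.fib_set_of_ne hn0 hD (k := l) (a := j + 1) (b := i)
      (by rw [hl]; exact fun h => hij h.symm) (fun h1 => h h1.symm)
    have h2 := p.fib_set_of_ne hn0 hD (k := k) (a := i) (b := j + 1)
      (by rw [hk]; exact fun h => hij (Int.ModEq.add_right_cancel' 1 h)) h
    rw [expE, expF, expE, expF, h1, h2]
    ring

/-- Both orders are sums over pairs of places `k`, `l`. Pairs with `k ≡ l` do not occur in either
order: after the first change the value in that residue class is not one that the second operator
changes. For the others the two changes commute and the total exponents agree. -/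
lemma opE_opF_of_eq_or (hn : 2 ≤ n) (hD : 0 < D) {i j : ℤ} (hij : ¬ i ≡ j [ZMOD n])
    (hij' : i = j + 1 ∨ ¬ i ≡ j + 1 [ZMOD n]) :
    (opE i * opF j : Module.End K (VD n D)) = opF j * opE i := by
  have hn0 : 0 < n := by omega
  refine end_ext fun p => ?_
  have h1 : ∀ l, (p.set l (j + 1)).fib (i + 1) =
      (p.fib (i + 1)).filter fun k => ¬ k ≡ l [ZMOD D] := fun l =>
    p.fib_set_eq_filter hn0 hD fun h => hij (Int.ModEq.add_right_cancel' 1 h).symm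
  have h2 : ∀ k, (p.set k i).fib j = (p.fib j).filter fun l => ¬ l ≡ k [ZMOD D] := fun k =>
    p.fib_set_eq_filter hn0 hD hij
  rw [Module.End.mul_apply, Module.End.mul_apply, opF_single, opE_single, map_sum, map_sum]
  simp only [map_smul, opF_single, opE_single, h1, h2, Finset.sum_filter, Finset.smul_sum]
  rw [Finset.sum_comm]
  refine Finset.sum_congr rfl fun k hk => Finset.sum_congr rfl fun l hl => ?_
  rw [PD.mem_fib hn0 hD] at hk hl
  by_cases hkl : k ≡ l [ZMOD D]
  · rw [if_neg (not_not.2 hkl), if_neg (not_not.2 hkl.symm), smul_zero, smul_zero]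
  · rw [if_pos hkl, if_pos fun h => hkl h.symm, smul_smul, smul_smul, ← zpow_add₀ v_ne_zero,
      ← zpow_add₀ v_ne_zero, expE_add_expF hn hD hij hij' p hk hl,
      PD.set_comm _ fun h => hkl h.symm]

lemma opE_opF (hn : 2 ≤ n) (hD : 0 < D) {i j : ℤ} (hij : ¬ i ≡ j [ZMOD n]) :
    (opE i * opF j : Module.End K (VD n D)) = opF j * opE i := by
  by_cases h : i ≡ j + 1 [ZMOD n]
  -- When `i ≡ j + 1`, the same residue of values enters both exponents. Periodicity permits `i = j
  -- + 1`, where the two fibres literally coincide.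
  · obtain ⟨m, rfl⟩ := modEq_iff_exists.1 h
    rw [opE_shift (by omega) hD]
    refine opE_opF_of_eq_or hn hD (not_modEq_add_one hn j) (Or.inl rfl)
  · exact opE_opF_of_eq_or hn hD hij (Or.inr h)

/-! ### Weight projections -/

open Classical in
/-- The projection to the span of the elements of weight `mu`. -/
def projW (mu : Wt n) : Module.End K (VD n D) :=
  Finsupp.linearCombination K fun p : PD n D => if sharp p = mu then Finsupp.single p (1 : K) else 0

open Classical in
lemma projW_single (mu : Wt n) (p : PD n D) :
    projW mu (Finsupp.single p 1) = if sharp p = mu then Finsupp.single p (1 : K) else 0 := by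
  rw [projW, Finsupp.linearCombination_single, one_smul]

lemma projW_of_eq {mu : Wt n} {p : PD n D} (h : sharp p = mu) :
    projW mu (Finsupp.single p 1) = Finsupp.single p (1 : K) := by
  rw [projW_single, if_pos h]

lemma projW_of_ne {mu : Wt n} {p : PD n D} (h : sharp p ≠ mu) :
    projW mu (Finsupp.single p 1) = (0 : VD n D) := by
  rw [projW_single, if_neg h]

/-- An endomorphism that changes all weights in the same way. -/
lemma mul_projW {S : Module.End K (VD n D)} {mu nu : Wt n}
    (hS : ∀ p : PD n D, ∀ q ∈ (S (Finsupp.single p 1)).support, sharp q = nu ↔ sharp p = mu) :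
    S * projW mu = projW nu * S := by
  classical
  have key : ∀ z : VD n D, (∀ q ∈ z.support, sharp q = nu) → projW nu z = z := by
    intro z hz
    rw [projW, Finsupp.linearCombination_apply]
    conv_rhs => rw [← Finsupp.sum_single z]
    refine Finset.sum_congr rfl fun q hq => ?_
    beta_reduce
    rw [if_pos (hz q hq), Finsupp.smul_single_one]
  have key' : ∀ z : VD n D, (∀ q ∈ z.support, sharp q ≠ nu) → projW nu z = 0 := by
    intro z hz
    rw [projW, Finsupp.linearCombination_apply]
    refine Finset.sum_eq_zero fun q hq => ?_
    beta_reduce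
    rw [if_neg (hz q hq), smul_zero]
  refine end_ext fun p => ?_
  rw [Module.End.mul_apply, Module.End.mul_apply]
  by_cases h : sharp p = mu
  · rw [projW_of_eq h, key _ fun q hq => (hS p q hq).2 h]
  · rw [projW_of_ne h, map_zero, key' _ fun q hq h1 => h ((hS p q hq).1 h1)]

lemma projW_mem_commutant (mu : Wt n) : projW mu ∈ commutant n D := by
  classical
  rw [commutant, Subalgebra.mem_centralizer_iff]
  rintro _ (⟨s, j, hs, rfl⟩ | ⟨m, rfl⟩)
  · refine mul_projW fun p q hq => ?_
    have : sharp q = sharp p := by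
      rw [opS_single] at hq
      have hpq : q = p.comp s ∨ q = p := by
        by_contra! h
        refine Finsupp.mem_support_iff.1 hq ?_
        split_ifs <;> simp [h.1.symm, h.2.symm]
      rcases hpq with rfl | rfl
      · exact sharp_comp _ _
      · rfl
    rw [this]
  · refine mul_projW fun p q hq => ?_
    have : sharp q = sharp p := by
      rw [opT_single] at hq
      have hpq := Finsupp.support_single_subset hq
      rw [Finset.mem_singleton.1 hpq]
      exact sharp_comp _ _
    rw [this]

lemma projW_mul_self (mu : Wt n) : (projW mu * projW mu : Module.End K (VD n D)) = projW mu :=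
  end_ext fun p => by
    rw [Module.End.mul_apply]
    by_cases h : sharp p = mu
    · rw [projW_of_eq h, projW_of_eq h]
    · rw [projW_of_ne h, map_zero]

lemma projW_mul_of_ne {mu nu : Wt n} (h : mu ≠ nu) :
    (projW mu * projW nu : Module.End K (VD n D)) = 0 :=
  end_ext fun p => by
    rw [Module.End.mul_apply]
    by_cases h1 : sharp p = nu
    · rw [projW_of_eq h1, projW_of_ne (h1.trans_ne h.symm)]; rfl
    · rw [projW_of_ne h1, map_zero]; rfl

lemma projW_of_neg {mu : Wt n} (h : ∃ j, mu j < 0) : (projW mu : Module.End K (VD n D)) = 0 :=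
  end_ext fun p => by
    obtain ⟨j, hj⟩ := h
    rw [projW_of_ne]
    · rfl
    · rintro rfl
      exact hj.not_ge (sharp_nonneg p j)

/-- The action of the letters. -/
def opL : Letter n → Module.End K (VD n D)
  | .e i => opE (i.val : ℤ)
  | .f i => opF (i.val : ℤ)

lemma opL_mem_commutant (hn : 2 ≤ n) (hD : 0 < D) (l : Letter n) : opL l ∈ commutant n D := by
  cases l
  · exact opE_mem_commutant (by omega) hD _
  · exact opF_mem_commutant (by omega) hD _

lemma val_intCast [NeZero n] (i : ZMod n) : (((i.val : ℤ) : ℤ) : ZMod n) = i := by simp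

lemma opL_mul_projW (hn : 2 ≤ n) (hD : 0 < D) (l : Letter n) (mu : Wt n) :
    (opL l * projW mu : Module.End K (VD n D)) = projW (l.shift mu) * opL l := by
  classical
  have : NeZero n := ⟨by omega⟩
  have hsupp : ∀ (S : Finset ℤ) (c : ℤ → K) (g : ℤ → PD n D),
      ∀ q ∈ (∑ k ∈ S, c k • Finsupp.single (g k) (1 : K)).support, ∃ k ∈ S, q = g k := by
    intro S c g q hq
    obtain ⟨k, hk, hq⟩ := Finset.mem_biUnion.1 (Finsupp.support_finsetSum hq)
    exact ⟨k, hk, Finset.mem_singleton.1 (Finsupp.support_single_subset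
      (Finsupp.support_smul hq))⟩
  cases l with
  | e i =>
    refine mul_projW fun p q hq => ?_
    rw [opL, opE_single] at hq
    obtain ⟨k, hk, rfl⟩ := hsupp _ _ _ q hq
    rw [PD.mem_fib (by omega) hD] at hk
    have h1 := sharp_set hn hD p hk (not_modEq_add_one hn _)
    push_cast at h1
    rw [ZMod.natCast_zmod_val] at h1
    rw [h1, Letter.shift]
    exact ⟨fun h => add_right_cancel (sub_left_injective h), fun h => by rw [h]⟩
  | f i =>
    refine mul_projW fun p q hq => ?_
    rw [opL, opF_single] at hq
    obtain ⟨k, hk, rfl⟩ := hsupp _ _ _ q hq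
    rw [PD.mem_fib (by omega) hD] at hk
    have h1 := sharp_set hn hD p hk (a := (i.val : ℤ) + 1) fun h => not_modEq_add_one hn _ h.symm
    push_cast at h1
    rw [ZMod.natCast_zmod_val] at h1
    rw [h1, Letter.shift, add_sub_right_comm]
    exact ⟨fun h => sub_left_injective (add_right_cancel h), fun h => by rw [h]⟩

lemma opE_opF_val (hn : 2 ≤ n) (hD : 0 < D) {i j : ZMod n} (h : i ≠ j) :
    (opE (i.val : ℤ) * opF (j.val : ℤ) : Module.End K (VD n D)) =
      opF (j.val : ℤ) * opE (i.val : ℤ) := by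
  have : NeZero n := ⟨by omega⟩
  refine opE_opF hn hD fun hij => h ?_
  rw [← val_intCast i, ← val_intCast j]
  exact (ZMod.intCast_eq_intCast_iff _ _ _).2 hij

/-- The basis vector of `p` is homogeneous for the string basis of index `i` as well, with weight
`♯p_i - ♯p_{i+1}`, so the commutator computed on string vectors applies to it. -/
lemma commutator_projW (hn : 2 ≤ n) (hD : 0 < D) (i : ZMod n) (mu : Wt n) :
    ((opE (i.val : ℤ) * opF (i.val : ℤ) - opF (i.val : ℤ) * opE (i.val : ℤ)) * projW mu :
      Module.End K (VD n D)) = qInt (mu i - mu (i + 1)) • projW mu := by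
  have : NeZero n := ⟨by omega⟩
  refine end_ext fun p => ?_
  rw [Module.End.mul_apply, LinearMap.smul_apply]
  by_cases h : sharp p = mu
  · have h1 := (sBasis_isStringFamily hn hD (i.val : ℤ)).commutator v_ne_zero v_sub_ne_zero
      (single_mem_wtSpan hn hD (i.val : ℤ) p)
    rw [projW_of_eq h, LinearMap.sub_apply, Module.End.mul_apply, Module.End.mul_apply, h1,
      add_sub_cancel_left, val_intCast, PD.hwt, h]
    rfl
  · rw [projW_of_ne h, map_zero, smul_zero]

end Commute

/-! ### The quantum Serre relations -/

section Serre

variable {n D : ℕ}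

lemma projW_mem_wtSpan (hn : 2 ≤ n) (hD : 0 < D) (i : ZMod n) (nu : Wt n) (z : VD n D) :
    projW nu z ∈ wtSpan (PD.crystal hn hD (i.val : ℤ)) (sBasis hn hD (i.val : ℤ))
      (nu i - nu (i + 1)) := by
  have : NeZero n := ⟨by omega⟩
  induction z using basis_induction (bBasis n D) with
  | zero => rw [map_zero]; exact zero_mem _
  | coe p =>
    rw [bBasis_apply, map_smul]
    refine Submodule.smul_mem _ _ ?_
    by_cases h : sharp p = nu
    · rw [projW_of_eq h]
      have := single_mem_wtSpan hn hD (i.val : ℤ) p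
      rwa [val_intCast, PD.hwt, h] at this
    · rw [projW_of_ne h]
      exact zero_mem _
  | add a b ha hb => rw [map_add]; exact add_mem ha hb
  | smul r a ha => rw [map_smul]; exact Submodule.smul_mem _ _ ha

lemma opL_mem_wtSpan (hn : 2 ≤ n) (hD : 0 < D) (i : ZMod n) (l : Letter n) {c : ℤ}
    (hc : ∀ mu : Wt n, l.shift mu i - l.shift mu (i + 1) = mu i - mu (i + 1) + c) {h : ℤ}
    {z : VD n D}
    (hz : z ∈ wtSpan (PD.crystal hn hD (i.val : ℤ)) (sBasis hn hD (i.val : ℤ)) h) :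
    opL l z ∈ wtSpan (PD.crystal hn hD (i.val : ℤ)) (sBasis hn hD (i.val : ℤ)) (h + c) := by
  have : NeZero n := ⟨by omega⟩
  rw [wtSpan_sBasis] at hz
  refine (Submodule.span_le (p := (wtSpan (PD.crystal hn hD (i.val : ℤ))
    (sBasis hn hD (i.val : ℤ)) (h + c)).comap (opL l))).2 ?_ hz
  rintro _ ⟨p, hp, rfl⟩
  have hp' : sharp p i - sharp p (i + 1) = h := by
    have : p.hwt (((i.val : ℤ)) : ZMod n) = h := hp
    rwa [val_intCast] at this
  have h1 := LinearMap.congr_fun (opL_mul_projW hn hD l (sharp p)) (bBasis n D p)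
  rw [Module.End.mul_apply, Module.End.mul_apply, bBasis_apply, map_smul (projW _),
    projW_of_eq rfl, ← bBasis_apply] at h1
  have h2 := projW_mem_wtSpan hn hD i (l.shift (sharp p)) (opL l (bBasis n D p))
  rw [← h1, hc, hp'] at h2
  exact h2

lemma shift_e {i j : ZMod n} (h : i ≠ j) (mu : Wt n) :
    (Letter.e j).shift mu i - (Letter.e j).shift mu (i + 1) = mu i - mu (i + 1) + cartan i j := by
  have h1 : i + 1 ≠ j + 1 := fun h1 => h (add_right_cancel h1)
  simp only [Letter.shift, Pi.add_apply, Pi.sub_apply, omega, Pi.single_apply, cartan, if_neg h,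
    if_neg h1]
  have h2 : i + 1 = j ↔ j = i + 1 := eq_comm
  simp only [h2]
  split_ifs <;> ring

lemma shift_f {i j : ZMod n} (h : i ≠ j) (mu : Wt n) :
    (Letter.f j).shift mu i - (Letter.f j).shift mu (i + 1) = mu i - mu (i + 1) + -cartan i j := by
  have h1 : i + 1 ≠ j + 1 := fun h1 => h (add_right_cancel h1)
  simp only [Letter.shift, Pi.add_apply, Pi.sub_apply, omega, Pi.single_apply, cartan, if_neg h,
    if_neg h1]
  have h2 : i + 1 = j ↔ j = i + 1 := eq_comm
  simp only [h2]
  split_ifs <;> ring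

lemma cartan_toNat {i j : ZMod n} (h : i ≠ j) : ((1 - cartan i j).toNat : ℤ) = 1 - cartan i j := by
  refine Int.toNat_of_nonneg ?_
  rw [cartan, if_neg h]
  split_ifs <;> norm_num

/-- With `m = 1 - a_{ij}`, the operator `e_j` commutes with `f_i` and changes the weight for the
index `i` by `a_{ij} = 1 - m`. These are the only two properties of `e_j` that the relation needs.
-/
lemma serreOp_opE (hn : 2 ≤ n) (hD : 0 < D) {i j : ZMod n} (h : i ≠ j) :
    serreOp v (opE (i.val : ℤ) : Module.End K (VD n D)) (opE (j.val : ℤ))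
      (1 - cartan i j).toNat = 0 := by
  refine (sBasis_isStringFamily hn hD (i.val : ℤ)).serreOp_eq_zero v_ne_zero v_sub_ne_zero
    qi_v_ne_zero (opE_opF_val hn hD h.symm) fun a z hz => ?_
  have := opL_mem_wtSpan hn hD i (.e j) (shift_e h) hz
  rw [cartan_toNat h]
  rwa [show a + 1 - (1 - cartan i j) = a + cartan i j by ring]

lemma wtSpan_swap {𝕜 V X : Type*} [Field 𝕜] [AddCommGroup V] [Module 𝕜 V] (C : Crystal X)
    (b : Module.Basis X 𝕜 V) (h : ℤ) : wtSpan C.swap b h = wtSpan C b (-h) := by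
  have : {w | (C.swap.phi w : ℤ) - C.swap.eps w = h} = {w | (C.phi w : ℤ) - C.eps w = -h} := by
    ext w
    show (C.eps w : ℤ) - C.phi w = h ↔ (C.phi w : ℤ) - C.eps w = -h
    omega
  rw [wtSpan, wtSpan, this]

lemma serreOp_opF (hn : 2 ≤ n) (hD : 0 < D) {i j : ZMod n} (h : i ≠ j) :
    serreOp v (opF (i.val : ℤ) : Module.End K (VD n D)) (opF (j.val : ℤ))
      (1 - cartan i j).toNat = 0 := by
  -- Exchanging the roles of `E` and `F` in the crystal reverses the sign of all weights and turns
  -- the same criterion into the relation for `f_i`.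
  refine (sBasis_isStringFamily hn hD (i.val : ℤ)).swap.serreOp_eq_zero v_ne_zero v_sub_ne_zero
    qi_v_ne_zero (opE_opF_val hn hD h).symm fun a z hz => ?_
  rw [wtSpan_swap] at hz ⊢
  have := opL_mem_wtSpan hn hD i (.f j) (shift_f h) hz
  rw [cartan_toNat h]
  rwa [show -(a + 1 - (1 - cartan i j)) = -a + -cartan i j by ring]

end Serre

/-! ### The homomorphism from the modified algebra -/

section Phi

variable {n D : ℕ}

/-- The operators attached to the generators of the modified algebra. -/
def genOp (D : ℕ) : UGen n → Module.End K (VD n D)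
  | .a mu => projW mu
  | .x l mu => opL l * projW mu

lemma genOp_mem_commutant (hn : 2 ≤ n) (hD : 0 < D) (g : UGen n) :
    genOp D g ∈ commutant n D := by
  cases g
  · exact projW_mem_commutant _
  · exact mul_mem (opL_mem_commutant hn hD _) (projW_mem_commutant _)

/-- The operators attached to the elements of the free algebra. -/
def freeRep (n D : ℕ) : FreeAlgebra K (UGen n) →ₐ[K] Module.End K (VD n D) :=
  FreeAlgebra.lift K (genOp D)

lemma freeRep_ι (g : UGen n) : freeRep n D (FreeAlgebra.ι K g) = genOp D g :=
  FreeAlgebra.lift_ι_apply _ _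

lemma prod_opL_mul_projW (hn : 2 ≤ n) (hD : 0 < D) (w : List (Letter n)) (mu : Wt n) :
    ((w.map opL).prod * projW mu : Module.End K (VD n D)) =
      projW (wordWt w mu) * (w.map opL).prod := by
  induction w with
  | nil => simp [wordWt]
  | cons l w ih =>
    rw [List.map_cons, List.prod_cons, wordWt, mul_assoc, ih, ← mul_assoc,
      opL_mul_projW hn hD, mul_assoc]

lemma freeRep_mono (hn : 2 ≤ n) (hD : 0 < D) (w : List (Letter n)) (mu : Wt n) :
    freeRep n D (mono w mu) = (w.map opL).prod * projW mu := by
  induction w with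
  | nil => rw [mono, freeRep_ι, List.map_nil, List.prod_nil, one_mul]; rfl
  | cons l w ih =>
    rw [mono, map_mul, ih, freeRep_ι, prod_opL_mul_projW hn hD, genOp, mul_assoc,
      ← mul_assoc (projW _) (projW _), projW_mul_self, ← prod_opL_mul_projW hn hD, ← mul_assoc,
      List.map_cons, List.prod_cons]

lemma freeRep_serre (hn : 2 ≤ n) (hD : 0 < D) (x y : Letter n) (m : ℕ) (mu : Wt n) :
    freeRep n D (serre x y m mu) = serreOp v (opL x) (opL y) m * projW mu := by
  rw [serre, serreOp, map_sum, Finset.sum_mul]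
  refine Finset.sum_congr rfl fun k _ => ?_
  rw [map_smul, freeRep_mono hn hD, List.map_append, List.map_cons, List.map_replicate,
    List.map_replicate, List.prod_append, List.prod_cons, List.prod_replicate, List.prod_replicate,
    divPow, divPow, smul_mul_assoc, smul_mul_assoc, mul_smul_comm, smul_mul_assoc,
    smul_mul_assoc, smul_mul_assoc, smul_smul, smul_smul, mul_inv, mul_assoc (opL x ^ k)]
  congr 1
  rw [mul_assoc, mul_comm (qfac v (m - k))⁻¹]
  rfl

lemma freeRep_rel (hn : 2 ≤ n) (hD : 0 < D) {a b : FreeAlgebra K (UGen n)} (h : UdotRel n a b) :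
    freeRep n D a = freeRep n D b := by
  induction h with
  | a_self mu => rw [map_mul, freeRep_ι]; exact projW_mul_self mu
  | a_orth mu nu h => rw [map_mul, freeRep_ι, freeRep_ι, map_zero]; exact projW_mul_of_ne h
  | a_neg mu h => rw [freeRep_ι, map_zero]; exact projW_of_neg h
  | x_source l mu =>
    rw [map_mul, freeRep_ι, freeRep_ι, genOp, genOp, mul_assoc, projW_mul_self]
  | x_target l mu =>
    rw [map_mul, freeRep_ι, freeRep_ι, genOp, genOp, opL_mul_projW hn hD, ← mul_assoc,
      projW_mul_self]
  | comm_self i mu =>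
    rw [map_sub, freeRep_mono hn hD, freeRep_mono hn hD, map_smul, freeRep_ι, genOp,
      ← commutator_projW hn hD]
    refine Eq.trans ?_ (sub_mul (α := Module.End K (VD n D)) _ _ _).symm
    simp [opL]
  | comm_ne i j h mu =>
    rw [map_sub, freeRep_mono hn hD, freeRep_mono hn hD, map_zero]
    have := opE_opF_val (D := D) hn hD h
    simp [opL, this]
  | serre_e i j h mu =>
    rw [freeRep_serre hn hD, map_zero]
    have := serreOp_opE (D := D) hn hD h
    rw [opL, opL, this, zero_mul]
  | serre_f i j h mu =>
    rw [freeRep_serre hn hD, map_zero]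
    have := serreOp_opF (D := D) hn hD h
    rw [opL, opL, this, zero_mul]

/-- The homomorphism from the modified algebra with unity to the commutant of the Hecke algebra. -/
def commRep (hn : 2 ≤ n) (hD : 0 < D) : UdotOne n →ₐ[K] commutant n D :=
  RingQuot.liftAlgHom K ⟨FreeAlgebra.lift K fun g => ⟨genOp D g, genOp_mem_commutant hn hD g⟩, by
    intro a b h
    have h1 : (commutant n D).val.comp
        (FreeAlgebra.lift K fun g => ⟨genOp D g, genOp_mem_commutant hn hD g⟩) = freeRep n D :=
      FreeAlgebra.hom_ext (funext fun g => by simp [freeRep])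
    have h2 := freeRep_rel hn hD h
    rw [← h1] at h2
    exact Subtype.ext h2⟩

lemma commRep_ugen (hn : 2 ≤ n) (hD : 0 < D) (g : UGen n) :
    (commRep hn hD (ugen g)).1 = genOp D g := by
  have : commRep hn hD (ugen g) = ⟨genOp D g, genOp_mem_commutant hn hD g⟩ := by
    rw [commRep, ugen]
    exact (RingQuot.liftAlgHom_mkAlgHom_apply K _ _ _).trans (FreeAlgebra.lift_ι_apply _ _)
  rw [this]

/-- The homomorphism from the modified algebra to the affine `q`-Schur algebra. -/
def phi (hn : 2 ≤ n) (hD : 0 < D) : Udot n →ₙₐ[K] SD n D :=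
  (((toSD (by omega : 0 < n) hD).comp (commRep hn hD) : UdotOne n →ₐ[K] SD n D) :
    UdotOne n →ₙₐ[K] SD n D).comp (NonUnitalSubalgebraClass.subtype (Udot n))

lemma phi_ua (hn : 2 ≤ n) (hD : 0 < D) (mu : Wt n) (z : VD n D) :
    phi hn hD (ua mu) (theta (by omega) hD z) = theta (by omega) hD (projW mu z) := by
  have := toSD_theta (by omega : 0 < n) hD (commRep hn hD (ugen (.a mu))) z
  rw [commRep_ugen] at this
  exact this

lemma phi_ux (hn : 2 ≤ n) (hD : 0 < D) (l : Letter n) (mu : Wt n) (z : VD n D) :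
    phi hn hD (ux l mu) (theta (by omega) hD z) = theta (by omega) hD (opL l (projW mu z)) := by
  have := toSD_theta (by omega : 0 < n) hD (commRep hn hD (ugen (.x l mu))) z
  rw [commRep_ugen] at this
  exact this

end Phi

/-! ### Relative positions of elements of `P_D` -/

section RelPos

variable {n D : ℕ}

lemma sum_sharp (hn : 0 < n) (hD : 0 < D) (p : PD n D) :
    ∑ j ∈ Finset.range n, sharp p (j : ZMod n) = D := by
  obtain ⟨lam, w, rfl⟩ := exists_CD_comp hn hD p
  have h1 : ∀ k : ℤ, k ≤ D ↔ k ≤ ∑ b ∈ Finset.range n, (sharpInt lam.1 (b + 1) : ℤ) := by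
    intro k
    rw [← CD.le_iff hn hD]
    have h2 := lam.pos_iff hD (k - D)
    have h3 := lam.1.shift (k - D) 1
    rw [one_mul, one_mul, sub_add_cancel] at h3
    rw [h3]
    constructor <;> intro h <;> by_contra h4
    · have := h2.1 (by omega); omega
    · have := h2.2 (by omega); omega
  have h2 : (D : ℤ) = ∑ b ∈ Finset.range n, (sharpInt lam.1 (b + 1) : ℤ) :=
    le_antisymm ((h1 D).1 le_rfl) ((h1 _).2 le_rfl)
  -- The sum obtained runs over the values `1, …, n`, the one wanted over `0, …, n - 1`; the fibres
  -- over `n` and `0` have the same size.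
  have h3 := Finset.sum_range_succ (fun b : ℕ => (sharpInt lam.1 b : ℤ)) n
  rw [Finset.sum_range_succ' (fun b : ℕ => (sharpInt lam.1 b : ℤ))] at h3
  have h4 : sharpInt lam.1 (n : ℤ) = sharpInt lam.1 0 := by
    simpa using sharpInt_add lam.1 0 1
  rw [h4] at h3
  push_cast at h3
  rw [sharp_comp]
  refine Eq.trans ?_ ((add_right_cancel h3).symm.trans h2.symm)
  refine Finset.sum_congr rfl fun j _ => ?_
  have := sharp_apply hn lam.1 (j : ℤ)
  rwa [Int.cast_natCast] at this

lemma relPos_pos (hn : 0 < n) (hD : 0 < D) (p q : PD n D) (k : ℤ) :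
    0 < relPos p.1 q.1 (p.1 k) (q.1 k) := by
  rw [relPos]
  have : {l | p.1 l = p.1 k ∧ q.1 l = q.1 k}.ncard ≠ 0 :=
    Set.ncard_ne_zero_of_mem (a := k) ⟨rfl, rfl⟩
      ((p.finite_fiber hn hD (p.1 k)).subset fun l hl => hl.1)
  omega

lemma relPos_eq_deltaMat (hn : 0 < n) (hD : 0 < D) {p q : PD n D} {lam : CD n D}
    (hp : ∀ a, sharpInt p a = sharpInt lam.1 a) :
    relPos p.1 q.1 = deltaMat lam ↔ p = q := by
  constructor
  · intro h
    ext k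
    have h1 := relPos_pos hn hD p q k
    rw [h, deltaMat] at h1
    by_contra h2
    rw [if_neg h2] at h1
    exact lt_irrefl _ h1
  · rintro rfl
    funext a b
    rw [relPos, deltaMat]
    split_ifs with h
    · subst h
      rw [← hp, sharpInt]
      simp only [and_self]
    · have : {k | p.1 k = a ∧ p.1 k = b} = ∅ := by
        ext k
        simp only [Set.mem_ofPred_eq, Set.mem_empty_iff_false, iff_false]
        rintro ⟨rfl, h2⟩
        exact h h2
      rw [this]
      simp

lemma intCast_eq_iff [NeZero n] {a : ℤ} {i : ZMod n} :
    (a : ZMod n) = i ↔ ∃ m : ℤ, a = i.val + m * n := by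
  rw [← modEq_iff_exists, ← ZMod.intCast_eq_intCast_iff, val_intCast]

/-- The relative position of `p` and `q` is given by `eMat` if and only if `p` arises from `q` by
replacing one value `i + 1` by `i`. -/
lemma relPos_eq_eMat (hn : 2 ≤ n) (hD : 0 < D) {p q : PD n D} {lam : CD n D} {i : ZMod n}
    (hp : ∀ a, sharpInt p a = sharpInt lam.1 a) :
    relPos p.1 q.1 = eMat lam i ↔ ∃ k, q.1 k = i.val + 1 ∧ p = q.set k i.val := by
  have hn0 : 0 < n := by omega
  have : NeZero n := ⟨hn0.ne'⟩
  constructor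
  · intro h
    -- Up to translation this is the only entry off the diagonal. It singles out the place `k` at
    -- which `p` and `q` differ; at every place not congruent to `k` they must agree.
    have h1 : relPos p.1 q.1 i.val (i.val + 1) = 1 := by
      rw [h, eMat, deltaMat, if_neg (by omega), if_neg (by omega), if_pos ⟨by simp, rfl⟩]
      ring
    rw [relPos, Nat.cast_eq_one, Set.ncard_eq_one] at h1
    obtain ⟨k, hk⟩ := h1
    have hk' : p.1 k = i.val ∧ q.1 k = i.val + 1 := by
      have : k ∈ {l | p.1 l = i.val ∧ q.1 l = i.val + 1} := by rw [hk]; rfl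
      exact this
    refine ⟨k, hk'.2, PD.ext fun l => ?_⟩
    have h2 := relPos_pos hn0 hD p q l
    by_cases hl : l ≡ k [ZMOD D]
    · obtain ⟨m, rfl⟩ := modEq_iff_exists.1 hl
      rw [PD.shift, PD.shift, PD.set_apply_self, hk'.1]
    · rw [PD.set_apply_of_not _ hl]
      by_contra h3
      rw [h, eMat, deltaMat, if_neg h3, if_neg (fun h4 => h3 h4.2.symm)] at h2
      split_ifs at h2 with h4
      · obtain ⟨m, hm⟩ := intCast_eq_iff.1 h4.1
        have h5 : l + (-m) * D ∈ {l | p.1 l = i.val ∧ q.1 l = i.val + 1} := by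
          refine ⟨?_, ?_⟩
          · rw [PD.shift, hm]; ring
          · rw [PD.shift, h4.2, hm]; ring
        rw [hk] at h5
        have h5 : l + (-m) * D = k := h5
        exact hl (modEq_iff_exists.2 ⟨m, by rw [← h5]; ring⟩)
      · exact lt_irrefl _ h2
  · rintro ⟨k, hk, rfl⟩
    funext a b
    have hcard : ((q.set k i.val).fib a).card = sharpInt lam.1 a := by
      rw [PD.card_fib _ hn0 hD, hp]
    have hset : {l | (q.set k i.val).1 l = a ∧ q.1 l = b} =
        (((q.set k i.val).fib a).filter fun l => q.1 l = b : Finset ℤ) := by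
      ext l
      simp [PD.mem_fib hn0 hD]
    have hsame : ∀ l, ¬ l ≡ k [ZMOD D] → q.1 l = (q.set k i.val).1 l := fun l hl =>
      (PD.set_apply_of_not _ hl).symm
    have hmod : ∀ l, l ≡ k [ZMOD D] → ((q.set k i.val).1 l : ZMod n) = i ∧
        q.1 l = (q.set k i.val).1 l + 1 := by
      intro l hl
      obtain ⟨m, rfl⟩ := modEq_iff_exists.1 hl
      rw [PD.shift, PD.shift, PD.set_apply_self, hk]
      exact ⟨intCast_eq_iff.2 ⟨m, rfl⟩, by ring⟩
    rw [relPos, hset, Set.ncard_coe_finset, eMat, deltaMat]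
    by_cases ha : (a : ZMod n) = i
    · obtain ⟨m, rfl⟩ := intCast_eq_iff.1 ha
      have hmem : k + m * D ∈ (q.set k i.val).fib (i.val + m * n) := by
        rw [PD.mem_fib hn0 hD, PD.shift, PD.set_apply_self]
      have huniq : ∀ l ∈ (q.set k i.val).fib (i.val + m * n), l ≡ k [ZMOD D] → l = k + m * D := by
        intro l hl hlk
        refine PD.eq_of_modEq hn0 (q.set k i.val)
          (hlk.trans (modEq_iff_exists.2 ⟨-m, by ring⟩)) ?_
        rw [PD.mem_fib hn0 hD] at hl hmem
        rw [hl, hmem]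
      by_cases hb : b = i.val + m * n
      · subst hb
        have : (((q.set k i.val).fib (i.val + m * n)).filter fun l => q.1 l = i.val + m * n) =
            ((q.set k i.val).fib (i.val + m * n)).erase (k + m * D) := by
          ext l
          rw [Finset.mem_filter, Finset.mem_erase, and_comm]
          refine and_congr_left fun hl => ?_
          rw [ne_eq]
          constructor
          · rintro h rfl
            rw [PD.shift, hk] at h
            omega
          · intro h
            rw [hsame l fun h1 => h (huniq l hl h1), (PD.mem_fib hn0 hD).1 hl]
        rw [this, if_pos rfl, if_pos ⟨ha, rfl⟩, if_neg (by omega), Finset.card_erase_of_mem hmem,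
          hcard, Nat.cast_sub]
        · push_cast; ring
        · rw [← hcard]; exact Finset.card_pos.2 ⟨_, hmem⟩
      · rw [if_neg (fun h => hb h.symm), if_neg (fun h => hb h.2)]
        by_cases hb' : b = i.val + m * n + 1
        · have : (((q.set k i.val).fib (i.val + m * n)).filter fun l => q.1 l = b) =
              {k + m * D} := by
            ext l
            rw [Finset.mem_filter, Finset.mem_singleton]
            constructor
            · rintro ⟨hl, h⟩
              refine huniq l hl (by_contra fun h1 => hb ?_)
              rw [← h, hsame l h1, (PD.mem_fib hn0 hD).1 hl]
            · rintro rfl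
              exact ⟨hmem, by rw [PD.shift, hk, hb']; ring⟩
          rw [this, if_pos ⟨ha, hb'⟩, Finset.card_singleton]
          rfl
        · rw [if_neg fun h => hb' h.2, Finset.card_eq_zero.2]
          · rfl
          · refine Finset.filter_eq_empty_iff.2 fun l hl h => ?_
            rw [PD.mem_fib hn0 hD] at hl
            by_cases h1 : l ≡ k [ZMOD D]
            · exact hb' (by rw [← h, (hmod l h1).2, hl])
            · exact hb (by rw [← h, hsame l h1, hl])
    · have ha1 : ¬ ((a : ZMod n) = i ∧ b = a) := fun h => ha h.1
      have ha2 : ¬ ((a : ZMod n) = i ∧ b = a + 1) := fun h => ha h.1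
      rw [if_neg ha1, if_neg ha2, sub_zero, add_zero]
      have hnk : ∀ l ∈ (q.set k i.val).fib a, q.1 l = a := by
        intro l hl
        rw [PD.mem_fib hn0 hD] at hl
        rw [hsame l fun h => ha (by rw [← hl]; exact (hmod l h).1), hl]
      split_ifs with h
      · subst h
        rw [Finset.filter_true_of_mem hnk, hcard]
      · rw [Finset.card_eq_zero.2]
        · rfl
        · exact Finset.filter_eq_empty_iff.2 fun l hl h1 => h ((hnk l hl).symm.trans h1)

/-! ### The exponents `y_s` -/

lemma ydim_deltaMat (lam : CD n D) : ydim n (deltaMat lam) = 0 := by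
  refine finsum_mem_eq_zero_of_forall_eq_zero ?_
  rintro ⟨a, b, c, d⟩ ⟨-, -, h1, h2⟩
  simp only at h1 h2
  show deltaMat lam a b * deltaMat lam c d = 0
  rw [deltaMat, deltaMat]
  split_ifs <;> omega

lemma finsum_mem_eq_of_unique {α M : Type*} [AddCommMonoid M] {S : Set α} {f : α → M} {a : α}
    (ha : a ∈ S) (h : ∀ x ∈ S, f x ≠ 0 → x = a) : ∑ᶠ x ∈ S, f x = f a := by
  rw [← finsum_mem_singleton (f := f) (a := a)]
  refine finsum_mem_inter_support_eq f S {a} (Set.ext fun x => ⟨?_, ?_⟩)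
  · rintro ⟨h1, h2⟩; exact ⟨h x h1 h2, h2⟩
  · rintro ⟨h1, h2⟩
    obtain rfl : x = a := h1
    exact ⟨ha, h2⟩

lemma eMat_ne_zero {lam : CD n D} {i : ZMod n} {a b : ℤ} (h : eMat lam i a b ≠ 0) :
    b = a ∨ ((a : ZMod n) = i ∧ b = a + 1) := by
  by_contra! h1
  refine h ?_
  rw [eMat, deltaMat, if_neg (fun h => h1.1 h.symm), if_neg (fun h => h1.1 h.2),
    if_neg (fun h => h1.2 h.1 h.2)]
  simp

lemma exists_rep [NeZero n] (i : ZMod n) :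
    ∃ a : ℤ, 1 ≤ a ∧ a ≤ n ∧ (a : ZMod n) = i ∧
      ∀ b : ℤ, 1 ≤ b → b ≤ n → (b : ZMod n) = i → b = a := by
  have hn : (0 : ℤ) < n := by exact_mod_cast NeZero.pos n
  obtain ⟨m, h1, h2⟩ := exists_shift_mem hn (i.val : ℤ)
  refine ⟨_, h1, h2, intCast_eq_iff.2 ⟨m, rfl⟩, fun b hb1 hb2 hb => ?_⟩
  obtain ⟨l, rfl⟩ := intCast_eq_iff.1 hb
  have : l = m := by nlinarith
  rw [this]

/-- A nonzero entry has column equal to its row or one more. So the conditions `d ≤ b` on the rows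
and `c < e` on the columns leave the single product of the entries `(a, a)` and `(a, a + 1)`, where
`a` represents `i` in `1, …, n`. -/
lemma ydim_eMat (hn : 2 ≤ n) (lam : CD n D) (i : ZMod n) :
    ydim n (eMat lam i) = sharp lam.1 i - 1 := by
  have : NeZero n := ⟨by omega⟩
  obtain ⟨a, h1, h2, h3, h4⟩ := exists_rep i
  rw [ydim, finsum_mem_eq_of_unique (a := (a, a, a, a + 1))]
  · show eMat lam i a a * eMat lam i a (a + 1) = _
    simp only [eMat, deltaMat, h3]
    rw [← h3, sharp_apply (by omega)]
    simp
  · exact ⟨h1, h2, le_rfl, lt_add_one a⟩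
  · rintro ⟨b, c, d, e⟩ ⟨hb1, hb2, hdb, hce⟩ hne
    simp only at hb1 hb2 hdb hce
    have e1 := eMat_ne_zero (left_ne_zero_of_mul hne)
    have e2 := eMat_ne_zero (right_ne_zero_of_mul hne)
    simp only at e1 e2
    rcases e2 with e2 | ⟨e2, e2'⟩
    · omega
    · obtain rfl : d = b := by omega
      obtain rfl := h4 d hb1 hb2 e2
      obtain rfl : c = d := by omega
      rw [e2']

/-- For the transpose the surviving product is that of the entries `(a, a - 1)` and `(a, a)`, now
with `a` representing `i + 1`. -/
lemma ydim_eMat_transpose (hn : 2 ≤ n) (lam : CD n D) (i : ZMod n) :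
    ydim n (fun k l => eMat lam i l k) = sharp lam.1 (i + 1) := by
  have : NeZero n := ⟨by omega⟩
  obtain ⟨a, h1, h2, h3, h4⟩ := exists_rep (i + 1)
  have h5 : ((a - 1 : ℤ) : ZMod n) = i := by push_cast; rw [h3]; ring
  have h6 : (a : ZMod n) ≠ i := by
    intro h
    refine not_modEq_add_one hn (a - 1) ((ZMod.intCast_eq_intCast_iff _ _ _).1 ?_)
    rw [h5, sub_add_cancel, h]
  rw [ydim, finsum_mem_eq_of_unique (a := (a, a - 1, a, a))]
  · show eMat lam i (a - 1) a * eMat lam i a a = _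
    simp only [eMat, deltaMat, h5]
    rw [← h3, sharp_apply (by omega)]
    have h7 : a ≠ a - 1 := by omega
    simp [h6, h7]
  · exact ⟨h1, h2, le_rfl, sub_one_lt a⟩
  · rintro ⟨b, c, d, e⟩ ⟨hb1, hb2, hdb, hce⟩ hne
    simp only at hb1 hb2 hdb hce
    have e1 := eMat_ne_zero (left_ne_zero_of_mul hne)
    have e2 := eMat_ne_zero (right_ne_zero_of_mul hne)
    simp only at e1 e2
    rcases e1 with e1 | ⟨e1, e1'⟩
    · omega
    · obtain rfl := h4 b hb1 hb2 (by rw [e1', Int.cast_add, e1, Int.cast_one])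
      have hd : d = b := by omega
      have he : e = b := by omega
      have hc : c = b - 1 := by omega
      rw [hd, he, hc]

end RelPos

/-! ### The homomorphism has the characterizing properties -/

section IsPhi

variable {n D : ℕ}

lemma theta_single_CD (hn : 0 < n) (hD : 0 < D) (mu : CD n D) :
    theta hn hD (Finsupp.single mu.1 1) = Tgen mu := by
  have := tp_comp hn hD mu 1
  rw [PD.comp_one] at this
  rw [theta_single, this, Tgen]

/-- The sum of the elements of a set of cosets. -/
lemma Tdouble_eq_sum (hn : 0 < n) (hD : 0 < D) {s : ℤ → ℤ → ℤ} {lam mu : CD n D} {F : Finset ℤ}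
    {g : ℤ → PD n D} (hg : Set.InjOn g F)
    (h : ∀ w : affineSym D, relPos (lam.1.comp w).1 mu.1.1 = s ↔ ∃ k ∈ F, lam.1.comp w = g k) :
    Tdouble s lam mu = ∑ k ∈ F, Tcoset lam (g k) := by
  have h1 : {w : affineSym D | relPos (fun k => lam.1.1 (w.1 k)) mu.1.1 = s} =
      ⋃ k ∈ (F : Set ℤ), cosetOf lam (g k) := by
    ext w
    rw [Set.mem_iUnion₂]
    refine (h w).trans ⟨?_, ?_⟩
    · rintro ⟨k, hk, hw⟩; exact ⟨k, hk, mem_cosetOf.2 hw⟩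
    · rintro ⟨k, hk, hw⟩; exact ⟨k, hk, mem_cosetOf.1 hw⟩
  rw [Tdouble, h1, finsum_mem_biUnion _ F.finite_toSet fun k _ => cosetOf_finite hn hD lam (g k)]
  · rw [finsum_mem_coe_finset]
    rfl
  · intro k hk l hl hkl
    refine Set.disjoint_left.2 fun w hw hw' => hkl (hg hk hl ?_)
    rw [← mem_cosetOf.1 hw, mem_cosetOf.1 hw']

lemma set_injOn (hn : 0 < n) (p : PD n D) {a b : ℤ} (hab : a ≠ b) {S : Set ℤ}
    (hS : ∀ k ∈ S, p.1 k = b) : Set.InjOn (fun k => p.set k a) S := by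
  intro k hk l hl h
  have h1 : (p.set k a).1 l = (p.set l a).1 l := by rw [show p.set k a = p.set l a from h]
  rw [PD.set_apply_self] at h1
  by_cases hlk : l ≡ k [ZMOD D]
  · exact (p.eq_of_modEq hn hlk ((hS l hl).trans (hS k hk).symm)).symm
  · rw [PD.set_apply_of_not _ hlk, hS l hl] at h1
    exact absurd h1.symm hab

/-- All places of value `i` precede those of value `i + 1` in a monotone function, so nothing is
subtracted in the exponent and all summands of `e_i T_μ` have the same coefficient. It agrees with
`y_s`, since `♯μ_i = ♯λ_i - 1`. -/
lemma expE_CD (hn : 0 < n) (hD : 0 < D) (mu : CD n D) {i k : ℤ} (hk : mu.1.1 k = i + 1) :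
    expE i mu.1 k = sharpInt mu.1 i := by
  have h : (mu.1.fib i).filter (k < ·) = ∅ := by
    refine Finset.filter_eq_empty_iff.2 fun l hl hkl => ?_
    rw [PD.mem_fib hn hD] at hl
    have := mu.monotone hD hkl.le
    omega
  rw [expE, h, PD.card_fib _ hn hD]
  simp

lemma expF_CD (hn : 0 < n) (hD : 0 < D) (mu : CD n D) {i k : ℤ} (hk : mu.1.1 k = i) :
    expF i mu.1 k = sharpInt mu.1 (i + 1) := by
  have h : (mu.1.fib (i + 1)).filter (· < k) = ∅ := by
    refine Finset.filter_eq_empty_iff.2 fun l hl hkl => ?_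
    rw [PD.mem_fib hn hD] at hl
    have := mu.monotone hD hkl.le
    omega
  rw [expF, h, PD.card_fib _ hn hD]
  simp

lemma Tcoset_eq_zero_of_sharp {kap : CD n D} {p : PD n D} (h : sharp p ≠ sharp kap.1) :
    Tcoset kap p = 0 :=
  Tcoset_eq_zero fun w hw => h (by rw [← hw, sharp_comp])

lemma theta_apply_sum (hn : 0 < n) (hD : 0 < D) (F : Finset ℤ) (c : ℤ → K) (g : ℤ → PD n D)
    (kap : CD n D) : (theta hn hD (∑ k ∈ F, c k • Finsupp.single (g k) 1) kap : Hecke D) =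
      ∑ k ∈ F, c k • Tcoset kap (g k) := by
  let ev : TD n D →+ Hecke D :=
    (rightIdeal kap).subtype.toAddMonoidHom.comp (Pi.evalAddMonoidHom (fun lam => rightIdeal lam) kap)
  change ev (theta hn hD (∑ k ∈ F, c k • Finsupp.single (g k) 1)) = _
  rw [map_sum, map_sum]
  refine Finset.sum_congr rfl fun k _ => ?_
  rw [map_smul, theta_single]
  rfl

/-- A criterion for an endomorphism to be a standard element. -/
lemma isStdEndo_of_sum (hn : 0 < n) (hD : 0 < D) {φ : SD n D} {s : ℤ → ℤ → ℤ} {lam mu : CD n D}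
    {F : Finset ℤ} {g : ℤ → PD n D} {c : ℤ → K} (hg : Set.InjOn g F)
    (hne : ∀ nu : CD n D, nu ≠ mu → φ (Tgen nu) = 0)
    (hmu : φ (Tgen mu) = theta hn hD (∑ k ∈ F, c k • Finsupp.single (g k) 1))
    (hc : ∀ k ∈ F, c k = v ^ ydim n s) (hsharp : ∀ k ∈ F, sharp (g k) = sharp lam.1)
    (h : ∀ w : affineSym D, relPos (lam.1.comp w).1 mu.1.1 = s ↔ ∃ k ∈ F, lam.1.comp w = g k) :
    IsStdEndo φ s lam mu := by
  intro nu kap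
  constructor
  · rintro ⟨rfl, rfl⟩
    rw [hmu, theta_apply_sum, Tdouble_eq_sum hn hD hg h, Finset.smul_sum]
    exact Finset.sum_congr rfl fun k hk => by rw [hc k hk]
  · intro h1
    by_cases h2 : nu = mu
    · subst h2
      rw [hmu, theta_apply_sum]
      refine Finset.sum_eq_zero fun k hk => ?_
      rw [Tcoset_eq_zero_of_sharp, smul_zero]
      rw [hsharp k hk]
      exact fun h3 => h1 ⟨rfl, (CD.eq_of_sharp hn hD h3).symm⟩
    · rw [hne nu h2]
      rfl

lemma phi_isPhi (hn : 2 ≤ n) (hD : 0 < D) : IsPhi (phi hn hD : Udot n →ₙₐ[K] SD n D) where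
  a_zero mu h0 hsum := by
    have hn0 : 0 < n := by omega
    have h1 : (projW mu : Module.End K (VD n D)) = 0 := end_ext fun p => by
      rw [projW_of_ne]
      · rfl
      · rintro rfl
        exact hsum (sum_sharp hn0 hD p)
    ext1 x
    obtain ⟨z, rfl⟩ := (theta hn0 hD).surjective x
    rw [phi_ua, h1, LinearMap.zero_apply, map_zero, LinearMap.zero_apply]
  a_sharp lam := by
    have hn0 : 0 < n := by omega
    have hphi : ∀ nu : CD n D, phi hn hD (ua (sharp lam.1)) (Tgen nu) =
        theta hn0 hD (projW (sharp lam.1) (Finsupp.single nu.1 1)) := fun nu => by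
      rw [← theta_single_CD hn0 hD, phi_ua]
    refine isStdEndo_of_sum hn0 hD (F := {0}) (g := fun _ => lam.1) (c := fun _ => 1)
      (by simp) (fun nu hnu => ?_) ?_ (by simp [ydim_deltaMat]) (by simp) (fun w => ?_)
    · rw [hphi, projW_of_ne fun h => hnu (CD.eq_of_sharp hn0 hD h), map_zero]
    · rw [hphi, projW_of_eq rfl]
      simp
    · rw [relPos_eq_deltaMat hn0 hD fun a => sharpInt_comp _ _ _]
      simp
  e_sharp i lam mu h1 hmu := by
    have hn0 : 0 < n := by omega
    have : NeZero n := ⟨hn0.ne'⟩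
    have hlam : (Letter.e i).shift (sharp mu.1) = sharp lam.1 := by
      rw [hmu, Letter.shift]; abel
    have hphi : ∀ nu : CD n D, phi hn hD (ua (sharp lam.1) * ux (.e i) (sharp mu.1)) (Tgen nu) =
        theta hn0 hD (opL (.e i) (projW (sharp mu.1) (Finsupp.single nu.1 1))) := fun nu => by
      rw [← theta_single_CD hn0 hD, map_mul, Module.End.mul_apply, phi_ux, phi_ua, ← hlam]
      congr 1
      have h := LinearMap.congr_fun (opL_mul_projW hn hD (.e i) (sharp mu.1))
        (projW (sharp mu.1) (Finsupp.single nu.1 1))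
      rw [Module.End.mul_apply, Module.End.mul_apply, ← Module.End.mul_apply (projW _) (projW _),
        projW_mul_self] at h
      exact h.symm
    have hii : i ≠ i + 1 := by
      intro h
      refine not_modEq_add_one hn (i.val : ℤ) ((ZMod.intCast_eq_intCast_iff _ _ _).1 ?_)
      push_cast
      rw [ZMod.natCast_zmod_val]
      exact h.symm
    refine isStdEndo_of_sum hn0 hD (F := mu.1.fib (i.val + 1)) (g := fun k => mu.1.set k i.val)
      (c := fun k => v ^ expE i.val mu.1 k)
      (set_injOn hn0 mu.1 (b := i.val + 1) (by omega) fun k hk => (PD.mem_fib hn0 hD).1 hk)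
      (fun nu hnu => ?_) ?_ (fun k hk => ?_) (fun k hk => ?_) (fun w => ?_)
    · rw [hphi, projW_of_ne fun h => hnu (CD.eq_of_sharp hn0 hD h), map_zero, map_zero]
    · rw [hphi, projW_of_eq rfl, opL, opE_single]
    · rw [PD.mem_fib hn0 hD] at hk
      rw [expE_CD hn0 hD mu hk, ydim_eMat hn, ← sharp_apply hn0, val_intCast, hmu]
      congr 1
      simp [omega, hii]
    · rw [PD.mem_fib hn0 hD] at hk
      rw [sharp_set hn hD mu.1 hk (not_modEq_add_one hn _), ← hlam, Letter.shift]
      push_cast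
      rw [ZMod.natCast_zmod_val]
    · rw [relPos_eq_eMat hn hD fun a => sharpInt_comp _ _ _]
      simp only [PD.mem_fib hn0 hD]
  f_sharp i lam mu h1 hmu := by
    have hn0 : 0 < n := by omega
    have : NeZero n := ⟨hn0.ne'⟩
    have hphi : ∀ nu : CD n D, phi hn hD (ux (.f i) (sharp lam.1)) (Tgen nu) =
        theta hn0 hD (opL (.f i) (projW (sharp lam.1) (Finsupp.single nu.1 1))) := fun nu => by
      rw [← theta_single_CD hn0 hD, phi_ux]
    refine isStdEndo_of_sum hn0 hD (F := lam.1.fib i.val) (g := fun k => lam.1.set k (i.val + 1))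
      (c := fun k => v ^ expF i.val lam.1 k)
      (set_injOn hn0 lam.1 (b := i.val) (by omega) fun k hk => (PD.mem_fib hn0 hD).1 hk)
      (fun nu hnu => ?_) ?_ (fun k hk => ?_) (fun k hk => ?_) (fun w => ?_)
    · rw [hphi, projW_of_ne fun h => hnu (CD.eq_of_sharp hn0 hD h), map_zero, map_zero]
    · rw [hphi, projW_of_eq rfl, opL, opF_single]
    · rw [PD.mem_fib hn0 hD] at hk
      rw [expF_CD hn0 hD lam hk, ydim_eMat_transpose hn, ← sharp_apply hn0]
      push_cast
      rw [ZMod.natCast_zmod_val]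
    · rw [PD.mem_fib hn0 hD] at hk
      rw [sharp_set hn hD lam.1 hk fun h => not_modEq_add_one hn _ h.symm, hmu]
      push_cast
      rw [ZMod.natCast_zmod_val]
      abel
    -- Transposing the matrix exchanges the two elements compared, so the description of `e_i` is
    -- reused with the roles reversed.
    · have h2 : relPos (mu.1.comp w).1 lam.1.1 = (fun k l => eMat lam i l k) ↔
          relPos lam.1.1 (mu.1.comp w).1 = eMat lam i := by
        have h3 : ∀ p q : ℤ → ℤ, relPos p q = fun a b => relPos q p b a := fun p q => by
          funext a b
          simp only [relPos, and_comm]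
        constructor
        · intro h; rw [h3, h]
        · intro h; rw [h3, h]
      rw [h2, relPos_eq_eMat hn hD fun a => rfl]
      constructor
      · rintro ⟨k, hk, h⟩
        have hk' : lam.1.1 k = i.val := by rw [h, PD.set_apply_self]
        exact ⟨k, (PD.mem_fib hn0 hD).2 hk', by rw [h, PD.set_set, PD.set_eq_self _ hk]⟩
      · rintro ⟨k, hk, h⟩
        rw [PD.mem_fib hn0 hD] at hk
        exact ⟨k, by rw [h, PD.set_apply_self], by rw [h, PD.set_set, PD.set_eq_self _ hk]⟩

/-! ### Uniqueness -/

/-- An endomorphism is determined by its values at the generators `T_λ`. -/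
lemma SD_ext (hD : 0 < D) {φ ψ : SD n D} (h : ∀ nu : CD n D, φ (Tgen nu) = ψ (Tgen nu)) :
    φ = ψ := by
  classical
  have := CD.finite (n := n) hD
  refine LinearMap.pi_ext' fun lam => LinearMap.ext fun y => ?_
  obtain ⟨y, hy⟩ := y
  obtain ⟨a, rfl⟩ := Submodule.mem_span_singleton.1 hy
  have h1 : (⟨a • Tcoset lam lam.1, hy⟩ : rightIdeal lam) =
      a • ⟨Tcoset lam lam.1, Submodule.subset_span rfl⟩ := rfl
  rw [h1, map_smul, map_smul]
  congr 1
  have h2 := h lam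
  simp only [LinearMap.comp_apply, LinearMap.coe_single]
  convert h2 <;> rw [Tgen]

lemma IsStdEndo.unique (hD : 0 < D) {φ ψ : SD n D} {s : ℤ → ℤ → ℤ} {lam mu : CD n D}
    (hφ : IsStdEndo φ s lam mu) (hψ : IsStdEndo ψ s lam mu) : φ = ψ := by
  refine SD_ext hD fun nu => funext fun kap => Subtype.ext ?_
  by_cases h : nu = mu ∧ kap = lam
  · rw [(hφ nu kap).1 h, (hψ nu kap).1 h]
  · rw [(hφ nu kap).2 h, (hψ nu kap).2 h]

lemma ugen_rel {a b : FreeAlgebra K (UGen n)} (h : UdotRel n a b) :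
    RingQuot.mkAlgHom K (UdotRel n) a = RingQuot.mkAlgHom K (UdotRel n) b :=
  RingQuot.mkAlgHom_rel K h

lemma ua_of_neg {mu : Wt n} (h : ∃ j, mu j < 0) : (ua mu : Udot n) = 0 :=
  Subtype.ext ((ugen_rel (UdotRel.a_neg mu h)).trans (map_zero _))

lemma ux_mul_ua (l : Letter n) (mu : Wt n) : ux l mu * ua mu = ux l mu :=
  Subtype.ext ((map_mul _ _ _).symm.trans (ugen_rel (UdotRel.x_source l mu)))

lemma ua_mul_ux (l : Letter n) (mu : Wt n) : ua (l.shift mu) * ux l mu = ux l mu :=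
  Subtype.ext ((map_mul _ _ _).symm.trans (ugen_rel (UdotRel.x_target l mu)))

lemma IsPhi.ua_eq_zero (hn : 0 < n) (hD : 0 < D) {Φ : Udot n →ₙₐ[K] SD n D} (H : IsPhi Φ)
    {mu : Wt n} (h : ¬ ∃ lam : CD n D, sharp lam.1 = mu) : Φ (ua mu) = 0 := by
  by_cases h0 : ∃ j, mu j < 0
  · rw [ua_of_neg h0, map_zero]
  · push Not at h0
    exact H.a_zero mu h0 fun hsum => h (exists_sharp_eq hn hD mu h0 hsum)

/-- A generator equals its product with the idempotents of its source and its target, and an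
idempotent whose weight is not some `♯λ` is killed: either an entry is negative or the sum of the
entries is not `D`. -/
lemma IsPhi.ux_eq_zero (hn : 0 < n) (hD : 0 < D) {Φ : Udot n →ₙₐ[K] SD n D} (H : IsPhi Φ)
    {l : Letter n} {mu : Wt n} (h : ¬ ((∃ lam : CD n D, sharp lam.1 = mu) ∧
      ∃ lam : CD n D, sharp lam.1 = l.shift mu)) : Φ (ux l mu) = 0 := by
  by_cases h1 : ∃ lam : CD n D, sharp lam.1 = mu
  · rw [← ua_mul_ux, map_mul, H.ua_eq_zero hn hD fun h2 => h ⟨h1, h2⟩, zero_mul]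
  · rw [← ux_mul_ua, map_mul, H.ua_eq_zero hn hD h1, mul_zero]

lemma IsPhi.unique (hn : 2 ≤ n) (hD : 0 < D) {Φ Ψ : Udot n →ₙₐ[K] SD n D} (hΦ : IsPhi Φ)
    (hΨ : IsPhi Ψ) : Ψ = Φ := by
  have hn0 : 0 < n := by omega
  have : NeZero n := ⟨hn0.ne'⟩
  have hii : ∀ i : ZMod n, i ≠ i + 1 := by
    intro i h
    refine not_modEq_add_one hn (i.val : ℤ) ((ZMod.intCast_eq_intCast_iff _ _ _).1 ?_)
    push_cast
    rw [ZMod.natCast_zmod_val]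
    exact h.symm
  have ha : ∀ mu, Ψ (ua mu) = Φ (ua mu) := by
    intro mu
    by_cases h : ∃ lam : CD n D, sharp lam.1 = mu
    · obtain ⟨lam, rfl⟩ := h
      exact (hΨ.a_sharp lam).unique hD (hΦ.a_sharp lam)
    · rw [hΨ.ua_eq_zero hn0 hD h, hΦ.ua_eq_zero hn0 hD h]
  have hx : ∀ l mu, Ψ (ux l mu) = Φ (ux l mu) := by
    intro l mu
    by_cases h : (∃ lam : CD n D, sharp lam.1 = mu) ∧ ∃ lam : CD n D, sharp lam.1 = l.shift mu
    · obtain ⟨⟨mu, rfl⟩, lam, hlam⟩ := h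
      cases l with
      | e i =>
        have h1 : sharp mu.1 = sharp lam.1 - omega i + omega (i + 1) := by
          rw [hlam, Letter.shift]; abel
        -- The property required of `e_i` presupposes `♯λ_i ≥ 1`. This is automatic: `♯μ_i = ♯λ_i -
        -- 1` is non-negative.
        have h2 : 1 ≤ sharp lam.1 i := by
          have := sharp_nonneg mu.1 i
          rw [h1] at this
          simp [omega, hii] at this
          omega
        have h3 := (hΨ.e_sharp i lam mu h2 h1).unique hD (hΦ.e_sharp i lam mu h2 h1)
        rwa [hlam, ua_mul_ux] at h3
      | f i =>
        have h2 : 1 ≤ sharp mu.1 i := by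
          have := sharp_nonneg lam.1 i
          rw [hlam, Letter.shift] at this
          simp [omega, hii] at this
          omega
        exact (hΨ.f_sharp i mu lam h2 hlam).unique hD (hΦ.f_sharp i mu lam h2 hlam)
    · rw [hΨ.ux_eq_zero hn0 hD h, hΦ.ux_eq_zero hn0 hD h]
  refine NonUnitalAlgHom.ext fun u => ?_
  obtain ⟨u, hu⟩ := u
  induction hu using NonUnitalAlgebra.adjoin_induction with
  | mem u hu =>
    obtain ⟨g, rfl⟩ := hu
    cases g with
    | a mu => exact ha mu
    | x l mu => exact hx l mu
  | add a b ha' hb' h1 h2 =>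
    have : (⟨a + b, add_mem ha' hb'⟩ : Udot n) = ⟨a, ha'⟩ + ⟨b, hb'⟩ := rfl
    exact (congrArg Ψ this).trans ((map_add Ψ _ _).trans
      ((congrArg₂ (· + ·) h1 h2).trans ((map_add Φ _ _).symm.trans (congrArg Φ this.symm))))
  | zero => exact (map_zero Ψ).trans (map_zero Φ).symm
  | mul a b ha' hb' h1 h2 =>
    have : (⟨a * b, mul_mem ha' hb'⟩ : Udot n) = ⟨a, ha'⟩ * ⟨b, hb'⟩ := rfl
    exact (congrArg Ψ this).trans ((map_mul Ψ _ _).trans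
      ((congrArg₂ (· * ·) h1 h2).trans ((map_mul Φ _ _).symm.trans (congrArg Φ this.symm))))
  | smul r a ha' h1 =>
    have : (⟨r • a, SMulMemClass.smul_mem r ha'⟩ : Udot n) = r • ⟨a, ha'⟩ := rfl
    exact (congrArg Ψ this).trans ((map_smul Ψ _ _).trans
      ((congrArg (r • ·) h1).trans ((map_smul Φ _ _).symm.trans (congrArg Φ this.symm))))

end IsPhi

/-! ### Lattices with a basis -/

section Lattice

variable {M X : Type*} [AddCommGroup M] [Module K M]

/-- The `Z₀`-lattice spanned by a basis. -/
def latticeOf (b : Module.Basis X K M) : Submodule Z₀ M := Submodule.span Z₀ (Set.range b)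

/-- The basis of the lattice. -/
def latticeBasis (b : Module.Basis X K M) : Module.Basis X Z₀ (latticeOf b) := b.restrictScalars Z₀

lemma latticeBasis_coe (b : Module.Basis X K M) (p : X) : (latticeBasis b p : M) = b p :=
  b.restrictScalars_apply Z₀ p

/-- The class of a basis vector modulo `v`. -/
def basisCls (b : Module.Basis X K M) (p : X) : latticeOf b ⧸ vL (latticeOf b) :=
  cls (latticeOf b) (latticeBasis b p)

lemma map_mem_latticeOf {b b' : Module.Basis X K M} (f : Module.End K M)
    (h : ∀ p, f (b p) ∈ latticeOf b') {x : M} (hx : x ∈ latticeOf b) : f x ∈ latticeOf b' := by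
  induction hx using Submodule.span_induction with
  | mem x hx => obtain ⟨p, rfl⟩ := hx; exact h p
  | zero => rw [map_zero]; exact zero_mem _
  | add x y _ _ hx hy => rw [map_add]; exact add_mem hx hy
  | smul r x _ hx =>
    rw [show r • x = (r : K) • x from rfl, map_smul]
    exact Submodule.smul_mem _ r hx

lemma cls_eq_of_sub {L : Submodule Z₀ M} {x y m : L} (h : (x : M) = y + v • (m : M)) :
    cls L x = cls L y := by
  refine (Submodule.Quotient.eq _).2 ?_
  have : x - y = vZ • m := Subtype.ext (by
    show (x : M) - y = v • (m : M)
    rw [h, add_sub_cancel_left])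
  rw [this]
  exact Submodule.smul_mem_smul (Ideal.mem_span_singleton_self _) trivial

lemma v_inv_notMem : v⁻¹ ∉ Z₀ := by
  rintro ⟨a, c, hc, h⟩
  have hc' : algebraMap ℂ[X] K c ≠ 0 := fun h0 =>
    hc (by rw [(map_eq_zero_iff _ (RatFunc.algebraMap_injective ℂ)).1 h0, eval_zero])
  rw [eq_div_iff hc', inv_mul_eq_iff_eq_mul₀ v_ne_zero, v, ← RatFunc.algebraMap_X, ← map_mul] at h
  rw [RatFunc.algebraMap_injective ℂ h] at hc
  simp at hc

/-- If `v` generated the unit ideal, its inverse would be regular at `0`. The nontriviality is what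
separates different classes `[p]` modulo `v`. -/
lemma residue_nontrivial : Nontrivial (Z₀ ⧸ Ideal.span {vZ}) := by
  refine Ideal.Quotient.nontrivial_iff.2 fun h => ?_
  obtain ⟨u, hu⟩ := isUnit_iff_exists_inv.1 (Ideal.span_singleton_eq_top.1 h)
  refine v_inv_notMem ?_
  rw [inv_eq_of_mul_eq_one_right (a := v) (b := (u : K)) (congrArg Subtype.val hu)]
  exact u.2

/-- The coordinates modulo `v`. -/
def coordMod (b : Module.Basis X K M) (p : X) :
    (latticeOf b ⧸ vL (latticeOf b)) →ₗ[Z₀] Z₀ ⧸ Ideal.span {vZ} :=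
  Submodule.liftQ _ ((Submodule.mkQ (Ideal.span {vZ})).comp ((latticeBasis b).coord p)) (by
    refine Submodule.smul_le.2 fun r hr m _ => ?_
    rw [LinearMap.mem_ker, LinearMap.comp_apply, map_smul, Submodule.mkQ_apply,
      Submodule.Quotient.mk_eq_zero, smul_eq_mul]
    exact Ideal.mul_mem_right _ _ hr)

lemma coordMod_basisCls_self (b : Module.Basis X K M) (p : X) :
    coordMod b p (basisCls b p) = 1 := by
  rw [coordMod, basisCls, cls, Submodule.liftQ_apply, LinearMap.comp_apply,
    Module.Basis.coord_apply, Module.Basis.repr_self, Finsupp.single_eq_same]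
  rfl

lemma coordMod_basisCls_of_ne (b : Module.Basis X K M) {p q : X} (h : q ≠ p) :
    coordMod b p (basisCls b q) = 0 := by
  rw [coordMod, basisCls, cls, Submodule.liftQ_apply, LinearMap.comp_apply,
    Module.Basis.coord_apply, Module.Basis.repr_self, Finsupp.single_eq_of_ne h.symm, map_zero]

lemma basisCls_ne_zero (b : Module.Basis X K M) (p : X) : basisCls b p ≠ 0 := fun h => by
  have := residue_nontrivial
  have h1 := coordMod_basisCls_self b p
  rw [h, map_zero] at h1
  exact zero_ne_one h1

lemma basisCls_injective (b : Module.Basis X K M) : Function.Injective (basisCls b) := by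
  intro p q h
  by_contra hpq
  have := residue_nontrivial
  have h1 := coordMod_basisCls_self b p
  rw [h, coordMod_basisCls_of_ne b (Ne.symm hpq)] at h1
  exact zero_ne_one h1

lemma basisCls_linearIndependent (b : Module.Basis X K M) :
    LinearIndependent (Z₀ ⧸ Ideal.span {vZ}) (basisCls b) := by
  rw [linearIndependent_iff']
  intro s g hg p hp
  choose r hr using fun q => Ideal.Quotient.mk_surjective (g q)
  have h1 : ∑ q ∈ s, r q • basisCls b q = 0 := by
    rw [← hg]
    exact Finset.sum_congr rfl fun q _ => by rw [← hr]; rfl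
  have h2 := congrArg (coordMod b p) h1
  rw [map_sum, map_zero, Finset.sum_eq_single_of_mem p hp fun q _ hq => by
    rw [map_smul, coordMod_basisCls_of_ne b hq, smul_zero], map_smul, coordMod_basisCls_self] at h2
  rw [← hr, ← h2, Algebra.smul_def, mul_one]
  rfl

lemma span_basisCls (b : Module.Basis X K M) :
    Submodule.span (Z₀ ⧸ Ideal.span {vZ}) (Set.range (basisCls b)) = ⊤ := by
  refine Submodule.eq_top_iff'.2 fun y => ?_
  obtain ⟨x, rfl⟩ := Submodule.Quotient.mk_surjective _ y
  have hx : x ∈ Submodule.span Z₀ (Set.range (latticeBasis b)) := by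
    rw [Module.Basis.span_eq]; trivial
  induction hx using Submodule.span_induction with
  | mem x hx => obtain ⟨p, rfl⟩ := hx; exact Submodule.subset_span ⟨p, rfl⟩
  | zero => exact zero_mem _
  | add x y _ _ hx hy => exact add_mem hx hy
  | smul r x _ hx => exact Submodule.smul_mem _ (Ideal.Quotient.mk _ r) hx

lemma exists_lift_basisCls {b s : Module.Basis X K M}
    (hs : ∀ p, ∃ m ∈ latticeOf b, s p = b p + v • m) (p : X) :
    ∃ x : latticeOf b, (x : M) = s p ∧ cls (latticeOf b) x = basisCls b p := by
  obtain ⟨m, hm, h⟩ := hs p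
  have hv : v • m ∈ latticeOf b := Submodule.smul_mem _ vZ hm
  refine ⟨⟨s p, h ▸ add_mem (Submodule.subset_span ⟨p, rfl⟩) hv⟩, rfl, ?_⟩
  refine cls_eq_of_sub (m := ⟨m, hm⟩) ?_
  rw [latticeBasis_coe]
  exact h

/-- An operator that maps a vector of a basis `s`, which agrees with `b` modulo `v`, to another
vector of this basis. -/
lemma induced_basisCls {b s : Module.Basis X K M}
    (hs : ∀ p, ∃ m ∈ latticeOf b, s p = b p + v • m) {G : Module.End K M}
    (hG : ∀ x ∈ latticeOf b, G x ∈ latticeOf b) {p q : X} (h : G (s p) = s q) :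
    induced (latticeOf b) G hG (basisCls b p) = basisCls b q := by
  obtain ⟨x, hx, hxp⟩ := exists_lift_basisCls hs p
  obtain ⟨y, hy, hyq⟩ := exists_lift_basisCls hs q
  rw [← hxp, ← hyq]
  show cls (latticeOf b) ⟨G x, _⟩ = _
  congr 1
  exact Subtype.ext (by rw [hy, ← h, ← hx])

lemma induced_basisCls_eq_zero {b s : Module.Basis X K M}
    (hs : ∀ p, ∃ m ∈ latticeOf b, s p = b p + v • m) {G : Module.End K M}
    (hG : ∀ x ∈ latticeOf b, G x ∈ latticeOf b) {p : X} (h : G (s p) = 0) :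
    induced (latticeOf b) G hG (basisCls b p) = 0 := by
  obtain ⟨x, hx, hxp⟩ := exists_lift_basisCls hs p
  rw [← hxp]
  have h0 : restrictTo (latticeOf b) G hG x = 0 := Subtype.ext (by
    show G (x : M) = 0
    rw [hx, h])
  show cls (latticeOf b) (restrictTo (latticeOf b) G hG x) = 0
  rw [h0]
  rfl

/-! ### Crystal bases from string bases -/

/-- A basis `b` of weight vectors such that, for all `i`, there is a basis that agrees with `b`
modulo `v`, spans the same lattice, and on which the Kashiwara operators act by permuting the
elements of strings, defines a crystal base. -/
lemma isCrystalBase_latticeOf {n : ℕ} (ρ : Udot n →ₙₐ[K] Module.End K M) (b : Module.Basis X K M)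
    (wt : X → Wt n) (hwt : ∀ p, b p ∈ wtSpace ρ (wt p))
    (hL : ∀ mu p, ρ (ua mu) (b p) ∈ latticeOf b) (C : ZMod n → Crystal X)
    (s : ZMod n → Module.Basis X K M) (hs : ∀ i p, ∃ m ∈ latticeOf b, s i p = b p + v • m)
    (hb : ∀ i p, b p ∈ latticeOf (s i))
    (hK : ∀ i, IsKashiwara ρ i (kashE (C i) (s i)) (kashF (C i) (s i))) :
    IsCrystalBase ρ (latticeOf b) (Set.range (basisCls b)) := by
  have hsL : ∀ i p, s i p ∈ latticeOf b := fun i p => by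
    obtain ⟨m, hm, h⟩ := hs i p
    have hv : v • m ∈ latticeOf b := Submodule.smul_mem _ vZ hm
    rw [h]
    exact add_mem (Submodule.subset_span ⟨p, rfl⟩) hv
  have hpres : ∀ i (G : Module.End K M), (∀ p, G (s i p) ∈ latticeOf b) →
      ∀ x ∈ latticeOf b, G x ∈ latticeOf b := by
    intro i G hG x hx
    -- The lattice is contained in the span of the string basis, so it is enough to know the
    -- operator on string vectors.
    refine map_mem_latticeOf (b := s i) G hG ?_
    exact map_mem_latticeOf (b := b) LinearMap.id (hb i) hx
  have hE : ∀ i, ∀ x ∈ latticeOf b, kashE (C i) (s i) x ∈ latticeOf b := fun i =>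
    hpres i _ fun p => by
      rw [kashE_basis]
      split_ifs
      · exact zero_mem _
      · exact hsL _ _
  have hF : ∀ i, ∀ x ∈ latticeOf b, kashF (C i) (s i) x ∈ latticeOf b := fun i =>
    hpres i _ fun p => by
      rw [kashF_basis]
      split_ifs
      · exact zero_mem _
      · exact hsL _ _
  have hE0 : ∀ i p, (C i).eps p = 0 →
      induced (latticeOf b) (kashE (C i) (s i)) (hE i) (basisCls b p) = 0 := fun i p h =>
    induced_basisCls_eq_zero (hs i) _ (by rw [kashE_basis, if_pos h])
  have hE1 : ∀ i p, (C i).eps p ≠ 0 →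
      induced (latticeOf b) (kashE (C i) (s i)) (hE i) (basisCls b p) =
        basisCls b ((C i).et p) := fun i p h =>
    induced_basisCls (hs i) _ (by rw [kashE_basis, if_neg h])
  have hF0 : ∀ i p, (C i).phi p = 0 →
      induced (latticeOf b) (kashF (C i) (s i)) (hF i) (basisCls b p) = 0 := fun i p h =>
    induced_basisCls_eq_zero (hs i) _ (by rw [kashF_basis, if_pos h])
  have hF1 : ∀ i p, (C i).phi p ≠ 0 →
      induced (latticeOf b) (kashF (C i) (s i)) (hF i) (basisCls b p) =
        basisCls b ((C i).ft p) := fun i p h =>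
    induced_basisCls (hs i) _ (by rw [kashF_basis, if_neg h])
  refine ⟨Module.Free.of_basis (latticeBasis b), ?_, ?_, ?_, span_basisCls b, ?_, ?_⟩
  · refine top_le_iff.1 (b.span_eq.ge.trans (Submodule.span_mono ?_))
    exact Submodule.subset_span
  · exact fun x hx mu => map_mem_latticeOf _ (hL mu) hx
  · exact (basisCls_linearIndependent b).linearIndepOn_id
  · rintro _ ⟨p, rfl⟩
    exact ⟨wt p, latticeBasis b p, by rw [latticeBasis_coe]; exact hwt p, rfl⟩
  · refine ⟨fun i => kashE (C i) (s i), fun i => kashF (C i) (s i), hK, hE, hF, ?_, ?_, ?_⟩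
    · rintro i _ ⟨p, rfl⟩
      by_cases h : (C i).eps p = 0
      · exact Or.inr (hE0 i p h)
      · exact Or.inl ⟨_, (hE1 i p h).symm⟩
    · rintro i _ ⟨p, rfl⟩
      by_cases h : (C i).phi p = 0
      · exact Or.inr (hF0 i p h)
      · exact Or.inl ⟨_, (hF1 i p h).symm⟩
    · rintro i _ ⟨p, rfl⟩ _ ⟨q, rfl⟩
      constructor
      · intro h
        by_cases he : (C i).eps p = 0
        · exact absurd (h.symm.trans (hE0 i p he)) (basisCls_ne_zero b q)
        -- Different basis vectors have different classes, so an equality of classes is an equality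
        -- in the combinatorial crystal, where `ft` inverts `et`.
        · obtain rfl := basisCls_injective b ((hE1 i p he).symm.trans h)
          have hpos := Nat.pos_of_ne_zero he
          refine (hF1 i _ ?_).trans ?_
          · rw [(C i).phi_et p hpos]; exact Nat.succ_ne_zero _
          · rw [(C i).ft_et p hpos]
      · intro h
        by_cases hf : (C i).phi q = 0
        · exact absurd (h.symm.trans (hF0 i q hf)) (basisCls_ne_zero b p)
        · obtain rfl := basisCls_injective b ((hF1 i q hf).symm.trans h)
          have hpos := Nat.pos_of_ne_zero hf
          refine (hE1 i _ ?_).trans ?_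
          · rw [(C i).eps_ft q hpos]; exact Nat.succ_ne_zero _
          · rw [(C i).et_ft q hpos]

end Lattice

/-! ### The module `T_D` -/

section Module

variable {n D : ℕ}

lemma projW_apply (mu : Wt n) (z : VD n D) (p : PD n D) [Decidable (sharp p = mu)] :
    projW mu z p = if sharp p = mu then z p else 0 := by
  classical
  induction z using Finsupp.induction_linear with
  | zero => simp
  | add y z hy hz => rw [map_add, Finsupp.add_apply, hy, hz, Finsupp.add_apply]; split_ifs <;> simp
  | single q a =>
    rw [← Finsupp.smul_single_one, map_smul, projW_single]
    by_cases h : q = p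
    · subst h; split_ifs <;> simp
    · split_ifs <;> simp [Finsupp.single_eq_of_ne (Ne.symm h)]

open Classical in
/-- A finite set that contains the weights of all components of `z`. -/
def wtSupport (z : VD n D) : Finset (Wt n) := z.support.image sharp

lemma projW_eq_zero {mu : Wt n} {z : VD n D} (h : mu ∉ wtSupport z) : projW mu z = 0 := by
  classical
  ext p
  rw [projW_apply]
  split_ifs with hp
  · by_contra h0
    exact h (Finset.mem_image.2 ⟨p, Finsupp.mem_support_iff.2 h0, hp⟩)
  · rfl

lemma sum_projW (z : VD n D) : ∑ mu ∈ wtSupport z, projW mu z = z := by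
  classical
  ext p
  rw [Finsupp.finsetSum_apply]
  simp only [projW_apply]
  rw [Finset.sum_ite_eq]
  split_ifs with h
  · rfl
  · by_contra h0
    exact h (Finset.mem_image.2 ⟨p, Finsupp.mem_support_iff.2 (Ne.symm h0), rfl⟩)

lemma projW_bBasis_self (p : PD n D) : projW (sharp p) (bBasis n D p) = bBasis n D p := by
  rw [bBasis_apply, map_smul, projW_of_eq rfl]

lemma projW_bBasis_of_ne {mu : Wt n} {p : PD n D} (h : sharp p ≠ mu) :
    projW mu (bBasis n D p) = 0 := by
  rw [bBasis_apply, map_smul, projW_of_ne h, smul_zero]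

variable (hn : 2 ≤ n) (hD : 0 < D)

lemma projW_eq_zero_of_mem_wtSpan {i : ZMod n} {h : ℤ} {z : VD n D}
    (hz : z ∈ wtSpan (PD.crystal hn hD i.val) (sBasis hn hD i.val) h) {mu : Wt n}
    (hmu : mu i - mu (i + 1) ≠ h) : projW mu z = 0 := by
  have : NeZero n := ⟨by omega⟩
  rw [wtSpan_sBasis] at hz
  have : Submodule.span K (bBasis n D '' {q | q.hwt (((i.val : ℤ)) : ZMod n) = h}) ≤
      LinearMap.ker (projW mu) := by
    refine Submodule.span_le.2 ?_
    rintro _ ⟨p, hp, rfl⟩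
    refine projW_bBasis_of_ne fun h1 => hmu ?_
    have hp' : p.hwt (((i.val : ℤ)) : ZMod n) = h := hp
    rw [val_intCast, PD.hwt, h1] at hp'
    exact hp'
  exact this hz

/-- The module `T_D`, as a representation of the modified algebra. -/
def repD : Udot n →ₙₐ[K] Module.End K (TD n D) := toRep (phi hn hD)

/-- The basis `[p]` of `T_D`. -/
def stdBasis (hn : 0 < n) (hD : 0 < D) : Module.Basis (PD n D) K (TD n D) :=
  (bBasis n D).map (theta hn hD)

lemma stdBasis_apply (hn : 0 < n) (hD : 0 < D) (p : PD n D) : stdBasis hn hD p = std p := by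
  rw [stdBasis, Module.Basis.map_apply, bBasis_apply, map_smul, theta_single, std_eq hn hD]

lemma repD_ua (mu : Wt n) (z : VD n D) :
    repD hn hD (ua mu) (theta (by omega) hD z) = theta (by omega) hD (projW mu z) :=
  phi_ua hn hD mu z

/-- Only finitely many weights occur in `z`, so the sum over all weights in `act` is finite, and the
weight components add up to `z`. -/
lemma act_repD (l : Letter n) (z : VD n D) :
    act (repD hn hD) l (theta (by omega) hD z) = theta (by omega) hD (opL l z) := by
  have h : ∀ mu, repD hn hD (ux l mu) (theta (by omega) hD z) =
      theta (by omega) hD (opL l (projW mu z)) := fun mu => phi_ux hn hD l mu z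
  rw [act, finsum_eq_sum_of_support_subset (s := wtSupport z)]
  · simp only [h]
    rw [← map_sum, ← map_sum, sum_projW]
  · intro mu hmu
    by_contra h0
    refine hmu ?_
    beta_reduce
    rw [h, projW_eq_zero h0, map_zero, map_zero]

lemma act_repD_iterate (l : Letter n) (N : ℕ) (z : VD n D) :
    (act (repD hn hD) l)^[N] (theta (by omega) hD z) = theta (by omega) hD ((opL l ^ N) z) := by
  induction N with
  | zero => rfl
  | succ N ih => rw [Function.iterate_succ_apply', ih, act_repD, pow_succ', Module.End.mul_apply]

lemma fDiv_repD (i : ZMod n) (k : ℕ) (z : VD n D) :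
    fDiv (repD hn hD) i k (theta (by omega) hD z) =
      theta (by omega) hD (divPow v (opF (i.val : ℤ)) k z) := by
  rw [fDiv, act_repD_iterate, divPow, LinearMap.smul_apply, map_smul]
  rfl

lemma theta_mem_wtSpace {mu : Wt n} {z : VD n D} (h : projW mu z = z) :
    theta (by omega) hD z ∈ wtSpace (repD hn hD) mu :=
  ⟨theta (by omega) hD z, by rw [repD_ua, h]⟩

lemma projW_of_mem_wtSpace {mu : Wt n} {z : VD n D}
    (h : theta (by omega) hD z ∈ wtSpace (repD hn hD) mu) : projW mu z = z := by
  obtain ⟨y, hy⟩ := h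
  obtain ⟨y, rfl⟩ := (theta (by omega : 0 < n) hD).surjective y
  rw [repD_ua] at hy
  rw [← (theta (by omega : 0 < n) hD).injective hy, ← Module.End.mul_apply, projW_mul_self]

theorem isIntegrable_repD : IsIntegrable (repD hn hD) where
  weight := by
    refine top_le_iff.1 ((stdBasis (by omega : 0 < n) hD).span_eq.ge.trans ?_)
    refine Submodule.span_le.2 ?_
    rintro _ ⟨p, rfl⟩
    refine Submodule.mem_iSup_of_mem (sharp p) ?_
    exact theta_mem_wtSpace hn hD (projW_bBasis_self p)
  nilpotent l m := by
    obtain ⟨z, rfl⟩ := (theta (by omega : 0 < n) hD).surjective m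
    simp only [act_repD_iterate]
    cases l with
    | e i =>
      obtain ⟨N, h⟩ := (sBasis_isStringFamily hn hD i.val).swap.exists_F_pow_eq_zero z
      exact ⟨N, (congrArg _ h).trans (map_zero _)⟩
    | f i =>
      obtain ⟨N, h⟩ := (sBasis_isStringFamily hn hD i.val).exists_F_pow_eq_zero z
      exact ⟨N, (congrArg _ h).trans (map_zero _)⟩

/-- The string basis of `T_D` for the index `i`. -/
def stringBasis (i : ZMod n) : Module.Basis (PD n D) K (TD n D) :=
  (sBasis hn hD i.val).map (theta (by omega) hD)

lemma kashE_map {X V W : Type*} [AddCommGroup V] [Module K V] [AddCommGroup W] [Module K W]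
    (C : Crystal X) (b : Module.Basis X K V) (e : V ≃ₗ[K] W) (z : V) :
    kashE C (b.map e) (e z) = e (kashE C b z) := by
  suffices h : kashE C (b.map e) ∘ₗ e.toLinearMap = e.toLinearMap ∘ₗ kashE C b from
    LinearMap.congr_fun h z
  refine b.ext fun w => ?_
  have := kashE_basis (C := C) (b := b.map e) w
  rw [Module.Basis.map_apply, Module.Basis.map_apply] at this
  rw [LinearMap.comp_apply, LinearMap.comp_apply, LinearEquiv.coe_coe, this, kashE_basis]
  split_ifs <;> simp

lemma kashF_map {X V W : Type*} [AddCommGroup V] [Module K V] [AddCommGroup W] [Module K W]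
    (C : Crystal X) (b : Module.Basis X K V) (e : V ≃ₗ[K] W) (z : V) :
    kashF C (b.map e) (e z) = e (kashF C b z) := kashE_map C.swap b e z

lemma isString_iff {i : ZMod n} {mu : Wt n} {z : VD n D} {k : ℕ} :
    IsString (repD hn hD) i mu (theta (by omega) hD z) k ↔
      projW mu z = z ∧ opE (i.val : ℤ) z = 0 ∧ (k : ℤ) ≤ mu i - mu (i + 1) := by
  rw [IsString, act_repD, LinearEquiv.map_eq_zero_iff]
  exact and_congr_left' ⟨projW_of_mem_wtSpace hn hD, theta_mem_wtSpace hn hD⟩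

/-- The Kashiwara operators are given by the string bases. -/
lemma isKashiwara_repD (i : ZMod n) :
    IsKashiwara (repD hn hD) i (kashE (PD.crystal hn hD i.val) (stringBasis hn hD i))
      (kashF (PD.crystal hn hD i.val) (stringBasis hn hD i)) := by
  have : NeZero n := ⟨by omega⟩
  have H := sBasis_isStringFamily hn hD i.val
  have hmem : ∀ {mu : Wt n} {z : VD n D}, projW mu z = z →
      z ∈ wtSpan (PD.crystal hn hD i.val) (sBasis hn hD i.val) (mu i - mu (i + 1)) := by
    intro mu z hz
    rw [← hz]
    exact projW_mem_wtSpan hn hD i mu z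
  have hsur := (theta (D := D) (by omega : 0 < n) hD).surjective
  refine ⟨?_, ?_, ?_, ?_⟩
  · refine top_le_iff.1 ((stringBasis hn hD i).span_eq.ge.trans ?_)
    refine Submodule.span_le.2 ?_
    rintro _ ⟨p, rfl⟩
    obtain ⟨u, hu, hphi, hp⟩ := H.exists_divPow qi_v_ne_zero p
    set k := (PD.crystal hn hD (i.val : ℤ)).eps p
    have hE : opE (i.val : ℤ) (sBasis hn hD i.val u) = 0 := by rw [H.E_apply, if_pos hu]
    -- The string vector of `u` is known to be homogeneous for the index `i` only, while the
    -- definition asks for vectors in a full weight space. So it is split into weight components,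
    -- each of which is still killed by `e_i`.
    rw [stringBasis, Module.Basis.map_apply, hp, ← sum_projW (sBasis hn hD (i.val : ℤ) u), map_sum,
      map_sum]
    refine sum_mem fun mu _ => ?_
    by_cases h0 : projW mu (sBasis hn hD i.val u) = 0
    · rw [h0, map_zero, map_zero]; exact zero_mem _
    refine Submodule.subset_span ⟨mu, theta (by omega) hD (projW mu (sBasis hn hD i.val u)), k,
      (isString_iff hn hD).2 ⟨?_, ?_, ?_⟩, (fDiv_repD hn hD i k _).symm⟩
    · rw [← Module.End.mul_apply, projW_mul_self]
    · have := LinearMap.congr_fun (opL_mul_projW hn hD (.e i) mu) (sBasis hn hD i.val u)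
      rw [Module.End.mul_apply, Module.End.mul_apply, opL, hE, map_zero] at this
      exact this
    -- A component violating the bound would have the wrong weight for the index `i`, which is `phi
    -- u = phi p + eps p ≥ k`, and would therefore be zero.
    · by_contra hlt
      refine h0 (projW_eq_zero_of_mem_wtSpan hn hD (basis_mem_wtSpan u) ?_)
      rw [hu, hphi]
      push_cast
      omega
  · intro mu u hu
    obtain ⟨z, rfl⟩ := hsur u
    obtain ⟨h1, h2, h3⟩ := (isString_iff hn hD).1 hu
    rw [fDiv_repD, stringBasis, kashE_map, divPow, pow_zero, qfac, Finset.prod_range_zero, inv_one,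
      one_smul, Module.End.one_apply, H.kashE_eq_zero qi_v_ne_zero (hmem h1) h2, map_zero]
  · intro mu u k hu
    obtain ⟨z, rfl⟩ := hsur u
    obtain ⟨h1, h2, h3⟩ := (isString_iff hn hD).1 hu
    rw [fDiv_repD, fDiv_repD, stringBasis, kashE_map, H.kashE_divPow qi_v_ne_zero (hmem h1) h2 h3]
  · intro mu u k hu
    obtain ⟨z, rfl⟩ := hsur u
    obtain ⟨h1, h2, h3⟩ := (isString_iff hn hD).1 hu
    rw [fDiv_repD, fDiv_repD, stringBasis, kashF_map, H.kashF_divPow qi_v_ne_zero (hmem h1) h2 h3]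

lemma theta_scale_mem {L : Submodule Z₀ (TD n D)}
    {Y : Set (VD n D)} (hY : ∀ y ∈ Y, theta (by omega) hD (scale n D y) ∈ L) {m : VD n D}
    (hm : m ∈ Submodule.span Z₀ Y) : theta (by omega : 0 < n) hD (scale n D m) ∈ L := by
  induction hm using Submodule.span_induction with
  | mem y hy => exact hY y hy
  | zero => rw [map_zero, map_zero]; exact zero_mem _
  | add x y _ _ hx hy => rw [map_add, map_add]; exact add_mem hx hy
  | smul r x _ hx =>
    rw [show r • x = (r : K) • x from rfl, map_smul, map_smul]
    exact Submodule.smul_mem _ r hx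

lemma exists_stringBasis_eq (i : ZMod n) (p : PD n D) :
    ∃ m ∈ latticeOf (stdBasis (by omega) hD),
      stringBasis hn hD i p = stdBasis (by omega) hD p + v • m := by
  obtain ⟨m, hm, h⟩ := exists_cBasis_eq (i := (i.val : ℤ)) hn hD gi_v_ne_zero v_mem p
  refine ⟨theta (by omega) hD (scale n D m), theta_scale_mem hn hD ?_ hm, ?_⟩
  · rintro _ ⟨q, rfl⟩
    beta_reduce
    rw [scale_single]
    exact Submodule.subset_span ⟨q, rfl⟩
  · rw [stringBasis, Module.Basis.map_apply, sBasis_apply, h, map_add, map_add, map_smul, map_smul,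
      scale_single]
    rfl

lemma stdBasis_mem (i : ZMod n) (p : PD n D) :
    stdBasis (by omega) hD p ∈ latticeOf (stringBasis hn hD i) := by
  have h := single_mem_span_cBasis (i := (i.val : ℤ)) hn hD gi_v_ne_zero v_mem gi_v_inv_mem p
  rw [stdBasis, Module.Basis.map_apply, ← scale_single]
  refine theta_scale_mem hn hD ?_ h
  rintro _ ⟨q, rfl⟩
  exact Submodule.subset_span ⟨q, rfl⟩

theorem isCrystalBase_repD : IsCrystalBase (repD hn hD) (latticeOf (stdBasis (by omega) hD))
    (Set.range (basisCls (stdBasis (n := n) (D := D) (by omega) hD))) := by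
  refine isCrystalBase_latticeOf (repD hn hD) (stdBasis (by omega) hD) sharp
    (fun p => theta_mem_wtSpace hn hD (projW_bBasis_self p)) (fun mu p => ?_)
    (fun i => PD.crystal hn hD i.val) (stringBasis hn hD) (exists_stringBasis_eq hn hD)
    (stdBasis_mem hn hD) (isKashiwara_repD hn hD)
  rw [stdBasis, Module.Basis.map_apply, repD_ua]
  by_cases h : sharp p = mu
  · rw [← h, projW_bBasis_self]
    exact Submodule.subset_span ⟨p, rfl⟩
  · rw [projW_bBasis_of_ne h, map_zero]
    exact zero_mem _

lemma LD_eq : LD n D = latticeOf (stdBasis (n := n) (D := D) (by omega) hD) := by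
  have : Set.range (std : PD n D → TD n D) = Set.range (stdBasis (n := n) (by omega) hD) :=
    congrArg Set.range (funext fun p => (stdBasis_apply (by omega) hD p).symm)
  rw [LD, this]
  rfl

lemma isCrystalBase_LD : IsCrystalBase (repD hn hD) (LD n D) (BD n D) := by
  -- The set `B_D` lives in a quotient that depends on `L_D`, so the equality of the two lattices is
  -- substituted with `L` as a variable.
  have key : ∀ (L : Submodule Z₀ (TD n D)) (hL : L = latticeOf (stdBasis (by omega) hD))
      (h : ∀ p : PD n D, std p ∈ L),
      IsCrystalBase (repD hn hD) L (Set.range fun p : PD n D => cls L ⟨std p, h p⟩) := by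
    rintro _ rfl h
    convert isCrystalBase_repD hn hD using 2
    funext p
    rw [basisCls]
    congr 1
    exact Subtype.ext (by rw [latticeBasis_coe, stdBasis_apply])
  exact key (LD n D) (LD_eq hn hD) fun p => Submodule.subset_span ⟨p, rfl⟩

end Module

end AffineSchur

end

theorem theorem3p1 (n D : ℕ) (hn : 2 ≤ n) (hD : 1 ≤ D) :
    (∀ (lam : AffineSchur.CD n D) (p : AffineSchur.PD n D),
      AffineSchur.Tcoset lam p ∈ AffineSchur.rightIdeal lam) ∧
    ∃ Φ : AffineSchur.Udot n →ₙₐ[AffineSchur.K] AffineSchur.SD n D,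
      AffineSchur.IsPhi Φ ∧ (∀ Ψ, AffineSchur.IsPhi Ψ → Ψ = Φ) ∧
      AffineSchur.IsIntegrable (AffineSchur.toRep Φ) ∧
      AffineSchur.IsCrystalBase (AffineSchur.toRep Φ) (AffineSchur.LD n D)
        (AffineSchur.BD n D) :=
  ⟨AffineSchur.Tcoset_mem_rightIdeal (by omega) hD, AffineSchur.phi hn hD,
    AffineSchur.phi_isPhi hn hD,
    fun _ hΨ => AffineSchur.IsPhi.unique hn hD (AffineSchur.phi_isPhi hn hD) hΨ,
    AffineSchur.isIntegrable_repD hn hD, AffineSchur.isCrystalBase_LD hn hD⟩
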